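/- Fix a topological space $X$. Rings, spaces and algebras are small (they belong to a fixed universe), and prestacks of categories on $X$ are contravariant pseudofunctors from the poset of open sets of $X$ to categories; a stack is a prestack with descent for morphisms and for objects. For a commutative ring $R$, a *stack of $R$-linear algebroids* on $X$ is a stack $\mathcal B$ of small $R$-linear categories on $X$ (with $R$-linear restriction functors) that is locally nonempty and locally connected by isomorphisms. A *weak equivalence* $\mathcal B\to\mathcal B'$ is an $R$-linear functor of stacks that is locally essentially surjective on objects and induces isomorphisms on the sheaves of morphisms. A *twisted sheaf of associative $R$-algebras* on $X$ is a triple $(\mathcal G,\mathcal A,\mathrm{cp})$ in which $\mathcal G$ is a small gerbe on $X$ (a locally nonempty, locally connected stack of groupoids), $\mathcal A$ is a functor of stacks from $\mathcal G$ to the stack of sheaves of associative unital $R$-algebras on $X$, and $\mathrm{cp}$ is a natural isomorphism from $\mathrm{Aut}_{\mathcal G}(i)$ to the sheaf of groups $\mathcal A(i)^\times$ of invertible sections, such that $\mathcal A(g)$ is conjugation by $\mathrm{cp}(g)$ for every automorphism $g$ of a local object $i$ of $\mathcal G$. A *twisted gauge transformation* $(\mathcal G,\mathcal A,\mathrm{cp})\to(\mathcal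 G',\mathcal A',\mathrm{cp}')$ is an equivalence of stacks $F:\mathcal G\to\mathcal G'$ together with an isomorphism $\mathcal A\cong\mathcal A'\circ F$ compatible with $\mathrm{cp}$ and $\mathrm{cp}'$. Let $\mathrm{Alg}(R)$ be the set of stacks of $R$-linear algebroids on $X$ modulo weak equivalence, and $\mathrm{Tw}(R)$ the set of twisted sheaves of associative $R$-algebras on $X$ modulo twisted gauge equivalence. For a ring homomorphism $\sigma:R\to S$, extension of scalars followed by sheafification and stackification is defined on both sides: $\mathcal B'$ is *induced* from $\mathcal B$ if there is an $R$-linear functor of stacks $F:\mathcal B\to\mathcal B'$, locally essentially surjective on objects, that makes each sheaf $\mathcal B'(F(i),F(j))$ the sheaf associated with $S\otimes_R\mathcal B(i,j)$; and $(\mathcal G',\mathcal A',\mathrm{cp}')$ is *induced* from $(\mathcal G,\mathcal A,\mathrm{cp})$ if there are a functor of stacks $F:\mathcal G\to\mathcal G'$ and $R$-linear homomorphisms of sheaves of rings $\mathcal A(i)\to\mathcal A'(F(i))$, natural in the local object $i$ and compatible with $\mathrm{cp}$ and $\mathrm{cp}'$, that make each $\mathcal A'(F(i))$ the sheaf associated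 with $S\otimes_R\mathcal A(i)$. **Proposition.** There are bijections $$\Phi_R:\ \mathrm{Alg}(R)\ \xrightarrow{\ \simeq\ }\ \mathrm{Tw}(R),$$ one for every commutative ring $R$, functorial in $R$, where $\Phi_R$ sends the class of $\mathcal B$ to the class of the twisted sheaf $(\mathcal B^{\times},\mathrm{End}_{\mathcal B},\mathrm{id})$ consisting of the gerbe of isomorphisms of $\mathcal B$, the sheaves of algebras of endomorphisms of the local objects of $\mathcal B$ (on which isomorphisms act by conjugation), and the tautological coupling; more precisely, $\Phi_R[\mathcal B]=[T]$ if and only if $T$ is isomorphic to that twisted sheaf through an equivalence of its gerbe with $\mathcal B^\times$. Functoriality means: for every $\sigma:R\to S$ there are maps $\mathrm{ind}_\sigma:\mathrm{Alg}(R)\to\mathrm{Alg}(S)$ and $\mathrm{ind}_\sigma:\mathrm{Tw}(R)\to\mathrm{Tw}(S)$ such that $\mathrm{ind}_\sigma[B]=[B']$ if and only if $B'$ is induced from $B$ along $\sigma$ (on either side), $\mathrm{ind}_{\mathrm{id}_R}=\mathrm{id}$, $\mathrm{ind}_{\tau\circ\sigma}=\mathrm{ind}_\tau\circ\mathrm{ind}_\sigma$,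 and $\Phi_S\circ\mathrm{ind}_\sigma=\mathrm{ind}_\sigma\circ\Phi_R$. -/

import Mathlib

open CategoryTheory Opposite TopologicalSpace
open scoped TensorProduct Pseudofunctor.StrongTrans

universe u

/- The quiver underlying a category is found through the category structure only. -/
attribute [-instance] CategoryTheory.catToReflQuiver

namespace TwistedSheaves

/-! ### Prestacks and stacks of categories on a topological space

The small sets are the terms of `Type u`. A category in `Cat.{u, u + 1}` is a category whose
objects form a subcollection of the universe and whose sets of morphisms are small. -/

/-- A prestack (of categories) on `X`: a contravariant pseudofunctor on the poset of open sets. -/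
abbrev Prestack (X : Type u) [TopologicalSpace X] :=
  Pseudofunctor (LocallyDiscrete (Opens X)ᵒᵖ) Cat.{u, u + 1}

namespace Prestack

variable {X : Type u} [TopologicalSpace X]

/-- The category `G(U)`. -/
abbrev fib (G : Prestack X) (U : Opens X) : Cat.{u, u + 1} :=
  G.obj (LocallyDiscrete.mk (op U))

/-- The restriction functor `G(U) ⥤ G(V)` for `V ⊆ U`. -/
abbrev res (G : Prestack X) {V U : Opens X} (f : V ⟶ U) : G.fib U ⥤ G.fib V :=
  (G.map f.op.toLoc).toFunctor

/-- The functor `F(U) : G(U) ⥤ H(U)` of a morphism of prestacks `F`. -/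
abbrev onFib {G H : Prestack X} (F : G ⟶ H) (U : Opens X) : G.fib U ⥤ H.fib U :=
  (F.app (LocallyDiscrete.mk (op U))).toFunctor

/-- The structural isomorphism `F(i|_V) ≅ F(i)|_V` of a morphism of prestacks `F`. -/
abbrev comparison {G H : Prestack X} (F : G ⟶ H) {V U : Opens X} (f : V ⟶ U) (i : G.fib U) :
    (onFib F V).obj ((G.res f).obj i) ≅ (H.res f).obj ((onFib F U).obj i) :=
  (Cat.Hom.toNatIso (F.naturality f.op.toLoc)).app i

/-- The restriction to `V` of a morphism `h : F(i) ⟶ F(j)` over `U`, seen as a morphism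
`F(i|_V) ⟶ F(j|_V)`. -/
abbrev resHom {G H : Prestack X} (F : G ⟶ H) {V U : Opens X} (f : V ⟶ U) {i j : G.fib U}
    (h : (onFib F U).obj i ⟶ (onFib F U).obj j) :
    (onFib F V).obj ((G.res f).obj i) ⟶ (onFib F V).obj ((G.res f).obj j) :=
  (comparison F f i).hom ≫ (H.res f).map h ≫ (comparison F f j).inv

/-- A stack: descent for morphisms and for objects, with respect to open coverings. -/
abbrev IsStack (G : Prestack X) : Prop :=
  Pseudofunctor.IsStack G (Opens.grothendieckTopology X)

/-- All the categories `G(U)` have small sets of objects. -/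
def IsSmall (G : Prestack X) : Prop :=
  ∀ U : Opens X, Small.{u} (G.fib U)

/-- All the categories `G(U)` are groupoids. -/
def IsGroupoidal (G : Prestack X) : Prop :=
  ∀ (U : Opens X) (i j : G.fib U) (g : i ⟶ j), IsIso g

/-- Every point has an open neighbourhood over which there is an object. -/
def LocallyNonempty (G : Prestack X) : Prop :=
  ∀ x : X, ∃ U : Opens X, x ∈ U ∧ Nonempty (G.fib U)

/-- Any two objects over the same open set are locally isomorphic. -/
def LocallyConnected (G : Prestack X) : Prop :=
  ∀ (U : Opens X) (i j : G.fib U), ∀ x ∈ U, ∃ (V : Opens X) (f : V ⟶ U),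
    x ∈ V ∧ Nonempty ((G.res f).obj i ≅ (G.res f).obj j)

/-- `F` is locally essentially surjective on objects. -/
def LocallyEssSurj {G H : Prestack X} (F : G ⟶ H) : Prop :=
  ∀ (U : Opens X) (j : H.fib U), ∀ x ∈ U, ∃ (V : Opens X) (f : V ⟶ U) (i : G.fib V),
    x ∈ V ∧ Nonempty ((onFib F V).obj i ≅ (H.res f).obj j)

/-- `F` is a weak equivalence: it is locally essentially surjective on objects, and induces
isomorphisms of the sheaves of morphisms (equivalently, bijections on all sets of morphisms). -/
structure IsWeakEquivalence {G H : Prestack X} (F : G ⟶ H) : Prop where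
  locallyEssSurj : LocallyEssSurj F
  bijective : ∀ (U : Opens X) (i j : G.fib U),
    Function.Bijective (fun g : i ⟶ j => (onFib F U).map g)

/-- `F` is an equivalence: it has a quasi-inverse in the 2-category of prestacks. -/
def IsEquivalence {G H : Prestack X} (F : G ⟶ H) : Prop :=
  ∃ E : H ⟶ G, Nonempty (F ≫ E ≅ 𝟙 G) ∧ Nonempty (E ≫ F ≅ 𝟙 H)

end Prestack

open Prestack

/-! ### Extension of scalars -/

section extendScalars

variable {R S M N : Type u} [CommRing R] [CommRing S] [Algebra R S]
  [AddCommGroup M] [Module R M] [AddCommGroup N] [Module S N]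

/-- The additive map `S ⊗[R] M → N`, `s ⊗ m ↦ s • φ m`, induced by a semilinear map `φ`. -/
noncomputable def extendScalars (φ : M →ₛₗ[algebraMap R S] N) : S ⊗[R] M →+ N :=
  TensorProduct.liftAddHom
    (((smulAddHom S N).flip.comp φ.toAddMonoidHom).flip) (by
      intro r s m
      simp [Algebra.smul_def, mul_smul, smul_comm (algebraMap R S r) s])

/-- The formula which defines `extendScalars`. -/
theorem extendScalars_tmul (φ : M →ₛₗ[algebraMap R S] N) (s : S) (m : M) :
    extendScalars φ (s ⊗ₜ m) = s • φ m := rfl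

end extendScalars

/-! ### Stacks of linear algebroids -/

/-- A stack of `R`-linear algebroids on `X`: a stack of (small) `R`-linear categories, with
`R`-linear restriction functors, which is locally nonempty and locally connected by
isomorphisms. -/
structure AlgebroidStack (R : Type u) [CommRing R] (X : Type u) [TopologicalSpace X] where
  /-- The underlying stack of categories. -/
  stack : Prestack X
  isStack : stack.IsStack
  isSmall : stack.IsSmall
  /-- The addition of morphisms. -/
  preadditive : ∀ U : Opens X, Preadditive (stack.fib U)
  /-- The action of `R` on morphisms. -/
  linear : ∀ U : Opens X, Linear R (stack.fib U)
  res_add : ∀ {V U : Opens X} (f : V ⟶ U) {i j : stack.fib U} (a b : i ⟶ j),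
    (stack.res f).map (a + b) = (stack.res f).map a + (stack.res f).map b
  res_smul : ∀ {V U : Opens X} (f : V ⟶ U) {i j : stack.fib U} (r : R) (a : i ⟶ j),
    (stack.res f).map (r • a) = r • (stack.res f).map a
  locallyNonempty : stack.LocallyNonempty
  locallyConnected : stack.LocallyConnected

namespace AlgebroidStack

attribute [instance] AlgebroidStack.preadditive AlgebroidStack.linear

variable {R S : Type u} [CommRing R] [CommRing S] {X : Type u} [TopologicalSpace X]

/-- Restriction of morphisms of an `R`-linear stack, as an `R`-linear map. -/
def resLinear (B : AlgebroidStack R X) {V U : Opens X} (f : V ⟶ U) (i j : B.stack.fib U) :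
    (i ⟶ j) →ₗ[R] ((B.stack.res f).obj i ⟶ (B.stack.res f).obj j) where
  toFun a := (B.stack.res f).map a
  map_add' := B.res_add f
  map_smul' := B.res_smul f

/-- A functor of stacks from an `R`-linear one to an `S`-linear one, where `S` is an `R`-algebra,
is `R`-linear. -/
structure IsLinear [Algebra R S] {B : AlgebroidStack R X} {B' : AlgebroidStack S X}
    (F : B.stack ⟶ B'.stack) : Prop where
  map_add : ∀ (U : Opens X) (i j : B.stack.fib U) (a b : i ⟶ j),
    (onFib F U).map (a + b) = (onFib F U).map a + (onFib F U).map b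
  map_smul : ∀ (U : Opens X) (i j : B.stack.fib U) (r : R) (a : i ⟶ j),
    (onFib F U).map (r • a) = algebraMap R S r • (onFib F U).map a

/-- The action on morphisms of an `R`-linear functor of stacks, as a semilinear map. -/
def IsLinear.mapHom [Algebra R S] {B : AlgebroidStack R X} {B' : AlgebroidStack S X}
    {F : B.stack ⟶ B'.stack} (hF : IsLinear F) (U : Opens X) (i j : B.stack.fib U) :
    (i ⟶ j) →ₛₗ[algebraMap R S] ((onFib F U).obj i ⟶ (onFib F U).obj j) where
  toFun a := (onFib F U).map a
  map_add' := hF.map_add U i j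
  map_smul' := hF.map_smul U i j

/-- There is an `R`-linear weak equivalence of stacks `B ⟶ B'`. -/
def WeaklyEquivalent (B B' : AlgebroidStack R X) : Prop :=
  ∃ F : B.stack ⟶ B'.stack, IsLinear F ∧ IsWeakEquivalence F

/-- The set of stacks of `R`-linear algebroids on `X` modulo weak equivalence. -/
def Classes (R : Type u) [CommRing R] (X : Type u) [TopologicalSpace X] :=
  Quot (WeaklyEquivalent (R := R) (X := X))

/-- The class of a stack of `R`-linear algebroids. -/
def cls (B : AlgebroidStack R X) : Classes R X := Quot.mk _ B

/-- `B'` is induced from `B` by the extension of scalars from `R` to `S`, that is, `B'` is the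
stack associated with the prestack of `S`-linear categories `U ↦ S ⊗[R] B(U)`: there is an
`R`-linear functor of stacks `F : B ⟶ B'` which is locally essentially surjective on objects and
such that the maps `S ⊗[R] B(U)(i, j) → B'(U)(F(i), F(j))` are locally injective and
locally surjective. -/
def IsInduced [Algebra R S] (B : AlgebroidStack R X) (B' : AlgebroidStack S X) : Prop :=
  ∃ (F : B.stack ⟶ B'.stack) (hF : IsLinear F), LocallyEssSurj F ∧
    (∀ (U : Opens X) (i j : B.stack.fib U) (t : S ⊗[R] (i ⟶ j)),
      extendScalars (hF.mapHom U i j) t = 0 →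
      ∀ x ∈ U, ∃ (V : Opens X) (f : V ⟶ U), x ∈ V ∧ (B.resLinear f i j).lTensor S t = 0) ∧
    (∀ (U : Opens X) (i j : B.stack.fib U) (h : (onFib F U).obj i ⟶ (onFib F U).obj j),
      ∀ x ∈ U, ∃ (V : Opens X) (f : V ⟶ U), x ∈ V ∧
        ∃ t : S ⊗[R] ((B.stack.res f).obj i ⟶ (B.stack.res f).obj j),
          extendScalars (hF.mapHom V _ _) t = resHom F f h)

end AlgebroidStack

/-! ### Sheaves of algebras and twisted sheaves of algebras -/

/-- The stack of sheaves of associative unital `R`-algebras on `X`. Its value on an open set `U` is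
the category of sheaves on the site of open subsets of `U`, and its restriction functors are the
restrictions of sheaves. -/
noncomputable abbrev assocStack (R : Type u) [CommRing R] (X : Type u) [TopologicalSpace X] :
    Prestack X :=
  (Opens.grothendieckTopology X).pseudofunctorOver (AlgCat.{u} R)

section sections

variable {R : Type u} [CommRing R] {X : Type u} [TopologicalSpace X]

/-- The algebra `Γ(V, 𝒜)` of sections of a sheaf of algebras `𝒜` on `U` over `V ⊆ U`. -/
abbrev sections {U : Opens X} (𝒜 : (assocStack R X).fib U) {V : Opens X} (f : V ⟶ U) :
    AlgCat.{u} R :=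
  (show Sheaf ((Opens.grothendieckTopology X).over U) (AlgCat.{u} R) from 𝒜).obj.obj
    (op (Over.mk f))

/-- The map `Γ(V, φ) : Γ(V, 𝒜) → Γ(V, ℬ)` of a morphism of sheaves of algebras `φ` on `U`. -/
abbrev sectionsMap {U : Opens X} {𝒜 ℬ : (assocStack R X).fib U} (φ : 𝒜 ⟶ ℬ) {V : Opens X}
    (f : V ⟶ U) : sections 𝒜 f →ₐ[R] sections ℬ f :=
  ((show (show Sheaf ((Opens.grothendieckTopology X).over U) (AlgCat.{u} R) from 𝒜) ⟶ ℬ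
    from φ).hom.app (op (Over.mk f))).hom

/-- The restriction of sections `Γ(U, 𝒜) → Γ(V, 𝒜)` of a sheaf of algebras `𝒜` on `U`. -/
abbrev sectionsRes {U : Opens X} (𝒜 : (assocStack R X).fib U) {V : Opens X} (f : V ⟶ U) :
    sections 𝒜 (𝟙 U) →ₐ[R] sections 𝒜 f :=
  ((show Sheaf ((Opens.grothendieckTopology X).over U) (AlgCat.{u} R) from 𝒜).obj.map
    (Over.homMk f : Over.mk f ⟶ Over.mk (𝟙 U)).op).hom

/-- The restriction of sections `Γ(U, 𝒜) → Γ(V, 𝒜|_V)`. -/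
abbrev sectionsRes' {U : Opens X} (𝒜 : (assocStack R X).fib U) {V : Opens X} (f : V ⟶ U) :
    sections 𝒜 (𝟙 U) →ₐ[R] sections (((assocStack R X).res f).obj 𝒜) (𝟙 V) :=
  ((show Sheaf ((Opens.grothendieckTopology X).over U) (AlgCat.{u} R) from 𝒜).obj.map
    (Over.homMk f : (Over.map f).obj (Over.mk (𝟙 V)) ⟶ Over.mk (𝟙 U)).op).hom

variable {G : Prestack X} (A : G ⟶ assocStack R X)

/-- For a functor of stacks `A` from `G` to the stack of sheaves of algebras, and an object `i` over
`U`, the algebra `Γ(U, A(i))`. -/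
noncomputable abbrev Sec {U : Opens X} (i : G.fib U) : AlgCat.{u} R :=
  sections ((onFib A U).obj i) (𝟙 U)

/-- The map `Γ(U, A(i)) → Γ(U, A(j))` given by a morphism `h : i ⟶ j`. -/
noncomputable abbrev secMap {U : Opens X} {i j : G.fib U} (h : i ⟶ j) : Sec A i →ₐ[R] Sec A j :=
  sectionsMap ((onFib A U).map h) (𝟙 U)

/-- The restriction `Γ(U, A(i)) → Γ(V, A(i)|_V) ≅ Γ(V, A(i|_V))`. -/
noncomputable abbrev secRes {V U : Opens X} (f : V ⟶ U) (i : G.fib U) :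
    Sec A i →ₐ[R] Sec A ((G.res f).obj i) :=
  (sectionsMap (comparison A f i).inv (𝟙 V)).comp (sectionsRes' ((onFib A U).obj i) f)

end sections

/-- A twisted sheaf of associative `R`-algebras on `X`, i.e. a twisted object of the stack of sheaves
of associative `R`-algebras on `X`, where the sheaf of inner gauge groups of `𝒜` is the sheaf of
invertible sections of `𝒜`, acting on `𝒜` by conjugation. -/
structure TwistedSheaf (R : Type u) [CommRing R] (X : Type u) [TopologicalSpace X] where
  /-- The gauge gerbe. -/
  gauge : Prestack X
  isStack : gauge.IsStack
  isSmall : gauge.IsSmall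
  isGroupoidal : gauge.IsGroupoidal
  locallyNonempty : gauge.LocallyNonempty
  locallyConnected : gauge.LocallyConnected
  /-- The representation: a functor of stacks. -/
  rep : gauge ⟶ assocStack R X
  /-- The coupling isomorphism between the sheaf of automorphisms of `i` and the sheaf of
  invertible sections of `A(i)`. It is given by its components on global sections, for all open
  sets `U` and all objects `i` over `U`; the component over `V ⊆ U` is that of `i|_V`. -/
  cp : ∀ {U : Opens X} (i : gauge.fib U), Aut i ≃* (Sec rep i)ˣ
  /-- The coupling isomorphism commutes with restrictions. -/
  cp_res : ∀ {V U : Opens X} (f : V ⟶ U) (i : gauge.fib U) (g : Aut i),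
    (cp ((gauge.res f).obj i) ((gauge.res f).mapIso g) : Sec rep ((gauge.res f).obj i)) =
      secRes rep f i (cp i g : Sec rep i)
  /-- The coupling isomorphism is natural: `h ∘ g ∘ h⁻¹` corresponds to `A(h)(cp(g))`. -/
  cp_conj : ∀ {U : Opens X} (i j : gauge.fib U) (h : i ≅ j) (g : Aut i),
    (cp j (h.symm ≪≫ g ≪≫ h) : Sec rep j) = secMap rep h.hom (cp i g : Sec rep i)
  /-- An automorphism `g` of `i` acts on the sheaf `A(i)` as conjugation by `cp(g)`. -/
  rep_aut : ∀ {V U : Opens X} (f : V ⟶ U) (i : gauge.fib U) (g : Aut i)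
    (a : sections ((onFib rep U).obj i) f),
    sectionsMap ((onFib rep U).map g.hom) f a =
      sectionsRes ((onFib rep U).obj i) f (cp i g : Sec rep i) * a *
        sectionsRes ((onFib rep U).obj i) f ((cp i g)⁻¹ : (Sec rep i)ˣ)

namespace TwistedSheaf

variable {R S : Type u} [CommRing R] [CommRing S] {X : Type u} [TopologicalSpace X]

/-- The map `Γ(U, A(i)) → Γ(U, A'(F(i)))` given by a natural transformation `A ⟶ A' ∘ F` of functors
of stacks. -/
noncomputable abbrev secComp {G G' : Prestack X} {A : G ⟶ assocStack R X} {A' : G' ⟶ assocStack R X}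
    {F : G ⟶ G'} (η : A ⟶ F ≫ A') {U : Opens X} (i : G.fib U) :
    Sec A i →ₐ[R] Sec A' ((onFib F U).obj i) :=
  sectionsMap ((η.as.app (LocallyDiscrete.mk (op U))).toNatTrans.app i) (𝟙 U)

/-- There is a twisted gauge transformation from `T` to `T'`: an equivalence of gauge gerbes `F`
together with an isomorphism between the representations of `T` and the pullback along `F` of that of
`T'`, which is compatible with the coupling isomorphisms. -/
def GaugeEquivalent (T T' : TwistedSheaf R X) : Prop :=
  ∃ (F : T.gauge ⟶ T'.gauge) (η : T.rep ≅ F ≫ T'.rep), Prestack.IsEquivalence F ∧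
    ∀ (U : Opens X) (i : T.gauge.fib U) (g : Aut i),
      (T'.cp ((onFib F U).obj i) ((onFib F U).mapIso g) : Sec T'.rep ((onFib F U).obj i)) =
        secComp η.hom i (T.cp i g : Sec T.rep i)

/-- The set of twisted sheaves of associative `R`-algebras on `X` modulo twisted gauge
equivalence. -/
def Classes (R : Type u) [CommRing R] (X : Type u) [TopologicalSpace X] :=
  Quot (GaugeEquivalent (R := R) (X := X))

/-- The class of a twisted sheaf. -/
def cls (T : TwistedSheaf R X) : Classes R X := Quot.mk _ T

/-- `T'` is induced from `T` by the extension of scalars from `R` to `S`: there are a functor of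
stacks `F` between the gauge gerbes, and `R`-linear homomorphisms of sheaves of rings
`ρ : A(i) → A'(F(i))`, compatible with restrictions, with morphisms of the gauge gerbe and
with the coupling isomorphisms, which make every `A'(F(i))` the sheaf associated with the presheaf
`S ⊗[R] A(i)`. A homomorphism of sheaves is given by its components on global
sections, for all objects `i` over all open sets. -/
def IsInduced [Algebra R S] (T : TwistedSheaf R X) (T' : TwistedSheaf S X) : Prop :=
  ∃ (F : T.gauge ⟶ T'.gauge)
    (ρ : ∀ (U : Opens X) (i : T.gauge.fib U), Sec T.rep i →+* Sec T'.rep ((onFib F U).obj i))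
    (ρ_smul : ∀ (U : Opens X) (i : T.gauge.fib U) (r : R) (a : Sec T.rep i),
      ρ U i (r • a) = algebraMap R S r • ρ U i a),
    (∀ (V U : Opens X) (f : V ⟶ U) (i : T.gauge.fib U) (a : Sec T.rep i),
      secMap T'.rep (comparison F f i).hom (ρ V ((T.gauge.res f).obj i) (secRes T.rep f i a)) =
        secRes T'.rep f ((onFib F U).obj i) (ρ U i a)) ∧
    (∀ (U : Opens X) (i j : T.gauge.fib U) (h : i ⟶ j) (a : Sec T.rep i),
      ρ U j (secMap T.rep h a) = secMap T'.rep ((onFib F U).map h) (ρ U i a)) ∧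
    (∀ (U : Opens X) (i : T.gauge.fib U) (g : Aut i),
      (T'.cp ((onFib F U).obj i) ((onFib F U).mapIso g) : Sec T'.rep ((onFib F U).obj i)) =
        ρ U i (T.cp i g : Sec T.rep i)) ∧
    (∀ (U : Opens X) (i : T.gauge.fib U) (t : S ⊗[R] Sec T.rep i),
      extendScalars ⟨(ρ U i).toAddMonoidHom.toAddHom, ρ_smul U i⟩ t = 0 →
      ∀ x ∈ U, ∃ (V : Opens X) (f : V ⟶ U), x ∈ V ∧
        (secRes T.rep f i).toLinearMap.lTensor S t = 0) ∧
    (∀ (U : Opens X) (i : T.gauge.fib U) (b : Sec T'.rep ((onFib F U).obj i)),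
      ∀ x ∈ U, ∃ (V : Opens X) (f : V ⟶ U), x ∈ V ∧
        ∃ t : S ⊗[R] Sec T.rep ((T.gauge.res f).obj i),
          secMap T'.rep (comparison F f i).hom
            (extendScalars ⟨(ρ V ((T.gauge.res f).obj i)).toAddMonoidHom.toAddHom,
              ρ_smul V ((T.gauge.res f).obj i)⟩ t) =
            secRes T'.rep f ((onFib F U).obj i) b)

/-- `T` is the twisted sheaf of the stack of algebroids `B`: its gauge gerbe is the gerbe of
isomorphisms of `B`, its representation sends `i` to the sheaf of algebras of endomorphisms of `i`
(with isomorphisms acting by conjugation), and its coupling isomorphism is the tautological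
one. Here the gauge gerbe is identified through a functor of stacks `E` which induces equivalences of
`T.gauge(U)` with the groupoid of isomorphisms of `B(U)`, and the representation through
isomorphisms of sheaves of algebras `ε`, given by their components on global sections. -/
def IsTwistedSheafOf (T : TwistedSheaf R X) (B : AlgebroidStack R X) : Prop :=
  ∃ (E : T.gauge ⟶ B.stack)
    (ε : ∀ (U : Opens X) (i : T.gauge.fib U), Sec T.rep i ≃ₐ[R] End ((onFib E U).obj i)),
    (∀ (U : Opens X) (i j : T.gauge.fib U),
      Function.Injective (fun g : i ⟶ j => (onFib E U).map g) ∧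
      ∀ e : (onFib E U).obj i ≅ (onFib E U).obj j, ∃ g : i ⟶ j, (onFib E U).map g = e.hom) ∧
    (∀ (U : Opens X) (j : B.stack.fib U), ∃ i : T.gauge.fib U,
      Nonempty ((onFib E U).obj i ≅ j)) ∧
    (∀ (V U : Opens X) (f : V ⟶ U) (i : T.gauge.fib U) (a : Sec T.rep i),
      ε V ((T.gauge.res f).obj i) (secRes T.rep f i a) = resHom E f (ε U i a)) ∧
    (∀ (U : Opens X) (i j : T.gauge.fib U) (h : i ⟶ j) (a : Sec T.rep i),
      (onFib E U).map h ≫ ε U j (secMap T.rep h a) = ε U i a ≫ (onFib E U).map h) ∧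
    (∀ (U : Opens X) (i : T.gauge.fib U) (g : Aut i),
      ε U i (T.cp i g : Sec T.rep i) = (onFib E U).map g.hom)

end TwistedSheaf

end TwistedSheaves

/-! A twisted sheaf and a stack of algebroids record the same local data. In an algebroid any two
objects are locally isomorphic, so a morphism `i ⟶ j` is locally an endomorphism of `i` followed by
an isomorphism `i ≅ j`. The stack can therefore be recovered from its gerbe of isomorphisms, its
sheaves of endomorphism algebras, and the identification of automorphisms with invertible sections.

Conversely, let `(G, A, cp)` be a twisted sheaf. A morphism `i ⟶ j` is declared to be a pair of an
isomorphism `g : i ⟶ j` and a section `a` of `A(i)`, where changing `g` by an automorphism `k` of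
`i` multiplies `a` by `cp k`; in other words an equivariant function on the isomorphisms with values
in `A(i)` (`TwSys.homSub`). If there is no isomorphism, the only morphism is zero. Composition is
well defined precisely because automorphisms act by conjugation with their coupling
(`TwSys.of_comp_eq`). The associated stack is `TwistedSheaf.algebroid`.

The two sides are compared through representations: `TwistedSheaf.Rep T B` is a functor from the
gauge gerbe of `T` to `B` with compatible maps from the algebras of `T` to endomorphisms. It is
`IsUniversal` if it identifies `T` with the twisted sheaf of `B`, and `IsExt` if it makes `B` the
extension of scalars of `T`. The main facts are as follows. `T` has a universal representation in
`T.algebroid` (`toAlgebroid_isUniversal`), and `B.twistedSheaf` has one in `B`. A representation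
with `IsExt` over the same ring yields a weak equivalence from `T.algebroid` to `B`. Twisted sheaves
with universal representations in one stack are gauge equivalent
(`Rep.IsUniversal.gaugeEquivalent`). Consequently gauge equivalence, being the twisted sheaf of `B`,
and being induced all translate into statements on `T.algebroid` (`gaugeEquivalent_iff`,
`isTwistedSheafOf_iff_algebroid`, `isInduced_iff_algebroid`). The bijection is the inverse of the
map `T ↦ T.algebroid` on classes, and extension of scalars of twisted sheaves is transported through
it.

Two devices keep the 2-categorical bookkeeping under control. Morphisms between restrictions of
objects with possibly different domains restrict strictly functorially, so a prestack is replaced by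
a strict system (`Sys`) and functors are built on systems. The associated stack of a linear system
is built by hand (`LinSys.loc`): its objects are families of objects of the stalks with local
charts, so gluing is done point by point. A stack locally equivalent to a system is weakly
equivalent to the associated stack (`weaklyEquivalent_algebroid`). Extension of scalars tensors the
morphisms of a system and then stackifies; its transitivity is checked on stalks, where it is base
change of modules in stages. -/

namespace TwistedSheaves

open Prestack

/-! ### Strictly functorial restriction of morphisms in a pseudofunctor -/

namespace Prestack

variable {X : Type u} [TopologicalSpace X]

/-- The restriction functor along an inclusion of open sets. -/
abbrev rs (G : Prestack X) {V U : Opens X} (h : V ≤ U) : G.fib U ⥤ G.fib V := G.res (homOfLE h)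

/-- Restriction along an identity is isomorphic to the identity. -/
def rsId (G : Prestack X) {U : Opens X} (i : G.fib U) : (G.rs le_rfl).obj i ≅ i :=
  (Cat.Hom.toNatIso (G.mapId (LocallyDiscrete.mk (op U)))).app i

/-- Restrictions compose up to isomorphism. -/
def rsComp (G : Prestack X) {W V U : Opens X} (h : W ≤ V) (h' : V ≤ U) (i : G.fib U) :
    (G.rs (h.trans h')).obj i ≅ (G.rs h).obj ((G.rs h').obj i) :=
  (Cat.Hom.toNatIso (G.mapComp (homOfLE h').op.toLoc (homOfLE h).op.toLoc)).app i

variable {G H : Prestack X}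

theorem rsId_naturality {U : Opens X} {i j : G.fib U} (t : i ⟶ j) :
    (G.rs le_rfl).map t ≫ (G.rsId j).hom = (G.rsId i).hom ≫ t :=
  (Cat.Hom.toNatIso (G.mapId (LocallyDiscrete.mk (op U)))).hom.naturality t

theorem rsId_naturality_assoc {U : Opens X} {i j k : G.fib U} (t : i ⟶ j) (s : j ⟶ k) :
    (G.rs le_rfl).map t ≫ (G.rsId j).hom ≫ s = (G.rsId i).hom ≫ t ≫ s := by
  rw [← Category.assoc, rsId_naturality, Category.assoc]

theorem rsComp_naturality {W V U : Opens X} (h : W ≤ V) (h' : V ≤ U) {i j : G.fib U} (t : i ⟶ j) :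
    (G.rs (h.trans h')).map t ≫ (G.rsComp h h' j).hom =
      (G.rsComp h h' i).hom ≫ (G.rs h).map ((G.rs h').map t) :=
  (Cat.Hom.toNatIso (G.mapComp (homOfLE h').op.toLoc (homOfLE h).op.toLoc)).hom.naturality t

theorem rsComp_naturality_assoc {W V U : Opens X} (h : W ≤ V) (h' : V ≤ U) {i j : G.fib U}
    {k : G.fib W} (t : i ⟶ j) (s : (G.rs h).obj ((G.rs h').obj j) ⟶ k) :
    (G.rs (h.trans h')).map t ≫ (G.rsComp h h' j).hom ≫ s =
      (G.rsComp h h' i).hom ≫ (G.rs h).map ((G.rs h').map t) ≫ s := by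
  rw [← Category.assoc, rsComp_naturality, Category.assoc]

/-- Descent data are formulated with `mapComp'`, which allows any name for the composite inclusion;
this lemma lets them be read in terms of `rsComp`. -/
theorem rsComp_eq {W V U : Opens X} (h : W ≤ V) (h' : V ≤ U) (i : G.fib U)
    (e) :
    (Cat.Hom.toNatIso (G.mapComp' (homOfLE h').op.toLoc (homOfLE h).op.toLoc (homOfLE (h.trans h')).op.toLoc e)).app i = G.rsComp h h' i := by
  have : G.mapComp' (homOfLE h').op.toLoc (homOfLE h).op.toLoc (homOfLE (h.trans h')).op.toLoc e =
    G.mapComp (homOfLE h').op.toLoc (homOfLE h).op.toLoc := Pseudofunctor.mapComp'_eq_mapComp _ _ _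
  rw [this]; rfl

/-- The restriction to a smaller open set of a morphism between restrictions of objects. -/
def rr {W' W U U' : Opens X} (h : W' ≤ W) {hi : W ≤ U} {hj : W ≤ U'} {i : G.fib U} {j : G.fib U'}
    (t : (G.rs hi).obj i ⟶ (G.rs hj).obj j) :
    (G.rs (h.trans hi)).obj i ⟶ (G.rs (h.trans hj)).obj j :=
  (G.rsComp h hi i).hom ≫ (G.rs h).map t ≫ (G.rsComp h hj j).inv

/-- This identification is the source of all coherence used later: the functoriality of `pullHom`
gives `rr_rfl` and `rr_rr`, and its occurrence in `presheafHom` and in descent data connects `rr`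
with the stack conditions. -/
theorem rr_eq_pullHom {W' W U U' : Opens X} (h : W' ≤ W) {hi : W ≤ U} {hj : W ≤ U'} {i : G.fib U} {j : G.fib U'}
    (t : (G.rs hi).obj i ⟶ (G.rs hj).obj j) (e e') :
    rr h t = Pseudofunctor.LocallyDiscreteOpToCat.pullHom (F := G) (M₁ := i) (M₂ := j) t (homOfLE h) (homOfLE (h.trans hi)) (homOfLE (h.trans hj)) e e' := by
  have h1 := G.rsComp_eq h hi i rfl
  have h2 := G.rsComp_eq h hj j rfl
  unfold rr
  rw [← h1, ← h2]; rfl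

theorem rr_rfl {W U U' : Opens X} {hi : W ≤ U} {hj : W ≤ U'} {i : G.fib U} {j : G.fib U'}
    (t : (G.rs hi).obj i ⟶ (G.rs hj).obj j) : rr le_rfl t = t := by
  rw [rr_eq_pullHom]
  exact Pseudofunctor.LocallyDiscreteOpToCat.pullHom_id _

theorem rr_rr {W'' W' W U U' : Opens X} (h' : W'' ≤ W') (h : W' ≤ W) {hi : W ≤ U} {hj : W ≤ U'} {i : G.fib U} {j : G.fib U'}
    (t : (G.rs hi).obj i ⟶ (G.rs hj).obj j) : rr h' (rr h t) = rr (h'.trans h) t := by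
  rw [rr_eq_pullHom h, rr_eq_pullHom h', rr_eq_pullHom]
  · exact Pseudofunctor.LocallyDiscreteOpToCat.pullHom_pullHom _ _ _ _ _ _ _ _ _ _ _
  all_goals rfl

@[simp]
theorem rr_id {W' W U : Opens X} (h : W' ≤ W) {hi : W ≤ U} {i : G.fib U} :
    rr h (𝟙 ((G.rs hi).obj i)) = 𝟙 _ := by
  simp [rr]

theorem rr_comp {W' W U U' U'' : Opens X} (h : W' ≤ W) {hi : W ≤ U} {hj : W ≤ U'} {hk : W ≤ U''} {i : G.fib U} {j : G.fib U'} {k : G.fib U''}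
    (t : (G.rs hi).obj i ⟶ (G.rs hj).obj j) (s : (G.rs hj).obj j ⟶ (G.rs hk).obj k) :
    rr h (t ≫ s) = rr h t ≫ rr h s := by
  simp [rr]

theorem rr_map {W' W U : Opens X} (h : W' ≤ W) (hi : W ≤ U) {i j : G.fib U} (t : i ⟶ j) :
    rr h ((G.rs hi).map t) = (G.rs (h.trans hi)).map t := by
  simp [rr, ← rsComp_naturality_assoc]

/-- One of the unit axioms of the pseudofunctor. With it every `rsComp` becomes a restriction of
some `rsId` (`rr_rsId`), so that identities between coherence isomorphisms follow from the
functoriality of `rr`. -/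
theorem rsComp_rfl_right {V U : Opens X} (h : V ≤ U) (i : G.fib U) :
    (G.rsComp h le_rfl i).hom = (G.rs h).map (G.rsId i).inv := by
  have h1 := congrArg (fun t => t.toNatTrans.app i)
    (G.mapComp'_id_comp_hom (homOfLE h).op.toLoc)
  rw [← G.rsComp_eq _ _ _ (by rfl)]
  refine h1.trans ?_
  dsimp
  erw [Category.id_comp]
  rfl

/-- The comparison isomorphisms are the restrictions of the identity isomorphisms. -/
theorem rr_rsId {V U W : Opens X} (h : V ≤ U) (hW : W ≤ V) (i : G.fib U) :
    rr hW (hi := h) (hj := le_rfl) (i := i) (j := (G.rs h).obj i) (G.rsId _).inv =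
      (G.rsComp hW h i).hom := by
  simp [rr, ← rsComp_rfl_right]

theorem rr_rsId_hom {V U W : Opens X} (h : V ≤ U) (hW : W ≤ V) (i : G.fib U) :
    rr hW (hj := h) (hi := le_rfl) (j := i) (i := (G.rs h).obj i) (G.rsId _).hom =
      (G.rsComp hW h i).inv := by
  rw [← cancel_epi (G.rsComp hW h i).hom, ← rr_rsId, ← rr_comp, Iso.inv_hom_id, rr_rsId,
    Iso.hom_inv_id, rr_id]

theorem rr_rsComp {W' W V U : Opens X} (h'' : W' ≤ W) (h : W ≤ V) (h' : V ≤ U) (i : G.fib U) :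
    rr h'' (hj := h) (j := (G.rs h').obj i) (G.rsComp h h' i).hom =
      (G.rsComp (h''.trans h) h' i).hom := by
  rw [← rr_rsId, rr_rr, rr_rsId]

theorem rr_rsComp_inv {W' W V U : Opens X} (h'' : W' ≤ W) (h : W ≤ V) (h' : V ≤ U) (i : G.fib U) :
    rr h'' (hi := h) (i := (G.rs h').obj i) (G.rsComp h h' i).inv =
      (G.rsComp (h''.trans h) h' i).inv := by
  rw [← rr_rsId_hom, rr_rr, rr_rsId_hom]

/-- Restriction of isomorphisms. -/
@[simps]
def rrIso {W' W U U' : Opens X} (h : W' ≤ W) {hi : W ≤ U} {hj : W ≤ U'} {i : G.fib U}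
    {j : G.fib U'} (t : (G.rs hi).obj i ≅ (G.rs hj).obj j) :
    (G.rs (h.trans hi)).obj i ≅ (G.rs (h.trans hj)).obj j where
  hom := rr h t.hom
  inv := rr h t.inv
  hom_inv_id := by rw [← rr_comp, Iso.hom_inv_id, rr_id]
  inv_hom_id := by rw [← rr_comp, Iso.inv_hom_id, rr_id]

end Prestack

/-! ### Strict systems -/

/-- A strict version of a prestack: objects with a domain of definition, and over each open set `W` a
category of the objects that are defined on `W`, with strictly functorial restriction. -/
structure Sys (X : Type u) [TopologicalSpace X] where
  /-- The objects. -/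
  Obj : Type (u + 1)
  /-- The domain of definition of an object. -/
  dom : Obj → Opens X
  /-- The category of objects that are defined on `W`. -/
  cat : ∀ W : Opens X, Category.{u} {i : Obj // W ≤ dom i}
  /-- The restriction of morphisms. -/
  res : ∀ {W' W : Opens X} (h : W' ≤ W) {i j : {i : Obj // W ≤ dom i}}, (i ⟶ j) →
    ((⟨i.1, h.trans i.2⟩ : {i : Obj // W' ≤ dom i}) ⟶ ⟨j.1, h.trans j.2⟩)
  res_id : ∀ {W' W : Opens X} (h : W' ≤ W) (i : {i : Obj // W ≤ dom i}), res h (𝟙 i) = 𝟙 _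
  res_comp : ∀ {W' W : Opens X} (h : W' ≤ W) {i j k : {i : Obj // W ≤ dom i}} (a : i ⟶ j)
    (b : j ⟶ k), res h (a ≫ b) = res h a ≫ res h b
  res_rfl : ∀ {W : Opens X} {i j : {i : Obj // W ≤ dom i}} (a : i ⟶ j), res le_rfl a = a
  res_res : ∀ {W'' W' W : Opens X} (h' : W'' ≤ W') (h : W' ≤ W) {i j : {i : Obj // W ≤ dom i}}
    (a : i ⟶ j), res h' (res h a) = res (h'.trans h) a

namespace Sys

variable {X : Type u} [TopologicalSpace X]

/-- The objects of a system which are defined on `W`. -/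
abbrev At (C : Sys X) (W : Opens X) : Type (u + 1) := {i : C.Obj // W ≤ C.dom i}

attribute [instance] Sys.cat
attribute [simp] res_id res_rfl res_res

/-- The restriction of an object. -/
abbrev At.rs {C : Sys X} {W' W : Opens X} (h : W' ≤ W) (i : C.At W) : C.At W' :=
  ⟨i.1, h.trans i.2⟩

/-- The restriction of an isomorphism. -/
@[simps]
def resIso (C : Sys X) {W' W : Opens X} (h : W' ≤ W) {i j : C.At W} (e : i ≅ j) :
    At.rs h i ≅ At.rs h j where
  hom := C.res h e.hom
  inv := C.res h e.inv
  hom_inv_id := by rw [← res_comp, Iso.hom_inv_id, res_id]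
  inv_hom_id := by rw [← res_comp, Iso.inv_hom_id, res_id]

end Sys

/-- The system of a prestack. -/
def Prestack.sys {X : Type u} [TopologicalSpace X] (G : Prestack X) : Sys X where
  Obj := Σ U : Opens X, G.fib U
  dom i := i.1
  cat W :=
    { Hom i j := (G.rs i.2).obj i.1.2 ⟶ (G.rs j.2).obj j.1.2
      id i := 𝟙 ((G.rs i.2).obj i.1.2)
      comp a b := CategoryStruct.comp (obj := G.fib W) a b
      id_comp _ := Category.id_comp (obj := G.fib W) _
      comp_id _ := Category.comp_id (obj := G.fib W) _
      assoc _ _ _ := Category.assoc (obj := G.fib W) _ _ _ }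
  res h _ _ t := rr h t
  res_id _ _ := rr_id _
  res_comp _ _ _ _ _ _ := rr_comp _ _ _
  res_rfl _ := rr_rfl _
  res_res _ _ _ _ _ := rr_rr _ _ _

/-- A functor from a strict system to a prestack. -/
structure SysHom {X : Type u} [TopologicalSpace X] (C : Sys X) (H : Prestack X) where
  /-- The action on objects. -/
  obj : ∀ i : C.Obj, H.fib (C.dom i)
  /-- The action on morphisms. -/
  map : ∀ {W : Opens X} {i j : C.At W}, (i ⟶ j) →
    ((H.rs i.2).obj (obj i.1) ⟶ (H.rs j.2).obj (obj j.1))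
  map_id : ∀ {W : Opens X} (i : C.At W), map (𝟙 i) = 𝟙 _
  map_comp : ∀ {W : Opens X} {i j k : C.At W} (a : i ⟶ j) (b : j ⟶ k),
    map (a ≫ b) = map a ≫ map b
  map_res : ∀ {W' W : Opens X} (h : W' ≤ W) {i j : C.At W} (a : i ⟶ j),
    map (C.res h a) = rr h (map a)

namespace SysHom
attribute [simp] map_id

variable {X : Type u} [TopologicalSpace X] {G H : Prestack X} {C : Sys X}

/-- The action on isomorphisms. -/
@[simps]
def mapIso (F : SysHom C H) {W : Opens X} {i j : C.At W} (e : i ≅ j) :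
    (H.rs i.2).obj (F.obj i.1) ≅ (H.rs j.2).obj (F.obj j.1) where
  hom := F.map e.hom
  inv := F.map e.inv
  hom_inv_id := by rw [← map_comp, Iso.hom_inv_id, map_id]
  inv_hom_id := by rw [← map_comp, Iso.inv_hom_id, map_id]

end SysHom

/-- A functor between prestacks, in terms of morphisms between restrictions of objects. -/
structure PreHom {X : Type u} [TopologicalSpace X] (G H : Prestack X) where
  /-- The action on objects. -/
  obj : ∀ {U : Opens X}, G.fib U → H.fib U
  /-- The action on morphisms. -/
  map : ∀ {W U U' : Opens X} (hi : W ≤ U) (hj : W ≤ U') {i : G.fib U} {j : G.fib U'},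
    ((G.rs hi).obj i ⟶ (G.rs hj).obj j) → ((H.rs hi).obj (obj i) ⟶ (H.rs hj).obj (obj j))
  map_id : ∀ {W U : Opens X} (hi : W ≤ U) (i : G.fib U),
    map hi hi (𝟙 ((G.rs hi).obj i)) = 𝟙 _
  map_comp : ∀ {W U U' U'' : Opens X} (hi : W ≤ U) (hj : W ≤ U') (hk : W ≤ U'') {i : G.fib U}
    {j : G.fib U'} {k : G.fib U''} (t : (G.rs hi).obj i ⟶ (G.rs hj).obj j)
    (s : (G.rs hj).obj j ⟶ (G.rs hk).obj k), map hi hk (t ≫ s) = map hi hj t ≫ map hj hk s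
  map_rr : ∀ {W' W U U' : Opens X} (hi : W ≤ U) (hj : W ≤ U') {i : G.fib U} {j : G.fib U'}
    (h : W' ≤ W) (t : (G.rs hi).obj i ⟶ (G.rs hj).obj j),
    map (h.trans hi) (h.trans hj) (rr h t) = rr h (map hi hj t)

namespace PreHom

variable {X : Type u} [TopologicalSpace X] {G H : Prestack X}

attribute [simp] map_id

/-- The action on isomorphisms between restrictions. -/
@[simps]
def mapIso (F : PreHom G H) {W U U' : Opens X} (hi : W ≤ U) (hj : W ≤ U') {i : G.fib U}
    {j : G.fib U'} (t : (G.rs hi).obj i ≅ (G.rs hj).obj j) :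
    (H.rs hi).obj (F.obj i) ≅ (H.rs hj).obj (F.obj j) where
  hom := F.map hi hj t.hom
  inv := F.map hj hi t.inv
  hom_inv_id := by rw [← map_comp, Iso.hom_inv_id, map_id]
  inv_hom_id := by rw [← map_comp, Iso.inv_hom_id, map_id]

variable (F : PreHom G H)

/-- The action on morphisms between objects. -/
def homMap {U : Opens X} {i j : G.fib U} (t : i ⟶ j) : F.obj i ⟶ F.obj j :=
  (H.rsId _).inv ≫ F.map le_rfl le_rfl ((G.rs le_rfl).map t) ≫ (H.rsId _).hom

@[simp]
theorem homMap_id {U : Opens X} (i : G.fib U) : F.homMap (𝟙 i) = 𝟙 _ := by simp [homMap]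

theorem homMap_comp {U : Opens X} {i j k : G.fib U} (s : i ⟶ j) (t : j ⟶ k) :
    F.homMap (s ≫ t) = F.homMap s ≫ F.homMap t := by simp [homMap, map_comp]

/-- Both sides are restrictions along `h` of morphisms over `U`. By `map_rr` it suffices to compare
these, and there `homMap` is a conjugate by `rsId`. -/
theorem rs_homMap {W U : Opens X} (h : W ≤ U) {i j : G.fib U} (t : i ⟶ j) :
    (H.rs h).map (F.homMap t) = F.map h h ((G.rs h).map t) := by
  rw [← rr_map h (le_rfl : U ≤ U), ← rr_map h (le_rfl : U ≤ U), map_rr]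
  congr 1
  rw [← cancel_mono (H.rsId _).hom, rsId_naturality]
  simp [homMap]

/-- The comparison isomorphism. -/
def comparisonIso {W U : Opens X} (h : W ≤ U) (i : G.fib U) :
    F.obj ((G.rs h).obj i) ≅ (H.rs h).obj (F.obj i) :=
  (H.rsId _).symm ≪≫ F.mapIso le_rfl h (G.rsId ((G.rs h).obj i))

theorem comparisonIso_hom {W U : Opens X} (h : W ≤ U) (i : G.fib U) :
    (F.comparisonIso h i).hom = (H.rsId _).inv ≫ F.map le_rfl h (G.rsId ((G.rs h).obj i)).hom :=
  rfl

theorem comparisonIso_naturality {W U : Opens X} (h : W ≤ U) {i j : G.fib U} (t : i ⟶ j) :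
    F.homMap ((G.rs h).map t) ≫ (F.comparisonIso h j).hom =
      (F.comparisonIso h i).hom ≫ (H.rs h).map (F.homMap t) := by
  rw [rs_homMap, homMap, comparisonIso_hom, comparisonIso_hom]
  simp only [Category.assoc, Iso.hom_inv_id_assoc, ← map_comp, rsId_naturality]

theorem rs_map_comparisonIso {W V U : Opens X} (h : W ≤ V) (h' : V ≤ U) (i : G.fib U) :
    (H.rs h).map (F.comparisonIso h' i).hom ≫ (H.rsComp h h' _).inv =
      F.map h (h.trans h') (G.rsComp h h' i).inv := by
  rw [← G.rr_rsId_hom, map_rr, rr, comparisonIso_hom,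
    Functor.map_comp, rsComp_rfl_right, Category.assoc]

/-- This becomes the `naturality_comp` axiom of `toTrans`. It holds because the comparison
isomorphisms are images of `rsId` under `map`, so the claim is the functoriality of `map`. -/
theorem comparisonIso_comp {W V U : Opens X} (h : W ≤ V) (h' : V ≤ U) (i : G.fib U) :
    (F.comparisonIso (h.trans h') i).hom ≫ (H.rsComp h h' _).hom =
      F.homMap (G.rsComp h h' i).hom ≫ (F.comparisonIso h _).hom ≫
        (H.rs h).map (F.comparisonIso h' i).hom := by
  rw [← Iso.eq_comp_inv]
  simp only [Category.assoc, rs_map_comparisonIso, homMap]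
  simp only [comparisonIso_hom, Category.assoc, Iso.hom_inv_id_assoc, ← map_comp,
    rsId_naturality_assoc, Iso.hom_inv_id, Category.comp_id]

theorem comparisonIso_rfl {U : Opens X} (i : G.fib U) :
    (F.comparisonIso le_rfl i).hom ≫ (H.rsId _).hom = F.homMap (G.rsId i).hom := by
  rw [homMap, comparisonIso_hom, Category.assoc]
  congr 3
  rw [← cancel_mono (G.rsId _).hom, rsId_naturality]

theorem map_eq {W U U' : Opens X} (hi : W ≤ U) (hj : W ≤ U') {i : G.fib U} {j : G.fib U'}
    (t : (G.rs hi).obj i ⟶ (G.rs hj).obj j) :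
    F.map hi hj t = (F.comparisonIso hi i).inv ≫ F.homMap t ≫ (F.comparisonIso hj j).hom := by
  refine (cancel_epi (F.comparisonIso hi i).hom).1 ?_
  rw [Iso.hom_inv_id_assoc, homMap, comparisonIso_hom, comparisonIso_hom]
  simp only [Category.assoc, Iso.hom_inv_id_assoc]
  rw [← map_comp, ← map_comp, rsId_naturality]

/-- A functor between prestacks as a morphism in the bicategory. -/
def toTrans : G ⟶ H where
  app U := (show G.fib U.as.unop ⥤ H.fib U.as.unop from
    { obj i := F.obj i
      map t := F.homMap t
      map_id i := F.homMap_id i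
      map_comp s t := F.homMap_comp s t }).toCatHom
  naturality {U V} f := Cat.Hom.isoMk (NatIso.ofComponents
    (fun i => F.comparisonIso (leOfHom f.as.unop) i)
    (fun t => F.comparisonIso_naturality (leOfHom f.as.unop) t))
  naturality_naturality {U V f g} η := by
    -- The base bicategory is locally discrete, so its 2-morphisms are identities and this axiom has
    -- no content beyond unit laws.
    obtain rfl := LocallyDiscrete.eq_of_hom η
    obtain rfl : η = 𝟙 _ := Subsingleton.elim _ _
    ext i
    have h₁ := congrArg (fun t => t.toNatTrans.app i) (G.map₂_id f)
    have h₂ := congrArg (fun t => t.toNatTrans.app (F.obj (U := U.as.unop) i)) (H.map₂_id f)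
    refine (congrArg (fun t => F.homMap (U := V.as.unop) t ≫ _) h₁).trans ?_
    refine Eq.trans ?_ (congrArg (_ ≫ ·) h₂).symm
    refine (congrArg (· ≫ _) (F.homMap_id _)).trans ?_
    exact (Category.id_comp _).trans (Category.comp_id _).symm
  naturality_id U := by
    ext i
    refine (F.comparisonIso_rfl (U := U.as.unop) i).trans ?_
    refine Eq.trans ?_ (congrArg (_ ≫ ·) (Category.id_comp _).symm)
    exact (Category.comp_id _).symm
  naturality_comp f g := by
    ext i
    refine (F.comparisonIso_comp (leOfHom g.as.unop) (leOfHom f.as.unop) i).trans ?_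
    refine congrArg (_ ≫ ·) ?_
    refine Eq.trans ?_ (Category.id_comp _).symm
    refine congrArg (_ ≫ ·) ?_
    refine Eq.trans ?_ (Category.id_comp _).symm
    exact (Category.comp_id _).symm

@[simp]
theorem onFib_toTrans_obj {U : Opens X} (i : G.fib U) :
    (onFib F.toTrans U).obj i = F.obj i := rfl

end PreHom

/-! ### Pseudonatural transformations acting on morphisms between restrictions -/

namespace Prestack

variable {X : Type u} [TopologicalSpace X] {G H : Prestack X} (F : G ⟶ H)

/-- The structural isomorphism of a morphism of prestacks. -/
def cmp {V U : Opens X} (h : V ≤ U) (i : G.fib U) :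
    (onFib F V).obj ((G.rs h).obj i) ≅ (H.rs h).obj ((onFib F U).obj i) :=
  comparison F (homOfLE h) i

theorem cmp_naturality {V U : Opens X} (h : V ≤ U) {i j : G.fib U} (t : i ⟶ j) :
    (onFib F V).map ((G.rs h).map t) ≫ (cmp F h j).hom =
      (cmp F h i).hom ≫ (H.rs h).map ((onFib F U).map t) :=
  (Cat.Hom.toNatIso (F.naturality (homOfLE h).op.toLoc)).hom.naturality t

theorem cmp_naturality_assoc {V U : Opens X} (h : V ≤ U) {i j : G.fib U} {k : H.fib V} (t : i ⟶ j)
    (s : (H.rs h).obj ((onFib F U).obj j) ⟶ k) :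
    (onFib F V).map ((G.rs h).map t) ≫ (cmp F h j).hom ≫ s =
      (cmp F h i).hom ≫ (H.rs h).map ((onFib F U).map t) ≫ s := by
  rw [← Category.assoc, cmp_naturality, Category.assoc]

theorem cmp_comp {W V U : Opens X} (h : W ≤ V) (h' : V ≤ U) (i : G.fib U) :
    (cmp F (h.trans h') i).hom ≫ (H.rsComp h h' _).hom =
      (onFib F W).map (G.rsComp h h' i).hom ≫ (cmp F h _).hom ≫
        (H.rs h).map (cmp F h' i).hom := by
  have := congrArg (fun t => t.toNatTrans.app i)
    (F.naturality_comp (homOfLE h').op.toLoc (homOfLE h).op.toLoc)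
  refine this.trans ?_
  refine congrArg (_ ≫ ·) ?_
  refine (Category.id_comp _).trans ?_
  refine congrArg (_ ≫ ·) ?_
  refine (Category.id_comp _).trans ?_
  exact (Category.comp_id _)

theorem cmp_rfl {U : Opens X} (i : G.fib U) :
    (cmp F le_rfl i).hom ≫ (H.rsId _).hom = (onFib F U).map (G.rsId i).hom := by
  have := congrArg (fun t => t.toNatTrans.app i)
    (F.naturality_id (LocallyDiscrete.mk (op U)))
  refine this.trans ?_
  refine (congrArg (_ ≫ ·) (Category.id_comp _)).trans ?_
  exact (Category.comp_id _)

/-- The action of a morphism of prestacks on morphisms between restrictions. -/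
def mapR {W U U' : Opens X} (hi : W ≤ U) (hj : W ≤ U') {i : G.fib U} {j : G.fib U'}
    (t : (G.rs hi).obj i ⟶ (G.rs hj).obj j) :
    (H.rs hi).obj ((onFib F U).obj i) ⟶ (H.rs hj).obj ((onFib F U').obj j) :=
  (cmp F hi i).inv ≫ (onFib F W).map t ≫ (cmp F hj j).hom

@[simp]
theorem mapR_id {W U : Opens X} (hi : W ≤ U) (i : G.fib U) :
    mapR F hi hi (𝟙 ((G.rs hi).obj i)) = 𝟙 _ := by
  simp [mapR]

theorem mapR_comp {W U U' U'' : Opens X} (hi : W ≤ U) (hj : W ≤ U') (hk : W ≤ U'') {i : G.fib U}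
    {j : G.fib U'} {k : G.fib U''} (t : (G.rs hi).obj i ⟶ (G.rs hj).obj j)
    (s : (G.rs hj).obj j ⟶ (G.rs hk).obj k) :
    mapR F hi hk (t ≫ s) = mapR F hi hj t ≫ mapR F hj hk s := by
  simp [mapR]

/-- The equations `e₁` and `e₂` are `cmp_comp` solved for the outer comparison isomorphisms; what
remains between them is the naturality of `cmp` along `h`. -/
theorem mapR_rr {W' W U U' : Opens X} (hi : W ≤ U) (hj : W ≤ U') {i : G.fib U} {j : G.fib U'}
    (h : W' ≤ W) (t : (G.rs hi).obj i ⟶ (G.rs hj).obj j) :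
    mapR F (h.trans hi) (h.trans hj) (rr h t) = rr h (mapR F hi hj t) := by
  have e₁ : (cmp F (h.trans hi) i).inv ≫ (onFib F W').map (G.rsComp h hi i).hom =
      (H.rsComp h hi _).hom ≫ (H.rs h).map (cmp F hi i).inv ≫ (cmp F h _).inv := by
    rw [Iso.inv_comp_eq, ← Category.assoc, cmp_comp]
    simp
  have e₂ : (onFib F W').map (G.rsComp h hj j).inv ≫ (cmp F (h.trans hj) j).hom =
      (cmp F h _).hom ≫ (H.rs h).map (cmp F hj j).hom ≫ (H.rsComp h hj _).inv := by
    rw [← cancel_mono (H.rsComp h hj _).hom, Category.assoc, cmp_comp]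
    simp [← Functor.map_comp_assoc]
  simp only [mapR, rr, Functor.map_comp, Category.assoc]
  rw [reassoc_of% e₁, e₂, cmp_naturality_assoc]
  simp

/-- A morphism in the bicategory as a functor between prestacks. -/
def toPreHom : PreHom G H where
  obj {U} i := (onFib F U).obj i
  map := fun hi hj _ _ t => mapR F hi hj t
  map_id := mapR_id F
  map_comp := mapR_comp F
  map_rr := mapR_rr F

/-- `mapR` computes the functor on restrictions of morphisms. -/
theorem mapR_map {W U : Opens X} (h : W ≤ U) {i j : G.fib U} (t : i ⟶ j) :
    mapR F h h ((G.rs h).map t) = (H.rs h).map ((onFib F U).map t) := by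
  rw [mapR, cmp_naturality, Iso.inv_hom_id_assoc]

/-- A functor constructed as a `PreHom` may thus be computed by its own `map`, without unfolding the
transformation built from it. -/
theorem mapR_toTrans (F : PreHom G H) {W U U' : Opens X} (hi : W ≤ U) (hj : W ≤ U')
    {i : G.fib U} {j : G.fib U'} (t : (G.rs hi).obj i ⟶ (G.rs hj).obj j) :
    mapR F.toTrans hi hj t = F.map hi hj t :=
  (F.map_eq hi hj t).symm

theorem mapR_rsId {V U : Opens X} (h : V ≤ U) (i : G.fib U) :
    mapR F le_rfl h (G.rsId ((G.rs h).obj i)).hom = (H.rsId _).hom ≫ (cmp F h i).hom := by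
  rw [mapR, ← cmp_rfl, Category.assoc, Iso.inv_hom_id_assoc]

end Prestack

/-! ### Isomorphisms, composition and lifting of functors between prestacks -/

namespace Prestack

variable {X : Type u} [TopologicalSpace X] {G H K : Prestack X}

section isoTrans

variable {F F' : G ⟶ H}

/-- Isomorphisms of morphisms of prestacks, from their components. -/
def isoTrans (e : ∀ {U : Opens X} (i : G.fib U), (onFib F U).obj i ≅ (onFib F' U).obj i)
    (nat : ∀ {U : Opens X} {i j : G.fib U} (t : i ⟶ j),
      (onFib F U).map t ≫ (e j).hom = (e i).hom ≫ (onFib F' U).map t)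
    (hc : ∀ {V U : Opens X} (h : V ≤ U) (i : G.fib U),
      (e ((G.rs h).obj i)).hom ≫ (cmp F' h i).hom = (cmp F h i).hom ≫ (H.rs h).map (e i).hom) :
    F ≅ F' :=
  Pseudofunctor.StrongTrans.isoMk
    (fun U => Cat.Hom.isoMk (NatIso.ofComponents (fun i => e (U := U.as.unop) i)
      (fun t => nat (U := U.as.unop) t)))
    (fun {U V} f => by
      ext i
      exact hc (leOfHom f.as.unop) i)

/-- Isomorphisms of morphisms of prestacks, from their components, with naturality expressed for morphisms between
restrictions. -/
def isoTransR (e : ∀ {U : Opens X} (i : G.fib U), (onFib F U).obj i ≅ (onFib F' U).obj i)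
    (nat : ∀ {W U U' : Opens X} (hi : W ≤ U) (hj : W ≤ U') {i : G.fib U} {j : G.fib U'}
      (t : (G.rs hi).obj i ⟶ (G.rs hj).obj j),
      mapR F hi hj t ≫ (H.rs hj).map (e j).hom = (H.rs hi).map (e i).hom ≫ mapR F' hi hj t) :
    F ≅ F' :=
  isoTrans e
    (fun {U i j} t => by
      have := nat le_rfl le_rfl ((G.rs le_rfl).map t)
      rw [mapR_map, mapR_map, ← Functor.map_comp, ← Functor.map_comp] at this
      rw [← cancel_epi (H.rsId _).hom, ← rsId_naturality, this, rsId_naturality])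
    (fun {V U} h i => by
      -- The morphism `rsId` joins `i|_V`, as an object over `V`, with `i`, as an object over `U`.
      -- Naturality at this morphism is compatibility with the comparison isomorphisms.
      have := nat le_rfl h (G.rsId ((G.rs h).obj i)).hom
      rw [mapR_rsId, mapR_rsId, rsId_naturality_assoc, Category.assoc] at this
      exact ((cancel_epi _).1 this).symm)

/-- The components of a morphism between morphisms of prestacks. -/
def homApp (η : F ⟶ F') {U : Opens X} (i : G.fib U) :
    (onFib F U).obj i ⟶ (onFib F' U).obj i :=
  (η.as.app (LocallyDiscrete.mk (op U))).toNatTrans.app i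

theorem homApp_naturality (η : F ⟶ F') {U : Opens X} {i j : G.fib U} (t : i ⟶ j) :
    (onFib F U).map t ≫ homApp η j = homApp η i ≫ (onFib F' U).map t :=
  (η.as.app (LocallyDiscrete.mk (op U))).toNatTrans.naturality t

theorem homApp_cmp (η : F ⟶ F') {V U : Opens X} (h : V ≤ U) (i : G.fib U) :
    homApp η ((G.rs h).obj i) ≫ (cmp F' h i).hom = (cmp F h i).hom ≫ (H.rs h).map (homApp η i) :=
  congrArg (fun t => t.toNatTrans.app i) (η.as.naturality (homOfLE h).op.toLoc)

/-- The components of an isomorphism between morphisms of prestacks. -/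
@[simps]
def isoApp (η : F ≅ F') {U : Opens X} (i : G.fib U) :
    (onFib F U).obj i ≅ (onFib F' U).obj i where
  hom := homApp η.hom i
  inv := homApp η.inv i
  hom_inv_id := congrArg (fun t => (t.as.app (LocallyDiscrete.mk (op U))).toNatTrans.app i)
    η.hom_inv_id
  inv_hom_id := congrArg (fun t => (t.as.app (LocallyDiscrete.mk (op U))).toNatTrans.app i)
    η.inv_hom_id

end isoTrans

section comp

variable (F : G ⟶ H) (F' : H ⟶ K)

@[simp]
theorem onFib_comp_obj {U : Opens X} (i : G.fib U) :
    (onFib (F ≫ F') U).obj i = (onFib F' U).obj ((onFib F U).obj i) := rfl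

theorem cmp_comp_hom {V U : Opens X} (h : V ≤ U) (i : G.fib U) :
    (cmp (F ≫ F') h i).hom = (onFib F' V).map (cmp F h i).hom ≫ (cmp F' h _).hom := by
  refine (Category.id_comp _).trans ?_
  refine congrArg (_ ≫ ·) ?_
  refine (Category.id_comp _).trans ?_
  exact (Category.comp_id _)

theorem cmp_comp_inv {V U : Opens X} (h : V ≤ U) (i : G.fib U) :
    (cmp (F ≫ F') h i).inv = (cmp F' h _).inv ≫ (onFib F' V).map (cmp F h i).inv :=
  congrArg Iso.inv (Iso.ext (cmp_comp_hom F F' h i) :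
    cmp (F ≫ F') h i = (onFib F' V).mapIso (cmp F h i) ≪≫ cmp F' h _)

theorem mapR_comp' {W U U' : Opens X} (hi : W ≤ U) (hj : W ≤ U') {i : G.fib U} {j : G.fib U'}
    (t : (G.rs hi).obj i ⟶ (G.rs hj).obj j) :
    mapR (F ≫ F') hi hj t = mapR F' hi hj (mapR F hi hj t) := by
  refine (congrArg₂ (fun a b => a ≫ (onFib F' W).map ((onFib F W).map t) ≫ b)
    (cmp_comp_inv F F' hi i) (cmp_comp_hom F F' hj j)).trans ?_
  simp [mapR]

end comp

/-- Lifting of a morphism of prestacks along another one. -/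
theorem exists_lift {G₁ G₂ : Prestack X} (F₁ : G₁ ⟶ H) (F₂ : G₂ ⟶ H)
    (inj : ∀ {U : Opens X} (i j : G₂.fib U),
      Function.Injective (fun t : i ⟶ j => (onFib F₂ U).map t))
    (lift : ∀ {U : Opens X} (i j : G₁.fib U) (i' j' : G₂.fib U)
      (e : (onFib F₂ U).obj i' ≅ (onFib F₁ U).obj i) (e' : (onFib F₂ U).obj j' ≅ (onFib F₁ U).obj j)
      (t : i ⟶ j), ∃ s : i' ⟶ j', (onFib F₂ U).map s = e.hom ≫ (onFib F₁ U).map t ≫ e'.inv)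
    (ess : ∀ {U : Opens X} (i : G₁.fib U),
      ∃ i' : G₂.fib U, Nonempty ((onFib F₂ U).obj i' ≅ (onFib F₁ U).obj i)) :
    ∃ K : G₁ ⟶ G₂, Nonempty (K ≫ F₂ ≅ F₁) := by
  -- The preimages are chosen independently over each open set. No compatibility with restriction is
  -- needed, since a `PreHom` only has to act on morphisms between restrictions.
  choose obj e using @ess
  replace e := fun {U} i => Classical.choice (@e U i)
  have injR : ∀ {W U U' : Opens X} (hi : W ≤ U) (hj : W ≤ U') {i : G₂.fib U} {j : G₂.fib U'}
      {s t : (G₂.rs hi).obj i ⟶ (G₂.rs hj).obj j}, mapR F₂ hi hj s = mapR F₂ hi hj t → s = t := by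
    intro W U U' hi hj i j s t h
    simp only [mapR, Iso.cancel_iso_inv_left, Iso.cancel_iso_hom_right] at h
    exact inj _ _ h
  have liftR : ∀ {W U U' : Opens X} (hi : W ≤ U) (hj : W ≤ U') (i : G₁.fib U) (j : G₁.fib U')
      (t : (G₁.rs hi).obj i ⟶ (G₁.rs hj).obj j),
      ∃ s : (G₂.rs hi).obj (obj i) ⟶ (G₂.rs hj).obj (obj j),
        mapR F₂ hi hj s = (H.rs hi).map (e i).hom ≫ mapR F₁ hi hj t ≫ (H.rs hj).map (e j).inv := by
    intro W U U' hi hj i j t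
    obtain ⟨s, hs⟩ := lift _ _ _ _ (cmp F₂ hi _ ≪≫ (H.rs hi).mapIso (e i) ≪≫ (cmp F₁ hi _).symm)
      (cmp F₂ hj _ ≪≫ (H.rs hj).mapIso (e j) ≪≫ (cmp F₁ hj _).symm) t
    refine ⟨s, ?_⟩
    rw [mapR, hs]
    simp [mapR]
  choose map hmap using @liftR
  -- All laws for `K` are checked after applying `F₂`, which is faithful; there `K` is the conjugate
  -- of `F₁` by the chosen isomorphisms `e`.
  let K : PreHom G₁ G₂ :=
    { obj := fun i => obj i
      map := fun hi hj i j t => map hi hj i j t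
      map_id := fun hi i => injR _ _ (by
        rw [hmap]
        simp [mapR])
      map_comp := fun hi hj hk i j k t s => injR _ _ (by
        rw [hmap, mapR_comp F₂ hi hj hk, hmap, hmap, mapR_comp F₁ hi hj hk]
        simp [← Functor.map_comp_assoc])
      map_rr := fun hi hj i j h t => injR _ _ (by
        rw [mapR_rr, hmap, hmap, mapR_rr, rr_comp, rr_comp, rr_map, rr_map]) }
  have hK : ∀ {W U U' : Opens X} (hi : W ≤ U) (hj : W ≤ U') {i : G₁.fib U} {j : G₁.fib U'}
      (t : (G₁.rs hi).obj i ⟶ (G₁.rs hj).obj j), mapR F₂ hi hj (mapR K.toTrans hi hj t) =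
        (H.rs hi).map (e i).hom ≫ mapR F₁ hi hj t ≫ (H.rs hj).map (e j).inv := by
    intro W U U' hi hj i j t
    exact (congrArg _ (mapR_toTrans K hi hj t)).trans (hmap hi hj i j t)
  refine ⟨K.toTrans, ⟨isoTransR e ?_⟩⟩
  intro W U U' hi hj i j t
  refine (congrArg (· ≫ (H.rs hj).map (e j).hom)
    ((mapR_comp' _ _ hi hj t).trans (hK hi hj t))).trans ?_
  simp [← Functor.map_comp]

/-- Two morphisms to a prestack are isomorphic if they become so after composition with a morphism
which is faithful and lifts isomorphisms. -/
theorem nonempty_iso_of_comp {G₁ G₂ : Prestack X} (A A' : G₁ ⟶ G₂) (F : G₂ ⟶ H)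
    (inj : ∀ {U : Opens X} (i j : G₂.fib U),
      Function.Injective (fun t : i ⟶ j => (onFib F U).map t))
    (lift : ∀ {U : Opens X} (i j : G₂.fib U) (e : (onFib F U).obj i ≅ (onFib F U).obj j),
      ∃ s : i ≅ j, (onFib F U).map s.hom = e.hom)
    (η : A ≫ F ≅ A' ≫ F) : Nonempty (A ≅ A') := by
  have h : ∀ {U : Opens X} (i : G₁.fib U), ∃ s : (onFib A U).obj i ≅ (onFib A' U).obj i,
      (onFib F U).map s.hom = homApp η.hom i := fun i => lift _ _ (isoApp η i)
  choose e he using @h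
  refine ⟨isoTrans e (fun {U i j} t => inj _ _ ?_) (fun {V U} h i => inj _ _ ?_)⟩
  · simp only [Functor.map_comp]
    rw [he, he]
    exact homApp_naturality η.hom t
  · simp only [Functor.map_comp]
    refine (cancel_mono (cmp F h _).hom).1 ?_
    rw [Category.assoc, Category.assoc, cmp_naturality, he, he]
    have := homApp_cmp η.hom h i
    rw [cmp_comp_hom, cmp_comp_hom] at this
    refine this.trans (Category.assoc _ _ _)

end Prestack

/-! ### Gluing -/

section glue

variable {X : Type u} [TopologicalSpace X]

/-- The sieve of an object of `Over U` which is generated by a family of open subsets. -/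
def coverSieve {U : Opens X} (T : Over U) {ι : Type*} (V : ι → Opens X) : Sieve T where
  arrows Y _ := ∃ a, Y.left ≤ V a
  downward_closed := by
    rintro Y Z f ⟨a, ha⟩ g
    exact ⟨a, g.left.le.trans ha⟩

theorem coverSieve_mem {U W : Opens X} (hW : W ≤ U) {ι : Type*} (V : ι → Opens X)
    (hV : ∀ a, V a ≤ W) (hc : ∀ x ∈ W, ∃ a, x ∈ V a) :
    coverSieve (Over.mk (homOfLE hW)) V ∈ (Opens.grothendieckTopology X).over U
      (Over.mk (homOfLE hW)) := by
  rw [GrothendieckTopology.mem_over_iff]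
  intro x hx
  obtain ⟨a, ha⟩ := hc x hx
  refine ⟨V a, homOfLE (hV a), ?_, ha⟩
  rw [Sieve.overEquiv_iff]
  exact ⟨a, le_rfl⟩

/-- The restriction of sections of a presheaf on `Over U`. -/
def ovRes {U : Opens X} (P : (Over U)ᵒᵖ ⥤ Type u) {V W : Opens X} (h : V ≤ W) (hW : W ≤ U)
    (s : P.obj (op (Over.mk (homOfLE hW)))) : P.obj (op (Over.mk (homOfLE (h.trans hW)))) :=
  P.map (Over.homMk (homOfLE h) : Over.mk (homOfLE (h.trans hW)) ⟶ Over.mk (homOfLE hW)).op s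

variable {U : Opens X} {P : (Over U)ᵒᵖ ⥤ Type u}
  (hP : Presheaf.IsSheaf ((Opens.grothendieckTopology X).over U) P)
  {W : Opens X} (hW : W ≤ U) {ι : Type*} (V : ι → Opens X) (hV : ∀ a, V a ≤ W)
  (hc : ∀ x ∈ W, ∃ a, x ∈ V a)

include hP hc

theorem sheafOver_ext (s t : P.obj (op (Over.mk (homOfLE hW))))
    (h : ∀ a, ovRes P (hV a) hW s = ovRes P (hV a) hW t) : s = t := by
  refine ((isSheaf_iff_isSheaf_of_type _ _).1 hP _
    (coverSieve_mem hW V hV hc)).isSeparatedFor.ext ?_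
  rintro Y f ⟨a, ha⟩
  let g : Y ⟶ Over.mk (homOfLE ((hV a).trans hW)) := Over.homMk (homOfLE ha)
  let g' : Over.mk (homOfLE ((hV a).trans hW)) ⟶ Over.mk (homOfLE hW) := Over.homMk (homOfLE (hV a))
  have : f = g ≫ g' := rfl
  rw [this, op_comp, P.map_comp]
  exact congrArg (P.map g.op) (h a)

theorem sheafOver_glue (s : ∀ a, P.obj (op (Over.mk (homOfLE ((hV a).trans hW)))))
    (h : ∀ a b (Y : Opens X) (ha : Y ≤ V a) (hb : Y ≤ V b),
      ovRes P ha ((hV a).trans hW) (s a) = ovRes P hb ((hV b).trans hW) (s b)) :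
    ∃ t : P.obj (op (Over.mk (homOfLE hW))), ∀ a, ovRes P (hV a) hW t = s a := by
  -- For each member of the sieve some index is chosen whose open set contains it; by the agreement
  -- on overlaps the value does not depend on the choice, which is `hx`.
  let x : Presieve.FamilyOfElements P (coverSieve (Over.mk (homOfLE hW)) V).arrows := fun Y f hf =>
    P.map (Over.homMk (homOfLE hf.choose_spec) :
      Y ⟶ Over.mk (homOfLE ((hV hf.choose).trans hW))).op (s hf.choose)
  have hx : ∀ {Y : Over U} (f : Y ⟶ Over.mk (homOfLE hW)) (hf) (a : ι) (ha : Y.left ≤ V a),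
      x f hf = P.map (Over.homMk (homOfLE ha) :
        Y ⟶ Over.mk (homOfLE ((hV a).trans hW))).op (s a) := by
    intro Y f hf a ha
    exact h _ _ Y.left _ _
  have hcomp : x.Compatible := by
    intro Y₁ Y₂ Z g₁ g₂ f₁ f₂ h₁ h₂ e
    obtain ⟨a, ha⟩ := id h₁
    obtain ⟨b, hb⟩ := id h₂
    have e₁ := hx f₁ h₁ a ha
    have e₂ := hx f₂ h₂ b hb
    refine (congrArg (P.map g₁.op) e₁).trans (Eq.trans ?_ (congrArg (P.map g₂.op) e₂).symm)
    rw [← types_comp_apply (P.map _), ← types_comp_apply (P.map _), ← P.map_comp, ← P.map_comp]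
    exact h a b Z.left (g₁.left.le.trans ha) (g₂.left.le.trans hb)
  obtain ⟨t, ht, -⟩ := (isSheaf_iff_isSheaf_of_type _ _).1 hP _ (coverSieve_mem hW V hV hc) x hcomp
  refine ⟨t, fun a => (ht _ ⟨a, le_rfl⟩).trans ((hx (Over.homMk (homOfLE (hV a)) :
    Over.mk (homOfLE ((hV a).trans hW)) ⟶ Over.mk (homOfLE hW)) ⟨a, le_rfl⟩ a le_rfl).trans ?_)⟩
  exact congrArg (fun f => f (s a)) (P.map_id _)

end glue

/-! ### Gluing of morphisms in a stack -/

namespace Prestack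

variable {X : Type u} [TopologicalSpace X] {G : Prestack X} (hG : G.IsStack)

theorem ovRes_presheafHom {W U V : Opens X} (h : V ≤ W) (hW : W ≤ U) (i j : G.fib U)
    (t : (G.rs hW).obj i ⟶ (G.rs hW).obj j) :
    ovRes (G.presheafHom i j) h hW t = rr h t := (rr_eq_pullHom h t rfl rfl).symm

/-- Replacing the objects by their restrictions. -/
def homRes {W U U' : Opens X} (hi : W ≤ U) (hj : W ≤ U') (i : G.fib U) (j : G.fib U') {V : Opens X}
    (hV : V ≤ W) : ((G.rs (hV.trans hi)).obj i ⟶ (G.rs (hV.trans hj)).obj j) ≃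
      ((G.rs hV).obj ((G.rs hi).obj i) ⟶ (G.rs hV).obj ((G.rs hj).obj j)) :=
  Iso.homCongr (G.rsComp hV hi i) (G.rsComp hV hj j)

theorem homRes_rr {W U U' : Opens X} (hi : W ≤ U) (hj : W ≤ U') (i : G.fib U) (j : G.fib U')
    {V V' : Opens X} (hV : V ≤ W) (hV' : V' ≤ V)
    (t : (G.rs (hV.trans hi)).obj i ⟶ (G.rs (hV.trans hj)).obj j) :
    homRes hi hj i j (hV'.trans hV) (rr hV' t) = rr hV' (homRes hi hj i j hV t) := by
  simp [homRes, rr_comp, rr_rsComp, rr_rsComp_inv]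

include hG

/-- The sheaf condition of a stack concerns two objects over the same open set. It is applied to the
restrictions of `i` and `j` to `W`, and `homRes` replaces iterated restrictions by single ones. -/
theorem hom_ext_of_cover {W U U' : Opens X} {hi : W ≤ U} {hj : W ≤ U'} {i : G.fib U}
    {j : G.fib U'} (s t : (G.rs hi).obj i ⟶ (G.rs hj).obj j)
    (h : ∀ x ∈ W, ∃ (V : Opens X) (hV : V ≤ W), x ∈ V ∧ rr hV s = rr hV t) : s = t := by
  choose V hV hxV e using h
  have := hG.toIsPrestack
  have hP := Pseudofunctor.IsPrestack.isSheaf (F := G) (Opens.grothendieckTopology X)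
    ((G.rs hi).obj i) ((G.rs hj).obj j)
  refine (homRes hi hj i j le_rfl).injective ?_
  refine sheafOver_ext hP le_rfl (ι := W) (fun x => V x.1 x.2) (fun x => hV x.1 x.2)
    (fun x hx => ⟨⟨x, hx⟩, hxV x hx⟩) _ _ (fun a => ?_)
  refine (ovRes_presheafHom _ _ _ _ _).trans (Eq.trans ?_ (ovRes_presheafHom _ _ _ _ _).symm)
  rw [← homRes_rr, ← homRes_rr, e]

theorem exists_hom_glue {W U U' : Opens X} {hi : W ≤ U} {hj : W ≤ U'} {i : G.fib U}
    {j : G.fib U'} {ι : Type*} (V : ι → Opens X) (hV : ∀ a, V a ≤ W) (hc : ∀ x ∈ W, ∃ a, x ∈ V a)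
    (s : ∀ a, (G.rs ((hV a).trans hi)).obj i ⟶ (G.rs ((hV a).trans hj)).obj j)
    (h : ∀ a b (Y : Opens X) (ha : Y ≤ V a) (hb : Y ≤ V b), rr ha (s a) = rr hb (s b)) :
    ∃ t : (G.rs hi).obj i ⟶ (G.rs hj).obj j, ∀ a, rr (hV a) t = s a := by
  have := hG.toIsPrestack
  have hP := Pseudofunctor.IsPrestack.isSheaf (F := G) (Opens.grothendieckTopology X)
    ((G.rs hi).obj i) ((G.rs hj).obj j)
  obtain ⟨t, ht⟩ := sheafOver_glue hP le_rfl V hV hc (fun a => homRes hi hj i j (hV a) (s a)) (by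
    intro a b Y ha hb
    refine (ovRes_presheafHom _ _ _ _ _).trans (Eq.trans ?_ (ovRes_presheafHom _ _ _ _ _).symm)
    rw [← homRes_rr, ← homRes_rr, h])
  refine ⟨(homRes hi hj i j le_rfl).symm t, fun a => ?_⟩
  refine (homRes hi hj i j (hV a)).injective ?_
  rw [homRes_rr _ _ _ _ le_rfl, Equiv.apply_symm_apply, ← ht a]
  exact (ovRes_presheafHom _ _ _ _ _).symm

/-- Local isomorphisms which agree glue. -/
theorem exists_iso_glue {W U U' : Opens X} {hi : W ≤ U} {hj : W ≤ U'} {i : G.fib U}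
    {j : G.fib U'} {ι : Type*} (V : ι → Opens X) (hV : ∀ a, V a ≤ W) (hc : ∀ x ∈ W, ∃ a, x ∈ V a)
    (s : ∀ a, (G.rs ((hV a).trans hi)).obj i ≅ (G.rs ((hV a).trans hj)).obj j)
    (h : ∀ a b (Y : Opens X) (ha : Y ≤ V a) (hb : Y ≤ V b), rr ha (s a).hom = rr hb (s b).hom) :
    ∃ t : (G.rs hi).obj i ≅ (G.rs hj).obj j, ∀ a, rr (hV a) t.hom = (s a).hom := by
  obtain ⟨t, ht⟩ := exists_hom_glue hG V hV hc (fun a => (s a).hom) h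
  -- The inverses agree on overlaps because equal isomorphisms have equal inverses. The glued
  -- morphisms are then inverse to each other locally, hence globally.
  obtain ⟨t', ht'⟩ := exists_hom_glue hG V hV hc (fun a => (s a).inv) (fun a b Y ha hb => by
    have : rrIso ha (s a) = rrIso hb (s b) := Iso.ext (h a b Y ha hb)
    exact congrArg Iso.inv this)
  refine ⟨⟨t, t', ?_, ?_⟩, ht⟩
  all_goals
    refine hom_ext_of_cover hG _ _ (fun x hx => ?_)
    obtain ⟨a, ha⟩ := hc x hx
    refine ⟨V a, hV a, ha, ?_⟩
    simp [rr_comp, ht, ht']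

end Prestack

/-! ### Effective descent for objects and a criterion for stacks -/

namespace Prestack

variable {X : Type u} [TopologicalSpace X] {G H : Prestack X}

theorem rsComp_rfl_right_inv {V U : Opens X} (h : V ≤ U) (i : G.fib U) :
    (G.rsComp h le_rfl i).inv = (G.rs h).map (G.rsId i).hom := by
  rw [← cancel_epi (G.rsComp h le_rfl i).hom, Iso.hom_inv_id, rsComp_rfl_right,
    ← Functor.map_comp, Iso.inv_hom_id, CategoryTheory.Functor.map_id]

/-- The hypothesis is the square occurring in morphisms of descent data; the conclusion is agreement
on an overlap in the strict language. -/
theorem rr_eq_rr_of_comm {U U' V V' Y : Opens X} {i : G.fib U} {j : G.fib U'} {hi : V ≤ U}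
    {hj : V ≤ U'} {hi' : V' ≤ U} {hj' : V' ≤ U'} (h : Y ≤ V) (h' : Y ≤ V')
    (s : (G.rs hi).obj i ⟶ (G.rs hj).obj j) (t : (G.rs hi').obj i ⟶ (G.rs hj').obj j)
    (e : (G.rs h).map s ≫ (G.rsComp h hj j).inv ≫ (G.rsComp h' hj' j).hom =
      ((G.rsComp h hi i).inv ≫ (G.rsComp h' hi' i).hom) ≫ (G.rs h').map t) :
    rr h s = rr h' t := by
  rw [rr, rr, ← cancel_mono (G.rsComp h' hj' j).hom]
  simp only [Category.assoc, Iso.inv_hom_id, Category.comp_id]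
  rw [e]
  simp only [Category.assoc, Iso.hom_inv_id_assoc]

theorem ofArrows_mem {U : Opens X} {ι : Type*} (V : ι → Opens X) (hV : ∀ a, V a ≤ U)
    (hc : ∀ x ∈ U, ∃ a, x ∈ V a) :
    Sieve.ofArrows V (fun a => homOfLE (hV a)) ∈ Opens.grothendieckTopology X U := by
  intro x hx
  obtain ⟨a, ha⟩ := hc x hx
  exact ⟨V a, homOfLE (hV a), Sieve.ofArrows_mk _ _ a, ha⟩

theorem ofObj_hom {U : Opens X} {ι : Type*} (V : ι → Opens X) (f : ∀ a, V a ⟶ U)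
    (i : G.fib U) {Y : Opens X} (q : Y ⟶ U) {a b : ι} (f₁ : Y ⟶ V a) (f₂ : Y ⟶ V b) (e₁ e₂) :
    (Pseudofunctor.DescentData.ofObj (F := G) (f := f) i).hom q f₁ f₂ e₁ e₂ =
      (G.rsComp f₁.le (f a).le i).inv ≫ (G.rsComp f₂.le (f b).le i).hom := by
  have h₁ := G.rsComp_eq f₁.le (f a).le i rfl
  have h₂ := G.rsComp_eq f₂.le (f b).le i rfl
  rw [← h₁, ← h₂]
  rfl

/-- Effective descent for objects. -/
theorem exists_obj_glue (hG : G.IsStack) {U : Opens X} {ι : Type*} (V : ι → Opens X)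
    (hV : ∀ a, V a ≤ U) (hc : ∀ x ∈ U, ∃ a, x ∈ V a) (i : ∀ a, G.fib (V a))
    (θ : ∀ a b (Y : Opens X) (ha : Y ≤ V a) (hb : Y ≤ V b),
      (G.rs ha).obj (i a) ⟶ (G.rs hb).obj (i b))
    (θ_rr : ∀ a b (Y Y' : Opens X) (ha : Y ≤ V a) (hb : Y ≤ V b) (hY : Y' ≤ Y),
      rr hY (θ a b Y ha hb) = θ a b Y' (hY.trans ha) (hY.trans hb))
    (θ_id : ∀ a (Y : Opens X) (ha : Y ≤ V a), θ a a Y ha ha = 𝟙 _)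
    (θ_comp : ∀ a b c (Y : Opens X) (ha : Y ≤ V a) (hb : Y ≤ V b) (hc : Y ≤ V c),
      θ a b Y ha hb ≫ θ b c Y hb hc = θ a c Y ha hc) :
    ∃ (j : G.fib U) (ψ : ∀ a, (G.rs (hV a)).obj j ≅ (G.rs le_rfl).obj (i a)),
      ∀ a b (Y : Opens X) (ha : Y ≤ V a) (hb : Y ≤ V b),
        rr ha (ψ a).hom ≫ θ a b Y ha hb = rr hb (ψ b).hom := by
  let D : G.DescentData (fun a => homOfLE (hV a)) :=
    { obj := i
      hom := fun Y q a b f₁ f₂ _ _ => θ a b Y f₁.le f₂.le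
      pullHom_hom := by
        intro Y' Y g q q' hq a b f₁ f₂ hf₁ hf₂ gf₁ gf₂ hgf₁ hgf₂
        refine (rr_eq_pullHom g.le _ rfl rfl).symm.trans (θ_rr a b Y Y' f₁.le f₂.le g.le)
      hom_self := fun Y q a g _ => θ_id a Y g.le
      hom_comp := fun Y q a b c f₁ f₂ f₃ _ _ _ => θ_comp a b c Y f₁.le f₂.le f₃.le }
  have := Pseudofunctor.isEquivalence_toDescentData (J := Opens.grothendieckTopology X) G
    (fun a => homOfLE (hV a)) (ofArrows_mem V hV hc)
  obtain ⟨j, ⟨ψ⟩⟩ := Functor.EssSurj.mem_essImage (F := G.toDescentData (fun a => homOfLE (hV a))) D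
  let ψ' : ∀ a, (G.rs (hV a)).obj j ≅ i a := fun a =>
    { hom := ψ.hom.hom a
      inv := ψ.inv.hom a
      hom_inv_id := congrArg (fun t => t.hom a) ψ.hom_inv_id
      inv_hom_id := congrArg (fun t => t.hom a) ψ.inv_hom_id }
  refine ⟨j, fun a => ψ' a ≪≫ (G.rsId _).symm, fun a b Y ha hb => ?_⟩
  have h := ψ.hom.comm (homOfLE (ha.trans (hV a))) (homOfLE ha) (homOfLE hb) rfl rfl
  have h' : (G.rs ha).map (ψ' a).hom ≫ θ a b Y ha hb =
      ((G.rsComp ha (hV a) j).inv ≫ (G.rsComp hb (hV b) j).hom) ≫ (G.rs hb).map (ψ' b).hom :=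
    h.trans (congrArg (· ≫ (G.rs hb).map (ψ' b).hom) (ofObj_hom V _ j _ _ _ _ _))
  simp only [rr, Iso.trans_hom, Functor.map_comp, Iso.symm_hom, ← rsComp_rfl_right,
    Category.assoc, Iso.hom_inv_id, Category.comp_id, h', Iso.hom_inv_id_assoc]

/-- A criterion for stacks. -/
theorem isStack_of_glue
    (sep : ∀ {U : Opens X} {i j : G.fib U} (s t : i ⟶ j),
      (∀ x ∈ U, ∃ (V : Opens X) (h : V ≤ U), x ∈ V ∧ (G.rs h).map s = (G.rs h).map t) → s = t)
    (glue : ∀ {U : Opens X} {i j : G.fib U} {ι : Type u} (V : ι → Opens X) (hV : ∀ a, V a ≤ U)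
      (_ : ∀ x ∈ U, ∃ a, x ∈ V a) (s : ∀ a, (G.rs (hV a)).obj i ⟶ (G.rs (hV a)).obj j)
      (_ : ∀ a b (Y : Opens X) (ha : Y ≤ V a) (hb : Y ≤ V b), rr ha (s a) = rr hb (s b)),
      ∃ t : i ⟶ j, ∀ a, (G.rs (hV a)).map t = s a)
    (obj : ∀ {U : Opens X} {ι : Type u} (V : ι → Opens X)
      (hV : ∀ a, V a ≤ U) (_ : ∀ x ∈ U, ∃ a, x ∈ V a) (i : ∀ a, G.fib (V a))
      (θ : ∀ a b (Y : Opens X) (ha : Y ≤ V a) (hb : Y ≤ V b),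
        (G.rs ha).obj (i a) ⟶ (G.rs hb).obj (i b))
      (_ : ∀ a b (Y Y' : Opens X) (ha : Y ≤ V a) (hb : Y ≤ V b) (hY : Y' ≤ Y),
        rr hY (θ a b Y ha hb) = θ a b Y' (hY.trans ha) (hY.trans hb))
      (_ : ∀ a (Y : Opens X) (ha : Y ≤ V a), θ a a Y ha ha = 𝟙 _)
      (_ : ∀ a b c (Y : Opens X) (ha : Y ≤ V a) (hb : Y ≤ V b) (hc : Y ≤ V c),
        θ a b Y ha hb ≫ θ b c Y hb hc = θ a c Y ha hc),
      ∃ (j : G.fib U) (ψ : ∀ a, (G.rs (hV a)).obj j ≅ (G.rs le_rfl).obj (i a)),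
        ∀ a b (Y : Opens X) (ha : Y ≤ V a) (hb : Y ≤ V b),
          rr ha (ψ a).hom ≫ θ a b Y ha hb = rr hb (ψ b).hom) : G.IsStack := by
  refine Pseudofunctor.IsStack.of_isStackFor (fun U R hR => ?_)
  have hc : ∀ x ∈ U, ∃ a : R.arrows.category, x ∈ a.obj.left := by
    intro x hx
    obtain ⟨V, f, hf, hxV⟩ := hR x hx
    exact ⟨⟨Over.mk f, hf⟩, hxV⟩
  -- The condition says that the functor to descent data over the sieve is an equivalence: `sep`,
  -- `glue` and `obj` give faithfulness, fullness and essential surjectivity.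
  rw [Pseudofunctor.isStackFor_iff]
  refine { faithful := ⟨fun {i j s t} e => ?_⟩, full := ⟨fun {i j} φ => ?_⟩, essSurj := ⟨fun D => ?_⟩ }
  · refine sep _ _ (fun x hx => ?_)
    obtain ⟨a, ha⟩ := hc x hx
    exact ⟨a.obj.left, a.obj.hom.le, ha, congrArg (fun t => t.hom a) e⟩
  · obtain ⟨t, ht⟩ := glue (fun a : R.arrows.category => a.obj.left) (fun a => a.obj.hom.le) hc (fun a => φ.hom a) (by
      intro a b Y ha hb
      have h := φ.comm (homOfLE (ha.trans a.obj.hom.le)) (homOfLE ha) (homOfLE hb) rfl rfl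
      have h' : (G.rs ha).map (φ.hom a) ≫ ((G.rsComp ha a.obj.hom.le j).inv ≫ (G.rsComp hb b.obj.hom.le j).hom) =
          ((G.rsComp ha a.obj.hom.le i).inv ≫ (G.rsComp hb b.obj.hom.le i).hom) ≫ (G.rs hb).map (φ.hom b) :=
        (congrArg ((G.rs ha).map (φ.hom a) ≫ ·) (ofObj_hom _ _ j _ _ _ _ _)).symm.trans
          (h.trans (congrArg (· ≫ (G.rs hb).map (φ.hom b)) (ofObj_hom _ _ i _ _ _ _ _)))
      exact rr_eq_rr_of_comm _ _ _ _ h')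
    exact ⟨t, Pseudofunctor.DescentData.hom_ext ht⟩
  · obtain ⟨j, ψ, hψ⟩ := obj (fun a : R.arrows.category => a.obj.left) (fun a => a.obj.hom.le) hc (fun a => D.obj a)
      (fun a b Y ha hb => D.hom (homOfLE (ha.trans a.obj.hom.le)) (homOfLE ha) (homOfLE hb) rfl rfl)
      (fun a b Y Y' ha hb hY => (rr_eq_pullHom hY _ rfl rfl).trans (D.pullHom_hom (homOfLE hY) _ _ rfl (homOfLE ha) (homOfLE hb) rfl rfl _ _ rfl rfl))
      (fun a Y ha => D.hom_self _ _ rfl)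
      (fun a b c Y ha hb hc => D.hom_comp _ (homOfLE ha) (homOfLE hb) (homOfLE hc) rfl rfl rfl)
    refine ⟨j, ⟨Pseudofunctor.DescentData.isoMk (fun a => ψ a ≪≫ G.rsId _) ?_⟩⟩
    intro Y q a b f₁ f₂ e₁ e₂
    have h := hψ a b Y f₁.le f₂.le
    have h' : (G.rs f₁.le).map ((ψ a).hom ≫ (G.rsId _).hom) ≫ D.hom q f₁ f₂ e₁ e₂ =
      ((G.rsComp f₁.le a.obj.hom.le j).inv ≫ (G.rsComp f₂.le b.obj.hom.le j).hom) ≫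
        (G.rs f₂.le).map ((ψ b).hom ≫ (G.rsId _).hom) := by
      rw [rr, rr, rsComp_rfl_right_inv, rsComp_rfl_right_inv] at h
      simp only [Category.assoc, Functor.map_comp] at h ⊢
      rw [← h, Iso.inv_hom_id_assoc]
      exact Category.assoc _ _ _
    exact h'.trans (congrArg (· ≫ (G.rs f₂.le).map ((ψ b).hom ≫ (G.rsId _).hom)) (ofObj_hom _ _ j _ _ _ _ _)).symm

/-! ### From local to global essential surjectivity -/

section essSurj

variable {E : G ⟶ H}
  (inj : ∀ {U : Opens X} {i j : G.fib U} {s t : i ⟶ j}, (onFib E U).map s = (onFib E U).map t → s = t)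
  (lift : ∀ {U : Opens X} {i j : G.fib U} (e : (onFib E U).obj i ≅ (onFib E U).obj j),
      ∃ s : i ⟶ j, (onFib E U).map s = e.hom)

include inj in
theorem mapR_injective {W U U' : Opens X} (hi : W ≤ U) (hj : W ≤ U') {i : G.fib U} {j : G.fib U'}
    {s t : (G.rs hi).obj i ⟶ (G.rs hj).obj j} (h : mapR E hi hj s = mapR E hi hj t) : s = t := by
  simp only [mapR, Iso.cancel_iso_inv_left, Iso.cancel_iso_hom_right] at h
  exact inj h

include lift in
theorem exists_mapR_eq {W U U' : Opens X} (hi : W ≤ U) (hj : W ≤ U') {i : G.fib U} {j : G.fib U'}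
    (e : (H.rs hi).obj ((onFib E U).obj i) ≅ (H.rs hj).obj ((onFib E U').obj j)) :
    ∃ s : (G.rs hi).obj i ⟶ (G.rs hj).obj j, mapR E hi hj s = e.hom := by
  obtain ⟨s, hs⟩ := lift (cmp E hi i ≪≫ e ≪≫ (cmp E hj j).symm)
  exact ⟨s, by simp [mapR, hs]⟩

include inj lift in
/-- A locally essentially surjective morphism of stacks which is bijective on isomorphisms is
essentially surjective. -/
theorem exists_iso_of_locallyEssSurj (hG : G.IsStack) (hH : H.IsStack) (hE : LocallyEssSurj E)
    {U : Opens X} (b : H.fib U) : ∃ i : G.fib U, Nonempty ((onFib E U).obj i ≅ b) := by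
  have hE' : ∀ x : U, ∃ (V : Opens X) (h : V ≤ U) (i : G.fib V),
      x.1 ∈ V ∧ Nonempty ((onFib E V).obj i ≅ (H.rs h).obj b) := by
    intro x
    obtain ⟨V, f, i, hx, e⟩ := hE U b x.1 x.2
    exact ⟨V, f.le, i, hx, e⟩
  choose V hV i hxV e using hE'
  replace e := fun x => Classical.choice (e x)
  have hc : ∀ x ∈ U, ∃ a : U, x ∈ V a := fun x hx => ⟨⟨x, hx⟩, hxV ⟨x, hx⟩⟩
  let α : ∀ (a : U) {Y : Opens X} (h : Y ≤ V a),
      (H.rs h).obj ((onFib E (V a)).obj (i a)) ≅ (H.rs (h.trans (hV a))).obj b :=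
    fun a Y h => (H.rs h).mapIso (e a) ≪≫ (H.rsComp h (hV a) b).symm
  have α_rr : ∀ (a : U) {Y Y' : Opens X} (h : Y ≤ V a) (h' : Y' ≤ Y),
      rr h' (α a h).hom = (α a (h'.trans h)).hom := by
    intro a Y Y' h h'
    simp [α, rr_comp, rr_map, rr_rsComp_inv]
  have α_rr' : ∀ (a : U) {Y Y' : Opens X} (h : Y ≤ V a) (h' : Y' ≤ Y),
      rr h' (α a h).inv = (α a (h'.trans h)).inv := by
    intro a Y Y' h h'
    simp [α, rr_comp, rr_map, rr_rsComp]
  -- The transition maps between the local preimages pass through `b`, so they satisfy the cocycle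
  -- condition after `E`. Being isomorphisms they lift along `E`, and faithfulness transfers the
  -- cocycle condition to the lifts.
  choose θ hθ using fun (a b : U) (Y : Opens X) (ha : Y ≤ V a) (hb : Y ≤ V b) =>
    exists_mapR_eq lift ha hb (α a ha ≪≫ (α b hb).symm)
  obtain ⟨j, ψ, hψ⟩ := exists_obj_glue hG V hV hc i θ
    (fun a b Y Y' ha hb hY => mapR_injective inj _ _ (by
      rw [mapR_rr, hθ, hθ]
      simp [rr_comp, α_rr, α_rr']))
    (fun a Y ha => mapR_injective inj _ _ (by rw [hθ]; simp))
    (fun a b c Y ha hb hc => mapR_injective inj _ _ (by rw [mapR_comp E ha hb hc, hθ, hθ, hθ]; simp))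
  -- The local isomorphisms from `E(j)` to `b` agree on overlaps since `θ` was defined as the
  -- discrepancy between the maps `α`.
  have key : ∀ (a b : U) (Y : Opens X) (ha : Y ≤ V a) (hb : Y ≤ V b),
      rr ha (mapR E (hV a) le_rfl (ψ a).hom ≫ (α a le_rfl).hom) =
        rr hb (mapR E (hV b) le_rfl (ψ b).hom ≫ (α b le_rfl).hom) := by
    intro a b Y ha hb
    rw [rr_comp, rr_comp, ← mapR_rr, ← mapR_rr, ← hψ a b Y ha hb, mapR_comp E _ ha hb, hθ, α_rr,
      α_rr]
    simp
  obtain ⟨t, -⟩ := exists_iso_glue hH (hi := le_rfl) (hj := le_rfl)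
    (i := (onFib E U).obj j) (j := b) V hV hc
    (fun a => (toPreHom E).mapIso (hV a) le_rfl (ψ a) ≪≫ α a le_rfl) key
  exact ⟨j, ⟨(H.rsId _).symm ≪≫ t ≪≫ H.rsId _⟩⟩

end essSurj

end Prestack

/-! ### Linear systems and their stalks -/

/-- A strict system with an `S`-linear structure. -/
structure LinSys (S : Type u) [CommRing S] (X : Type u) [TopologicalSpace X] extends Sys X where
  preadditive : ∀ W : Opens X, Preadditive (toSys.At W)
  linear : ∀ W : Opens X, Linear S (toSys.At W)
  res_add : ∀ {W' W : Opens X} (h : W' ≤ W) {i j : toSys.At W} (a b : i ⟶ j),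
    res h (a + b) = res h a + res h b
  res_smul : ∀ {W' W : Opens X} (h : W' ≤ W) {i j : toSys.At W} (r : S) (a : i ⟶ j),
    res h (r • a) = r • res h a

namespace LinSys

attribute [instance] LinSys.preadditive LinSys.linear

variable {S : Type u} [CommRing S] {X : Type u} [TopologicalSpace X]

/-- Restriction as a linear map. -/
@[simps]
def resL (C : LinSys S X) {W' W : Opens X} (h : W' ≤ W) (i j : C.At W) :
    (i ⟶ j) →ₗ[S] (Sys.At.rs h i ⟶ Sys.At.rs h j) where
  toFun a := C.res h a
  map_add' := C.res_add h
  map_smul' := C.res_smul h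

theorem res_zero (C : LinSys S X) {W' W : Opens X} (h : W' ≤ W) (i j : C.At W) :
    C.res h (0 : i ⟶ j) = 0 := map_zero (C.resL h i j)

theorem res_neg (C : LinSys S X) {W' W : Opens X} (h : W' ≤ W) {i j : C.At W} (a : i ⟶ j) :
    C.res h (-a) = -C.res h a := map_neg (C.resL h i j) a

/-- The objects of a system which are defined at a point. -/
@[ext]
structure Pt (C : LinSys S X) (x : X) : Type (u + 1) where
  /-- The underlying object. -/
  obj : C.Obj
  mem : x ∈ C.dom obj

/-- An object over a neighbourhood of a point as an object at the point. -/
abbrev pt {C : LinSys S X} {W : Opens X} {x : X} (hx : x ∈ W) (i : C.At W) : C.Pt x :=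
  ⟨i.1, i.2 hx⟩

variable {C : LinSys S X} {x : X}

/-- An object at a point as an object over a neighbourhood of the point. -/
abbrev Pt.at' (i : C.Pt x) {W : Opens X} (h : W ≤ C.dom i.1) : C.At W := ⟨i.1, h⟩

/-- A morphism over some neighbourhood of a point. -/
structure PreGerm (i j : C.Pt x) : Type u where
  W : Opens X
  mem : x ∈ W
  hi : W ≤ C.dom i.1
  hj : W ≤ C.dom j.1
  t : i.at' hi ⟶ j.at' hj

/-- Two morphisms have the same germ if they agree on a neighbourhood. -/
instance germSetoid (i j : C.Pt x) : Setoid (PreGerm i j) where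
  r a b := ∃ (V : Opens X) (h : V ≤ a.W) (h' : V ≤ b.W), x ∈ V ∧ C.res h a.t = C.res h' b.t
  iseqv :=
    { refl a := ⟨a.W, le_rfl, le_rfl, a.mem, rfl⟩
      symm := fun ⟨V, h, h', hx, e⟩ => ⟨V, h', h, hx, e.symm⟩
      trans := by
        rintro a b c ⟨V, h, h', hx, e⟩ ⟨V', k, k', hx', e'⟩
        refine ⟨V ⊓ V', inf_le_left.trans h, inf_le_right.trans k', ⟨hx, hx'⟩, ?_⟩
        have e₁ := congrArg (C.res (inf_le_left : V ⊓ V' ≤ V)) e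
        have e₂ := congrArg (C.res (inf_le_right : V ⊓ V' ≤ V')) e'
        rw [C.res_res, C.res_res] at e₁ e₂
        exact e₁.trans e₂ }

/-- The germs at `x` of morphisms. -/
def Germ (i j : C.Pt x) : Type u := Quotient (germSetoid i j)

/-- The germ of a morphism. -/
def germ {W : Opens X} (hx : x ∈ W) {i j : C.At W} (t : i ⟶ j) : Germ (pt hx i) (pt hx j) :=
  Quotient.mk _ ⟨W, hx, i.2, j.2, t⟩

theorem exists_germ {i j : C.Pt x} (a : Germ i j) : ∃ (W : Opens X) (hx : x ∈ W)
    (hi : W ≤ C.dom i.1) (hj : W ≤ C.dom j.1) (t : i.at' hi ⟶ j.at' hj), germ hx t = a := by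
  induction a using Quotient.ind with
  | _ a => exact ⟨a.W, a.mem, a.hi, a.hj, a.t, rfl⟩

theorem germ_res {V W : Opens X} (hx : x ∈ V) (h : V ≤ W) {i j : C.At W} (t : i ⟶ j) :
    germ hx (C.res h t) = germ (h hx) t :=
  Quotient.sound ⟨V, le_rfl, h, hx, by simp⟩

theorem exists_res_eq {W : Opens X} (hx : x ∈ W) {i j : C.At W} {s t : i ⟶ j}
    (h : germ hx s = germ hx t) : ∃ (V : Opens X) (h : V ≤ W), x ∈ V ∧ C.res h s = C.res h t := by
  obtain ⟨V, h, h', hx, e⟩ := Quotient.exact h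
  exact ⟨V, h, hx, e⟩

/-- Neighbourhoods of `x` are directed, so finitely many germs have representatives over a common
open set. The algebraic laws in the stalk reduce to those for sections in this way. -/
theorem exists_germ₂ {i j i' j' : C.Pt x} (a : Germ i j) (b : Germ i' j') :
    ∃ (W : Opens X) (hx : x ∈ W) (hi : W ≤ C.dom i.1) (hj : W ≤ C.dom j.1)
      (hi' : W ≤ C.dom i'.1) (hj' : W ≤ C.dom j'.1)
      (t : i.at' hi ⟶ j.at' hj) (t' : i'.at' hi' ⟶ j'.at' hj'), germ hx t = a ∧ germ hx t' = b := by
  obtain ⟨W, hx, hi, hj, t, rfl⟩ := exists_germ a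
  obtain ⟨W', hx', hi', hj', t', rfl⟩ := exists_germ b
  exact ⟨W ⊓ W', ⟨hx, hx'⟩, inf_le_left.trans hi, inf_le_left.trans hj, inf_le_right.trans hi',
    inf_le_right.trans hj', C.res inf_le_left t, C.res inf_le_right t', germ_res _ _ _,
    germ_res _ _ _⟩

theorem exists_germ₃ {i j i' j' i'' j'' : C.Pt x} (a : Germ i j) (b : Germ i' j')
    (c : Germ i'' j'') :
    ∃ (W : Opens X) (hx : x ∈ W) (hi : W ≤ C.dom i.1) (hj : W ≤ C.dom j.1)
      (hi' : W ≤ C.dom i'.1) (hj' : W ≤ C.dom j'.1) (hi'' : W ≤ C.dom i''.1)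
      (hj'' : W ≤ C.dom j''.1) (t : i.at' hi ⟶ j.at' hj) (t' : i'.at' hi' ⟶ j'.at' hj')
      (t'' : i''.at' hi'' ⟶ j''.at' hj''), germ hx t = a ∧ germ hx t' = b ∧ germ hx t'' = c := by
  obtain ⟨W, hx, hi, hj, hi', hj', t, t', rfl, rfl⟩ := exists_germ₂ a b
  obtain ⟨W', hx', hi'', hj'', t'', rfl⟩ := exists_germ c
  exact ⟨W ⊓ W', ⟨hx, hx'⟩, inf_le_left.trans hi, inf_le_left.trans hj, inf_le_left.trans hi',
    inf_le_left.trans hj', inf_le_right.trans hi'', inf_le_right.trans hj'',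
    C.res inf_le_left t, C.res inf_le_left t', C.res inf_le_right t'', germ_res _ _ _,
    germ_res _ _ _, germ_res _ _ _⟩

/-- Functions on germs. -/
def liftGerm {i j : C.Pt x} {β : Type*}
    (f : ∀ {W : Opens X} (_ : x ∈ W) (hi : W ≤ C.dom i.1) (hj : W ≤ C.dom j.1)
      (_ : i.at' hi ⟶ j.at' hj), β)
    (hf : ∀ {V W : Opens X} (hx : x ∈ V) (h : V ≤ W) (hi : W ≤ C.dom i.1) (hj : W ≤ C.dom j.1)
      (t : i.at' hi ⟶ j.at' hj), f hx (h.trans hi) (h.trans hj) (C.res h t) = f (h hx) hi hj t) :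
    Germ i j → β :=
  Quotient.lift (fun a => f a.mem a.hi a.hj a.t) (by
    rintro a b ⟨V, h, h', hx, e⟩
    rw [← hf hx h, ← hf hx h']
    exact congrArg _ e)

/-- Functions of two germs. -/
def liftGerm₂ {i j i' j' : C.Pt x} {β : Type*}
    (f : ∀ {W : Opens X} (_ : x ∈ W) (hi : W ≤ C.dom i.1) (hj : W ≤ C.dom j.1)
      (hi' : W ≤ C.dom i'.1) (hj' : W ≤ C.dom j'.1)
      (_ : i.at' hi ⟶ j.at' hj) (_ : i'.at' hi' ⟶ j'.at' hj'), β)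
    (hf : ∀ {V W : Opens X} (hx : x ∈ V) (h : V ≤ W) (hi : W ≤ C.dom i.1) (hj : W ≤ C.dom j.1)
      (hi' : W ≤ C.dom i'.1) (hj' : W ≤ C.dom j'.1)
      (t : i.at' hi ⟶ j.at' hj) (t' : i'.at' hi' ⟶ j'.at' hj'),
      f hx (h.trans hi) (h.trans hj) (h.trans hi') (h.trans hj') (C.res h t) (C.res h t') =
        f (h hx) hi hj hi' hj' t t') : Germ i j → Germ i' j' → β :=
  Quotient.lift₂ (fun a b => f (W := a.W ⊓ b.W) ⟨a.mem, b.mem⟩ (inf_le_left.trans a.hi)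
    (inf_le_left.trans a.hj) (inf_le_right.trans b.hi) (inf_le_right.trans b.hj)
    (C.res inf_le_left a.t) (C.res inf_le_right b.t)) (by
    rintro a b a' b' ⟨V, h, h', hx, e⟩ ⟨V', k, k', hx', e'⟩
    have hx'' : x ∈ V ⊓ V' := ⟨hx, hx'⟩
    change f _ _ _ _ _ _ _ = f _ _ _ _ _ _ _
    rw [← hf hx'' (inf_le_inf h k), ← hf hx'' (inf_le_inf h' k')]
    have e₁ := congrArg (C.res (inf_le_left : V ⊓ V' ≤ V)) e
    have e₂ := congrArg (C.res (inf_le_right : V ⊓ V' ≤ V')) e'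
    simp only [C.res_res] at e₁ e₂ ⊢
    exact congrArg₂ _ e₁ e₂)

/-- The composition of germs. -/
def compGerm {i j k : C.Pt x} : Germ i j → Germ j k → Germ i k :=
  liftGerm₂ (fun hx hi _ _ hk t t' =>
    (germ hx (CategoryStruct.comp (Y := j.at' _) t t') : Germ i k))
    (fun hx h hi hj hi' hk t t' => by rw [← germ_res hx h, C.res_comp])

/-- By construction `liftGerm₂` first restricts to the intersection of the two domains, here `W ⊓
W`; this restriction does not change the germ. -/
theorem compGerm_germ {W : Opens X} (hx : x ∈ W) {i j k : C.At W} (s : i ⟶ j) (t : j ⟶ k) :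
    compGerm (germ hx s) (germ hx t) = germ hx (s ≫ t) := by
  rw [← germ_res (V := W ⊓ W) ⟨hx, hx⟩ inf_le_left (s ≫ t), C.res_comp]
  rfl

/-- The stalk of a system at `x`. -/
instance stalkCat (x : X) : Category.{u} (C.Pt x) where
  Hom i j := Germ i j
  id i := germ (W := C.dom i.1) i.2 (𝟙 (i.at' le_rfl))
  comp a b := compGerm a b
  id_comp {i j} a := by
    obtain ⟨W, hx, hi, hj, t, rfl⟩ := exists_germ a
    have h := germ_res hx hi (𝟙 (i.at' le_rfl))
    refine (congrArg (compGerm · _) h.symm).trans ((compGerm_germ hx _ _).trans ?_)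
    rw [C.res_id, Category.id_comp]
  comp_id {i j} a := by
    obtain ⟨W, hx, hi, hj, t, rfl⟩ := exists_germ a
    have h := germ_res hx hj (𝟙 (j.at' le_rfl))
    refine (congrArg (compGerm _ ·) h.symm).trans ((compGerm_germ hx _ _).trans ?_)
    rw [C.res_id, Category.comp_id]
  assoc {i j k l} a b c := by
    obtain ⟨W, hx, hi, hj, hj', hk, hk', hl, t, t', t'', rfl, rfl, rfl⟩ := exists_germ₃ a b c
    have h₁ := compGerm_germ hx t t'
    have h₂ := compGerm_germ hx t' t''
    refine (congrArg (compGerm · _) h₁).trans (Eq.trans ?_ (congrArg (compGerm _ ·) h₂).symm)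
    refine (compGerm_germ hx _ _).trans (Eq.trans ?_ (compGerm_germ hx _ _).symm)
    rw [Category.assoc]

/-- The germ of a morphism, as a morphism in the stalk. -/
def germHom {W : Opens X} (hx : x ∈ W) {i j : C.At W} (t : i ⟶ j) : pt hx i ⟶ pt hx j := germ hx t

theorem germHom_id {W : Opens X} (hx : x ∈ W) (i : C.At W) : germHom hx (𝟙 i) = 𝟙 _ := by
  rw [← C.res_id i.2 ⟨i.1, le_rfl⟩]
  exact germ_res hx i.2 _

theorem germHom_comp {W : Opens X} (hx : x ∈ W) {i j k : C.At W} (s : i ⟶ j) (t : j ⟶ k) :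
    germHom hx (s ≫ t) = germHom hx s ≫ germHom hx t :=
  (compGerm_germ hx s t).symm

theorem germHom_res {V W : Opens X} (hx : x ∈ V) (h : V ≤ W) {i j : C.At W} (t : i ⟶ j) :
    germHom hx (C.res h t) = germHom (h hx) t := germ_res hx h t

instance (i j : C.Pt x) : Add (Germ i j) where
  add := liftGerm₂ (fun hx hi hj _ _ t t' => (germ hx (t + t') : Germ i j))
    (fun hx h hi hj _ _ t t' => by rw [← germ_res hx h, C.res_add])

instance (i j : C.Pt x) : Zero (Germ i j) where
  zero := germ (W := C.dom i.1 ⊓ C.dom j.1) ⟨i.2, j.2⟩ (0 : i.at' inf_le_left ⟶ j.at' inf_le_right)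

instance (i j : C.Pt x) : Neg (Germ i j) where
  neg := liftGerm (fun hx hi hj t => (germ hx (-t) : Germ i j))
    (fun hx h hi hj t => by rw [← germ_res hx h, C.res_neg])

instance (i j : C.Pt x) : SMul S (Germ i j) where
  smul r := liftGerm (fun hx hi hj t => (germ hx (r • t) : Germ i j))
    (fun hx h hi hj t => by rw [← germ_res hx h, C.res_smul])

theorem germ_add {W : Opens X} (hx : x ∈ W) {i j : C.At W} (s t : i ⟶ j) :
    germ hx (s + t) = germ hx s + germ hx t := by
  rw [← germ_res (V := W ⊓ W) ⟨hx, hx⟩ inf_le_left (s + t), C.res_add]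
  rfl

theorem germ_smul {W : Opens X} (hx : x ∈ W) {i j : C.At W} (r : S) (t : i ⟶ j) :
    germ hx (r • t) = r • germ hx t := rfl

theorem germ_zero {W : Opens X} (hx : x ∈ W) (i j : C.At W) : germ hx (0 : i ⟶ j) = 0 := by
  have : W ≤ C.dom i.1 ⊓ C.dom j.1 := le_inf i.2 j.2
  have h := C.res_zero this ⟨i.1, inf_le_left⟩ ⟨j.1, inf_le_right⟩
  rw [← h]
  exact germ_res hx this _

instance (i j : C.Pt x) : AddGroup (Germ i j) :=
  AddGroup.ofLeftAxioms
    (fun a b c => by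
      obtain ⟨W, hx, hi, hj, hi', hj', hi'', hj'', t, t', t'', rfl, rfl, rfl⟩ := exists_germ₃ a b c
      have := congrArg (germ hx) (add_assoc t t' t'')
      rwa [germ_add, germ_add, germ_add, germ_add] at this)
    (fun a => by
      obtain ⟨W, hx, hi, hj, t, rfl⟩ := exists_germ a
      have := congrArg (germ hx) (zero_add t)
      rwa [germ_add, germ_zero] at this)
    (fun a => by
      obtain ⟨W, hx, hi, hj, t, rfl⟩ := exists_germ a
      have := congrArg (germ hx) (neg_add_cancel t)
      rwa [germ_add, germ_zero] at this)

instance (i j : C.Pt x) : AddCommGroup (Germ i j) where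
  add_comm a b := by
    obtain ⟨W, hx, hi, hj, hi', hj', t, t', rfl, rfl⟩ := exists_germ₂ a b
    have := congrArg (germ hx) (add_comm t t')
    rwa [germ_add, germ_add] at this

instance (i j : C.Pt x) : Module S (Germ i j) where
  one_smul a := by
    obtain ⟨W, hx, hi, hj, t, rfl⟩ := exists_germ a
    exact congrArg (germ hx) (one_smul S t)
  mul_smul r s a := by
    obtain ⟨W, hx, hi, hj, t, rfl⟩ := exists_germ a
    exact congrArg (germ hx) (mul_smul r s t)
  smul_zero r := by
    exact congrArg (germ _) (smul_zero r)
  smul_add r a b := by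
    obtain ⟨W, hx, hi, hj, hi', hj', t, t', rfl, rfl⟩ := exists_germ₂ a b
    have := congrArg (germ hx) (smul_add r t t')
    rwa [germ_add, germ_smul, germ_smul, germ_smul, germ_add] at this
  add_smul r s a := by
    obtain ⟨W, hx, hi, hj, t, rfl⟩ := exists_germ a
    have := congrArg (germ hx) (add_smul r s t)
    rwa [germ_add] at this
  zero_smul a := by
    obtain ⟨W, hx, hi, hj, t, rfl⟩ := exists_germ a
    have := congrArg (germ hx) (zero_smul S t)
    rwa [germ_zero] at this

instance : Preadditive (C.Pt x) where
  homGroup i j := inferInstanceAs (AddCommGroup (Germ i j))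
  add_comp i j k a a' b := by
    obtain ⟨W, hx, hi, hj, hi', hj', hi'', hj'', t, t', t'', rfl, rfl, rfl⟩ := exists_germ₃ a a' b
    have := congrArg (germHom hx) (Preadditive.add_comp _ _ _ t t' t'')
    rw [germHom_comp] at this
    refine (congrArg (· ≫ germHom hx t'') (germ_add hx t t').symm).trans (this.trans ?_)
    refine (germ_add hx _ _).trans ?_
    exact congrArg₂ (· + ·) (germHom_comp hx t t'') (germHom_comp hx t' t'')
  comp_add i j k a b b' := by
    obtain ⟨W, hx, hi, hj, hi', hj', hi'', hj'', t, t', t'', rfl, rfl, rfl⟩ := exists_germ₃ a b b'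
    have := congrArg (germHom hx) (Preadditive.comp_add _ _ _ t t' t'')
    rw [germHom_comp] at this
    refine (congrArg (germHom hx t ≫ ·) (germ_add hx t' t'').symm).trans (this.trans ?_)
    refine (germ_add hx _ _).trans ?_
    exact congrArg₂ (· + ·) (germHom_comp hx t t') (germHom_comp hx t t'')

instance : Linear S (C.Pt x) where
  homModule i j := inferInstanceAs (Module S (Germ i j))
  smul_comp i j k r a b := by
    obtain ⟨W, hx, hi, hj, hi', hj', t, t', rfl, rfl⟩ := exists_germ₂ a b
    have := congrArg (germHom hx) (Linear.smul_comp _ _ _ r t t')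
    rw [germHom_comp] at this
    exact this.trans (congrArg (fun a : Germ _ _ => r • a) (germHom_comp hx t t'))
  comp_smul i j k a r b := by
    obtain ⟨W, hx, hi, hj, hi', hj', t, t', rfl, rfl⟩ := exists_germ₂ a b
    have := congrArg (germHom hx) (Linear.comp_smul _ _ _ t r t')
    rw [germHom_comp] at this
    exact this.trans (congrArg (fun a : Germ _ _ => r • a) (germHom_comp hx t t'))

theorem exists_germHom {i j : C.Pt x} (a : i ⟶ j) : ∃ (W : Opens X) (hx : x ∈ W)
    (hi : W ≤ C.dom i.1) (hj : W ≤ C.dom j.1) (t : i.at' hi ⟶ j.at' hj), germHom hx t = a :=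
  exists_germ a

theorem germHom_add {W : Opens X} (hx : x ∈ W) {i j : C.At W} (s t : i ⟶ j) :
    germHom hx (s + t) = germHom hx s + germHom hx t := germ_add hx s t

theorem germHom_zero {W : Opens X} (hx : x ∈ W) (i j : C.At W) :
    germHom hx (0 : i ⟶ j) = 0 := germ_zero hx i j

theorem germHom_smul {W : Opens X} (hx : x ∈ W) {i j : C.At W} (r : S) (t : i ⟶ j) :
    germHom hx (r • t) = r • germHom hx t := rfl

end LinSys

/-! ### The stack associated with a linear system -/

namespace LinSys

variable {S : Type u} [CommRing S] {X : Type u} [TopologicalSpace X]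

/-- A local trivialisation of a family of objects at points. -/
structure Chart (C : LinSys S X) {U : Opens X} (p : ∀ z : U, C.Pt z.1) where
  /-- The model object. -/
  o : C.Obj
  /-- The domain of the chart. -/
  D : Opens X
  le : D ≤ C.dom o
  /-- The trivialisation. -/
  τ : ∀ (z : X) (hU : z ∈ U) (hD : z ∈ D), (⟨o, le hD⟩ : C.Pt z) ≅ p ⟨z, hU⟩

variable {C : LinSys S X}

/-- The model object of a chart over an open subset of its domain. -/
abbrev Chart.at' {U : Opens X} {p : ∀ z : U, C.Pt z.1} (c : Chart C p) {W : Opens X}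
    (h : W ≤ c.D) : C.At W := ⟨c.o, h.trans c.le⟩

/-- The restriction of a chart. -/
@[simps]
def Chart.res {U V : Opens X} (h : V ≤ U) {p : ∀ z : U, C.Pt z.1} (c : Chart C p) :
    Chart C (fun z : V => p ⟨z.1, h z.2⟩) where
  o := c.o
  D := c.D
  le := c.le
  τ z hV hD := c.τ z (h hV) hD

/-- A family of morphisms at points is, in terms of the charts, given by a section near `x`. -/
def Cont {U : Opens X} {p p' : ∀ z : U, C.Pt z.1} (c : Chart C p) (c' : Chart C p')
    (m : ∀ z : U, p z ⟶ p' z) (x : X) : Prop :=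
  ∃ (W : Opens X) (_ : x ∈ W) (h : W ≤ c.D) (h' : W ≤ c'.D) (t : c.at' h ⟶ c'.at' h'),
    ∀ (z : X) (hU : z ∈ U) (hW : z ∈ W),
      germHom hW t ≫ (c'.τ z hU (h' hW)).hom = (c.τ z hU (h hW)).hom ≫ m ⟨z, hU⟩

section Cont

variable {U : Opens X} {p p' p'' : ∀ z : U, C.Pt z.1} {c : Chart C p} {c' : Chart C p'}
  {c'' : Chart C p''} {x : X}

theorem Cont.refl (hx : x ∈ c.D) : Cont c c (fun _ => 𝟙 _) x :=
  ⟨c.D, hx, le_rfl, le_rfl, 𝟙 _, fun z hU hW => by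
    rw [germHom_id, Category.comp_id]; exact Category.id_comp _⟩

theorem Cont.comp {m : ∀ z : U, p z ⟶ p' z} {m' : ∀ z : U, p' z ⟶ p'' z} (h : Cont c c' m x)
    (h' : Cont c' c'' m' x) : Cont c c'' (fun z => m z ≫ m' z) x := by
  obtain ⟨W, hx, h₁, h₂, t, ht⟩ := h
  obtain ⟨W', hx', h₁', h₂', t', ht'⟩ := h'
  refine ⟨W ⊓ W', ⟨hx, hx'⟩, inf_le_left.trans h₁, inf_le_right.trans h₂',
    CategoryStruct.comp (Y := c'.at' (inf_le_left.trans h₂)) (C.res inf_le_left t)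
      (C.res inf_le_right t'), fun z hU hW => ?_⟩
  rw [germHom_comp, germHom_res, germHom_res, ← reassoc_of% ht z hU hW.1, ← ht' z hU hW.2]
  exact Category.assoc _ _ _

theorem Cont.add {m m' : ∀ z : U, p z ⟶ p' z} (h : Cont c c' m x)
    (h' : Cont c c' m' x) : Cont c c' (fun z => m z + m' z) x := by
  obtain ⟨W, hx, h₁, h₂, t, ht⟩ := h
  obtain ⟨W', hx', h₁', h₂', t', ht'⟩ := h'
  refine ⟨W ⊓ W', ⟨hx, hx'⟩, inf_le_left.trans h₁, inf_le_right.trans h₂',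
    C.res inf_le_left t + C.res inf_le_right t', fun z hU hW => ?_⟩
  rw [germHom_add, germHom_res, germHom_res, Preadditive.comp_add, ← ht z hU hW.1,
    ← ht' z hU hW.2]
  exact Preadditive.add_comp _ _ _ _ _ _

theorem Cont.smul {m : ∀ z : U, p z ⟶ p' z} (r : S) (h : Cont c c' m x) :
    Cont c c' (fun z => r • m z) x := by
  obtain ⟨W, hx, h₁, h₂, t, ht⟩ := h
  refine ⟨W, hx, h₁, h₂, r • t, fun z hU hW => ?_⟩
  rw [germHom_smul, Linear.comp_smul, ← ht z hU hW]
  exact Linear.smul_comp _ _ _ _ _ _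

theorem Cont.zero {c : Chart C p} {c' : Chart C p'} (h : x ∈ c.D) (h' : x ∈ c'.D) :
    Cont c c' (fun _ => 0) x :=
  ⟨c.D ⊓ c'.D, ⟨h, h'⟩, inf_le_left, inf_le_right, 0, fun z hU hW => by
    rw [germHom_zero, Limits.comp_zero]; exact Limits.zero_comp⟩

theorem Cont.res {m : ∀ z : U, p z ⟶ p' z} (h : Cont c c' m x) {V : Opens X} (hV : V ≤ U) :
    Cont (c.res hV) (c'.res hV) (fun z => m ⟨z.1, hV z.2⟩) x := by
  obtain ⟨W, hx, h₁, h₂, t, ht⟩ := h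
  exact ⟨W, hx, h₁, h₂, t, fun z hU hW => ht z (hV hU) hW⟩

/-- Continuity at `x` concerns only a neighbourhood of `x`: the section is shrunk to `W ⊓ V`, at
whose points the equation over `V` is available. -/
theorem Cont.of_res {m : ∀ z : U, p z ⟶ p' z} {V : Opens X} (hV : V ≤ U) (hx : x ∈ V)
    (h : Cont (c.res hV) (c'.res hV) (fun z => m ⟨z.1, hV z.2⟩) x) : Cont c c' m x := by
  obtain ⟨W, hx', h₁, h₂, t, ht⟩ := h
  refine ⟨W ⊓ V, ⟨hx', hx⟩, inf_le_left.trans h₁, inf_le_left.trans h₂, C.res inf_le_left t,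
    fun z hU hW => ?_⟩
  exact (congrArg (· ≫ _) (germHom_res hW (inf_le_left : W ⊓ V ≤ W) t)).trans (ht z hW.2 hW.1)

end Cont

/-- The objects of the stack associated with a linear system: families of objects at points with
local trivialisations whose transition maps are given by sections. -/
structure Loc (C : LinSys S X) (U : Opens X) where
  /-- The object at a point. -/
  p : ∀ z : U, C.Pt z.1
  /-- The chart at a point. -/
  chart : U → Chart C p
  mem : ∀ x : U, x.1 ∈ (chart x).D
  compat : ∀ (x y : U) (z : X), z ∈ U → z ∈ (chart x).D → z ∈ (chart y).D →
    Cont (chart x) (chart y) (fun _ => 𝟙 _) z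

namespace Loc

/-- The morphisms of the stack associated with a linear system. -/
@[ext]
structure Hom {U : Opens X} (a b : C.Loc U) where
  /-- The morphism at a point. -/
  m : ∀ z : U, a.p z ⟶ b.p z
  cont : ∀ x : U, Cont (a.chart x) (b.chart x) m x.1

instance (U : Opens X) : Category.{u} (C.Loc U) where
  Hom a b := Hom a b
  id a := ⟨fun _ => 𝟙 _, fun x => Cont.refl (a.mem x)⟩
  comp s t := ⟨fun z => s.m z ≫ t.m z, fun x => (s.cont x).comp (t.cont x)⟩
  id_comp _ := Hom.ext (funext fun _ => Category.id_comp _)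
  comp_id _ := Hom.ext (funext fun _ => Category.comp_id _)
  assoc _ _ _ := Hom.ext (funext fun _ => Category.assoc _ _ _)

variable {U : Opens X}

/-- The components of a morphism. -/
def ev {a b : C.Loc U} (s : a ⟶ b) (z : U) : a.p z ⟶ b.p z := Hom.m s z

theorem hom_ext {a b : C.Loc U} {s t : a ⟶ b} (h : ∀ z, ev s z = ev t z) : s = t :=
  Hom.ext (funext h)

@[simp] theorem ev_id (a : C.Loc U) (z : U) : ev (𝟙 a) z = 𝟙 _ := rfl
@[simp] theorem ev_comp {a b c : C.Loc U} (s : a ⟶ b) (t : b ⟶ c) (z : U) :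
    ev (s ≫ t) z = ev s z ≫ ev t z := rfl

instance (a b : C.Loc U) : Add (a ⟶ b) where
  add s t := ⟨fun z => ev s z + ev t z, fun x => (Hom.cont s x).add (Hom.cont t x)⟩

instance (a b : C.Loc U) : Zero (a ⟶ b) where
  zero := ⟨fun _ => 0, fun x => Cont.zero (a.mem x) (b.mem x)⟩

instance (a b : C.Loc U) : SMul S (a ⟶ b) where
  smul r s := ⟨fun z => r • ev s z, fun x => (Hom.cont s x).smul r⟩

instance (a b : C.Loc U) : Neg (a ⟶ b) where
  neg s := (-1 : S) • s

@[simp] theorem ev_add {a b : C.Loc U} (s t : a ⟶ b) (z : U) : ev (s + t) z = ev s z + ev t z := rfl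
@[simp] theorem ev_zero (a b : C.Loc U) (z : U) : ev (0 : a ⟶ b) z = 0 := rfl
@[simp] theorem ev_smul {a b : C.Loc U} (r : S) (s : a ⟶ b) (z : U) : ev (r • s) z = r • ev s z :=
  rfl
@[simp] theorem ev_neg {a b : C.Loc U} (s : a ⟶ b) (z : U) : ev (-s) z = -ev s z := by
  refine (ev_smul (-1 : S) s z).trans ?_
  rw [neg_smul, one_smul]

instance (a b : C.Loc U) : AddCommGroup (a ⟶ b) :=
  { AddGroup.ofLeftAxioms (G := (a ⟶ b)) (fun s t w => hom_ext fun z => by simp [add_assoc])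
      (fun s => hom_ext fun z => by simp) (fun s => hom_ext fun z => by simp) with
    add_comm := fun s t => hom_ext fun z => by simp [add_comm] }

instance (a b : C.Loc U) : Module S (a ⟶ b) where
  one_smul s := hom_ext fun z => by simp
  mul_smul r r' s := hom_ext fun z => by simp [mul_smul]
  smul_zero r := hom_ext fun z => by simp
  smul_add r s t := hom_ext fun z => by simp
  add_smul r r' s := hom_ext fun z => by simp [add_smul]
  zero_smul s := hom_ext fun z => by simp

instance : Preadditive (C.Loc U) where
  add_comp _ _ _ s t w := hom_ext fun z => by simp
  comp_add _ _ _ s t w := hom_ext fun z => by simp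

instance : Linear S (C.Loc U) where
  smul_comp _ _ _ r s t := hom_ext fun z => by simp
  comp_smul _ _ _ s r t := hom_ext fun z => by simp

/-- The restriction of an object. -/
@[simps]
def res {V U : Opens X} (h : V ≤ U) (a : C.Loc U) : C.Loc V where
  p z := a.p ⟨z.1, h z.2⟩
  chart x := (a.chart ⟨x.1, h x.2⟩).res h
  mem _ := a.mem _
  compat _ _ z hz hx hy := (a.compat _ _ z (h hz) hx hy).res h

/-- The restriction functor. -/
def resFunctor {V U : Opens X} (h : V ≤ U) : C.Loc U ⥤ C.Loc V where
  obj a := res h a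
  map s := ⟨fun z => ev s ⟨z.1, h z.2⟩, fun x => (Hom.cont s ⟨x.1, h x.2⟩).res h⟩

end Loc

/-- The stack associated with a linear system. -/
def loc (C : LinSys S X) : Prestack X :=
  LocallyDiscrete.mkPseudofunctor (B₀ := (Opens X)ᵒᵖ) (fun U => Cat.of (C.Loc U.unop))
    (fun f => (Loc.resFunctor f.unop.le).toCatHom)
    -- Families indexed by points restrict strictly, so all structural isomorphisms are identities
    -- and the coherence axioms reduce to unit laws.
    (fun U => Cat.Hom.isoMk (Iso.refl (𝟭 _)))
    (fun {U V W} f g => Cat.Hom.isoMk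
      (Iso.refl (Loc.resFunctor (C := C) f.unop.le ⋙ Loc.resFunctor g.unop.le)))
    (by
      intro U₀ U₁ U₂ U₃ f g h
      ext a
      refine Loc.hom_ext (C := C) fun z => ?_
      refine (Category.id_comp _).trans ?_
      refine (Category.id_comp _).trans ?_
      refine (Category.id_comp _).trans ?_
      refine (Category.id_comp _).trans ?_
      rfl)
    (by
      intro U₀ U₁ f
      ext a
      refine Loc.hom_ext (C := C) fun z => ?_
      refine (Category.id_comp _).trans ?_
      refine (Category.id_comp _).trans ?_
      rfl)
    (by
      intro U₀ U₁ f
      ext a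
      refine Loc.hom_ext (C := C) fun z => ?_
      refine (Category.id_comp _).trans ?_
      refine (Category.id_comp _).trans ?_
      rfl)

theorem Loc.ev_rr {W' W U U' : Opens X} {i : C.loc.fib U} {j : C.loc.fib U'} {hi : W ≤ U}
    {hj : W ≤ U'} (h : W' ≤ W) (t : (C.loc.rs hi).obj i ⟶ (C.loc.rs hj).obj j) (z : W') :
    Loc.ev (C := C) (rr h t) z = Loc.ev (C := C) t ⟨z.1, h z.2⟩ := by
  refine (Category.id_comp _).trans ?_
  exact Category.comp_id _

end LinSys

/-! ### Descent for the associated stack -/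

namespace LinSys

variable {S : Type u} [CommRing S] {X : Type u} [TopologicalSpace X] {C : LinSys S X}

theorem Cont.congr {U : Opens X} {p p' : ∀ z : U, C.Pt z.1} {c : Chart C p} {c' : Chart C p'}
    {x : X} {m m' : ∀ z : U, p z ⟶ p' z} (h : Cont c c' m x) (e : ∀ z, m z = m' z) :
    Cont c c' m' x :=
  (funext e : m = m') ▸ h

/-- The component at a point is taken from any member of the cover containing it. Continuity of the
resulting family is local, so it is inherited from the given morphisms. -/
theorem loc_exists_glue {U : Opens X} {i j : C.Loc U} {ι : Type u} (V : ι → Opens X)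
    (hV : ∀ a, V a ≤ U) (hc : ∀ x ∈ U, ∃ a, x ∈ V a) (s : ∀ a, i.res (hV a) ⟶ j.res (hV a))
    (h : ∀ a b (z : X) (ha : z ∈ V a) (hb : z ∈ V b), Loc.ev (s a) ⟨z, ha⟩ = Loc.ev (s b) ⟨z, hb⟩) :
    ∃ t : i ⟶ j, ∀ a (z : V a), Loc.ev t ⟨z.1, hV a z.2⟩ = Loc.ev (s a) z := by
  choose a ha using fun z : U => hc z.1 z.2
  let m : ∀ z : U, i.p z ⟶ j.p z := fun z => Loc.ev (s (a z)) ⟨z.1, ha z⟩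
  have hm : ∀ b (z : X) (hz : z ∈ V b), m ⟨z, hV b hz⟩ = Loc.ev (s b) ⟨z, hz⟩ :=
    fun b z hz => h _ _ z _ _
  refine ⟨⟨m, fun x => Cont.of_res (hV (a x)) (ha x) ?_⟩, fun b z => hm b z.1 z.2⟩
  have e : (fun z : V (a x) => m ⟨z.1, hV _ z.2⟩) = Loc.Hom.m (s (a x)) :=
    funext fun z => hm _ z.1 z.2
  rw [e]
  exact Loc.Hom.cont (s (a x)) ⟨x.1, ha x⟩

/-- The gluing data of objects of the associated stack. -/
structure LocGlue (C : LinSys S X) {U : Opens X} {ι : Type u} (V : ι → Opens X) where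
  hV : ∀ a, V a ≤ U
  /-- The objects. -/
  i : ∀ a, C.Loc (V a)
  /-- The transition maps. -/
  θ : ∀ a b (z : X) (ha : z ∈ V a) (hb : z ∈ V b), (i a).p ⟨z, ha⟩ ≅ (i b).p ⟨z, hb⟩
  id : ∀ a (z : X) (ha : z ∈ V a), (θ a a z ha ha).hom = 𝟙 _
  comp : ∀ a b c (z : X) (ha : z ∈ V a) (hb : z ∈ V b) (hc : z ∈ V c),
    (θ a b z ha hb).hom ≫ (θ b c z hb hc).hom = (θ a c z ha hc).hom
  cont : ∀ a b (x : V a) (y : V b) (z : X), z ∈ V a → z ∈ V b → z ∈ ((i a).chart x).D →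
    z ∈ ((i b).chart y).D → Cont (((i a).chart x).res inf_le_left)
      (((i b).chart y).res inf_le_right)
      (fun w : (V a ⊓ V b : Opens X) => (θ a b w.1 w.2.1 w.2.2).hom) z

namespace LocGlue

variable {U : Opens X} {ι : Type u} {V : ι → Opens X} (g : C.LocGlue (U := U) V)
  (a : U → ι) (ha : ∀ z, z.1 ∈ V (a z))

theorem exists_section (a b : ι) (x : V a) (y : V b) (z : X) (ha : z ∈ V a) (hb : z ∈ V b)
    (hx : z ∈ ((g.i a).chart x).D) (hy : z ∈ ((g.i b).chart y).D) :
    ∃ (W : Opens X) (_ : z ∈ W) (h : W ≤ ((g.i a).chart x).D) (h' : W ≤ ((g.i b).chart y).D)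
      (hWa : W ≤ V a) (hWb : W ≤ V b)
      (t : ((g.i a).chart x).at' h ⟶ ((g.i b).chart y).at' h'), ∀ (w : X) (hW : w ∈ W),
      germHom hW t ≫ (((g.i b).chart y).τ w (hWb hW) (h' hW)).hom =
        (((g.i a).chart x).τ w (hWa hW) (h hW)).hom ≫ (g.θ a b w (hWa hW) (hWb hW)).hom := by
  obtain ⟨W, hzW, h, h', t, ht⟩ := g.cont a b x y z ha hb hx hy
  refine ⟨W ⊓ (V a ⊓ V b), ⟨hzW, ha, hb⟩, inf_le_left.trans h, inf_le_left.trans h',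
    inf_le_right.trans inf_le_left, inf_le_right.trans inf_le_right, C.res inf_le_left t,
    fun w hW => ?_⟩
  exact (congrArg (· ≫ _) (germHom_res hW (inf_le_left : W ⊓ (V a ⊓ V b) ≤ W) t)).trans
    (ht w hW.2 hW.1)

/-- The charts of the glued object. -/
@[simps]
def chart (x : U) : Chart C (fun z : U => (g.i (a z)).p ⟨z.1, ha z⟩) where
  o := ((g.i (a x)).chart ⟨x.1, ha x⟩).o
  D := ((g.i (a x)).chart ⟨x.1, ha x⟩).D ⊓ V (a x)
  le := inf_le_left.trans ((g.i (a x)).chart ⟨x.1, ha x⟩).le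
  τ z hU hD := ((g.i (a x)).chart ⟨x.1, ha x⟩).τ z hD.2 hD.1 ≪≫ g.θ _ _ z hD.2 (ha ⟨z, hU⟩)

/-- The glued object. -/
@[simps]
def glue : C.Loc U where
  p z := (g.i (a z)).p ⟨z.1, ha z⟩
  chart x := g.chart a ha x
  mem x := ⟨(g.i (a x)).mem _, ha x⟩
  compat x y z hz hx hy := by
    obtain ⟨W, hzW, h, h', hWa, hWb, t, ht⟩ := g.exists_section (a x) (a y)
      ⟨x.1, ha x⟩ ⟨y.1, ha y⟩ z hx.2 hy.2 hx.1 hy.1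
    refine ⟨W, hzW, le_inf h hWa, le_inf h' hWb, t, fun w hU hW => ?_⟩
    refine (Category.assoc _ _ _).symm.trans
      ((congrArg (· ≫ (g.θ _ _ w (hWb hW) (ha ⟨w, hU⟩)).hom) (ht w hW)).trans ?_)
    refine (Category.assoc _ _ _).trans (Eq.trans ?_ (Category.comp_id _).symm)
    exact congrArg (_ ≫ ·) (g.comp _ _ _ _ _ _ _)

/-- The glued object restricts to the given objects. -/
def glueIso (b : ι) : (g.glue a ha).res (g.hV b) ≅ g.i b where
  hom := ⟨fun z => (g.θ _ _ z.1 (ha ⟨z.1, g.hV b z.2⟩) z.2).hom, fun x => by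
    obtain ⟨W, hzW, h, h', hWa, hWb, t, ht⟩ := g.exists_section _ b
      ⟨x.1, ha ⟨x.1, g.hV b x.2⟩⟩ x x.1 (ha ⟨x.1, g.hV b x.2⟩) x.2 ((g.i _).mem _) ((g.i _).mem _)
    refine ⟨W, hzW, le_inf h hWa, h', t, fun w hU hW => ?_⟩
    refine (ht w hW).trans (Eq.trans ?_ (Category.assoc _ _ _).symm)
    exact congrArg (_ ≫ ·) (g.comp _ _ _ _ _ _ _).symm⟩
  inv := ⟨fun z => (g.θ _ _ z.1 z.2 (ha ⟨z.1, g.hV b z.2⟩)).hom, fun x => by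
    obtain ⟨W, hzW, h, h', hWa, hWb, t, ht⟩ := g.exists_section b _ x
      ⟨x.1, ha ⟨x.1, g.hV b x.2⟩⟩ x.1 x.2 (ha ⟨x.1, g.hV b x.2⟩) ((g.i _).mem _) ((g.i _).mem _)
    refine ⟨W, hzW, h, le_inf h' hWb, t, fun w hU hW => ?_⟩
    refine (Category.assoc _ _ _).symm.trans
      ((congrArg (· ≫ (g.θ _ _ w (hWb hW) (ha ⟨w, _⟩)).hom) (ht w hW)).trans ?_)
    refine (Category.assoc _ _ _).trans ?_
    exact congrArg (_ ≫ ·) (g.comp _ _ _ _ _ _ _)⟩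
  hom_inv_id := Loc.hom_ext fun z => (g.comp _ _ _ _ _ _ _).trans (g.id _ _ _)
  inv_hom_id := Loc.hom_ext fun z => (g.comp _ _ _ _ _ _ _).trans (g.id _ _ _)

end LocGlue

/-- Morphisms and objects are families over points subject to local conditions, so they glue
pointwise. For objects, a member of the cover is chosen at each point to supply the fibre, and the
descent datum compares the choices. -/
theorem loc_isStack (C : LinSys S X) : C.loc.IsStack := by
  refine isStack_of_glue (fun {U i j} s t h => ?_) (fun {U i j ι} V hV hc s h => ?_)
    (fun {U ι} V hV hc i θ hrr hid hcomp => ?_)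
  · refine Loc.hom_ext (C := C) fun z => ?_
    obtain ⟨V, hV, hz, e⟩ := h z.1 z.2
    exact congrArg (fun t => Loc.ev (C := C) t ⟨z.1, hz⟩) e
  · obtain ⟨t, ht⟩ := loc_exists_glue (C := C) V hV hc s (fun a b z (ha : z ∈ V a) hb => by
      have e := congrArg (fun t => Loc.ev (C := C) (U := V a ⊓ V b) t ⟨z, ⟨ha, hb⟩⟩)
        (h a b (V a ⊓ V b) inf_le_left inf_le_right)
      exact (Loc.ev_rr _ _ _).symm.trans (e.trans (Loc.ev_rr _ _ _)))
    exact ⟨t, fun a => Loc.hom_ext (C := C) (ht a)⟩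
  · let Θ : ∀ a b (z : X) (ha : z ∈ V a) (hb : z ∈ V b),
        (Loc.p (C := C) (i a) ⟨z, ha⟩ ⟶ Loc.p (C := C) (i b) ⟨z, hb⟩) := fun a b z ha hb =>
      Loc.ev (C := C) (θ a b (V a ⊓ V b) inf_le_left inf_le_right) ⟨z, ha, hb⟩
    -- Since `θ` is compatible with restriction, its component at `z` does not depend on the overlap
    -- on which it is evaluated.
    have hΘ : ∀ a b (Y : Opens X) ha hb (z : Y), Loc.ev (C := C) (θ a b Y ha hb) z =
        Θ a b z.1 (ha z.2) (hb z.2) := fun a b Y ha hb z => by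
      have e := congrArg (fun t => Loc.ev (C := C) t z)
        (hrr a b (V a ⊓ V b) Y inf_le_left inf_le_right (le_inf ha hb))
      exact e.symm.trans (Loc.ev_rr _ _ _)
    have Θid : ∀ a z ha, Θ a a z ha ha = 𝟙 _ := fun a z ha =>
      (hΘ a a (V a) le_rfl le_rfl ⟨z, ha⟩).symm.trans
        (congrArg (fun t => Loc.ev (C := C) t ⟨z, ha⟩) (hid a (V a) le_rfl))
    have Θcomp : ∀ a b c z ha hb hc, Θ a b z ha hb ≫ Θ b c z hb hc = Θ a c z ha hc := by
      intro a b c z ha hb hc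
      have e := congrArg (fun t => Loc.ev (C := C) (U := V a ⊓ V b ⊓ V c) t ⟨z, ⟨ha, hb⟩, hc⟩)
        (hcomp a b c (V a ⊓ V b ⊓ V c) (inf_le_left.trans inf_le_left)
          (inf_le_left.trans inf_le_right) inf_le_right)
      have e₁ := hΘ a b (V a ⊓ V b ⊓ V c) (inf_le_left.trans inf_le_left)
        (inf_le_left.trans inf_le_right) ⟨z, ⟨ha, hb⟩, hc⟩
      have e₂ := hΘ b c (V a ⊓ V b ⊓ V c) (inf_le_left.trans inf_le_right) inf_le_right
        ⟨z, ⟨ha, hb⟩, hc⟩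
      exact (congrArg₂ (· ≫ ·) e₁ e₂).symm.trans (e.trans (hΘ _ _ _ _ _ _))
    let g : C.LocGlue (U := U) V :=
      { hV := hV
        i := i
        θ := fun a b z ha hb => ⟨Θ a b z ha hb, Θ b a z hb ha, (Θcomp _ _ _ _ _ _ _).trans (Θid _ _ _),
          (Θcomp _ _ _ _ _ _ _).trans (Θid _ _ _)⟩
        id := Θid
        comp := Θcomp
        cont := fun a b x y z ha hb hx hy => by
          -- The map `θ` is continuous with respect to the charts attached to `z`; the compatibility
          -- of charts within `i a` and within `i b` passes to those attached to `x` and `y`.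
          have := ((((i a : C.Loc (V a)).compat x ⟨z, ha⟩ z ha hx (Loc.mem _ _)).res
            (inf_le_left : V a ⊓ V b ≤ V a)).comp (Loc.Hom.cont (C := C)
              (θ a b (V a ⊓ V b) inf_le_left inf_le_right) ⟨z, ha, hb⟩)).comp
            (((i b : C.Loc (V b)).compat ⟨z, hb⟩ y z hb (Loc.mem _ _) hy).res
              (inf_le_right : V a ⊓ V b ≤ V b))
          exact this.congr fun w => (Category.comp_id _).trans (Category.id_comp _) }
    choose a ha using fun z : U => hc z.1 z.2
    let j : C.loc.fib U := g.glue a ha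
    let ψ : ∀ b, (C.loc.rs (hV b)).obj j ≅ (C.loc.rs le_rfl).obj (i b) := fun b =>
      ⟨(g.glueIso a ha b).hom, (g.glueIso a ha b).inv, (g.glueIso a ha b).hom_inv_id,
        (g.glueIso a ha b).inv_hom_id⟩
    refine ⟨j, ψ, fun b b' Y hb hb' => Loc.hom_ext (C := C) fun z => ?_⟩
    have e₁ := Loc.ev_rr hb (ψ b).hom z
    have e₂ := Loc.ev_rr hb' (ψ b').hom z
    refine Eq.trans (congrArg₂ (· ≫ ·) e₁ (hΘ _ _ _ _ _ _)) (Eq.trans ?_ e₂.symm)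
    exact Θcomp _ _ _ _ _ _ _

end LinSys

/-! ### Locally bijective functors from systems to prestacks -/

namespace SysHom

variable {X : Type u} [TopologicalSpace X]

/-- A functor from a system to a prestack is locally essentially surjective. -/
def LocEssSurj {C : Sys X} {H : Prestack X} (F : SysHom C H) : Prop :=
  ∀ (U : Opens X) (b : H.fib U) (x : X), x ∈ U → ∃ (i : C.Obj) (V : Opens X) (hi : V ≤ C.dom i)
    (h : V ≤ U), x ∈ V ∧ Nonempty ((H.rs hi).obj (F.obj i) ≅ (H.rs h).obj b)

/-- A functor from a system to a prestack is locally an equivalence. -/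
structure IsLocEquiv {C : Sys X} {H : Prestack X} (F : SysHom C H) : Prop where
  ess : F.LocEssSurj
  inj : ∀ {W : Opens X} {i j : C.At W} {s t : i ⟶ j}, F.map s = F.map t → ∀ x ∈ W,
    ∃ (V : Opens X) (h : V ≤ W), x ∈ V ∧ C.res h s = C.res h t
  surj : ∀ {W : Opens X} {i j : C.At W} (s : (H.rs i.2).obj (F.obj i.1) ⟶ (H.rs j.2).obj (F.obj j.1)),
    ∀ x ∈ W, ∃ (V : Opens X) (h : V ≤ W), x ∈ V ∧
      ∃ t : Sys.At.rs h i ⟶ Sys.At.rs h j, F.map t = rr h s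

end SysHom

namespace LinSys

variable {S : Type u} [CommRing S] {X : Type u} [TopologicalSpace X] {C : LinSys S X}

/-- A section `t` with invertible germ at `x` is invertible nearby: a section `u` representing the
inverse germ satisfies `u ≫ t = 𝟙` on a neighbourhood. One composite suffices, because the germs of
`t` at all points are already isomorphisms by `e₀`. -/
theorem Cont.inv {U : Opens X} {p p' : ∀ z : U, C.Pt z.1} {c : Chart C p} {c' : Chart C p'}
    {x : X} (hxU : x ∈ U) {m : ∀ z : U, p z ≅ p' z} (h : Cont c c' (fun z => (m z).hom) x) :
    Cont c' c (fun z => (m z).inv) x := by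
  obtain ⟨W, hx, h, h', t, ht⟩ := h
  have e₀ : ∀ z (hU : z ∈ U) (hW : z ∈ W), germHom hW t =
      (c.τ z hU (h hW)).hom ≫ (m ⟨z, hU⟩).hom ≫ (c'.τ z hU (h' hW)).inv := fun z hU hW => by
    rw [← Category.assoc, Iso.eq_comp_inv]
    exact ht z hU hW
  obtain ⟨W', hx', hi, hj, u, hu⟩ := exists_germHom
    ((c'.τ x hxU (h' hx)).hom ≫ (m ⟨x, hxU⟩).inv ≫ (c.τ x hxU (h hx)).inv)
  have hx₂ : x ∈ W ⊓ W' := ⟨hx, hx'⟩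
  have e : germHom hx₂ (CategoryStruct.comp (X := c'.at' (inf_le_left.trans h'))
      (Y := c.at' (inf_le_left.trans h)) (C.res inf_le_right u) (C.res inf_le_left t)) =
      germHom hx₂ (𝟙 _) := by
    rw [germHom_comp, germHom_res, germHom_res, germHom_id]
    refine (congrArg₂ (· ≫ ·) hu (e₀ x hxU hx)).trans ?_
    simp
  obtain ⟨V, hV, hxV, e⟩ := exists_res_eq hx₂ e
  refine ⟨V, hxV, (hV.trans inf_le_left).trans h', (hV.trans inf_le_left).trans h,
    C.res (hV.trans inf_le_right) u, fun z hU hz => ?_⟩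
  have e' := congrArg (germHom hz) e
  rw [C.res_comp, C.res_res, C.res_res, germHom_comp, germHom_res hz (hV.trans inf_le_left) t,
    C.res_id, germHom_id, e₀ z hU] at e'
  refine (cancel_mono ((m ⟨z, hU⟩).hom ≫ (c'.τ z hU (h' (hV hz).1)).inv)).1 ?_
  simpa using e'

/-- An isomorphism from its components. -/
@[simps]
def Loc.mkIso {U : Opens X} {a b : C.Loc U} (m : ∀ z : U, a.p z ≅ b.p z)
    (h : ∀ x : U, Cont (a.chart x) (b.chart x) (fun z => (m z).hom) x.1) : a ≅ b where
  hom := ⟨fun z => (m z).hom, h⟩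
  inv := ⟨fun z => (m z).inv, fun x => (h x).inv x.2⟩
  hom_inv_id := Loc.hom_ext fun z => (m z).hom_inv_id
  inv_hom_id := Loc.hom_ext fun z => (m z).inv_hom_id

instance (x : X) [Small.{u} C.Obj] : Small.{u} (C.Pt x) :=
  small_of_injective (f := fun i : C.Pt x => i.obj) fun _ _ h => Pt.ext h

instance {D : Type (u + 1)} [Category.{u} D] (a b : D) : Small.{u} (a ≅ b) :=
  small_of_injective (f := fun e : a ≅ b => e.hom) fun _ _ h => Iso.ext h

/-- A chart amounts to a model object, an open set and trivialisations, all ranging over small sets.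
The third component runs over points of both `D` and `C.dom o`, so that its type does not depend on
the inclusion `le`. Thus stackification preserves smallness. -/
instance [Small.{u} C.Obj] {U : Opens X} (p : ∀ z : U, C.Pt z.1) : Small.{u} (Chart C p) :=
  small_of_injective (β := Σ (o : C.Obj) (D : Opens X),
      ∀ z : {z : U // z.1 ∈ D ∧ z.1 ∈ C.dom o}, (⟨o, z.2.2⟩ : C.Pt z.1.1) ≅ p z.1)
    (f := fun c : Chart C p => ⟨c.o, c.D, fun z => c.τ z.1.1 z.1.2 z.2.1⟩) (by
      rintro ⟨o, D, le, τ⟩ ⟨o', D', le', τ'⟩ h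
      obtain ⟨rfl, h⟩ := Sigma.mk.inj h
      obtain ⟨rfl, h⟩ := Sigma.mk.inj (eq_of_heq h)
      have h := eq_of_heq h
      congr 1
      funext z hU hD
      exact congrFun h ⟨⟨z, hU⟩, hD, le hD⟩)

instance [Small.{u} C.Obj] (U : Opens X) : Small.{u} (C.Loc U) :=
  small_of_injective (β := Σ p : (∀ z : U, C.Pt z.1), (U → Chart C p))
    (f := fun a : C.Loc U => ⟨a.p, a.chart⟩) (by
      rintro ⟨p, c, _, _⟩ ⟨p', c', _, _⟩ h
      obtain ⟨rfl, h⟩ := Sigma.mk.inj h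
      obtain rfl := eq_of_heq h
      rfl)

theorem loc_isSmall [Small.{u} C.Obj] : C.loc.IsSmall := fun U =>
  inferInstanceAs (Small.{u} (C.Loc U))

/-- The trivial object. -/
@[simps]
def locObj (i : C.Obj) : C.Loc (C.dom i) where
  p z := ⟨i, z.2⟩
  chart _ := ⟨i, C.dom i, le_rfl, fun _ _ _ => Iso.refl _⟩
  mem x := x.2
  compat _ _ _ _ hx _ := Cont.refl hx

/-- The trivial object, as an object of the associated stack. -/
abbrev locObj' (i : C.Obj) : C.loc.fib (C.dom i) := locObj i

/-- A section as a morphism between trivial objects. -/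
def locMap {W : Opens X} {i j : C.At W} (t : i ⟶ j) :
    (C.loc.rs i.2).obj (locObj' i.1) ⟶ (C.loc.rs j.2).obj (locObj' j.1) :=
  (show (locObj i.1).res i.2 ⟶ (locObj j.1).res j.2 from
    ⟨fun z => germHom z.2 t, fun x => ⟨W, x.2, i.2, j.2, t, fun _ _ _ =>
      (Category.comp_id _).trans (Category.id_comp _).symm⟩⟩)

/-- The functor from a linear system to the associated stack. -/
def toLoc (C : LinSys S X) : SysHom C.toSys C.loc where
  obj i := locObj' i
  map t := locMap t
  map_id _ := Loc.hom_ext fun _ => germHom_id _ _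
  map_comp _ _ := Loc.hom_ext fun _ => germHom_comp _ _ _
  map_res h _ _ t := Loc.hom_ext fun z => (germHom_res _ _ _).trans
    (Loc.ev_rr h (locMap t) z).symm

/-- A chart as an isomorphism with a trivial object. -/
def Loc.chartIso {U : Opens X} (a : C.Loc U) (x : U) {W : Opens X} (hW : W ≤ U)
    (hD : W ≤ (a.chart x).D) :
    (locObj (a.chart x).o).res (hD.trans (a.chart x).le) ≅ a.res hW :=
  Loc.mkIso (fun z => (a.chart x).τ z.1 (hW z.2) (hD z.2)) fun y => by
    obtain ⟨V, hy, h, h', t, ht⟩ := a.compat x ⟨y.1, hW y.2⟩ y.1 (hW y.2) (hD y.2) (a.mem _)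
    refine ⟨V, hy, h.trans (a.chart x).le, h', t, fun z hU hV => ?_⟩
    exact (ht z (hW hU) hV).trans ((Category.comp_id _).trans (Category.id_comp _).symm)

/-- Charts identify every object locally with a trivial one; equal germs at a point mean equality
near it; and continuity is exactly the local existence of a section inducing the family. -/
theorem toLoc_isLocEquiv (C : LinSys S X) : C.toLoc.IsLocEquiv where
  ess U b x hx := ⟨((b : C.Loc U).chart ⟨x, hx⟩).o, ((b : C.Loc U).chart ⟨x, hx⟩).D ⊓ U,
    inf_le_left.trans ((b : C.Loc U).chart ⟨x, hx⟩).le, inf_le_right, ⟨Loc.mem _ _, hx⟩,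
    ⟨Loc.chartIso (b : C.Loc U) ⟨x, hx⟩ inf_le_right inf_le_left⟩⟩
  inj {W i j s t} e x hx := exists_res_eq hx (congrArg (fun t => Loc.ev (C := C) t ⟨x, hx⟩) e)
  surj {W i j} s x hx := by
    obtain ⟨V, hxV, h, h', t, ht⟩ := Loc.Hom.cont (C := C) s ⟨x, hx⟩
    refine ⟨V ⊓ W, inf_le_right, ⟨hxV, hx⟩, C.res (i := ⟨i.1, h⟩) (j := ⟨j.1, h'⟩) inf_le_left t,
      Loc.hom_ext (C := C) fun z => ?_⟩
    refine (germHom_res z.2 inf_le_left t).trans (Eq.trans ?_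
      (Loc.ev_rr (C := C) (i := locObj' i.1) (j := locObj' j.1) inf_le_right s z).symm)
    exact (Category.comp_id _).symm.trans ((ht z.1 z.2.2 z.2.1).trans (Category.id_comp _))

/-- A linear system generates a stack of algebroids. -/
structure IsAlgebroid (C : LinSys S X) : Prop where
  small : Small.{u} C.Obj
  nonempty : ∀ x : X, ∃ i : C.Obj, x ∈ C.dom i
  connected : ∀ (i j : C.Obj) (x : X), x ∈ C.dom i → x ∈ C.dom j → ∃ (W : Opens X)
    (hi : W ≤ C.dom i) (hj : W ≤ C.dom j), x ∈ W ∧ Nonempty ((⟨i, hi⟩ : C.At W) ≅ ⟨j, hj⟩)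

/-- The stack of algebroids generated by a linear system. -/
@[simps stack]
def algebroid (C : LinSys S X) (hC : C.IsAlgebroid) : AlgebroidStack S X where
  stack := C.loc
  isStack := C.loc_isStack
  isSmall := have := hC.small; loc_isSmall
  preadditive U := inferInstanceAs (Preadditive (C.Loc U))
  linear U := inferInstanceAs (Linear S (C.Loc U))
  res_add _ _ _ _ _ := rfl
  res_smul _ _ _ _ _ := rfl
  locallyNonempty x := by
    obtain ⟨i, hi⟩ := hC.nonempty x
    exact ⟨C.dom i, hi, ⟨C.toLoc.obj i⟩⟩
  locallyConnected U a b x hx := by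
    let a' : C.Loc U := a
    let b' : C.Loc U := b
    -- Near `x` the charts identify `a` and `b` with their model objects, and the latter are locally
    -- isomorphic in the system.
    obtain ⟨W, hi, hj, hxW, ⟨e⟩⟩ := hC.connected (a'.chart ⟨x, hx⟩).o (b'.chart ⟨x, hx⟩).o x
      ((a'.chart ⟨x, hx⟩).le (a'.mem _)) ((b'.chart ⟨x, hx⟩).le (b'.mem _))
    let V : Opens X := W ⊓ ((a'.chart ⟨x, hx⟩).D ⊓ ((b'.chart ⟨x, hx⟩).D ⊓ U))
    have hVW : V ≤ W := inf_le_left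
    have hVa : V ≤ (a'.chart ⟨x, hx⟩).D := inf_le_right.trans inf_le_left
    have hVb : V ≤ (b'.chart ⟨x, hx⟩).D := inf_le_right.trans (inf_le_right.trans inf_le_left)
    have hVU : V ≤ U := inf_le_right.trans (inf_le_right.trans inf_le_right)
    exact ⟨V, homOfLE hVU, ⟨hxW, a'.mem _, b'.mem _, hx⟩,
      ⟨(a'.chartIso ⟨x, hx⟩ hVU hVa).symm ≪≫ C.toLoc.mapIso (C.resIso hVW e) ≪≫
        b'.chartIso ⟨x, hx⟩ hVU hVb⟩⟩

end LinSys

/-! ### Functoriality of the associated stack -/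

section

variable {R S : Type u} [CommRing R] [CommRing S] {X : Type u} [TopologicalSpace X]

namespace AlgebroidStack

theorem rr_add (B : AlgebroidStack R X) {W' W U U' : Opens X} (h : W' ≤ W) {hi : W ≤ U}
    {hj : W ≤ U'} {i : B.stack.fib U} {j : B.stack.fib U'}
    (a b : (B.stack.rs hi).obj i ⟶ (B.stack.rs hj).obj j) : rr h (a + b) = rr h a + rr h b := by
  simp only [rr, B.res_add, Preadditive.add_comp, Preadditive.comp_add]

theorem rr_smul (B : AlgebroidStack R X) {W' W U U' : Opens X} (h : W' ≤ W) {hi : W ≤ U}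
    {hj : W ≤ U'} {i : B.stack.fib U} {j : B.stack.fib U'} (r : R)
    (a : (B.stack.rs hi).obj i ⟶ (B.stack.rs hj).obj j) : rr h (r • a) = r • rr h a := by
  simp only [rr, B.res_smul, Linear.smul_comp, Linear.comp_smul]

/-- The addition of morphisms in the system of a stack of algebroids. -/
@[reducible] def sysPreadditive (B : AlgebroidStack R X) (W : Opens X) :
    Preadditive (B.stack.sys.At W) where
  homGroup i j := inferInstanceAs
    (AddCommGroup ((B.stack.rs i.2).obj i.1.2 ⟶ (B.stack.rs j.2).obj j.1.2))
  add_comp _ _ _ _ _ _ := Preadditive.add_comp (C := B.stack.fib W) _ _ _ _ _ _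
  comp_add _ _ _ _ _ _ := Preadditive.comp_add (C := B.stack.fib W) _ _ _ _ _ _

/-- The action of scalars on morphisms in the system of a stack of algebroids. -/
@[reducible] def sysLinear (B : AlgebroidStack R X) (W : Opens X) :
    letI := B.sysPreadditive W
    Linear R (B.stack.sys.At W) :=
  letI := B.sysPreadditive W
  { homModule i j := inferInstanceAs
      (Module R ((B.stack.rs i.2).obj i.1.2 ⟶ (B.stack.rs j.2).obj j.1.2))
    smul_comp _ _ _ _ _ _ := Linear.smul_comp (C := B.stack.fib W) _ _ _ _ _ _
    comp_smul _ _ _ _ _ _ := Linear.comp_smul (C := B.stack.fib W) _ _ _ _ _ _ }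

/-- The linear system of a stack of algebroids. -/
def linSys (B : AlgebroidStack R X) : LinSys R X where
  toSys := B.stack.sys
  preadditive W := B.sysPreadditive W
  linear W := B.sysLinear W
  res_add h _ _ _ _ := B.rr_add h _ _
  res_smul h _ _ _ _ := B.rr_smul h _ _

theorem linSys_isAlgebroid (B : AlgebroidStack R X) : B.linSys.IsAlgebroid where
  small := have : ∀ U, Small.{u} (B.stack.fib U) := B.isSmall; inferInstanceAs (Small.{u} (Σ U : Opens X, B.stack.fib U))
  nonempty x := by
    obtain ⟨U, hx, ⟨i⟩⟩ := B.locallyNonempty x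
    exact ⟨⟨U, i⟩, hx⟩
  connected := by
    rintro ⟨U, i⟩ ⟨V, j⟩ x hx hx'
    obtain ⟨W, f, hxW, ⟨e⟩⟩ := B.locallyConnected (U ⊓ V) ((B.stack.rs inf_le_left).obj i)
      ((B.stack.rs inf_le_right).obj j) x ⟨hx, hx'⟩
    let e' := B.stack.rsComp f.le inf_le_left i ≪≫ e ≪≫
      (B.stack.rsComp f.le inf_le_right j).symm
    exact ⟨W, f.le.trans inf_le_left, f.le.trans inf_le_right, hxW,
      ⟨⟨e'.hom, e'.inv, e'.hom_inv_id, e'.inv_hom_id⟩⟩⟩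

end AlgebroidStack

/-- A functor from a linear system to a stack of algebroids is linear. -/
structure SysHom.IsLinear [Algebra R S] {C : LinSys R X} {B : AlgebroidStack S X}
    (F : SysHom C.toSys B.stack) : Prop where
  map_add : ∀ {W : Opens X} {i j : C.At W} (a b : i ⟶ j), F.map (a + b) = F.map a + F.map b
  map_smul : ∀ {W : Opens X} {i j : C.At W} (r : R) (a : i ⟶ j),
    F.map (r • a) = algebraMap R S r • F.map a

namespace SysHom

variable {C : LinSys R X} {B : AlgebroidStack S X} (F : SysHom C.toSys B.stack) {x : X}

/-- The action on objects over an open set. -/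
abbrev objAt {W : Opens X} (i : C.At W) : B.linSys.At W := ⟨⟨C.dom i.1, F.obj i.1⟩, i.2⟩

/-- The action on morphisms over an open set. -/
abbrev mapAt {W : Opens X} {i j : C.At W} (t : i ⟶ j) : F.objAt i ⟶ F.objAt j := F.map t

/-- The action on objects of the stalks. -/
abbrev stalkObj (i : C.Pt x) : B.linSys.Pt x := ⟨⟨C.dom i.1, F.obj i.1⟩, i.2⟩

/-- The action on stalks. -/
def stalkMap {i j : C.Pt x} (a : i ⟶ j) : F.stalkObj i ⟶ F.stalkObj j :=
  LinSys.liftGerm (fun hx _ _ t => LinSys.germHom hx (F.mapAt t))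
    (fun hx h hi hj t => by
      refine (congrArg (LinSys.germHom hx) (F.map_res h t)).trans ?_
      exact LinSys.germHom_res (C := B.linSys) hx h (F.mapAt t)) a

theorem stalkMap_germHom {W : Opens X} (hx : x ∈ W) {i j : C.At W} (t : i ⟶ j) :
    F.stalkMap (LinSys.germHom hx t) = LinSys.germHom hx (F.mapAt t) := rfl

theorem stalkMap_id (i : C.Pt x) : F.stalkMap (𝟙 i) = 𝟙 _ := by
  have e := LinSys.germHom_id i.mem (i.at' le_rfl)
  refine (congrArg F.stalkMap e.symm).trans ((F.stalkMap_germHom _ _).trans ?_)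
  refine (congrArg (LinSys.germHom _) (F.map_id (i.at' le_rfl))).trans ?_
  exact LinSys.germHom_id (C := B.linSys) i.mem (F.objAt (i.at' le_rfl))

theorem stalkMap_comp {i j k : C.Pt x} (a : i ⟶ j) (b : j ⟶ k) :
    F.stalkMap (a ≫ b) = F.stalkMap a ≫ F.stalkMap b := by
  obtain ⟨W, hx, hi, hj, hi', hj', t, t', rfl, rfl⟩ := LinSys.exists_germ₂ a b
  have e := LinSys.germHom_comp hx t t'
  refine (congrArg F.stalkMap e.symm).trans ((F.stalkMap_germHom _ _).trans ?_)
  refine (congrArg (LinSys.germHom _) (F.map_comp t t')).trans ?_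
  exact LinSys.germHom_comp (C := B.linSys) hx (F.mapAt t) (F.mapAt t')

/-- The action on isomorphisms of stalks. -/
@[simps]
def stalkIso {i j : C.Pt x} (a : i ≅ j) : F.stalkObj i ≅ F.stalkObj j where
  hom := F.stalkMap a.hom
  inv := F.stalkMap a.inv
  hom_inv_id := by rw [← stalkMap_comp, Iso.hom_inv_id, stalkMap_id]
  inv_hom_id := by rw [← stalkMap_comp, Iso.inv_hom_id, stalkMap_id]

variable {F} in
theorem IsLinear.stalkMap_add [Algebra R S] (hF : F.IsLinear) {i j : C.Pt x} (a b : i ⟶ j) :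
    F.stalkMap (a + b) = F.stalkMap a + F.stalkMap b := by
  obtain ⟨W, hx, hi, hj, hi', hj', t, t', rfl, rfl⟩ := LinSys.exists_germ₂ a b
  have e := LinSys.germHom_add hx t t'
  refine (congrArg F.stalkMap e.symm).trans ((F.stalkMap_germHom _ _).trans ?_)
  refine (congrArg (LinSys.germHom _) (hF.map_add t t')).trans ?_
  exact LinSys.germHom_add (C := B.linSys) hx (F.mapAt t) (F.mapAt t')

variable {F} in
theorem IsLinear.stalkMap_smul [Algebra R S] (hF : F.IsLinear) {i j : C.Pt x} (r : R)
    (a : i ⟶ j) : F.stalkMap (r • a) = algebraMap R S r • F.stalkMap a := by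
  obtain ⟨W, hx, hi, hj, t, rfl⟩ := LinSys.exists_germHom a
  refine (congrArg F.stalkMap (LinSys.germHom_smul hx r t).symm).trans ?_
  refine (F.stalkMap_germHom _ _).trans ?_
  exact congrArg (LinSys.germHom _) (hF.map_smul r t)

variable {F} in
theorem IsLocEquiv.stalkMap_injective (hF : F.IsLocEquiv) {i j : C.Pt x} {a b : i ⟶ j}
    (h : F.stalkMap a = F.stalkMap b) : a = b := by
  obtain ⟨W, hx, hi, hj, hi', hj', t, t', rfl, rfl⟩ := LinSys.exists_germ₂ a b
  obtain ⟨V, hV, hxV, e⟩ := LinSys.exists_res_eq hx h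
  have e' : F.map (C.res hV t) = F.map (C.res hV t') :=
    (F.map_res hV t).trans (e.trans (F.map_res hV t').symm)
  obtain ⟨V', hV', hxV', e''⟩ := hF.inj e' x hxV
  have := congrArg (LinSys.germHom hxV') e''
  rwa [LinSys.germHom_res, LinSys.germHom_res, LinSys.germHom_res, LinSys.germHom_res] at this

variable {F} in
theorem IsLocEquiv.exists_stalkMap_eq (hF : F.IsLocEquiv) {i j : C.Pt x}
    (a : F.stalkObj i ⟶ F.stalkObj j) : ∃ b : i ⟶ j, F.stalkMap b = a := by
  obtain ⟨W, hx, hi, hj, s, rfl⟩ := LinSys.exists_germHom a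
  obtain ⟨V, hV, hxV, t, ht⟩ := hF.surj (i := i.at' hi) (j := j.at' hj) s x hx
  refine ⟨LinSys.germHom hxV t, ?_⟩
  refine (congrArg (LinSys.germHom _) ht).trans ?_
  exact LinSys.germHom_res (C := B.linSys) hxV hV s

/-- The action on charts. -/
@[simps]
def mapChart {U : Opens X} {p : ∀ z : U, C.Pt z.1} (c : LinSys.Chart C p) :
    LinSys.Chart B.linSys (fun z => F.stalkObj (p z)) where
  o := ⟨C.dom c.o, F.obj c.o⟩
  D := c.D
  le := c.le
  τ z hU hD := F.stalkIso (c.τ z hU hD)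

theorem _root_.TwistedSheaves.LinSys.Cont.map {U : Opens X} {p p' : ∀ z : U, C.Pt z.1}
    {c : LinSys.Chart C p} {c' : LinSys.Chart C p'} {m : ∀ z : U, p z ⟶ p' z}
    (h : LinSys.Cont c c' m x) :
    LinSys.Cont (F.mapChart c) (F.mapChart c') (fun z => F.stalkMap (m z)) x := by
  obtain ⟨W, hx, h, h', t, ht⟩ := h
  refine ⟨W, hx, h, h', F.mapAt t, fun z hU hW => ?_⟩
  have e := congrArg F.stalkMap (ht z hU hW)
  rw [stalkMap_comp, stalkMap_comp] at e
  exact e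

-- A section realising the image family lifts to `C` after shrinking, and the pointwise equations
-- descend because `F` is faithful on stalks.
variable {F} in
theorem IsLocEquiv.cont_of_map (hF : F.IsLocEquiv) {U : Opens X} {p p' : ∀ z : U, C.Pt z.1}
    {c : LinSys.Chart C p} {c' : LinSys.Chart C p'} {m : ∀ z : U, p z ⟶ p' z}
    (h : LinSys.Cont (F.mapChart c) (F.mapChart c') (fun z => F.stalkMap (m z)) x) :
    LinSys.Cont c c' m x := by
  obtain ⟨W, hx, h, h', s, hs⟩ := h
  obtain ⟨V, hV, hxV, t, ht⟩ := hF.surj (i := c.at' h) (j := c'.at' h') s x hx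
  refine ⟨V, hxV, hV.trans h, hV.trans h', t, fun z hU hz => hF.stalkMap_injective ?_⟩
  rw [stalkMap_comp, stalkMap_comp]
  refine Eq.trans (congrArg (· ≫ _) ?_) (hs z hU (hV hz))
  refine (congrArg (LinSys.germHom _) ht).trans ?_
  exact LinSys.germHom_res (C := B.linSys) hz hV s

/-- The action on objects of the associated stacks. -/
@[simps]
def locObj {U : Opens X} (a : C.Loc U) : B.linSys.Loc U where
  p z := F.stalkObj (a.p z)
  chart x := F.mapChart (a.chart x)
  mem x := a.mem x
  compat x y z hz hx hy := ((a.compat x y z hz hx hy).map F).congr fun _ => F.stalkMap_id _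

/-- The action on morphisms of the associated stacks. -/
def locMap {U : Opens X} {a b : C.Loc U} (s : a ⟶ b) : F.locObj a ⟶ F.locObj b :=
  ⟨fun z => F.stalkMap (LinSys.Loc.ev s z), fun x => (LinSys.Loc.Hom.cont s x).map F⟩

/-- The action on objects of the associated stacks. -/
abbrev locObj' {U : Opens X} (a : C.loc.fib U) : B.linSys.loc.fib U := F.locObj (U := U) a

/-- The action on morphisms between restrictions of objects of the associated stacks. -/
abbrev locMap' {W U U' : Opens X} (hi : W ≤ U) (hj : W ≤ U') {i : C.loc.fib U} {j : C.loc.fib U'}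
    (t : (C.loc.rs hi).obj i ⟶ (C.loc.rs hj).obj j) :
    (B.linSys.loc.rs hi).obj (F.locObj' i) ⟶ (B.linSys.loc.rs hj).obj (F.locObj' j) :=
  F.locMap (a := LinSys.Loc.res (U := U) hi i) (b := LinSys.Loc.res (U := U') hj j) t

/-- The functor between the associated stacks. -/
def locPreHom : PreHom C.loc B.linSys.loc where
  obj a := F.locObj' a
  map := fun hi hj _ _ t => F.locMap' hi hj t
  map_id _ _ := LinSys.Loc.hom_ext fun _ => F.stalkMap_id _
  map_comp _ _ _ _ _ _ _ _ := LinSys.Loc.hom_ext fun _ => F.stalkMap_comp _ _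
  map_rr := by
    intro W' W U U' hi hj i j h t
    refine LinSys.Loc.hom_ext fun z => ?_
    refine (congrArg F.stalkMap (LinSys.Loc.ev_rr (C := C) h t z)).trans ?_
    exact (LinSys.Loc.ev_rr h (F.locMap' hi hj t) z).symm

theorem ev_homMap_locPreHom {U : Opens X} {i j : C.loc.fib U} (t : i ⟶ j) (z : U) :
    LinSys.Loc.ev (C := B.linSys) (F.locPreHom.homMap t) z =
      F.stalkMap (LinSys.Loc.ev (C := C) t z) :=
  (Category.id_comp _).trans (Category.comp_id _)

/-- On stalks `F` is fully faithful, and continuity may be tested after applying `F`; together these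
give bijectivity on morphisms. Essential surjectivity holds because the model object of a chart in
the target is locally isomorphic to an object in the image of `F`. -/
theorem IsLocEquiv.isWeakEquivalence (hF : F.IsLocEquiv) :
    IsWeakEquivalence F.locPreHom.toTrans where
  locallyEssSurj U b x hx := by
    let b' : B.linSys.Loc U := b
    obtain ⟨i, V, hi, hV, hxV, ⟨e⟩⟩ := hF.ess _ (b'.chart ⟨x, hx⟩).o.2 x
      ((b'.chart ⟨x, hx⟩).le (b'.mem _))
    let W : Opens X := V ⊓ ((b'.chart ⟨x, hx⟩).D ⊓ U)
    have hWV : W ≤ V := inf_le_left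
    have hWD : W ≤ (b'.chart ⟨x, hx⟩).D := inf_le_right.trans inf_le_left
    have hWU : W ≤ U := inf_le_right.trans inf_le_right
    let e' : (⟨⟨C.dom i, F.obj i⟩, hWV.trans hi⟩ : B.linSys.At W) ≅
        ⟨(b'.chart ⟨x, hx⟩).o, hWD.trans (b'.chart ⟨x, hx⟩).le⟩ :=
      ⟨rr hWV e.hom, rr hWV e.inv, (rrIso hWV e).hom_inv_id, (rrIso hWV e).inv_hom_id⟩
    let k : F.locObj ((C.locObj i).res (hWV.trans hi)) ≅ (LinSys.locObj
        (C := B.linSys) ⟨C.dom i, F.obj i⟩).res (hWV.trans hi) :=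
      LinSys.Loc.mkIso (fun z => Iso.refl _) fun y => by
        refine ⟨W, y.2, hWV.trans hi, hWV.trans hi, 𝟙 _, fun z hU hW => ?_⟩
        refine (congrArg (· ≫ _) (LinSys.germHom_id (C := B.linSys) hW _)).trans ?_
        exact congrArg (· ≫ _) (F.stalkMap_id (⟨i, hi (hWV hW)⟩ : C.Pt z)).symm
    exact ⟨W, homOfLE hWU, (C.locObj i).res (hWV.trans hi), ⟨hxV, b'.mem _, hx⟩,
      ⟨k ≪≫ B.linSys.toLoc.mapIso e' ≪≫ b'.chartIso ⟨x, hx⟩ hWU hWD⟩⟩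
  bijective U i j := by
    refine ⟨fun s t e => LinSys.Loc.hom_ext (C := C) fun z => hF.stalkMap_injective ?_, fun s => ?_⟩
    · refine (F.ev_homMap_locPreHom s z).symm.trans (Eq.trans ?_ (F.ev_homMap_locPreHom t z))
      exact congrArg (fun t => LinSys.Loc.ev (C := B.linSys) t z) e
    · choose m hm using fun z : U => hF.exists_stalkMap_eq (LinSys.Loc.ev (C := B.linSys) s z)
      refine ⟨⟨m, fun y => hF.cont_of_map ?_⟩, LinSys.Loc.hom_ext (C := B.linSys) fun z =>
        (F.ev_homMap_locPreHom _ z).trans (hm z)⟩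
      exact (LinSys.Loc.Hom.cont (C := B.linSys) s y).congr fun z => (hm z).symm

end SysHom

end

/-! ### Functors from the system of a prestack -/

namespace SysHom

variable {X : Type u} [TopologicalSpace X] {G H : Prestack X}

/-- A functor from the system of a prestack as a functor between prestacks. -/
def toPreHom (F : SysHom G.sys H) : PreHom G H where
  obj {U} i := F.obj ⟨U, i⟩
  map := fun {_ U U'} hi hj i j t => F.map (i := ⟨⟨U, i⟩, hi⟩) (j := ⟨⟨U', j⟩, hj⟩) t
  map_id {_ U} hi i := F.map_id ⟨⟨U, i⟩, hi⟩
  map_comp {_ U U' U''} hi hj hk {i j k} s t := F.map_comp (i := ⟨⟨U, i⟩, hi⟩)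
    (j := ⟨⟨U', j⟩, hj⟩) (k := ⟨⟨U'', k⟩, hk⟩) s t
  map_rr {_ _ U U'} hi hj {i j} h t := F.map_res h (i := ⟨⟨U, i⟩, hi⟩) (j := ⟨⟨U', j⟩, hj⟩) t

/-- A morphism of prestacks as a functor from the system. -/
@[simps]
def ofTrans (E : G ⟶ H) : SysHom G.sys H where
  obj i := (onFib E i.1).obj i.2
  map {_ i j} t := mapR E i.2 j.2 t
  map_id _ := mapR_id E _ _
  map_comp _ _ := mapR_comp E _ _ _ _ _
  map_res h _ _ t := mapR_rr E _ _ h t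

/-- The composition of a functor from a system with a morphism of prestacks. -/
@[simps]
def comp {C : Sys X} (F : SysHom C G) (E : G ⟶ H) : SysHom C H where
  obj i := (onFib E _).obj (F.obj i)
  map t := mapR E _ _ (F.map t)
  map_id _ := by rw [F.map_id, mapR_id]
  map_comp _ _ := by rw [F.map_comp, mapR_comp E _ _ _]
  map_res h _ _ t := by rw [F.map_res, mapR_rr]

theorem _root_.TwistedSheaves.PreHom.bijective_homMap (F : PreHom G H)
    (h : ∀ {U : Opens X} (i j : G.fib U),
      Function.Bijective (F.map (le_refl U) (le_refl U) (i := i) (j := j)))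
    {U : Opens X} (i j : G.fib U) : Function.Bijective (F.homMap (i := i) (j := j)) := by
  refine ⟨fun s t e => ?_, fun s => ?_⟩
  · have e' := (h i j).1 (by simpa [PreHom.homMap] using e)
    rw [← cancel_epi (G.rsId i).hom, ← rsId_naturality, ← rsId_naturality, e']
  · obtain ⟨t, ht⟩ := (h i j).2 ((H.rsId _).hom ≫ s ≫ (H.rsId _).inv)
    refine ⟨(G.rsId i).inv ≫ t ≫ (G.rsId j).hom, ?_⟩
    have e : (G.rs le_rfl).map ((G.rsId i).inv ≫ t ≫ (G.rsId j).hom) = t := by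
      rw [← cancel_mono (G.rsId j).hom, rsId_naturality, Iso.hom_inv_id_assoc]
    rw [PreHom.homMap, e, ht]
    simp

/-- Morphisms form sheaves in both stacks, so local bijectivity is global. Injectivity over every
open set comes first, as it forces the local preimages to agree on overlaps. -/
theorem IsLocEquiv.bijective_map (hG : G.IsStack) (hH : H.IsStack) {F : SysHom G.sys H}
    (hF : F.IsLocEquiv) {W : Opens X} (i j : G.sys.At W) :
    Function.Bijective (F.map (i := i) (j := j)) := by
  have inj : ∀ {W : Opens X} {i j : G.sys.At W} {s t : i ⟶ j}, F.map s = F.map t → s = t := by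
    intro W i j s t h
    refine hom_ext_of_cover hG (i := i.1.2) (j := j.1.2) s t fun x hx => ?_
    exact hF.inj h x hx
  refine ⟨fun s t h => inj h, fun s => ?_⟩
  choose V hV hxV t ht using fun x : W => hF.surj s x.1 x.2
  obtain ⟨t', ht'⟩ := exists_hom_glue hG (hi := i.2) (hj := j.2) (i := i.1.2) (j := j.1.2) V hV
    (fun x hx => ⟨⟨x, hx⟩, hxV _⟩) t (fun a b Y ha hb => inj
      (((F.map_res ha (t a)).trans (by rw [ht, rr_rr])).trans
        ((F.map_res hb (t b)).trans (by rw [ht, rr_rr])).symm))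
  refine ⟨t', hom_ext_of_cover hH _ _ fun x hx => ⟨V ⟨x, hx⟩, hV _, hxV _, ?_⟩⟩
  exact (F.map_res (hV ⟨x, hx⟩) t').symm.trans ((congrArg F.map (ht' _)).trans (ht _))

theorem IsLocEquiv.isWeakEquivalence_toPreHom (hG : G.IsStack) (hH : H.IsStack)
    {F : SysHom G.sys H} (hF : F.IsLocEquiv) : IsWeakEquivalence F.toPreHom.toTrans where
  locallyEssSurj U b x hx := by
    obtain ⟨i, V, hi, h, hxV, ⟨e⟩⟩ := hF.ess U b x hx
    let e' : (H.rs hi).obj (F.toPreHom.obj i.2) ≅ (H.rs h).obj b := e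
    exact ⟨V, homOfLE h, (G.rs hi).obj i.2, hxV, ⟨F.toPreHom.comparisonIso hi i.2 ≪≫ e'⟩⟩
  bijective U i j := F.toPreHom.bijective_homMap (fun {U} i j => hF.bijective_map hG hH
    (i := ⟨⟨U, i⟩, le_rfl⟩) (j := ⟨⟨U, j⟩, le_rfl⟩)) i j

end SysHom

/-! ### Weak equivalences -/

namespace Prestack

variable {X : Type u} [TopologicalSpace X] {G H K : Prestack X}

theorem isWeakEquivalence_id (G : Prestack X) : IsWeakEquivalence (𝟙 G) where
  locallyEssSurj U j _ hx := ⟨U, 𝟙 U, (G.rs le_rfl).obj j, hx, ⟨Iso.refl _⟩⟩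
  bijective _ _ _ := Function.bijective_id

theorem IsWeakEquivalence.exists_map_iso {F : G ⟶ H} (hF : IsWeakEquivalence F) {U : Opens X}
    {i j : G.fib U} (e : (onFib F U).obj i ≅ (onFib F U).obj j) :
    ∃ s : i ≅ j, (onFib F U).map s.hom = e.hom := by
  obtain ⟨s, hs⟩ := (hF.bijective U i j).2 e.hom
  obtain ⟨t, ht⟩ := (hF.bijective U j i).2 e.inv
  refine ⟨⟨s, t, (hF.bijective U _ _).1 ?_, (hF.bijective U _ _).1 ?_⟩, hs⟩
  · refine ((onFib F U).map_comp s t).trans (Eq.trans ?_ ((onFib F U).map_id i).symm)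
    exact (congrArg₂ (· ≫ ·) hs ht).trans e.hom_inv_id
  · refine ((onFib F U).map_comp t s).trans (Eq.trans ?_ ((onFib F U).map_id j).symm)
    exact (congrArg₂ (· ≫ ·) ht hs).trans e.inv_hom_id

/-- Weak equivalences of stacks are essentially surjective. -/
theorem IsWeakEquivalence.exists_iso {F : G ⟶ H} (hF : IsWeakEquivalence F) (hG : G.IsStack)
    (hH : H.IsStack) {U : Opens X} (b : H.fib U) :
    ∃ i : G.fib U, Nonempty ((onFib F U).obj i ≅ b) :=
  exists_iso_of_locallyEssSurj (fun h => (hF.bijective _ _ _).1 h)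
    (fun e => (hF.bijective _ _ _).2 e.hom) hG hH hF.locallyEssSurj b

/-- Morphisms of stacks lift along weak equivalences. -/
theorem IsWeakEquivalence.exists_lift {G' : Prestack X} {F : G ⟶ H} (hF : IsWeakEquivalence F)
    (hG : G.IsStack) (hH : H.IsStack) (F' : G' ⟶ H) : ∃ E : G' ⟶ G, Nonempty (E ≫ F ≅ F') :=
  Prestack.exists_lift F' F (fun i j => (hF.bijective _ i j).1)
    (fun _ _ _ _ _ _ _ => (hF.bijective _ _ _).2 _) (fun _ => hF.exists_iso hG hH _)

theorem map_eq_of_iso {F F' : G ⟶ H} (η : F ≅ F') {U : Opens X} {i j : G.fib U} (t : i ⟶ j) :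
    (onFib F U).map t = (isoApp η i).hom ≫ (onFib F' U).map t ≫ (isoApp η j).inv := by
  rw [← Category.assoc, Iso.eq_comp_inv]
  exact homApp_naturality η.hom t

theorem exists_iso_of_comp_iso {E : G ⟶ H} {F : H ⟶ K} {F' : G ⟶ K} (η : E ≫ F ≅ F') :
    ∃ e : ∀ {U : Opens X} (i : G.fib U),
      (onFib F U).obj ((onFib E U).obj i) ≅ (onFib F' U).obj i,
      ∀ {U : Opens X} {i j : G.fib U} (t : i ⟶ j), (onFib F U).map ((onFib E U).map t) =
        (e i).hom ≫ (onFib F' U).map t ≫ (e j).inv :=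
  ⟨fun i => isoApp η i, fun t => map_eq_of_iso η t⟩

/-- A two-out-of-three property. An object `j` is reached by lifting `F(j)` through the essentially
surjective `F'` and then reflecting the isomorphism along the fully faithful `F`. -/
theorem IsWeakEquivalence.of_comp {E : G ⟶ H} {F : H ⟶ K} {F' : G ⟶ K} (hF : IsWeakEquivalence F)
    (hF' : IsWeakEquivalence F') (hG : G.IsStack) (hK : K.IsStack) (η : E ≫ F ≅ F') :
    IsWeakEquivalence E where
  locallyEssSurj U j x hx := by
    obtain ⟨i, ⟨e⟩⟩ := hF'.exists_iso hG hK ((onFib F U).obj j)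
    obtain ⟨s, -⟩ := hF.exists_map_iso (j := j) (isoApp η i ≪≫ e)
    exact ⟨U, 𝟙 U, i, hx, ⟨s ≪≫ (H.rsId j).symm⟩⟩
  bijective U i j := by
    obtain ⟨e, h⟩ := exists_iso_of_comp_iso η
    refine ⟨fun s t he => (hF'.bijective U i j).1 ?_, fun s => ?_⟩
    · have e' := congrArg (onFib F U).map he
      dsimp only at e'
      rw [h, h] at e'
      simpa using e'
    · obtain ⟨t, ht⟩ := (hF'.bijective U i j).2
        ((e i).inv ≫ (onFib F U).map s ≫ (e j).hom)
      refine ⟨t, (hF.bijective U _ _).1 ((h t).trans ?_)⟩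
      dsimp only at ht
      rw [ht]
      simp

end Prestack

/-! ### Weak equivalence as an equivalence relation, and recognition of associated stacks -/

namespace AlgebroidStack

variable {R S Q : Type u} [CommRing R] [CommRing S] [CommRing Q] {X : Type u} [TopologicalSpace X]

/-- Linearity can be tested after composition with a linear weak equivalence. -/
theorem IsLinear.of_comp {A B D : AlgebroidStack R X} {E : A.stack ⟶ B.stack}
    {F : B.stack ⟶ D.stack} {F' : A.stack ⟶ D.stack} (hF : IsLinear (R := R) (S := R) F)
    (hF' : IsLinear (R := R) (S := R) F') (hw : IsWeakEquivalence F) (η : E ≫ F ≅ F') :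
    IsLinear (R := R) (S := R) E := by
  obtain ⟨e, h⟩ := exists_iso_of_comp_iso η
  constructor
  · intro U i j a b
    refine (hw.bijective U _ _).1 ?_
    dsimp only
    rw [hF.map_add, h, h, h, hF'.map_add]
    simp
  · intro U i j r a
    refine (hw.bijective U _ _).1 ?_
    dsimp only
    rw [hF.map_smul, h, h, hF'.map_smul]
    simp

namespace WeaklyEquivalent

theorem refl (B : AlgebroidStack R X) : B.WeaklyEquivalent B :=
  ⟨𝟙 _, ⟨fun _ _ _ _ _ => rfl, fun _ _ _ _ _ => rfl⟩, isWeakEquivalence_id _⟩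

/-- The functor `A ⟶ D` lifts along the weak equivalence `B ⟶ D`, and the lift is again linear and a
weak equivalence. Symmetry and transitivity are both instances of this, so equality of classes is
weak equivalence itself. -/
theorem of_cospan {A B D : AlgebroidStack R X} (h : A.WeaklyEquivalent D)
    (h' : B.WeaklyEquivalent D) : A.WeaklyEquivalent B := by
  obtain ⟨F, hF, hw⟩ := h
  obtain ⟨F', hF', hw'⟩ := h'
  obtain ⟨E, ⟨η⟩⟩ := hw'.exists_lift B.isStack D.isStack F
  exact ⟨E, hF'.of_comp hF hw' η, hw'.of_comp hw A.isStack D.isStack η⟩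

theorem symm {A B : AlgebroidStack R X} (h : A.WeaklyEquivalent B) : B.WeaklyEquivalent A :=
  (refl B).of_cospan h

theorem trans {A B D : AlgebroidStack R X} (h : A.WeaklyEquivalent B)
    (h' : B.WeaklyEquivalent D) : A.WeaklyEquivalent D :=
  h.of_cospan h'.symm

end WeaklyEquivalent

theorem weaklyEquivalent_equivalence : Equivalence (WeaklyEquivalent (R := R) (X := X)) :=
  ⟨WeaklyEquivalent.refl, WeaklyEquivalent.symm, WeaklyEquivalent.trans⟩

theorem cls_eq_iff {A B : AlgebroidStack R X} : A.cls = B.cls ↔ A.WeaklyEquivalent B :=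
  weaklyEquivalent_equivalence.quot_mk_eq_iff A B

theorem ev_homMap_toLoc (B : AlgebroidStack R X) {U : Opens X} {i j : B.stack.fib U} (t : i ⟶ j)
    (z : U) : LinSys.Loc.ev (C := B.linSys)
      ((SysHom.toPreHom (G := B.stack) B.linSys.toLoc).homMap t) z =
        LinSys.germHom (C := B.linSys) (i := ⟨⟨U, i⟩, le_rfl⟩) (j := ⟨⟨U, j⟩, le_rfl⟩) z.2
          ((B.stack.rs le_rfl).map t) :=
  (Category.id_comp _).trans (Category.comp_id _)

/-- A stack of algebroids which is locally equivalent to a linear system is the associated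
stack. -/
theorem weaklyEquivalent_algebroid {C : LinSys R X} (hC : C.IsAlgebroid) {B : AlgebroidStack R X}
    {F : SysHom C.toSys B.stack} (hl : F.IsLinear (R := R) (S := R)) (hF : F.IsLocEquiv) :
    (C.algebroid hC).WeaklyEquivalent B := by
  -- Both stacks map to the stack associated with the linear system of `B`: the first by
  -- functoriality of `loc`, and `B` because it is already a stack. This replaces a universal
  -- property of stackification.
  refine WeaklyEquivalent.of_cospan (D := B.linSys.algebroid B.linSys_isAlgebroid)
    ⟨F.locPreHom.toTrans, ⟨fun U i j a b => ?_, fun U i j r a => ?_⟩, hF.isWeakEquivalence⟩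
    ⟨(SysHom.toPreHom (G := B.stack) B.linSys.toLoc).toTrans,
      ⟨fun U i j a b => ?_, fun U i j r a => ?_⟩,
      B.linSys.toLoc_isLocEquiv.isWeakEquivalence_toPreHom B.isStack B.linSys.loc_isStack⟩
  · refine LinSys.Loc.hom_ext (C := B.linSys) fun z => ?_
    refine (F.ev_homMap_locPreHom (a + b) z).trans ((hl.stalkMap_add _ _).trans ?_)
    exact (congrArg₂ (· + ·) (F.ev_homMap_locPreHom a z) (F.ev_homMap_locPreHom b z)).symm
  · refine LinSys.Loc.hom_ext (C := B.linSys) fun z => ?_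
    refine (F.ev_homMap_locPreHom (r • a) z).trans ((hl.stalkMap_smul _ _).trans ?_)
    exact (congrArg (r • ·) (F.ev_homMap_locPreHom a z)).symm
  · refine LinSys.Loc.hom_ext (C := B.linSys) fun z => ?_
    refine (B.ev_homMap_toLoc (a + b) z).trans ((congrArg _ (B.res_add _ a b)).trans ?_)
    refine (LinSys.germHom_add (C := B.linSys) (i := ⟨⟨U, i⟩, le_rfl⟩) (j := ⟨⟨U, j⟩, le_rfl⟩)
      z.2 _ _).trans ?_
    exact (congrArg₂ (· + ·) (B.ev_homMap_toLoc a z) (B.ev_homMap_toLoc b z)).symm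
  · refine LinSys.Loc.hom_ext (C := B.linSys) fun z => ?_
    refine (B.ev_homMap_toLoc (r • a) z).trans ((congrArg _ (B.res_smul _ r a)).trans ?_)
    exact (congrArg (r • ·) (B.ev_homMap_toLoc a z)).symm

end AlgebroidStack

/-! ### Extension of scalars of linear systems -/

section extendScalars

variable {R S M N M' N' : Type u} [CommRing R] [CommRing S] [Algebra R S]
  [AddCommGroup M] [Module R M] [AddCommGroup N] [Module S N]
  [AddCommGroup M'] [Module R M'] [AddCommGroup N'] [Module S N']

theorem extendScalars_smul (φ : M →ₛₗ[algebraMap R S] N) (s : S) (t : S ⊗[R] M) :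
    extendScalars φ (s • t) = s • extendScalars φ t := by
  induction t with
  | zero => simp
  | tmul s' m => rw [TensorProduct.smul_tmul', extendScalars_tmul, extendScalars_tmul, smul_smul]; rfl
  | add t t' h h' => rw [smul_add, map_add, map_add, smul_add, h, h']

/-- `extendScalars` as a linear map. -/
@[simps]
noncomputable def extendScalarsL (φ : M →ₛₗ[algebraMap R S] N) : S ⊗[R] M →ₗ[S] N where
  toFun := extendScalars φ
  map_add' := map_add _
  map_smul' := extendScalars_smul φ

/-- Naturality of `extendScalars` in the semilinear map. Compatibility of tensors with restrictions,
germs and conjugations is always an instance of it. -/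
theorem extendScalars_lTensor (φ : M →ₛₗ[algebraMap R S] N) (ψ : M' →ₛₗ[algebraMap R S] N')
    (α : M →ₗ[R] M') (β : N →ₗ[S] N') (h : ∀ m, ψ (α m) = β (φ m)) (t : S ⊗[R] M) :
    extendScalars ψ (α.lTensor S t) = β (extendScalars φ t) := by
  induction t with
  | zero => simp
  | tmul s m => rw [LinearMap.lTensor_tmul, extendScalars_tmul, extendScalars_tmul, h, map_smul]
  | add t t' h h' => rw [map_add, map_add, map_add, map_add, h, h']

theorem extendScalars_congr (φ : M →ₛₗ[algebraMap R S] N) (ψ : M →ₛₗ[algebraMap R S] N')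
    (β : N →ₗ[S] N') (h : ∀ m, ψ m = β (φ m)) (t : S ⊗[R] M) :
    extendScalars ψ t = β (extendScalars φ t) := by
  have := extendScalars_lTensor φ ψ LinearMap.id β h t
  rwa [LinearMap.lTensor_id] at this

end extendScalars

namespace LinSys

variable {R : Type u} (S : Type u) [CommRing R] [CommRing S] [Algebra R S] {X : Type u}
  [TopologicalSpace X] (C : LinSys R X)

/-- The morphisms after extension of scalars. -/
abbrev ExtHom {W : Opens X} (i j : C.At W) : Type u := S ⊗[R] (i ⟶ j)

/-- The composition of morphisms after extension of scalars. -/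
noncomputable def extComp {W : Opens X} (i j k : C.At W) :
    S ⊗[R] (i ⟶ j) →ₗ[R] S ⊗[R] (j ⟶ k) →ₗ[R] S ⊗[R] (i ⟶ k) :=
  TensorProduct.map₂ (LinearMap.mul R S) (Linear.comp i j k)

variable {C} in
@[simp]
theorem extComp_tmul {W : Opens X} {i j k : C.At W} (s s' : S) (a : i ⟶ j) (b : j ⟶ k) :
    C.extComp S i j k (s ⊗ₜ a) (s' ⊗ₜ b) = (s * s') ⊗ₜ (a ≫ b) := rfl

theorem extComp_smul_left {W : Opens X} {i j k : C.At W} (r : S) (t : S ⊗[R] (i ⟶ j))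
    (t' : S ⊗[R] (j ⟶ k)) : C.extComp S i j k (r • t) t' = r • C.extComp S i j k t t' := by
  induction t with
  | zero => simp
  | add t₁ t₂ h₁ h₂ => simp only [smul_add, map_add, LinearMap.add_apply, h₁, h₂]
  | tmul s a =>
    induction t' with
    | zero => simp
    | add t₁ t₂ h₁ h₂ => simp only [smul_add, map_add, h₁, h₂]
    | tmul s' b => simp [TensorProduct.smul_tmul', mul_assoc]

theorem extComp_smul_right {W : Opens X} {i j k : C.At W} (r : S) (t : S ⊗[R] (i ⟶ j))
    (t' : S ⊗[R] (j ⟶ k)) : C.extComp S i j k t (r • t') = r • C.extComp S i j k t t' := by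
  induction t with
  | zero => simp
  | add t₁ t₂ h₁ h₂ => simp only [smul_add, map_add, LinearMap.add_apply, h₁, h₂]
  | tmul s a =>
    induction t' with
    | zero => simp
    | add t₁ t₂ h₁ h₂ => simp only [smul_add, map_add, h₁, h₂]
    | tmul s' b => simp [TensorProduct.smul_tmul', mul_left_comm]

theorem extComp_id_left {W : Opens X} {i j : C.At W} (t : S ⊗[R] (i ⟶ j)) :
    C.extComp S i i j (1 ⊗ₜ 𝟙 i) t = t := by
  induction t with
  | zero => simp
  | add t₁ t₂ h₁ h₂ => simp only [map_add, h₁, h₂]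
  | tmul s' b => simp

theorem extComp_id_right {W : Opens X} {i j : C.At W} (t : S ⊗[R] (i ⟶ j)) :
    C.extComp S i j j t (1 ⊗ₜ 𝟙 j) = t := by
  induction t with
  | zero => simp
  | add t₁ t₂ h₁ h₂ => simp only [map_add, LinearMap.add_apply, h₁, h₂]
  | tmul s' b => simp

theorem extComp_assoc {W : Opens X} {i j k l : C.At W} (t : S ⊗[R] (i ⟶ j)) (t' : S ⊗[R] (j ⟶ k))
    (t'' : S ⊗[R] (k ⟶ l)) : C.extComp S i k l (C.extComp S i j k t t') t'' =
      C.extComp S i j l t (C.extComp S j k l t' t'') := by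
  induction t with
  | zero => simp
  | add t₁ t₂ h₁ h₂ => simp only [map_add, LinearMap.add_apply, h₁, h₂]
  | tmul s a =>
    induction t' with
    | zero => simp
    | add t₁ t₂ h₁ h₂ => simp only [map_add, LinearMap.add_apply, h₁, h₂]
    | tmul s' b =>
      induction t'' with
      | zero => simp
      | add t₁ t₂ h₁ h₂ => simp only [map_add, h₁, h₂]
      | tmul s'' c => simp [mul_assoc]

theorem extComp_res {W' W : Opens X} (h : W' ≤ W) {i j k : C.At W} (t : S ⊗[R] (i ⟶ j))
    (t' : S ⊗[R] (j ⟶ k)) : (C.resL h i k).lTensor S (C.extComp S i j k t t') =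
      C.extComp S _ _ _ ((C.resL h i j).lTensor S t) ((C.resL h j k).lTensor S t') := by
  induction t with
  | zero => simp
  | add t₁ t₂ h₁ h₂ => simp only [map_add, LinearMap.add_apply, h₁, h₂]
  | tmul s a =>
    induction t' with
    | zero => simp
    | add t₁ t₂ h₁ h₂ => simp only [map_add, h₁, h₂]
    | tmul s' b => simp [C.res_comp]

theorem lTensor_resL_smul {W' W : Opens X} (h : W' ≤ W) {i j : C.At W} (r : S)
    (t : S ⊗[R] (i ⟶ j)) :
    (C.resL h i j).lTensor S (r • t) = r • (C.resL h i j).lTensor S t := by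
  induction t with
  | zero => simp
  | add t₁ t₂ h₁ h₂ => simp only [smul_add, map_add, h₁, h₂]
  | tmul s a => simp [TensorProduct.smul_tmul']

theorem lTensor_resL_rfl {W : Opens X} {i j : C.At W} (t : S ⊗[R] (i ⟶ j)) :
    (C.resL le_rfl i j).lTensor S t = t := by
  induction t with
  | zero => simp
  | add t₁ t₂ h₁ h₂ => simp only [map_add, h₁, h₂]
  | tmul s a => simp

theorem lTensor_resL_resL {W'' W' W : Opens X} (h' : W'' ≤ W') (h : W' ≤ W) {i j : C.At W}
    (t : S ⊗[R] (i ⟶ j)) :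
    (C.resL h' (Sys.At.rs h i) (Sys.At.rs h j)).lTensor S ((C.resL h i j).lTensor S t) =
      (C.resL (h'.trans h) i j).lTensor S t := by
  induction t with
  | zero => simp
  | add t₁ t₂ h₁ h₂ => simp only [map_add, h₁, h₂]
  | tmul s a => simp

theorem extComp_add_left {W : Opens X} (i j k : C.At W) (t t' : C.ExtHom S i j)
    (t'' : C.ExtHom S j k) :
    C.extComp S i j k (t + t') t'' = C.extComp S i j k t t'' + C.extComp S i j k t' t'' := by
  rw [map_add, LinearMap.add_apply]

theorem extComp_add_right {W : Opens X} (i j k : C.At W) (t : C.ExtHom S i j)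
    (t' t'' : C.ExtHom S j k) :
    C.extComp S i j k t (t' + t'') = C.extComp S i j k t t' + C.extComp S i j k t t'' :=
  map_add _ _ _

/-- The underlying system of the extension of scalars. -/
noncomputable def extSys : Sys X where
  Obj := C.Obj
  dom := C.dom
  cat W :=
    { Hom i j := C.ExtHom S i j
      id i := 1 ⊗ₜ 𝟙 (show C.At W from i)
      comp {i j k} t t' := C.extComp S i j k t t'
      id_comp t := C.extComp_id_left S t
      comp_id t := C.extComp_id_right S t
      assoc t t' t'' := C.extComp_assoc S t t' t'' }
  res h i j t := (C.resL h i j).lTensor S t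
  res_id h i := congrArg ((1 : S) ⊗ₜ[R] ·) (C.res_id h i)
  res_comp h _ _ _ t t' := C.extComp_res S h t t'
  res_rfl t := C.lTensor_resL_rfl S t
  res_res h' h _ _ t := C.lTensor_resL_resL S h' h t

/-- An object as an object of the extension of scalars. -/
abbrev extAt {W : Opens X} (i : C.At W) : (C.extSys S).At W := i

/-- An object of the extension of scalars as an object. -/
abbrev extAt' {W : Opens X} (i : (C.extSys S).At W) : C.At W := i

/-- The addition of morphisms of the extension of scalars. -/
@[reducible] noncomputable def extPreadditive (W : Opens X) : Preadditive ((C.extSys S).At W) where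
  homGroup i j := inferInstanceAs (AddCommGroup (C.ExtHom S i j))
  add_comp i j k t t' t'' := C.extComp_add_left S i j k t t' t''
  comp_add i j k t t' t'' := C.extComp_add_right S i j k t t' t''

/-- The extension of scalars of a linear system. -/
noncomputable def ext : LinSys S X where
  toSys := C.extSys S
  preadditive W := C.extPreadditive S W
  linear W := letI := C.extPreadditive S W
    { homModule i j := inferInstanceAs (Module S (C.ExtHom S i j))
      smul_comp _ _ _ r t t' := C.extComp_smul_left S r t t'
      comp_smul _ _ _ t r t' := C.extComp_smul_right S r t t' }
  res_add h i j _ _ := map_add ((C.resL h (C.extAt' S i) (C.extAt' S j)).lTensor S) _ _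
  res_smul h _ _ r t := C.lTensor_resL_smul S h r t

/-- A morphism as a morphism of the extension of scalars. -/
noncomputable def extMk {W : Opens X} {i j : C.At W} (t : S ⊗[R] (i ⟶ j)) :
    (C.extAt S i : (C.ext S).At W) ⟶ C.extAt S j := t

variable {C} in
theorem IsAlgebroid.ext (hC : C.IsAlgebroid) : (C.ext S).IsAlgebroid where
  small := hC.small
  nonempty := hC.nonempty
  connected i j x hi hj := by
    obtain ⟨W, hi, hj, hx, ⟨e⟩⟩ := hC.connected i j x hi hj
    have h₁ : C.extComp S _ _ _ (1 ⊗ₜ e.hom) (1 ⊗ₜ e.inv) = (1 : S) ⊗ₜ[R] 𝟙 _ := by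
      rw [extComp_tmul, mul_one, e.hom_inv_id]
    have h₂ : C.extComp S _ _ _ (1 ⊗ₜ e.inv) (1 ⊗ₜ e.hom) = (1 : S) ⊗ₜ[R] 𝟙 _ := by
      rw [extComp_tmul, mul_one, e.inv_hom_id]
    exact ⟨W, hi, hj, hx, ⟨⟨C.extMk S (i := ⟨i, hi⟩) (j := ⟨j, hj⟩) (1 ⊗ₜ e.hom),
      C.extMk S (i := ⟨j, hj⟩) (j := ⟨i, hi⟩) (1 ⊗ₜ e.inv), h₁, h₂⟩⟩⟩

end LinSys

/-! ### Functors which are extensions of scalars -/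

section

variable {R S : Type u} [CommRing R] [CommRing S] [Algebra R S] {X : Type u}
  [TopologicalSpace X]

namespace SysHom

variable {C : LinSys R X} {B : AlgebroidStack S X} {F : SysHom C.toSys B.stack}

/-- The action on morphisms of a linear functor, as a semilinear map. -/
def IsLinear.mapL (hF : F.IsLinear) {W : Opens X} (i j : C.At W) : (i ⟶ j) →ₛₗ[algebraMap R S]
    ((B.stack.rs i.2).obj (F.obj i.1) ⟶ (B.stack.rs j.2).obj (F.obj j.1)) where
  toFun a := F.map a
  map_add' := hF.map_add
  map_smul' := hF.map_smul

/-- Restriction as a linear map. -/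
def _root_.TwistedSheaves.AlgebroidStack.rrL (B : AlgebroidStack S X) {W' W U U' : Opens X}
    (h : W' ≤ W) {hi : W ≤ U} {hj : W ≤ U'} (i : B.stack.fib U) (j : B.stack.fib U') :
    ((B.stack.rs hi).obj i ⟶ (B.stack.rs hj).obj j) →ₗ[S]
      ((B.stack.rs (h.trans hi)).obj i ⟶ (B.stack.rs (h.trans hj)).obj j) where
  toFun := rr h
  map_add' := B.rr_add h
  map_smul' := B.rr_smul h

theorem IsLinear.extendScalars_mapL_res (hF : F.IsLinear) {W' W : Opens X} (h : W' ≤ W)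
    {i j : C.At W} (t : S ⊗[R] (i ⟶ j)) :
    extendScalars (hF.mapL (Sys.At.rs h i) (Sys.At.rs h j)) ((C.resL h i j).lTensor S t) =
      rr h (extendScalars (hF.mapL i j) t) :=
  extendScalars_lTensor _ _ _ (B.rrL h _ _) (fun m => F.map_res h m) t

/-- The target of a linear functor is the stack associated with the extension of scalars of the
source. -/
structure IsExt (hF : F.IsLinear) : Prop where
  ess : F.LocEssSurj
  inj : ∀ {W : Opens X} (i j : C.At W) (t : S ⊗[R] (i ⟶ j)), extendScalars (hF.mapL i j) t = 0 →
    ∀ x ∈ W, ∃ (V : Opens X) (h : V ≤ W), x ∈ V ∧ (C.resL h i j).lTensor S t = 0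
  surj : ∀ {W : Opens X} (i j : C.At W)
    (s : (B.stack.rs i.2).obj (F.obj i.1) ⟶ (B.stack.rs j.2).obj (F.obj j.1)),
    ∀ x ∈ W, ∃ (V : Opens X) (h : V ≤ W), x ∈ V ∧
      ∃ t : S ⊗[R] (Sys.At.rs h i ⟶ Sys.At.rs h j), extendScalars (hF.mapL _ _) t = rr h s

/-- The functor from the extension of scalars. -/
noncomputable def IsLinear.extHom (hF : F.IsLinear) : SysHom (C.ext S).toSys B.stack where
  obj i := F.obj i
  map {W i j} t := extendScalars (hF.mapL (C.extAt' S i) (C.extAt' S j)) t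
  map_id {W} i := by
    refine (extendScalars_tmul (hF.mapL (C.extAt' S i) (C.extAt' S i)) 1 _).trans ?_
    rw [one_smul]
    exact F.map_id _
  map_comp {W i j k} t t' := by
    suffices h : ∀ (i j k : C.At W) (t : S ⊗[R] (i ⟶ j)) (t' : S ⊗[R] (j ⟶ k)),
        extendScalars (hF.mapL i k) (C.extComp S i j k t t') =
          extendScalars (hF.mapL i j) t ≫ extendScalars (hF.mapL j k) t' from h _ _ _ t t'
    intro i j k t t'
    induction t with
    | zero => rw [map_zero, LinearMap.zero_apply, map_zero, map_zero]; exact Limits.zero_comp.symm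
    | add t₁ t₂ h₁ h₂ => simp only [_root_.map_add, LinearMap.add_apply, h₁, h₂, Preadditive.add_comp]
    | tmul s a =>
      induction t' with
      | zero => rw [map_zero, map_zero, map_zero]; exact Limits.comp_zero.symm
      | add t₁ t₂ h₁ h₂ => simp only [_root_.map_add, h₁, h₂, Preadditive.comp_add]
      | tmul s' b =>
        rw [LinSys.extComp_tmul, extendScalars_tmul, extendScalars_tmul, extendScalars_tmul,
          Linear.smul_comp, Linear.comp_smul, smul_smul]
        exact congrArg ((s * s') • ·) (F.map_comp a b)
  map_res h i j t := hF.extendScalars_mapL_res h t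

theorem IsLinear.extHom_isLinear (hF : F.IsLinear) :
    hF.extHom.IsLinear (R := S) (S := S) where
  map_add {_ i j} a b := _root_.map_add (extendScalars (hF.mapL (C.extAt' S i) (C.extAt' S j))) a b
  map_smul {_ i j} r a := extendScalars_smul (hF.mapL (C.extAt' S i) (C.extAt' S j)) r a

/-- Local injectivity in `IsExt` is a condition on kernels; applied to a difference of tensors it
gives faithfulness of `extHom`. The other two conditions are the same on both sides. -/
theorem IsExt.isLocEquiv {hF : F.IsLinear} (h : IsExt hF) : hF.extHom.IsLocEquiv where
  ess := h.ess
  inj {W i j s t} e x hx := by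
    suffices H : ∀ (i j : C.At W) (s t : S ⊗[R] (i ⟶ j)),
        extendScalars (hF.mapL i j) s = extendScalars (hF.mapL i j) t →
        ∃ (V : Opens X) (h : V ≤ W), x ∈ V ∧ (C.resL h i j).lTensor S s =
          (C.resL h i j).lTensor S t from H _ _ s t e
    intro i j s t e
    obtain ⟨V, hV, hxV, e⟩ := h.inj i j (s - t) (by rw [map_sub, e, sub_self]) x hx
    exact ⟨V, hV, hxV, by rwa [map_sub, sub_eq_zero] at e⟩
  surj {W i j} s x hx := h.surj _ _ s x hx

theorem IsExt.weaklyEquivalent_algebroid {hF : F.IsLinear} (h : IsExt hF) (hC : C.IsAlgebroid) :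
    ((C.ext S).algebroid (hC.ext S)).WeaklyEquivalent B :=
  AlgebroidStack.weaklyEquivalent_algebroid _ hF.extHom_isLinear h.isLocEquiv

end SysHom

/-! ### The stack associated with an extension of scalars -/

namespace LinSys

variable (S) (C : LinSys R X)

theorem toLoc_map_add (C : LinSys R X) {W : Opens X} {i j : C.At W} (s t : i ⟶ j) :
    LinSys.locMap (s + t) = (show (locObj i.1).res i.2 ⟶ (locObj j.1).res j.2 from locMap s) +
      (show (locObj i.1).res i.2 ⟶ (locObj j.1).res j.2 from locMap t) :=
  Loc.hom_ext fun z => germHom_add z.2 s t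

/-- The functor from a linear system to the stack associated with its extension of scalars. -/
noncomputable def toExt (hC : C.IsAlgebroid) :
    SysHom C.toSys ((C.ext S).algebroid (hC.ext S)).stack where
  obj i := (C.ext S).toLoc.obj i
  map {W i j} t := (C.ext S).toLoc.map (C.extMk S (1 ⊗ₜ t))
  map_id i := (C.ext S).toLoc.map_id (C.extAt S i)
  map_comp {W i j k} t t' := by
    have h := (C.ext S).toLoc.map_comp (C.extMk S (1 ⊗ₜ t)) (C.extMk S (1 ⊗ₜ t'))
    refine Eq.trans (congrArg _ ?_) h
    have := extComp_tmul S 1 1 t t'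
    rw [mul_one] at this
    exact this.symm
  map_res h _ _ t := (C.ext S).toLoc.map_res h (C.extMk S (1 ⊗ₜ t))

theorem toExt_isLinear (hC : C.IsAlgebroid) : (C.toExt S hC).IsLinear where
  map_add {W i j} a b := by
    refine Eq.trans (congrArg (fun t => (C.ext S).toLoc.map (C.extMk S t))
      (TensorProduct.tmul_add 1 a b)) ?_
    exact (C.ext S).toLoc_map_add _ _
  map_smul {W i j} r a := by
    have h : (1 : S) ⊗ₜ[R] (r • a) = algebraMap R S r • ((1 : S) ⊗ₜ[R] a) := by
      rw [TensorProduct.tmul_smul, algebraMap_smul]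
    refine Eq.trans (congrArg (fun t => (C.ext S).toLoc.map (C.extMk S t)) h) ?_
    exact Loc.hom_ext fun z => germHom_smul (C := C.ext S) z.2 _ _

theorem extendScalars_toExt (hC : C.IsAlgebroid) {W : Opens X} (i j : C.At W)
    (t : S ⊗[R] (i ⟶ j)) : extendScalars ((C.toExt_isLinear S hC).mapL i j) t =
      (C.ext S).toLoc.map (C.extMk S t) := by
  induction t with
  | zero =>
    rw [map_zero]
    exact (Loc.hom_ext fun z => (germHom_zero (C := C.ext S) z.2 _ _).symm)
  | add t t' h h' =>
    rw [map_add, h, h']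
    exact ((C.ext S).toLoc_map_add (C.extMk S t) (C.extMk S t')).symm
  | tmul s a =>
    rw [extendScalars_tmul]
    refine Eq.trans ?_ (congrArg (fun t => (C.ext S).toLoc.map (C.extMk S t))
      (?_ : (s • ((1 : S) ⊗ₜ[R] a) : S ⊗[R] (i ⟶ j)) = s ⊗ₜ a))
    · exact (Loc.hom_ext fun z => (germHom_smul (C := C.ext S) z.2 _ _).symm)
    · rw [TensorProduct.smul_tmul', smul_eq_mul, mul_one]

theorem toExt_isExt (hC : C.IsAlgebroid) : SysHom.IsExt (C.toExt_isLinear S hC) where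
  ess := (C.ext S).toLoc_isLocEquiv.ess
  inj {W} i j t h x hx := by
    rw [extendScalars_toExt] at h
    obtain ⟨V, hV, hxV, e⟩ := (C.ext S).toLoc_isLocEquiv.inj (t := C.extMk S 0)
      (h.trans (Loc.hom_ext fun z => (germHom_zero (C := C.ext S) z.2 _ _).symm)) x hx
    exact ⟨V, hV, hxV, e.trans (map_zero _)⟩
  surj {W} i j s x hx := by
    obtain ⟨V, hV, hxV, t, ht⟩ := (C.ext S).toLoc_isLocEquiv.surj
      (i := C.extAt S i) (j := C.extAt S j) s x hx
    exact ⟨V, hV, hxV, t, (extendScalars_toExt S C hC _ _ t).trans ht⟩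

end LinSys

end

/-! ### The stalks of an extension of scalars -/

section

variable {R S Q : Type u} [CommRing R] [CommRing S] [CommRing Q] [Algebra R S] [Algebra S Q]
  [Algebra R Q] [IsScalarTower R S Q] {X : Type u} [TopologicalSpace X]

namespace LinSys

variable {C : LinSys R X} {x : X}

/-- Germs, as a linear map. -/
@[simps]
def germL {W : Opens X} (hx : x ∈ W) (i j : C.At W) : (i ⟶ j) →ₗ[R] (pt hx i ⟶ pt hx j) where
  toFun t := germHom hx t
  map_add' := germHom_add hx
  map_smul' := germHom_smul hx

variable (S)

theorem lTensor_germL_res {V W : Opens X} (hx : x ∈ V) (h : V ≤ W) {i j : C.At W}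
    (t : S ⊗[R] (i ⟶ j)) :
    (germL hx (Sys.At.rs h i) (Sys.At.rs h j)).lTensor S ((C.resL h i j).lTensor S t) =
      (germL (h hx) i j).lTensor S t := by
  induction t with
  | zero => simp
  | add t₁ t₂ h₁ h₂ => simp only [map_add, h₁, h₂]
  | tmul s a =>
    rw [LinearMap.lTensor_tmul, LinearMap.lTensor_tmul, LinearMap.lTensor_tmul]
    exact congrArg (s ⊗ₜ[R] ·) (germHom_res hx h a)

theorem exists_lTensor_germL {i j : C.Pt x} (t : S ⊗[R] (i ⟶ j)) :
    ∃ (W : Opens X) (hx : x ∈ W) (hi : W ≤ C.dom i.1) (hj : W ≤ C.dom j.1)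
      (t' : S ⊗[R] (i.at' hi ⟶ j.at' hj)), (germL hx (i.at' hi) (j.at' hj)).lTensor S t' = t := by
  induction t with
  | zero =>
    exact ⟨C.dom i.1 ⊓ C.dom j.1, ⟨i.2, j.2⟩, inf_le_left, inf_le_right, 0, map_zero _⟩
  | tmul s a =>
    obtain ⟨W, hx, hi, hj, a, rfl⟩ := exists_germHom a
    exact ⟨W, hx, hi, hj, s ⊗ₜ a, LinearMap.lTensor_tmul _ _ _ _⟩
  | add t₁ t₂ h₁ h₂ =>
    obtain ⟨W, hx, hi, hj, t, rfl⟩ := h₁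
    obtain ⟨W', hx', hi', hj', t', rfl⟩ := h₂
    refine ⟨W ⊓ W', ⟨hx, hx'⟩, inf_le_left.trans hi, inf_le_left.trans hj,
      (C.resL inf_le_left (i.at' hi) (j.at' hj)).lTensor S t +
        (C.resL inf_le_right (i.at' hi') (j.at' hj')).lTensor S t', ?_⟩
    refine (map_add _ _ _).trans (congrArg₂ (· + ·) ?_ ?_)
    · exact lTensor_germL_res (V := W ⊓ W') (W := W) S ⟨hx, hx'⟩ inf_le_left t
    · exact lTensor_germL_res (V := W ⊓ W') (W := W') S ⟨hx, hx'⟩ inf_le_right t'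

/-- An object at a point, as an object of the extension of scalars. -/
abbrev extPt (i : C.Pt x) : (C.ext S).Pt x := ⟨i.1, i.2⟩

/-- The germ `s ⊗ a` in the extension of scalars. -/
noncomputable def extGermTmul {i j : C.Pt x} (s : S) (a : i ⟶ j) : extPt S i ⟶ extPt S j :=
  liftGerm (fun hx _ _ t => germHom (C := C.ext S) hx (C.extMk S (s ⊗ₜ t)))
    (fun hx h _ _ t => germHom_res (C := C.ext S) hx h (C.extMk S (s ⊗ₜ t))) a

theorem extGermTmul_add_right {i j : C.Pt x} (s : S) (a b : i ⟶ j) :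
    extGermTmul S s (a + b) = extGermTmul S s a + extGermTmul S s b := by
  obtain ⟨W, hx, hi, hj, hi', hj', t, t', rfl, rfl⟩ := exists_germ₂ a b
  refine (congrArg (extGermTmul S s) (germHom_add hx t t').symm).trans ?_
  refine (congrArg (fun t => germHom (C := C.ext S) hx (C.extMk S t)) (TensorProduct.tmul_add s t t')).trans ?_
  exact germHom_add (C := C.ext S) hx (C.extMk S (s ⊗ₜ t)) (C.extMk S (s ⊗ₜ t'))

theorem extGermTmul_add_left {i j : C.Pt x} (s s' : S) (a : i ⟶ j) :
    extGermTmul S (s + s') a = extGermTmul S s a + extGermTmul S s' a := by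
  obtain ⟨W, hx, hi, hj, t, rfl⟩ := exists_germHom a
  refine (congrArg (fun t => germHom (C := C.ext S) hx (C.extMk S t)) (TensorProduct.add_tmul s s' t)).trans ?_
  exact germHom_add (C := C.ext S) hx (C.extMk S (s ⊗ₜ t)) (C.extMk S (s' ⊗ₜ t))

theorem extGermTmul_smul {i j : C.Pt x} (r : R) (s : S) (a : i ⟶ j) :
    extGermTmul S (r • s) a = extGermTmul S s (r • a) := by
  obtain ⟨W, hx, hi, hj, t, rfl⟩ := exists_germHom a
  refine Eq.trans ?_ (congrArg (extGermTmul S s) (germHom_smul hx r t))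
  exact congrArg (fun t => germHom (C := C.ext S) hx (C.extMk S t)) (TensorProduct.smul_tmul r s t)

/-- The comparison from the extension of scalars of a stalk to the stalk of the extension of
scalars. -/
noncomputable def extGerm (i j : C.Pt x) : S ⊗[R] (i ⟶ j) →+ (extPt S i ⟶ extPt S j) :=
  TensorProduct.liftAddHom
    (AddMonoidHom.mk' (fun s => AddMonoidHom.mk' (extGermTmul S s) (extGermTmul_add_right S s))
      fun s s' => AddMonoidHom.ext (extGermTmul_add_left S s s'))
    (extGermTmul_smul S)

theorem extGerm_lTensor {W : Opens X} (hx : x ∈ W) {i j : C.At W} (t : S ⊗[R] (i ⟶ j)) :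
    extGerm S (pt hx i) (pt hx j) ((germL hx i j).lTensor S t) = germHom (C := C.ext S) hx (C.extMk S t) := by
  induction t with
  | zero =>
    rw [map_zero, map_zero]
    exact (germHom_zero (C := C.ext S) hx _ _).symm
  | tmul s a => rfl
  | add t₁ t₂ h₁ h₂ =>
    rw [map_add, map_add, h₁, h₂]
    exact (germHom_add (C := C.ext S) hx _ _).symm

/-- One half of the fact that tensor products commute with the filtered colimit defining a stalk.
The map `extGerm` sends the vanishing tensor to the germ of `t` in `C.ext S`; that germ is then
zero, so `t` vanishes on a neighbourhood. -/
theorem exists_lTensor_resL_eq_zero {W : Opens X} (hx : x ∈ W) {i j : C.At W} {t : S ⊗[R] (i ⟶ j)}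
    (h : (germL hx i j).lTensor S t = 0) :
    ∃ (V : Opens X) (h : V ≤ W), x ∈ V ∧ (C.resL h i j).lTensor S t = 0 := by
  have e := extGerm_lTensor S hx t
  rw [h, map_zero] at e
  obtain ⟨V, hV, hxV, e⟩ := exists_res_eq (C := C.ext S) hx (s := C.extMk S t) (t := C.extMk S 0)
    (e.symm.trans (germHom_zero (C := C.ext S) hx _ _).symm)
  exact ⟨V, hV, hxV, e.trans (map_zero _)⟩

end LinSys

namespace SysHom

open LinSys

variable {C : LinSys R X} {B : AlgebroidStack S X} {F : SysHom C.toSys B.stack} {x : X}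

/-- The action on stalks, as a semilinear map. -/
def IsLinear.stalkL (hF : F.IsLinear) (i j : C.Pt x) :
    (i ⟶ j) →ₛₗ[algebraMap R S] (F.stalkObj i ⟶ F.stalkObj j) where
  toFun a := F.stalkMap a
  map_add' := hF.stalkMap_add
  map_smul' := hF.stalkMap_smul

theorem IsLinear.extendScalars_stalkL (hF : F.IsLinear) {W : Opens X} (hx : x ∈ W) {i j : C.At W}
    (t : S ⊗[R] (i ⟶ j)) :
    extendScalars (hF.stalkL (pt hx i) (pt hx j)) ((germL hx i j).lTensor S t) =
      germHom hx (show F.objAt i ⟶ F.objAt j from extendScalars (hF.mapL i j) t) :=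
  extendScalars_lTensor (hF.mapL i j) _ _ (germL (C := B.linSys) hx (F.objAt i) (F.objAt j))
    (fun _ => rfl) t

/-- Together with `IsExt.of_bijective_stalk`, this turns the local conditions into bijectivity of `S
⊗ stalk → stalk`. In this form composition of extensions becomes a statement about modules. -/
theorem IsExt.bijective_stalk {hF : F.IsLinear} (h : IsExt hF) (i j : C.Pt x) :
    Function.Bijective (extendScalars (hF.stalkL i j)) := by
  refine ⟨(injective_iff_map_eq_zero _).2 fun t ht => ?_, fun a => ?_⟩
  · obtain ⟨W, hx, hi, hj, t, rfl⟩ := exists_lTensor_germL S t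
    have e := (hF.extendScalars_stalkL hx t).symm.trans (ht.trans
      (germHom_zero (C := B.linSys) hx (F.objAt (i.at' hi)) (F.objAt (j.at' hj))).symm)
    obtain ⟨V, hV, hxV, e⟩ := exists_res_eq (C := B.linSys) hx e
    have e' := (hF.extendScalars_mapL_res hV t).trans
      (e.trans (B.linSys.res_zero hV (F.objAt (i.at' hi)) (F.objAt (j.at' hj))))
    obtain ⟨V', hV', hxV', e''⟩ := h.inj _ _ _ e' x hxV
    have := lTensor_germL_res S hxV' hV' ((C.resL hV (i.at' hi) (j.at' hj)).lTensor S t)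
    rw [e'', map_zero, lTensor_germL_res] at this
    exact this.symm
  · obtain ⟨W, hx, hi, hj, s, rfl⟩ := exists_germHom (C := B.linSys) a
    obtain ⟨V, hV, hxV, t, ht⟩ := h.surj (i.at' hi) (j.at' hj) s x hx
    refine ⟨(germL hxV (i.at' (hV.trans hi)) (j.at' (hV.trans hj))).lTensor S t, ?_⟩
    refine (hF.extendScalars_stalkL hxV t).trans ((congrArg (germHom hxV) ht).trans ?_)
    exact germHom_res (C := B.linSys) hxV hV s

theorem IsExt.of_bijective_stalk (hF : F.IsLinear) (ess : F.LocEssSurj)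
    (h : ∀ (x : X) (i j : C.Pt x), Function.Bijective (extendScalars (hF.stalkL i j))) :
    IsExt hF where
  ess := ess
  inj {W} i j t ht x hx := by
    refine exists_lTensor_resL_eq_zero S hx ?_
    refine (h x (pt hx i) (pt hx j)).1 ?_
    refine (hF.extendScalars_stalkL hx t).trans ?_
    rw [map_zero]
    exact (congrArg (germHom hx) ht).trans (germHom_zero (C := B.linSys) hx (F.objAt i) (F.objAt j))
  surj {W} i j s x hx := by
    obtain ⟨u, hu⟩ := (h x (pt hx i) (pt hx j)).2
      (germHom hx (show F.objAt i ⟶ F.objAt j from s))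
    obtain ⟨W', hx', hi, hj, t, rfl⟩ := exists_lTensor_germL S u
    have e : germHom (C := B.linSys) (x := x) (W := W ⊓ W') ⟨hx, hx'⟩
        (B.linSys.res inf_le_right (show F.objAt (Pt.at' (pt hx i) hi) ⟶ F.objAt (Pt.at' (pt hx j) hj)
          from extendScalars (hF.mapL _ _) t)) =
        germHom (C := B.linSys) (x := x) (W := W ⊓ W') ⟨hx, hx'⟩ (B.linSys.res inf_le_left
          (show F.objAt i ⟶ F.objAt j from s)) := by
      refine (germHom_res (C := B.linSys) (W := W') _ inf_le_right _).trans
        (Eq.trans ?_ (germHom_res (C := B.linSys) (W := W) _ inf_le_left (show F.objAt i ⟶ F.objAt j from s)).symm)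
      exact (hF.extendScalars_stalkL hx' t).symm.trans hu
    obtain ⟨V, hV, hxV, e⟩ := exists_res_eq (C := B.linSys) _ e
    rw [B.linSys.res_res, B.linSys.res_res] at e
    exact ⟨V, hV.trans inf_le_left, hxV, (C.resL (hV.trans inf_le_right)
      (Pt.at' (pt hx i) hi) (Pt.at' (pt hx j) hj)).lTensor S t,
      (hF.extendScalars_mapL_res (hV.trans inf_le_right) t).trans e⟩

end SysHom

end

/-! ### Composition of extensions of scalars -/

section

variable {R S Q : Type u} [CommRing R] [CommRing S] [CommRing Q] [Algebra R S] [Algebra S Q]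
  [Algebra R Q] {X : Type u} [TopologicalSpace X]

theorem extendScalars_comp [IsScalarTower R S Q] {M N P : Type u} [AddCommGroup M] [Module R M]
    [AddCommGroup N] [Module S N] [AddCommGroup P] [Module Q P] (φ : M →ₛₗ[algebraMap R S] N)
    (ψ : N →ₛₗ[algebraMap S Q] P) (χ : M →ₛₗ[algebraMap R Q] P) (h : ∀ m, χ m = ψ (φ m))
    (t : Q ⊗[S] (S ⊗[R] M)) :
    extendScalars χ (TensorProduct.AlgebraTensorModule.cancelBaseChange R S Q Q M t) =
      extendScalars ψ ((extendScalarsL φ).lTensor Q t) := by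
  induction t with
  | zero => simp
  | add t t' h h' => simp only [map_add, h, h']
  | tmul q t =>
    induction t with
    | zero => simp
    | add t t' h h' => simp only [TensorProduct.tmul_add, map_add, h, h']
    | tmul s m =>
      rw [TensorProduct.AlgebraTensorModule.cancelBaseChange_tmul, LinearMap.lTensor_tmul,
        extendScalars_tmul, extendScalars_tmul, extendScalarsL_apply, extendScalars_tmul, h,
        map_smulₛₗ, smul_smul, Algebra.smul_def, mul_comm]

/-- Base change in stages: under the isomorphism of `Q ⊗[S] (S ⊗[R] M)` with `Q ⊗[R] M`, the map for
`χ` is the map for `ψ` preceded by the base change of the isomorphism given by `φ`. -/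
theorem bijective_extendScalars_comp [IsScalarTower R S Q] {M N P : Type u} [AddCommGroup M]
    [Module R M] [AddCommGroup N] [Module S N] [AddCommGroup P] [Module Q P]
    (φ : M →ₛₗ[algebraMap R S] N)
    (ψ : N →ₛₗ[algebraMap S Q] P) (χ : M →ₛₗ[algebraMap R Q] P) (h : ∀ m, χ m = ψ (φ m))
    (hφ : Function.Bijective (extendScalars φ)) (hψ : Function.Bijective (extendScalars ψ)) :
    Function.Bijective (extendScalars χ) := by
  let f : S ⊗[R] M ≃ₗ[S] N := LinearEquiv.ofBijective (extendScalarsL φ) hφ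
  have e : ⇑(extendScalars ψ) ∘ (f.lTensor Q) =
      ⇑(extendScalars χ) ∘ (TensorProduct.AlgebraTensorModule.cancelBaseChange R S Q Q M) :=
    funext fun t => (extendScalars_comp φ ψ χ h t).symm
  rw [← Function.Bijective.of_comp_iff _
    (TensorProduct.AlgebraTensorModule.cancelBaseChange R S Q Q M).bijective, ← e]
  exact hψ.comp (f.lTensor Q).bijective

theorem bijective_one_tmul (M : Type u) [AddCommGroup M] [Module R M]
    (hb : Function.Bijective (algebraMap R S)) :
    Function.Bijective (fun m : M => (1 : S) ⊗ₜ[R] m) := by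
  let f := (LinearEquiv.ofBijective (Algebra.linearMap R S) hb).rTensor M
  have : (fun m : M => (1 : S) ⊗ₜ[R] m) = f ∘ (TensorProduct.lid R M).symm := by
    ext m
    simp only [Function.comp_apply, TensorProduct.lid_symm_apply, f, LinearEquiv.rTensor_tmul]
    exact congrArg (· ⊗ₜ[R] m) (map_one (algebraMap R S)).symm
  rw [this]
  exact f.bijective.comp (TensorProduct.lid R M).symm.bijective

namespace SysHom

variable {C : LinSys R X} {B : AlgebroidStack S X} {B' : AlgebroidStack Q X}
  {F : SysHom C.toSys B.stack} {E : B.stack ⟶ B'.stack}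

theorem IsLinear.comp [IsScalarTower R S Q] (hF : F.IsLinear)
    (hE : IsLinear (C := B.linSys) (B := B') (SysHom.ofTrans E)) : (F.comp E).IsLinear (B := B') where
  map_add {_ i j} a b := (congrArg (mapR E _ _) (hF.map_add a b)).trans
    (hE.map_add (i := F.objAt i) (j := F.objAt j) _ _)
  map_smul {_ i j} r a := by
    refine (congrArg (mapR E _ _) (hF.map_smul r a)).trans
      ((hE.map_smul (i := F.objAt i) (j := F.objAt j) _ _).trans ?_)
    rw [IsScalarTower.algebraMap_apply R S Q]
    rfl

theorem LocEssSurj.comp {C : Sys X} {G H : Prestack X} {F : SysHom C G} {E : G ⟶ H}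
    (hF : F.LocEssSurj) (hE : (SysHom.ofTrans E).LocEssSurj) : (F.comp E).LocEssSurj := by
  intro U b x hx
  obtain ⟨⟨U', i⟩, V, hi, h, hxV, ⟨e⟩⟩ := hE U b x hx
  obtain ⟨k, V', hk, h', hxV', ⟨e'⟩⟩ := hF U' i x (hi hxV)
  refine ⟨k, V ⊓ V', inf_le_right.trans hk, inf_le_left.trans h, ⟨hxV, hxV'⟩, ⟨?_⟩⟩
  let e₁ := (SysHom.ofTrans E).mapIso (C := G.sys) (i := ⟨⟨_, F.obj k⟩, hk⟩) (j := ⟨⟨U', i⟩, h'⟩)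
    ⟨e'.hom, e'.inv, e'.hom_inv_id, e'.inv_hom_id⟩
  exact H.rrIso inf_le_right e₁ ≪≫ H.rrIso inf_le_left e

/-- The conditions are compared on stalks, where no shrinking of neighbourhoods is involved. -/
theorem IsExt.comp [IsScalarTower R S Q] {hF : F.IsLinear}
    {hE : IsLinear (C := B.linSys) (B := B') (SysHom.ofTrans E)} (h : IsExt hF) (h' : IsExt hE) :
    IsExt (hF.comp hE) := by
  refine IsExt.of_bijective_stalk _ (h.ess.comp h'.ess) fun x i j => ?_
  refine bijective_extendScalars_comp _ (hE.stalkL (F.stalkObj i) (F.stalkObj j)) _ (fun a => ?_)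
    (h.bijective_stalk i j) (h'.bijective_stalk (F.stalkObj i) (F.stalkObj j))
  obtain ⟨W, hx, hi, hj, t, rfl⟩ := LinSys.exists_germHom a
  rfl

/-- When the structure map is bijective every tensor is `1 ⊗ m` for a unique `m`, so both notions
impose the same conditions. Applied to the identity of `R`, this exhibits weak equivalences as
extensions of scalars. -/
theorem isExt_iff_isLocEquiv (hF : F.IsLinear) (hb : Function.Bijective (algebraMap R S)) :
    IsExt hF ↔ F.IsLocEquiv := by
  have key {W : Opens X} {i j : C.At W} (m : i ⟶ j) :
      extendScalars (hF.mapL i j) ((1 : S) ⊗ₜ[R] m) = F.map m := one_smul S _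
  refine ⟨fun h => ⟨h.ess, fun {W i j s t} e x hx => ?_, fun {W i j} s x hx => ?_⟩,
    fun h => ⟨h.ess, fun {W} i j t e x hx => ?_, fun {W} i j s x hx => ?_⟩⟩
  · obtain ⟨V, hV, hxV, e⟩ := h.inj i j ((1 : S) ⊗ₜ s - (1 : S) ⊗ₜ t)
      (by rw [map_sub, key, key, e, sub_self]) x hx
    rw [map_sub, sub_eq_zero] at e
    exact ⟨V, hV, hxV, (bijective_one_tmul _ hb).1 e⟩
  · obtain ⟨V, hV, hxV, t, e⟩ := h.surj i j s x hx
    obtain ⟨t, rfl⟩ := (bijective_one_tmul _ hb).2 t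
    exact ⟨V, hV, hxV, t, (key t).symm.trans e⟩
  · obtain ⟨t, rfl⟩ := (bijective_one_tmul _ hb).2 t
    obtain ⟨V, hV, hxV, e⟩ := h.inj (t := 0)
      (((key t).symm.trans e).trans (map_zero (hF.mapL i j)).symm) x hx
    refine ⟨V, hV, hxV, ?_⟩
    dsimp only
    rw [LinearMap.lTensor_tmul]
    exact (congrArg ((1 : S) ⊗ₜ[R] ·) (e.trans (C.res_zero hV i j))).trans
      (TensorProduct.tmul_zero _ _)
  · obtain ⟨V, hV, hxV, t, e⟩ := h.surj s x hx
    exact ⟨V, hV, hxV, 1 ⊗ₜ t, (key t).trans e⟩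

end SysHom

/-! ### Induced stacks of algebroids -/

theorem conj_add {D : Type*} [Category D] [Preadditive D] {i i' j j' : D} (a : i' ⟶ i) (b : j ⟶ j')
    (s t : i ⟶ j) : a ≫ (s + t) ≫ b = a ≫ s ≫ b + a ≫ t ≫ b := by
  rw [Preadditive.add_comp, Preadditive.comp_add]

theorem conj_smul {D : Type*} [Category D] [Preadditive D] [Linear S D] {i i' j j' : D}
    (a : i' ⟶ i) (b : j ⟶ j') (r : S) (t : i ⟶ j) : a ≫ (r • t) ≫ b = r • (a ≫ t ≫ b) := by
  rw [Linear.smul_comp, Linear.comp_smul]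

theorem conj_cancel {D : Type*} [Category D] {i i' j j' : D} (a : i' ≅ i) (b : j' ≅ j)
    (t : i ⟶ j) : a.inv ≫ (a.hom ≫ t ≫ b.inv) ≫ b.hom = t := by simp

/-- Conjugation with isomorphisms, as a linear equivalence. -/
@[simps! apply]
def conjL {D : Type*} [Category D] [Preadditive D] [Linear S D] {i i' j j' : D} (a : i' ≅ i)
    (b : j ≅ j') : (i ⟶ j) ≃ₗ[S] (i' ⟶ j') :=
  LinearEquiv.ofLinearMap (M := i ⟶ j)
    { toFun t := a.hom ≫ t ≫ b.hom, map_add' := conj_add _ _, map_smul' := conj_smul _ _ }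
    { toFun t := a.inv ≫ t ≫ b.inv, map_add' := conj_add _ _, map_smul' := conj_smul _ _ }
    (by ext; simp) (by ext; simp)

/-- Translates between `resHom`, used to define induced stacks, and `rr`, used for systems. The
extra factors are the comparison isomorphisms of `F` for iterated restrictions, which cancel by
`cmp_comp`. -/
theorem rr_eq_conj_resHom {G H : Prestack X} (F : G ⟶ H) {V W U U' : Opens X} (h : V ≤ W) (hi : W ≤ U)
    (hj : W ≤ U') (i : G.fib U) (j : G.fib U')
    (s : (onFib F W).obj ((G.rs hi).obj i) ⟶ (onFib F W).obj ((G.rs hj).obj j)) :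
    (cmp F (h.trans hi) i).inv ≫ ((onFib F V).map (G.rsComp h hi i).hom ≫
      resHom F (homOfLE h) s ≫ (onFib F V).map (G.rsComp h hj j).inv) ≫
        (cmp F (h.trans hj) j).hom = rr h ((cmp F hi i).inv ≫ s ≫ (cmp F hj j).hom) := by
  have e₁ : (cmp F (h.trans hi) i).inv ≫ (onFib F V).map (G.rsComp h hi i).hom =
      (H.rsComp h hi _).hom ≫ (H.rs h).map (cmp F hi i).inv ≫ (cmp F h _).inv := by
    rw [Iso.inv_comp_eq, ← Category.assoc, cmp_comp]
    simp
  have e₂ : (onFib F V).map (G.rsComp h hj j).inv ≫ (cmp F (h.trans hj) j).hom =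
      (cmp F h _).hom ≫ (H.rs h).map (cmp F hj j).hom ≫ (H.rsComp h hj _).inv := by
    rw [← Category.assoc (cmp F h _).hom, Iso.eq_comp_inv, Category.assoc, cmp_comp]
    simp
  have e₃ : resHom F (homOfLE h) s = (cmp F h _).hom ≫ (H.rs h).map s ≫ (cmp F h _).inv :=
    rfl
  rw [e₃]
  simp only [Category.assoc]
  rw [e₂, reassoc_of% e₁]
  simp [rr]

namespace AlgebroidStack

open SysHom

variable {B : AlgebroidStack R X} {B' : AlgebroidStack S X}

/-- Restriction, as a linear map. -/
abbrev rsL (B : AlgebroidStack R X) {V U : Opens X} (h : V ≤ U) (i j : B.stack.fib U) :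
    (i ⟶ j) →ₗ[R] ((B.stack.rs h).obj i ⟶ (B.stack.rs h).obj j) :=
  B.resLinear (homOfLE h) i j

/-- The functor from the system of a stack given by a linear functor. -/
theorem IsLinear.ofTrans {F : B.stack ⟶ B'.stack} (hF : IsLinear F) :
    SysHom.IsLinear (C := B.linSys) (B := B') (SysHom.ofTrans F) where
  map_add {W i j} a b := by
    refine (congrArg (fun t => (cmp F i.2 i.1.2).inv ≫ t ≫ (cmp F j.2 j.1.2).hom)
      (hF.map_add W _ _ a b)).trans ?_
    exact conj_add _ _ _ _
  map_smul {W i j} r a := by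
    refine (congrArg (fun t => (cmp F i.2 i.1.2).inv ≫ t ≫ (cmp F j.2 j.1.2).hom)
      (hF.map_smul W _ _ r a)).trans ?_
    exact conj_smul _ _ _ _

theorem _root_.TwistedSheaves.SysHom.IsLinear.toTrans {F : SysHom B.stack.sys B'.stack}
    (hF : SysHom.IsLinear (C := B.linSys) (B := B') F) : IsLinear F.toPreHom.toTrans where
  map_add U i j a b := by
    refine (congrArg (fun t => (B'.stack.rsId _).inv ≫ t ≫ (B'.stack.rsId _).hom)
      ((congrArg F.map (B.res_add _ a b)).trans (hF.map_add (i := ⟨⟨U, i⟩, le_rfl⟩)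
        (j := ⟨⟨U, j⟩, le_rfl⟩) _ _))).trans ?_
    exact conj_add _ _ _ _
  map_smul U i j r a := by
    refine (congrArg (fun t => (B'.stack.rsId _).inv ≫ t ≫ (B'.stack.rsId _).hom)
      ((congrArg F.map (B.res_smul _ r a)).trans (hF.map_smul (i := ⟨⟨U, i⟩, le_rfl⟩)
        (j := ⟨⟨U, j⟩, le_rfl⟩) _ _))).trans ?_
    exact conj_smul _ _ _ _

theorem locEssSurj_ofTrans {G H : Prestack X} {F : G ⟶ H} (hF : LocallyEssSurj F) :
    (SysHom.ofTrans F).LocEssSurj := by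
  intro U b x hx
  obtain ⟨V, f, i, hxV, ⟨e⟩⟩ := hF U b x hx
  let e' : (onFib F V).obj i ≅ (H.rs f.le).obj b := e
  exact ⟨⟨V, i⟩, V, le_rfl, f.le, hxV, ⟨H.rsId _ ≪≫ e'⟩⟩

theorem locallyEssSurj_toTrans {G H : Prestack X} {F : SysHom G.sys H} (hF : F.LocEssSurj) :
    LocallyEssSurj F.toPreHom.toTrans := by
  intro U b x hx
  obtain ⟨i, V, hi, h, hxV, ⟨e⟩⟩ := hF U b x hx
  let e' : (H.rs hi).obj (F.toPreHom.obj i.2) ≅ (H.rs h).obj b := e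
  exact ⟨V, homOfLE h, (G.rs hi).obj i.2, hxV, ⟨F.toPreHom.comparisonIso hi i.2 ≪≫ e'⟩⟩

theorem IsLinear.extendScalars_ofTrans {F : B.stack ⟶ B'.stack} (hF : IsLinear F)
    {W U U' : Opens X} (hi : W ≤ U) (hj : W ≤ U') (i : B.stack.fib U) (j : B.stack.fib U')
    (t : S ⊗[R] ((B.stack.rs hi).obj i ⟶ (B.stack.rs hj).obj j)) :
    extendScalars (hF.ofTrans.mapL ⟨⟨U, i⟩, hi⟩ ⟨⟨U', j⟩, hj⟩) t =
      conjL (S := S) (cmp F hi i).symm (cmp F hj j) (extendScalars (hF.mapHom W _ _) t) :=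
  extendScalars_congr (hF.mapHom W _ _) _ (conjL (S := S) (cmp F hi i).symm (cmp F hj j)).toLinearMap
    (fun _ => rfl) t

/-- The definition of an induced stack concerns objects over one open set, whereas `IsExt` allows
two objects with larger, different domains. The definition is applied to their restrictions, and
tensors are carried back by conjugation with `rsComp`. -/
theorem IsInduced.exists_isExt (h : B.IsInduced B') : ∃ (F : B.stack ⟶ B'.stack) (hF : IsLinear F),
    IsExt hF.ofTrans := by
  obtain ⟨F, hF, ess, inj, surj⟩ := h
  refine ⟨F, hF, locEssSurj_ofTrans ess, ?_, ?_⟩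
  · rintro W ⟨⟨U, i⟩, hi⟩ ⟨⟨U', j⟩, hj⟩ t e x hx
    have e' := (hF.extendScalars_ofTrans hi hj i j t).symm.trans e
    obtain ⟨V, f, hxV, e''⟩ := inj W _ _ t ((LinearEquiv.map_eq_zero_iff _).1 e') x hx
    refine ⟨V, f.le, hxV, ?_⟩
    have := LinearMap.lTensor_comp_apply S (conjL (S := R) (B.stack.rsComp f.le hi i)
      (B.stack.rsComp f.le hj j).symm).toLinearMap (B.rsL f.le _ _) t
    exact this.trans ((congrArg _ e'').trans (map_zero _))
  · rintro W ⟨⟨U, i⟩, hi⟩ ⟨⟨U', j⟩, hj⟩ s x hx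
    obtain ⟨V, f, hxV, t, e⟩ := surj W ((B.stack.rs hi).obj i) ((B.stack.rs hj).obj j)
      ((cmp F hi i).hom ≫ s ≫ (cmp F hj j).inv) x hx
    refine ⟨V, f.le, hxV, (conjL (S := R) (B.stack.rsComp f.le hi i)
      (B.stack.rsComp f.le hj j).symm).toLinearMap.lTensor S t, ?_⟩
    refine (hF.extendScalars_ofTrans (f.le.trans hi) (f.le.trans hj) i j _).trans ?_
    have e₁ := extendScalars_lTensor (hF.mapHom V _ _) (hF.mapHom V _ _)
      (conjL (S := R) (B.stack.rsComp f.le hi i) (B.stack.rsComp f.le hj j).symm).toLinearMap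
      (conjL (S := S) ((onFib F V).mapIso (B.stack.rsComp f.le hi i))
        ((onFib F V).mapIso (B.stack.rsComp f.le hj j).symm)).toLinearMap
      (fun m => ((onFib F V).map_comp _ _).trans (congrArg (_ ≫ ·) ((onFib F V).map_comp _ _))) t
    refine (congrArg _ (e₁.trans (congrArg _ e))).trans ?_
    refine (rr_eq_conj_resHom F f.le hi hj i j _).trans (congrArg (rr f.le) ?_)
    exact conj_cancel (cmp F hi i) (cmp F hj j) s

theorem _root_.TwistedSheaves.SysHom.IsExt.isInduced {F : SysHom B.stack.sys B'.stack}
    {hF : SysHom.IsLinear (C := B.linSys) (B := B') F} (h : IsExt hF) : B.IsInduced B' := by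
  -- The functor built from `F` acts on morphisms over `U` by restricting along the identity,
  -- applying `F`, and conjugating with `rsId`; the same formula persists after extending scalars.
  have key {U : Opens X} (i j : B.stack.fib U) (t : S ⊗[R] (i ⟶ j)) :
      extendScalars (hF.toTrans.mapHom U i j) t =
        conjL (S := S) (B'.stack.rsId (F.toPreHom.obj i)).symm (B'.stack.rsId (F.toPreHom.obj j))
          (extendScalars (hF.mapL ⟨⟨U, i⟩, le_rfl⟩ ⟨⟨U, j⟩, le_rfl⟩)
            ((B.rsL le_rfl i j).lTensor S t)) :=
    ((congrArg _ (extendScalars_lTensor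
      ((hF.mapL ⟨⟨U, i⟩, le_rfl⟩ ⟨⟨U, j⟩, le_rfl⟩).comp (B.rsL le_rfl i j)) _ _ LinearMap.id
        (fun _ => rfl) t)).trans (extendScalars_congr _ _ (conjL (S := S)
          (B'.stack.rsId (F.toPreHom.obj i)).symm (B'.stack.rsId (F.toPreHom.obj j))).toLinearMap
        (fun _ => rfl) t).symm).symm
  refine ⟨F.toPreHom.toTrans, hF.toTrans, locallyEssSurj_toTrans h.ess, fun U i j t e x hx => ?_,
    fun U i j s x hx => ?_⟩
  · have e₀ := (LinearEquiv.map_eq_zero_iff _).1 ((key i j t).symm.trans e)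
    obtain ⟨V, hV, hxV, e'⟩ := h.inj _ _ _ e₀ x hx
    refine ⟨V, homOfLE hV, hxV, ?_⟩
    refine Eq.trans ?_ ((LinearMap.lTensor_comp_apply S _ (B.rsL le_rfl i j) t).trans e')
    refine congrArg (fun l => LinearMap.lTensor S l t) (LinearMap.ext fun m => ?_)
    exact (rr_map hV le_rfl m).symm
  · obtain ⟨V, hV, hxV, t, e⟩ := h.surj (i := ⟨⟨U, i⟩, le_rfl⟩) (j := ⟨⟨U, j⟩, le_rfl⟩)
      ((B'.stack.rs le_rfl).map s) x hx
    refine ⟨V, homOfLE hV, hxV, t, ?_⟩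
    have e₁ := extendScalars_congr (hF.mapL ⟨⟨U, i⟩, hV⟩ ⟨⟨U, j⟩, hV⟩)
      (hF.toTrans.mapHom V ((B.stack.rs hV).obj i) ((B.stack.rs hV).obj j))
      (conjL (S := S) (F.toPreHom.comparisonIso hV i)
        (F.toPreHom.comparisonIso hV j).symm).toLinearMap (fun m => ?_) t
    · refine e₁.trans ?_
      refine (congrArg (fun s => (F.toPreHom.comparisonIso hV i).hom ≫ s ≫
        (F.toPreHom.comparisonIso hV j).inv) (e.trans (rr_map hV le_rfl s)))
    · have := F.toPreHom.map_eq hV hV m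
      refine Eq.trans ?_ (congrArg (fun s => (F.toPreHom.comparisonIso hV i).hom ≫ s ≫
        (F.toPreHom.comparisonIso hV j).inv) this).symm
      simp
      rfl

end AlgebroidStack

end

/-! ### Extension of scalars of classes of stacks of algebroids -/

section

variable {R S Q : Type u} [CommRing R] [CommRing S] [CommRing Q] [Algebra R S] [Algebra S Q]
  [Algebra R Q] {X : Type u} [TopologicalSpace X]

theorem Prestack.IsWeakEquivalence.isLocEquiv_ofTrans {G H : Prestack X} {F : G ⟶ H}
    (hF : IsWeakEquivalence F) : (SysHom.ofTrans F).IsLocEquiv where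
  ess := AlgebroidStack.locEssSurj_ofTrans hF.locallyEssSurj
  inj {W i j s t} e x hx := by
    refine ⟨W, le_rfl, hx, congrArg (Sys.res _ _) ((hF.bijective W _ _).1 ?_)⟩
    exact (cancel_epi (cmp F i.2 i.1.2).inv).1 ((cancel_mono (cmp F j.2 j.1.2).hom).1
      ((Category.assoc _ _ _).trans (e.trans (Category.assoc _ _ _).symm)))
  surj {W i j} s x hx := by
    obtain ⟨t, ht⟩ := (hF.bijective W ((G.rs i.2).obj i.1.2) ((G.rs j.2).obj j.1.2)).2
      ((cmp F i.2 i.1.2).hom ≫ s ≫ (cmp F j.2 j.1.2).inv)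
    refine ⟨W, le_rfl, hx, t, ?_⟩
    refine Eq.trans ?_ (rr_rfl _).symm
    refine (congrArg (fun s => (cmp F i.2 i.1.2).inv ≫ s ≫ (cmp F j.2 j.1.2).hom) ht).trans ?_
    exact conj_cancel (cmp F i.2 i.1.2) (cmp F j.2 j.1.2) s

namespace AlgebroidStack

open SysHom

theorem IsInduced.comp [IsScalarTower R S Q] {B : AlgebroidStack R X} {B' : AlgebroidStack S X}
    {B'' : AlgebroidStack Q X} (h : B.IsInduced B') (h' : B'.IsInduced B'') : B.IsInduced B'' := by
  obtain ⟨F, hF, h⟩ := h.exists_isExt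
  obtain ⟨F', hF', h'⟩ := h'.exists_isExt
  exact (h.comp h').isInduced

theorem WeaklyEquivalent.isInduced {B B' : AlgebroidStack R X} (h : B.WeaklyEquivalent B') :
    B.IsInduced B' := by
  obtain ⟨F, hF, hw⟩ := h
  exact ((isExt_iff_isLocEquiv hF.ofTrans Function.bijective_id).2 hw.isLocEquiv_ofTrans).isInduced

variable (S) in
/-- The extension of scalars of a stack of algebroids. -/
noncomputable def extend (B : AlgebroidStack R X) : AlgebroidStack S X :=
  (B.linSys.ext S).algebroid (B.linSys_isAlgebroid.ext S)

/-- The stack `B.extend S` is one induced stack and all others are weakly equivalent to it.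
Existence, uniqueness and functoriality of extension of scalars on classes follow from this and
`IsInduced.comp`. -/
theorem isInduced_iff {B : AlgebroidStack R X} {B' : AlgebroidStack S X} :
    B.IsInduced B' ↔ (B.extend S).WeaklyEquivalent B' := by
  refine ⟨fun h => ?_, fun h => ?_⟩
  · obtain ⟨F, hF, h⟩ := h.exists_isExt
    exact h.weaklyEquivalent_algebroid B.linSys_isAlgebroid
  · exact (B.linSys.toExt_isExt S B.linSys_isAlgebroid).isInduced.comp h.isInduced

theorem isInduced_extend (B : AlgebroidStack R X) : B.IsInduced (B.extend S) :=
  isInduced_iff.2 (WeaklyEquivalent.refl _)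

variable (S) in
/-- Extension of scalars of classes of stacks of algebroids. -/
noncomputable def Classes.extend : Classes R X → Classes S X :=
  Quot.lift (fun B => (B.extend S).cls) fun _ B' h =>
    cls_eq_iff.2 (isInduced_iff.1 (h.isInduced.comp B'.isInduced_extend))

theorem extend_cls_eq_iff {B : AlgebroidStack R X} {B' : AlgebroidStack S X} :
    Classes.extend S B.cls = B'.cls ↔ B.IsInduced B' :=
  cls_eq_iff.trans isInduced_iff.symm

theorem Classes.extend_self (b : Classes R X) : b.extend R = b := by
  induction b using Quot.ind with
  | mk B => exact extend_cls_eq_iff.2 (WeaklyEquivalent.refl B).isInduced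

theorem Classes.extend_extend [IsScalarTower R S Q] (b : Classes R X) :
    b.extend Q = (b.extend S).extend Q := by
  induction b using Quot.ind with
  | mk B => exact extend_cls_eq_iff.2 ((B.isInduced_extend (S := S)).comp (isInduced_extend _))

end AlgebroidStack

end

/-! ### Strict twisted systems of algebras

A strict system of groupoids with a representation on algebras and a coupling. -/

/-- A strict version of a twisted sheaf of algebras. -/
structure TwSys (R : Type u) [CommRing R] (X : Type u) [TopologicalSpace X] extends Sys X where
  isIso : ∀ {W : Opens X} {i j : toSys.At W} (g : i ⟶ j), IsIso g
  /-- The algebras. -/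
  Γ : ∀ {W : Opens X}, toSys.At W → AlgCat.{u} R
  /-- The action of morphisms. -/
  act : ∀ {W : Opens X} {i j : toSys.At W}, (i ⟶ j) → (Γ i →ₐ[R] Γ j)
  act_id : ∀ {W : Opens X} (i : toSys.At W) (a : Γ i), act (𝟙 i) a = a
  act_comp : ∀ {W : Opens X} {i j k : toSys.At W} (g : i ⟶ j) (h : j ⟶ k) (a : Γ i),
    act (g ≫ h) a = act h (act g a)
  /-- The restriction. -/
  resΓ : ∀ {W' W : Opens X} (h : W' ≤ W) (i : toSys.At W), Γ i →ₐ[R] Γ (Sys.At.rs h i)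
  resΓ_rfl : ∀ {W : Opens X} (i : toSys.At W) (a : Γ i), resΓ le_rfl i a = a
  resΓ_resΓ : ∀ {W'' W' W : Opens X} (h' : W'' ≤ W') (h : W' ≤ W) (i : toSys.At W) (a : Γ i),
    resΓ h' (Sys.At.rs h i) (resΓ h i a) = resΓ (h'.trans h) i a
  act_res : ∀ {W' W : Opens X} (h : W' ≤ W) {i j : toSys.At W} (g : i ⟶ j) (a : Γ i),
    act (toSys.res h g) (resΓ h i a) = resΓ h j (act g a)
  /-- The coupling. -/
  cp : ∀ {W : Opens X} {i : toSys.At W}, (i ⟶ i) → Γ i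
  cp_id : ∀ {W : Opens X} (i : toSys.At W), cp (𝟙 i) = 1
  cp_comp : ∀ {W : Opens X} {i : toSys.At W} (g h : i ⟶ i), cp (g ≫ h) = cp h * cp g
  cp_res : ∀ {W' W : Opens X} (h : W' ≤ W) {i : toSys.At W} (g : i ⟶ i),
    cp (toSys.res h g) = resΓ h i (cp g)
  cp_conj : ∀ {W : Opens X} {i j : toSys.At W} (h : i ⟶ j) (g : i ⟶ i) (g' : j ⟶ j),
    g ≫ h = h ≫ g' → cp g' = act h (cp g)
  act_aut : ∀ {W : Opens X} {i : toSys.At W} (g : i ⟶ i) (a : Γ i), act g a * cp g = cp g * a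

namespace TwSys

attribute [instance] TwSys.isIso

variable {R S : Type u} [CommRing R] [CommRing S] [Algebra R S] {X : Type u} [TopologicalSpace X]

variable (T : TwSys R X) {W : Opens X}

/-- The morphisms of the associated linear system: equivariant functions. -/
def homSub (i j : T.At W) : Submodule R ((i ⟶ j) → T.Γ i) where
  -- The value `φ g` is the section `a` such that the morphism is `a` followed by `g`. Writing it
  -- through `k ≫ g` instead splits off the automorphism `k`, whence the factor `cp k`; it stands on
  -- the left because products are compositions in reverse order.
  carrier := {φ | ∀ (k : i ⟶ i) (g : i ⟶ j), φ g = T.cp k * φ (k ≫ g)}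
  zero_mem' k g := (mul_zero _).symm
  add_mem' {φ ψ} h h' k g := by
    rw [Pi.add_apply, Pi.add_apply, mul_add, ← h, ← h']
  smul_mem' r φ h k g := by
    rw [Pi.smul_apply, Pi.smul_apply, mul_smul_comm, ← h]

variable {T}

theorem cp_inv_conj {i j : T.At W} (h : i ⟶ j) (g : j ⟶ j) :
    T.cp (h ≫ g ≫ inv h) = T.act (inv h) (T.cp g) :=
  T.cp_conj _ _ _ (by simp)

/-- The morphism corresponding to a section and an isomorphism. -/
noncomputable def of {i j : T.At W} (g : i ⟶ j) : T.Γ i →ₗ[R] T.homSub i j where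
  toFun a := ⟨fun g' => T.cp (g ≫ inv g') * a, fun k g' => by
    rw [← mul_assoc, ← T.cp_comp]
    simp⟩
  map_add' a b := Subtype.ext (funext fun g' => mul_add _ _ _)
  map_smul' r a := Subtype.ext (funext fun g' => mul_smul_comm _ _ _)

theorem of_apply {i j : T.At W} (g g' : i ⟶ j) (a : T.Γ i) :
    (of g a).1 g' = T.cp (g ≫ inv g') * a := rfl

@[simp]
theorem of_apply_self {i j : T.At W} (g : i ⟶ j) (a : T.Γ i) : (of g a).1 g = a := by
  rw [of_apply, IsIso.hom_inv_id, T.cp_id, one_mul]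

theorem of_self {i j : T.At W} (φ : T.homSub i j) (g : i ⟶ j) : of g (φ.1 g) = φ := by
  refine Subtype.ext (funext fun g' => ?_)
  rw [of_apply, φ.2 (g ≫ inv g') g']
  simp

/-- The change-of-isomorphism formula: every well-definedness statement about `comp`, `resHom` and
`TwRep.map` rests on it or on its pointwise form. -/
theorem of_eq_of {i j : T.At W} (g g' : i ⟶ j) (a : T.Γ i) :
    of g a = of g' (T.cp (g ≫ inv g') * a) := (of_self _ g').symm

theorem eq_zero_of_isEmpty {i j : T.At W} (h : IsEmpty (i ⟶ j)) (φ : T.homSub i j) : φ = 0 :=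
  Subtype.ext (funext fun g => h.elim g)

/-- If an isomorphism exists, the equivariant function is determined by its value there; otherwise
the module is zero. Identities can therefore be checked on elements `of g a`. -/
theorem eq_zero_or {i j : T.At W} (φ : T.homSub i j) : φ = 0 ∨ ∃ g a, φ = of g a := by
  rcases isEmpty_or_nonempty (i ⟶ j) with h | ⟨⟨g⟩⟩
  · exact .inl (eq_zero_of_isEmpty h φ)
  · exact .inr ⟨g, _, (of_self φ g).symm⟩

open Classical in
/-- The composition. -/
noncomputable def comp {i j k : T.At W} (φ : T.homSub i j) (ψ : T.homSub j k) : T.homSub i k :=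
  if h : Nonempty (i ⟶ j) ∧ Nonempty (j ⟶ k) then
    of (h.1.some ≫ h.2.some) (T.act (inv h.1.some) (ψ.1 h.2.some) * φ.1 h.1.some)
  else 0

/-- Independence of the composition from the chosen isomorphisms. Moving the section `b` of `Γ j` in
front of `g` turns it into `act (inv g) b`. The discrepancy between two choices is a coupling
factor, which can be moved across this section because automorphisms act by conjugation (`act_aut`).
-/
theorem of_comp_eq {i j k : T.At W} (g g₁ : i ⟶ j) (g' g₂ : j ⟶ k) (a : T.Γ i) (b : T.Γ j) :
    of (g₁ ≫ g₂) (T.act (inv g₁) ((of g' b).1 g₂) * (of g a).1 g₁) =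
      of (g ≫ g') (T.act (inv g) b * a) := by
  rw [of_eq_of (g ≫ g') (g₁ ≫ g₂)]
  congr 1
  have e₁ : (g ≫ g') ≫ inv (g₁ ≫ g₂) = (g ≫ inv g₁) ≫ (g₁ ≫ (g' ≫ inv g₂) ≫ inv g₁) := by simp
  have e₂ : T.act (inv g₁) b = T.act (g ≫ inv g₁) (T.act (inv g) b) := by
    rw [← T.act_comp]; simp
  rw [e₁, T.cp_comp, cp_inv_conj, of_apply, of_apply, map_mul, e₂, mul_assoc, mul_assoc,
    ← mul_assoc _ (T.cp _) a, T.act_aut, mul_assoc]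

theorem comp_of {i j k : T.At W} (g : i ⟶ j) (g' : j ⟶ k) (a : T.Γ i) (b : T.Γ j) :
    comp (of g a) (of g' b) = of (g ≫ g') (T.act (inv g) b * a) := by
  have h : Nonempty (i ⟶ j) ∧ Nonempty (j ⟶ k) := ⟨⟨g⟩, ⟨g'⟩⟩
  rw [comp, dif_pos h, of_comp_eq]

theorem zero_comp {i j k : T.At W} (ψ : T.homSub j k) : comp (0 : T.homSub i j) ψ = 0 := by
  unfold comp
  split_ifs with h
  · refine (congrArg (of _) (mul_zero _)).trans (map_zero _)
  · rfl

theorem comp_zero {i j k : T.At W} (φ : T.homSub i j) : comp φ (0 : T.homSub j k) = 0 := by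
  unfold comp
  split_ifs with h
  · refine (congrArg (of _) ((congrArg (· * _) (map_zero _)).trans (zero_mul _))).trans (map_zero _)
  · rfl

theorem add_comp {i j k : T.At W} (φ φ' : T.homSub i j) (ψ : T.homSub j k) :
    comp (φ + φ') ψ = comp φ ψ + comp φ' ψ := by
  unfold comp
  split_ifs with h
  · rw [← map_add, ← mul_add]; rfl
  · simp

theorem comp_add {i j k : T.At W} (φ : T.homSub i j) (ψ ψ' : T.homSub j k) :
    comp φ (ψ + ψ') = comp φ ψ + comp φ ψ' := by
  unfold comp
  split_ifs with h
  · rw [← map_add, ← add_mul, ← map_add]; rfl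
  · simp

theorem smul_comp {i j k : T.At W} (r : R) (φ : T.homSub i j) (ψ : T.homSub j k) :
    comp (r • φ) ψ = r • comp φ ψ := by
  unfold comp
  split_ifs with h
  · rw [← map_smul, ← mul_smul_comm]; rfl
  · simp

theorem comp_smul {i j k : T.At W} (r : R) (φ : T.homSub i j) (ψ : T.homSub j k) :
    comp φ (r • ψ) = r • comp φ ψ := by
  unfold comp
  split_ifs with h
  · rw [← map_smul, ← smul_mul_assoc, ← map_smul]; rfl
  · simp

theorem one_comp {i j : T.At W} (φ : T.homSub i j) : comp (of (𝟙 i) 1) φ = φ := by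
  rcases eq_zero_or φ with rfl | ⟨g, a, rfl⟩
  · exact comp_zero _
  · rw [comp_of]
    simp [T.act_id]

theorem comp_one {i j : T.At W} (φ : T.homSub i j) : comp φ (of (𝟙 j) 1) = φ := by
  rcases eq_zero_or φ with rfl | ⟨g, a, rfl⟩
  · exact zero_comp _
  · rw [comp_of]
    simp

theorem comp_assoc {i j k l : T.At W} (φ : T.homSub i j) (ψ : T.homSub j k) (χ : T.homSub k l) :
    comp (comp φ ψ) χ = comp φ (comp ψ χ) := by
  rcases eq_zero_or φ with rfl | ⟨g, a, rfl⟩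
  · rw [zero_comp, zero_comp, zero_comp]
  rcases eq_zero_or ψ with rfl | ⟨g', b, rfl⟩
  · rw [zero_comp, comp_zero, zero_comp, comp_zero]
  rcases eq_zero_or χ with rfl | ⟨g'', c, rfl⟩
  · rw [comp_zero, comp_zero, comp_zero]
  rw [comp_of, comp_of, comp_of, comp_of, Category.assoc, map_mul (T.act _),
    ← T.act_comp, mul_assoc, IsIso.inv_comp]

open Classical in
/-- The restriction. -/
noncomputable def resHom {W' : Opens X} (h : W' ≤ W) {i j : T.At W} (φ : T.homSub i j) :
    T.homSub (Sys.At.rs h i) (Sys.At.rs h j) :=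
  if h' : Nonempty (i ⟶ j) then of (T.res h h'.some) (T.resΓ h i (φ.1 h'.some)) else 0

theorem inv_res {W' : Opens X} (h : W' ≤ W) {i j : T.At W} (g : i ⟶ j) :
    T.res h (inv g) = inv (T.res h g) := by
  refine IsIso.eq_inv_of_hom_inv_id ?_
  rw [← T.res_comp, IsIso.hom_inv_id, T.res_id]

/-- The restriction is independent of the chosen isomorphism since the coupling commutes with
restriction. -/
theorem resHom_of {W' : Opens X} (h : W' ≤ W) {i j : T.At W} (g : i ⟶ j) (a : T.Γ i) :
    resHom h (of g a) = of (T.res h g) (T.resΓ h i a) := by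
  have h' : Nonempty (i ⟶ j) := ⟨g⟩
  rw [resHom, dif_pos h', of_eq_of (T.res h g) (T.res h h'.some), of_apply,
    map_mul (T.resΓ h i), ← T.cp_res, T.res_comp, inv_res]

theorem resHom_add {W' : Opens X} (h : W' ≤ W) {i j : T.At W} (φ ψ : T.homSub i j) :
    resHom h (φ + ψ) = resHom h φ + resHom h ψ := by
  unfold resHom
  split_ifs with h
  · rw [← map_add, ← map_add]; rfl
  · simp

theorem resHom_smul {W' : Opens X} (h : W' ≤ W) {i j : T.At W} (r : R) (φ : T.homSub i j) :
    resHom h (r • φ) = r • resHom h φ := by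
  unfold resHom
  split_ifs with h
  · rw [← map_smul, ← map_smul]; rfl
  · simp

theorem resHom_zero {W' : Opens X} (h : W' ≤ W) (i j : T.At W) :
    resHom h (0 : T.homSub i j) = 0 := by
  have := resHom_smul h 0 (0 : T.homSub i j)
  rwa [zero_smul, zero_smul] at this

theorem resHom_comp {W' : Opens X} (h : W' ≤ W) {i j k : T.At W} (φ : T.homSub i j)
    (ψ : T.homSub j k) : resHom h (comp φ ψ) = comp (resHom h φ) (resHom h ψ) := by
  rcases eq_zero_or φ with rfl | ⟨g, a, rfl⟩
  · rw [zero_comp, resHom_zero, resHom_zero, zero_comp]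
  rcases eq_zero_or ψ with rfl | ⟨g', b, rfl⟩
  · rw [comp_zero, resHom_zero, resHom_zero, comp_zero]
  rw [comp_of, resHom_of, resHom_of, resHom_of, comp_of, map_mul (T.resΓ h _), ← T.act_res, T.res_comp, inv_res]

variable (T) in
/-- The associated linear system. -/
noncomputable def homSys : Sys X where
  Obj := T.Obj
  dom := T.dom
  cat W :=
    { Hom i j := T.homSub (W := W) i j
      id i := of (𝟙 (show T.At W from i)) 1
      comp φ ψ := comp φ ψ
      id_comp := one_comp
      comp_id := comp_one
      assoc := comp_assoc }
  res h _ _ φ := resHom h φ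
  res_id h i := by
    refine (resHom_of h (𝟙 (show T.At _ from i)) 1).trans ?_
    rw [T.res_id, map_one]
    rfl
  res_comp h _ _ _ φ ψ := resHom_comp h φ ψ
  res_rfl {W i j} φ := by
    suffices H : ∀ (i j : T.At W) (φ : T.homSub i j), resHom le_rfl φ = φ from H i j φ
    intro i j φ
    rcases eq_zero_or φ with rfl | ⟨g, a, rfl⟩
    · exact resHom_zero _ _ _
    · refine (resHom_of _ g a).trans ?_
      rw [T.res_rfl]
      exact congrArg (of g) (T.resΓ_rfl i a)
  res_res {W'' W' W} h' h {i j} φ := by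
    suffices H : ∀ (i j : T.At W) (φ : T.homSub i j), resHom h' (resHom h φ) =
      resHom (h'.trans h) φ from H i j φ
    intro i j φ
    rcases eq_zero_or φ with rfl | ⟨g, a, rfl⟩
    · rw [resHom_zero]
      exact (resHom_zero _ _ _).trans (resHom_zero (h'.trans h) _ _).symm
    · rw [resHom_of, resHom_of, resHom_of, T.res_res, T.resΓ_resΓ]

variable (T) in
/-- The addition on the associated linear system. -/
@[reducible] noncomputable def homPreadditive (W : Opens X) : Preadditive (T.homSys.At W) where
  homGroup i j := inferInstanceAs (AddCommGroup (T.homSub (W := W) i j))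
  add_comp _ _ _ φ φ' ψ := add_comp φ φ' ψ
  comp_add _ _ _ φ ψ ψ' := comp_add φ ψ ψ'

variable (T) in
/-- The associated linear system. -/
noncomputable def linSys : LinSys R X where
  toSys := T.homSys
  preadditive W := T.homPreadditive W
  linear W := letI := T.homPreadditive W
    { homModule i j := inferInstanceAs (Module R (T.homSub (W := W) i j))
      smul_comp _ _ _ r φ ψ := smul_comp r φ ψ
      comp_smul _ _ _ φ r ψ := comp_smul r φ ψ }
  res_add h _ _ φ ψ := resHom_add h φ ψ
  res_smul h _ _ r φ := resHom_smul h r φ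

end TwSys

/-! ### Representations of twisted systems in stacks of algebroids -/

/-- A representation of a twisted system in a stack of algebroids. -/
structure TwRep {R S : Type u} [CommRing R] [CommRing S] [Algebra R S] {X : Type u}
    [TopologicalSpace X] (T : TwSys R X) (B : AlgebroidStack S X) where
  /-- The functor. -/
  F : SysHom T.toSys B.stack
  /-- The action of the algebras. -/
  ε : ∀ {W : Opens X} (i : T.At W), T.Γ i →ₛₗ[algebraMap R S]
    ((B.stack.rs i.2).obj (F.obj i.1) ⟶ (B.stack.rs i.2).obj (F.obj i.1))
  one : ∀ {W : Opens X} (i : T.At W), ε i 1 = 𝟙 _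
  mul : ∀ {W : Opens X} (i : T.At W) (a b : T.Γ i), ε i (a * b) = ε i b ≫ ε i a
  res : ∀ {W' W : Opens X} (h : W' ≤ W) (i : T.At W) (a : T.Γ i),
    ε (Sys.At.rs h i) (T.resΓ h i a) = rr h (ε i a)
  act : ∀ {W : Opens X} {i j : T.At W} (g : i ⟶ j) (a : T.Γ i),
    F.map g ≫ ε j (T.act g a) = ε i a ≫ F.map g
  cp : ∀ {W : Opens X} {i : T.At W} (g : i ⟶ i), ε i (T.cp g) = F.map g

namespace TwRep

variable {R S : Type u} [CommRing R] [CommRing S] [Algebra R S] {X : Type u} [TopologicalSpace X]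
  {T : TwSys R X} {B : AlgebroidStack S X} (E : TwRep T B) {W : Opens X}

open TwSys

open Classical in
/-- The action on morphisms. -/
noncomputable def map {i j : T.At W} (φ : T.homSub i j) :
    (B.stack.rs i.2).obj (E.F.obj i.1) ⟶ (B.stack.rs j.2).obj (E.F.obj j.1) :=
  if h : Nonempty (i ⟶ j) then E.ε i (φ.1 h.some) ≫ E.F.map h.some else 0

/-- For another isomorphism the section acquires the coupling of an automorphism; the representation
turns this coupling into the image of that automorphism, which makes up for the change of
isomorphism. -/
theorem map_of {i j : T.At W} (g : i ⟶ j) (a : T.Γ i) : E.map (of g a) = E.ε i a ≫ E.F.map g := by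
  have h : Nonempty (i ⟶ j) := ⟨g⟩
  rw [map, dif_pos h, of_apply, E.mul, E.cp, Category.assoc, ← E.F.map_comp, Category.assoc,
    IsIso.inv_hom_id, Category.comp_id]

theorem map_add {i j : T.At W} (φ ψ : T.homSub i j) : E.map (φ + ψ) = E.map φ + E.map ψ := by
  unfold map
  split_ifs with h
  · refine (congrArg (· ≫ _) ((E.ε i).map_add _ _)).trans (Preadditive.add_comp _ _ _ _ _ _)
  · rw [add_zero]

theorem map_smul {i j : T.At W} (r : R) (φ : T.homSub i j) :
    E.map (r • φ) = algebraMap R S r • E.map φ := by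
  unfold map
  split_ifs with h
  · refine (congrArg (· ≫ _) ((E.ε i).map_smulₛₗ _ _)).trans (Linear.smul_comp _ _ _ _ _ _)
  · rw [smul_zero]

theorem map_zero (i j : T.At W) : E.map (0 : T.homSub i j) = 0 := by
  have := E.map_smul 0 (0 : T.homSub i j)
  rwa [zero_smul, _root_.map_zero, zero_smul] at this

theorem map_comp {i j k : T.At W} (φ : T.homSub i j) (ψ : T.homSub j k) :
    E.map (comp φ ψ) = E.map φ ≫ E.map ψ := by
  rcases eq_zero_or φ with rfl | ⟨g, a, rfl⟩
  · rw [zero_comp, map_zero, map_zero, Limits.zero_comp]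
  rcases eq_zero_or ψ with rfl | ⟨g', b, rfl⟩
  · rw [comp_zero, map_zero, map_zero, Limits.comp_zero]
  have e : E.ε i (T.act (inv g) b) ≫ E.F.map g = E.F.map g ≫ E.ε j b := by
    have := E.act g (T.act (inv g) b)
    rwa [← T.act_comp, IsIso.inv_hom_id, T.act_id, eq_comm] at this
  rw [comp_of, map_of, map_of, map_of, E.mul, E.F.map_comp]
  simp only [Category.assoc]
  rw [reassoc_of% e]

theorem map_res {W' : Opens X} (h : W' ≤ W) {i j : T.At W} (φ : T.homSub i j) :
    E.map (resHom h φ) = rr h (E.map φ) := by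
  rcases eq_zero_or φ with rfl | ⟨g, a, rfl⟩
  · rw [resHom_zero, map_zero, map_zero]
    exact (_root_.map_zero (B.rrL h _ _)).symm
  · rw [resHom_of, map_of, map_of, rr_comp, E.res, E.F.map_res]

/-- The functor on the associated linear system. -/
noncomputable def toSysHom : SysHom T.linSys.toSys B.stack where
  obj i := E.F.obj i
  map φ := E.map φ
  map_id i := by
    refine (E.map_of (𝟙 (show T.At _ from i)) 1).trans ?_
    refine (congrArg₂ (· ≫ ·) (E.one (show T.At _ from i)) (E.F.map_id (show T.At _ from i))).trans ?_
    exact Category.comp_id _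
  map_comp φ ψ := E.map_comp φ ψ
  map_res h _ _ φ := E.map_res h φ

theorem isLinear : E.toSysHom.IsLinear where
  map_add a b := E.map_add a b
  map_smul r a := E.map_smul r a

variable (T) in
/-- Restriction of sections as a linear map. -/
abbrev _root_.TwistedSheaves.TwSys.resΓL {W' : Opens X} (h : W' ≤ W) (i : T.At W) :
    T.Γ i →ₗ[R] T.Γ (Sys.At.rs h i) := (T.resΓ h i).toLinearMap

/-- Locally connected systems. -/
structure _root_.TwistedSheaves.TwSys.IsTwisted (T : TwSys R X) : Prop where
  small : Small.{u} T.Obj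
  nonempty : ∀ x : X, ∃ i : T.Obj, x ∈ T.dom i
  connected : ∀ {W : Opens X} (i j : T.At W), ∀ x ∈ W, ∃ (V : Opens X) (h : V ≤ W), x ∈ V ∧
    Nonempty (Sys.At.rs h i ⟶ Sys.At.rs h j)

/-- A representation which makes the stack of algebroids the extension of scalars of the twisted
system. -/
structure IsExt : Prop where
  ess : E.F.LocEssSurj
  inj : ∀ {W : Opens X} (i : T.At W) (t : S ⊗[R] T.Γ i), extendScalars (E.ε i) t = 0 →
    ∀ x ∈ W, ∃ (V : Opens X) (h : V ≤ W), x ∈ V ∧ (T.resΓL h i).lTensor S t = 0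
  surj : ∀ {W : Opens X} (i : T.At W)
    (s : (B.stack.rs i.2).obj (E.F.obj i.1) ⟶ (B.stack.rs i.2).obj (E.F.obj i.1)),
    ∀ x ∈ W, ∃ (V : Opens X) (h : V ≤ W), x ∈ V ∧
      ∃ t : S ⊗[R] T.Γ (Sys.At.rs h i), extendScalars (E.ε _) t = rr h s

/-- An object as an object of the associated linear system. -/
abbrev _root_.TwistedSheaves.TwSys.lat (i : T.At W) : T.linSys.At W := i

/-- The map `of`, with values in the morphisms of the associated linear system. -/
noncomputable def _root_.TwistedSheaves.TwSys.ofL {i j : T.At W} (g : i ⟶ j) :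
    T.Γ i →ₗ[R] (lat i ⟶ lat j) := of g

theorem extendScalars_of {i j : T.At W} (g : i ⟶ j) (t : S ⊗[R] T.Γ i) :
    extendScalars (E.isLinear.mapL (lat i) (lat j)) ((ofL g).lTensor S t) =
      extendScalars (E.ε i) t ≫ E.F.map g :=
  extendScalars_lTensor (E.ε i) (E.isLinear.mapL (lat i) (lat j)) (ofL g)
    (Linear.rightComp S _ (E.F.map g)) (fun a => E.map_of g a) t

theorem exists_lTensor_of {i j : T.At W} (g : i ⟶ j) (t : S ⊗[R] (lat i ⟶ lat j)) :
    ∃ t', (ofL g).lTensor S t' = t := by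
  induction t with
  | zero => exact ⟨0, _root_.map_zero _⟩
  | tmul s φ => exact ⟨s ⊗ₜ (show T.homSub i j from φ).1 g, (LinearMap.lTensor_tmul _ _ _ _).trans
      (congrArg (s ⊗ₜ[R] ·) (of_self (show T.homSub i j from φ) g))⟩
  | add t t' h h' =>
    obtain ⟨a, rfl⟩ := h
    obtain ⟨b, rfl⟩ := h'
    exact ⟨a + b, _root_.map_add _ _ _⟩

theorem lTensor_resL_of {W' : Opens X} (h : W' ≤ W) {i j : T.At W} (g : i ⟶ j)
    (t : S ⊗[R] T.Γ i) : (T.linSys.resL h (lat i) (lat j)).lTensor S ((ofL g).lTensor S t) =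
      (ofL (T.res h g)).lTensor S ((T.resΓL h i).lTensor S t) := by
  refine (LinearMap.lTensor_comp_apply S _ _ t).symm.trans
    (Eq.trans ?_ (LinearMap.lTensor_comp_apply S _ _ t))
  exact congrArg (fun l => LinearMap.lTensor S l t) (LinearMap.ext fun a => resHom_of h g a)

variable {E} in
theorem IsExt.exists_extendScalars_eq (hT : T.IsTwisted) (hE : E.IsExt) (i j : T.At W)
    (s : (B.stack.rs i.2).obj (E.F.obj i.1) ⟶ (B.stack.rs j.2).obj (E.F.obj j.1))
    (x : X) (hx : x ∈ W) : ∃ (V : Opens X) (h : V ≤ W), x ∈ V ∧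
      ∃ t : S ⊗[R] (lat (Sys.At.rs h i) ⟶ lat (Sys.At.rs h j)),
        extendScalars (E.isLinear.mapL (lat (Sys.At.rs h i)) (lat (Sys.At.rs h j))) t = rr h s := by
  obtain ⟨V, h, hxV, ⟨g⟩⟩ := hT.connected i j x hx
  obtain ⟨V', h', hxV', t, ht⟩ := hE.surj (Sys.At.rs (C := T.toSys) h i)
    (rr h s ≫ E.F.map (inv g)) x hxV
  refine ⟨V', h'.trans h, hxV', (ofL (T.res h' g)).lTensor S t, ?_⟩
  refine (E.extendScalars_of (T.res h' g) t).trans ((congrArg (· ≫ _) ht).trans ?_)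
  rw [rr_comp, rr_rr, E.F.map_res, Category.assoc, ← rr_comp, ← E.F.map_comp, IsIso.inv_hom_id,
    E.F.map_id, rr_id, Category.comp_id]

-- Conditions on the algebras `Γ i` control all morphisms: `i` and `j` are isomorphic on a
-- neighbourhood of each point, and composing with such an isomorphism reduces morphisms `i ⟶ j` to
-- endomorphisms of `i`.
variable {E} in
theorem IsExt.isExt (hT : T.IsTwisted) (hE : E.IsExt) : SysHom.IsExt E.isLinear where
  ess := hE.ess
  inj {W} i' j' t e x hx := by
    let i : T.At W := i'
    let j : T.At W := j'
    obtain ⟨V, h, hxV, ⟨g⟩⟩ := hT.connected i j x hx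
    obtain ⟨t', ht'⟩ := exists_lTensor_of (S := S) g ((T.linSys.resL h (lat i) (lat j)).lTensor S t)
    have e₁ : extendScalars (E.ε _) t' ≫ E.F.map g = 0 := by
      refine (E.extendScalars_of g t').symm.trans ((congrArg _ ht').trans ?_)
      refine (E.isLinear.extendScalars_mapL_res h t).trans ((congrArg (rr h) e).trans ?_)
      exact _root_.map_zero (B.rrL h _ _)
    have e₂ : extendScalars (E.ε _) t' = 0 := by
      have := congrArg (· ≫ E.F.map (inv g)) e₁
      simp only [Category.assoc] at this
      rwa [← E.F.map_comp, IsIso.hom_inv_id, E.F.map_id, Category.comp_id, Limits.zero_comp] at this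
    obtain ⟨V', h', hxV', e₃⟩ := hE.inj _ _ e₂ x hxV
    refine ⟨V', h'.trans h, hxV', ?_⟩
    refine (T.linSys.lTensor_resL_resL S h' h t).symm.trans ((congrArg _ ht').symm.trans ?_)
    refine (lTensor_resL_of h' g t').trans ?_
    rw [e₃, _root_.map_zero]
    rfl
  surj i j s x hx := hE.exists_extendScalars_eq hT i j s x hx

theorem _root_.TwistedSheaves.TwSys.IsTwisted.isAlgebroid (hT : T.IsTwisted) :
    T.linSys.IsAlgebroid where
  small := hT.small
  nonempty := hT.nonempty
  connected i' j' x hi hj := by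
    let i : T.Obj := i'
    let j : T.Obj := j'
    obtain ⟨V, h, hxV, ⟨g⟩⟩ := hT.connected (W := T.dom i ⊓ T.dom j) ⟨i, inf_le_left⟩
      ⟨j, inf_le_right⟩ x ⟨hi, hj⟩
    have key {i j : T.At V} (g : i ⟶ j) : comp (of g 1) (of (inv g) 1) = of (𝟙 i) 1 := by
      rw [comp_of, _root_.map_one, mul_one, IsIso.hom_inv_id]
    have e := key (inv g)
    rw [IsIso.inv_inv] at e
    exact ⟨V, h.trans inf_le_left, h.trans inf_le_right, hxV,
      ⟨⟨of g 1, of (inv g) 1, key g, e⟩⟩⟩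

end TwRep

/-! ### Sections of sheaves of algebras -/

section

variable {R : Type u} [CommRing R] {X : Type u} [TopologicalSpace X] {W' W U U' U'' : Opens X}

/-- The sections over `W` of a sheaf of algebras on `U`. -/
noncomputable abbrev shSec (𝒜 : (assocStack R X).fib U) (h : W ≤ U) : AlgCat.{u} R :=
  sections 𝒜 (homOfLE h)

/-- The restriction of sections. -/
noncomputable def shRes (𝒜 : (assocStack R X).fib U) (h : W' ≤ W) (hi : W ≤ U) :
    shSec 𝒜 hi →ₐ[R] shSec 𝒜 (h.trans hi) :=
  ((show Sheaf ((Opens.grothendieckTopology X).over U) (AlgCat.{u} R) from 𝒜).obj.map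
    (Over.homMk (homOfLE h) :
      Over.mk (homOfLE (h.trans hi)) ⟶ Over.mk (homOfLE hi)).op).hom

/-- The action of a morphism between restrictions on sections. -/
noncomputable def shMap {hi : W ≤ U} {hj : W ≤ U'} {𝒜 : (assocStack R X).fib U}
    {ℬ : (assocStack R X).fib U'}
    (t : ((assocStack R X).rs hi).obj 𝒜 ⟶ ((assocStack R X).rs hj).obj ℬ) :
    shSec 𝒜 hi →ₐ[R] shSec ℬ hj :=
  sectionsMap t (𝟙 W)

variable {hi : W ≤ U} {hj : W ≤ U'} {hk : W ≤ U''} {𝒜 : (assocStack R X).fib U}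
    {ℬ : (assocStack R X).fib U'} {𝒞 : (assocStack R X).fib U''}

theorem shRes_rfl (a : shSec 𝒜 hi) : shRes 𝒜 le_rfl hi a = a :=
  congrArg (fun f => f.hom a) ((show Sheaf ((Opens.grothendieckTopology X).over U)
    (AlgCat.{u} R) from 𝒜).obj.map_id (op (Over.mk (homOfLE hi))))

theorem shRes_shRes {W'' : Opens X} (h' : W'' ≤ W') (h : W' ≤ W) (a : shSec 𝒜 hi) :
    shRes 𝒜 h' (h.trans hi) (shRes 𝒜 h hi a) = shRes 𝒜 (h'.trans h) hi a :=
  congrArg (fun f => f.hom a) ((show Sheaf ((Opens.grothendieckTopology X).over U)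
    (AlgCat.{u} R) from 𝒜).obj.map_comp
      (Over.homMk (homOfLE h) :
        Over.mk (homOfLE (h.trans hi)) ⟶ Over.mk (homOfLE hi)).op
      (Over.homMk (homOfLE h') :
        Over.mk (homOfLE (h'.trans (h.trans hi))) ⟶ Over.mk (homOfLE (h.trans hi))).op).symm

/-- Iterated restriction of sheaves to open subsets does not change the sections, and the structural
isomorphism acts on them as the restriction map of an identity. -/
theorem sectionsMap_rsComp_hom (h : W' ≤ W) (hi : W ≤ U) (a : shSec 𝒜 (h.trans hi)) :
    sectionsMap ((assocStack R X).rsComp h hi 𝒜).hom (𝟙 W') a = a :=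
  congrArg (fun f => f.hom a) ((show Sheaf ((Opens.grothendieckTopology X).over U)
    (AlgCat.{u} R) from 𝒜).obj.map_id (op (Over.mk (homOfLE (h.trans hi)))))

theorem sectionsMap_rsComp_inv (h : W' ≤ W) (hi : W ≤ U) (a : shSec 𝒜 (h.trans hi)) :
    sectionsMap ((assocStack R X).rsComp h hi 𝒜).inv (𝟙 W') a = a :=
  congrArg (fun f => f.hom a) ((show Sheaf ((Opens.grothendieckTopology X).over U)
    (AlgCat.{u} R) from 𝒜).obj.map_id (op (Over.mk (homOfLE (h.trans hi)))))

theorem sectionsMap_rsId_hom (a : shSec 𝒜 (le_refl U)) :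
    sectionsMap ((assocStack R X).rsId 𝒜).hom (𝟙 U) a = a :=
  congrArg (fun f => f.hom a) ((show Sheaf ((Opens.grothendieckTopology X).over U)
    (AlgCat.{u} R) from 𝒜).obj.map_id (op (Over.mk (homOfLE le_rfl))))

theorem shRes_naturality {𝒜 ℬ : (assocStack R X).fib U} (t : 𝒜 ⟶ ℬ) (h : W' ≤ W) (hi : W ≤ U)
    (a : shSec 𝒜 hi) :
    sectionsMap t (homOfLE (h.trans hi)) (shRes 𝒜 h hi a) =
      shRes ℬ h hi (sectionsMap t (homOfLE hi) a) :=
  congrArg (fun f => f.hom a) ((show (show Sheaf ((Opens.grothendieckTopology X).over U)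
    (AlgCat.{u} R) from 𝒜) ⟶ ℬ from t).hom.naturality (Over.homMk (homOfLE h) :
        Over.mk (homOfLE (h.trans hi)) ⟶ Over.mk (homOfLE hi)).op)

theorem shMap_rs (h : W' ≤ W)
    (t : ((assocStack R X).rs hi).obj 𝒜 ⟶ ((assocStack R X).rs hj).obj ℬ) (a : shSec 𝒜 hi) :
    (sectionsMap t (homOfLE h) (shRes 𝒜 h hi a) : shSec ℬ (h.trans hj)) =
      shRes ℬ h hj (shMap t a) :=
  congrArg (fun f => f.hom a) ((show (show Sheaf ((Opens.grothendieckTopology X).over W)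
    (AlgCat.{u} R) from ((assocStack R X).rs hi).obj 𝒜) ⟶ ((assocStack R X).rs hj).obj ℬ
      from t).hom.naturality (Over.homMk (homOfLE h) :
        Over.mk (homOfLE h) ⟶ Over.mk (𝟙 W)).op)

theorem sectionsMap_comp₃ {𝒜 ℬ 𝒞 𝒟 : (assocStack R X).fib U} (t : 𝒜 ⟶ ℬ) (s : ℬ ⟶ 𝒞) (r : 𝒞 ⟶ 𝒟)
    {V : Opens X} (f : V ⟶ U) (a : sections 𝒜 f) : sectionsMap (t ≫ s ≫ r) f a =
      sectionsMap r f (sectionsMap s f (sectionsMap t f a)) :=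
  rfl

theorem sectionsMap_rs {𝒜 ℬ : (assocStack R X).fib U} (t : 𝒜 ⟶ ℬ) (h : W ≤ U) (a : shSec 𝒜 h) :
    (sectionsMap (((assocStack R X).rs h).map t) (𝟙 W) a : shSec ℬ h) =
      sectionsMap t (homOfLE h) a :=
  rfl

theorem shMap_rr (h : W' ≤ W)
    (t : ((assocStack R X).rs hi).obj 𝒜 ⟶ ((assocStack R X).rs hj).obj ℬ) (a : shSec 𝒜 hi) :
    shMap (hi := h.trans hi) (hj := h.trans hj) (rr h t) (shRes 𝒜 h hi a) =
      shRes ℬ h hj (shMap t a) := by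
  have e₀ := sectionsMap_comp₃ ((assocStack R X).rsComp h hi 𝒜).hom (((assocStack R X).rs h).map t)
    ((assocStack R X).rsComp h hj ℬ).inv (𝟙 W') (shRes 𝒜 h hi a)
  have e₁ := sectionsMap_rsComp_hom h hi (shRes 𝒜 h hi a)
  have e₂ := (sectionsMap_rs t h (shRes 𝒜 h hi a)).trans (shMap_rs h t a)
  have e₃ := sectionsMap_rsComp_inv h hj (shRes ℬ h hj (shMap t a))
  exact e₀.trans ((congrArg (fun y => sectionsMap ((assocStack R X).rsComp h hj ℬ).inv (𝟙 W')
    (sectionsMap (((assocStack R X).rs h).map t) (𝟙 W') y)) e₁).trans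
      ((congrArg (sectionsMap ((assocStack R X).rsComp h hj ℬ).inv (𝟙 W')) e₂).trans e₃))

/-- Two sections which agree locally are equal. -/
theorem shSec_ext (a b : shSec 𝒜 hi)
    (h : ∀ x ∈ W, ∃ (V : Opens X) (hV : V ≤ W), x ∈ V ∧ shRes 𝒜 hV hi a = shRes 𝒜 hV hi b) :
    a = b := by
  choose V hV hxV e using fun x : W => h x.1 x.2
  have hP := (Presheaf.isSheaf_iff_isSheaf_forget _ _ (forget (AlgCat.{u} R))).1
    (show Sheaf ((Opens.grothendieckTopology X).over U) (AlgCat.{u} R) from 𝒜).property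
  exact sheafOver_ext hP hi V hV (fun x hx => ⟨⟨x, hx⟩, hxV _⟩) a b e

/-- Gluing of sections. -/
theorem exists_shSec_glue {ι : Type*} (V : ι → Opens X) (hV : ∀ a, V a ≤ W)
    (hc : ∀ x ∈ W, ∃ a, x ∈ V a) (s : ∀ a, shSec 𝒜 ((hV a).trans hi))
    (h : ∀ a b (Y : Opens X) (ha : Y ≤ V a) (hb : Y ≤ V b),
      shRes 𝒜 ha ((hV a).trans hi) (s a) = shRes 𝒜 hb ((hV b).trans hi) (s b)) :
    ∃ t : shSec 𝒜 hi, ∀ a, shRes 𝒜 (hV a) hi t = s a := by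
  have hP := (Presheaf.isSheaf_iff_isSheaf_forget _ _ (forget (AlgCat.{u} R))).1
    (show Sheaf ((Opens.grothendieckTopology X).over U) (AlgCat.{u} R) from 𝒜).property
  exact sheafOver_glue hP hi V hV hc s h

end

/-! ### The twisted system of a twisted sheaf -/

section

variable {R : Type u} [CommRing R] {X : Type u} [TopologicalSpace X] {G : Prestack X}
  (A : G ⟶ assocStack R X) {W' W U U' : Opens X}

/-- Sections over `W` of the algebra of an object restricted to `W`. -/
noncomputable def toSh (h : W ≤ U) (i : G.fib U) :
    Sec A ((G.rs h).obj i) ≃ₐ[R] shSec ((onFib A U).obj i) h :=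
  AlgEquiv.ofAlgHom (sectionsMap (cmp A h i).hom (𝟙 W)) (sectionsMap (cmp A h i).inv (𝟙 W))
    (AlgHom.ext fun a => congrArg (fun t => sectionsMap t (𝟙 W) a) (cmp A h i).inv_hom_id)
    (AlgHom.ext fun a => congrArg (fun t => sectionsMap t (𝟙 W) a) (cmp A h i).hom_inv_id)

theorem toSh_secRes (h : W ≤ U) (i : G.fib U) (a : Sec A i) :
    toSh A h i (secRes A (homOfLE h) i a) = shRes ((onFib A U).obj i) h le_rfl a :=
  (toSh A h i).apply_symm_apply _

theorem toSh_secMap {hi : W ≤ U} {hj : W ≤ U'} {i : G.fib U} {j : G.fib U'}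
    (t : (G.rs hi).obj i ⟶ (G.rs hj).obj j) (a : Sec A ((G.rs hi).obj i)) :
    toSh A hj j (secMap A t a) = shMap (mapR A hi hj t) (toSh A hi i a) := by
  have e := (toSh A hi i).symm_apply_apply a
  exact congrArg (fun a => toSh A hj j (secMap A t a)) e.symm

/-- The map `toSh` passes from `Γ(W, A(i|_W))`, in which twisted sheaves are formulated, to `Γ(W,
A(i))`, where restriction is strict. Writing the coherence isomorphism as a restriction of `rsId`
shows that the two restrictions correspond. -/
theorem toSh_rsComp (h : W' ≤ W) (hi : W ≤ U) (i : G.fib U) (a : Sec A ((G.rs hi).obj i)) :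
    toSh A (h.trans hi) i (secMap A (G.rsComp h hi i).inv (secRes A (homOfLE h) _ a)) =
      shRes ((onFib A U).obj i) h hi (toSh A hi i a) := by
  rw [← rr_rsId_hom]
  refine (toSh_secMap A (hi := h) (hj := h.trans hi) (rr h (G.rsId _).hom) _).trans ?_
  rw [toSh_secRes]
  rw [mapR_rr A le_rfl hi h]
  refine (shMap_rr (hi := le_rfl) (hj := hi) h (mapR A le_rfl hi (G.rsId _).hom) a).trans ?_
  rw [mapR_rsId]
  have e := sectionsMap_rsId_hom (𝒜 := (onFib A W).obj ((G.rs hi).obj i)) a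
  exact congrArg (fun a => shRes _ h hi (toSh A hi i a)) e

namespace TwistedSheaf

variable (T : TwistedSheaf R X)

/-- A morphism of the gauge gerbe as an isomorphism. -/
noncomputable def iso {i j : T.gauge.fib U} (g : i ⟶ j) : i ≅ j :=
  @asIso _ _ _ _ g (T.isGroupoidal U i j g)

theorem iso_hom {i j : T.gauge.fib U} (g : i ⟶ j) : (T.iso g).hom = g := rfl

/-- The conjugation formula for the action on global sections, with the inverse moved to the other
side. -/
theorem secMap_mul_cp {i : T.gauge.fib U} (g : Aut i) (a : Sec T.rep i) :
    secMap T.rep g.hom a * (T.cp i g : Sec T.rep i) = (T.cp i g : Sec T.rep i) * a := by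
  have key (a : Sec T.rep i) : sectionsRes ((onFib T.rep U).obj i) (𝟙 U) a = a :=
    shRes_rfl (hi := le_refl U) a
  have e := T.rep_aut (𝟙 U) i g a
  rw [key, key] at e
  rw [e, mul_assoc, Units.inv_mul, mul_one]

/-- The coupling as a function on endomorphisms. -/
noncomputable def cpEnd {i : T.gauge.fib U} (g : i ⟶ i) : Sec T.rep i := T.cp i (T.iso g)

theorem cpEnd_hom {i : T.gauge.fib U} (g : Aut i) : T.cpEnd g.hom = T.cp i g :=
  congrArg (fun g => (T.cp i g : Sec T.rep i)) (Iso.ext rfl)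

theorem secMap_mul_cpEnd {i : T.gauge.fib U} (g : i ⟶ i) (a : Sec T.rep i) :
    secMap T.rep g a * T.cpEnd g = T.cpEnd g * a :=
  T.secMap_mul_cp (T.iso g) a

theorem cpEnd_id (i : T.gauge.fib U) : T.cpEnd (𝟙 i) = 1 := by
  rw [← Units.val_one, ← map_one (T.cp i)]
  exact T.cpEnd_hom (1 : Aut i)

theorem cpEnd_comp {i : T.gauge.fib U} (g h : i ⟶ i) :
    T.cpEnd (g ≫ h) = T.cpEnd h * T.cpEnd g := by
  let g' : Aut i := T.iso g
  let h' : Aut i := T.iso h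
  exact (T.cpEnd_hom (h' * g')).trans (congrArg Units.val (map_mul (T.cp i) h' g'))

theorem cpEnd_conj {i j : T.gauge.fib U} (h : i ⟶ j) (g : i ⟶ i) (g' : j ⟶ j)
    (e : g ≫ h = h ≫ g') : T.cpEnd g' = secMap T.rep h (T.cpEnd g) := by
  have := T.cp_conj i j (T.iso h) (T.iso g)
  refine Eq.trans (congrArg T.cpEnd ?_) ((T.cpEnd_hom
    ((T.iso h).symm ≪≫ T.iso g ≪≫ T.iso h : Aut j)).trans this)
  change _ = (T.iso h).inv ≫ g ≫ h
  rw [e, Iso.eq_inv_comp]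
  rfl

theorem cpEnd_res (h : W ≤ U) {i : T.gauge.fib U} (g : i ⟶ i) :
    T.cpEnd ((T.gauge.rs h).map g) = secRes T.rep (homOfLE h) i (T.cpEnd g) := by
  refine Eq.trans ?_ (T.cp_res (homOfLE h) i (T.iso g))
  exact T.cpEnd_hom ((T.gauge.rs h).mapIso (T.iso g))

theorem toSh_cpEnd_rr (h : W' ≤ W) {hi : W ≤ U} {i : T.gauge.fib U}
    (g : (T.gauge.rs hi).obj i ⟶ (T.gauge.rs hi).obj i) :
    toSh T.rep (h.trans hi) i (T.cpEnd (rr h g)) =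
      shRes ((onFib T.rep U).obj i) h hi (toSh T.rep hi i (T.cpEnd g)) := by
  rw [← toSh_rsComp, ← cpEnd_res]
  refine congrArg _ (T.cpEnd_conj _ _ _ ?_)
  simp [rr]

theorem shMap_mul_toSh_cpEnd {hi : W ≤ U} {i : T.gauge.fib U}
    (g : (T.gauge.rs hi).obj i ⟶ (T.gauge.rs hi).obj i) (a : Sec T.rep ((T.gauge.rs hi).obj i)) :
    shMap (mapR T.rep hi hi g) (toSh T.rep hi i a) * toSh T.rep hi i (T.cpEnd g) =
      toSh T.rep hi i (T.cpEnd g) * toSh T.rep hi i a := by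
  rw [← toSh_secMap, ← map_mul, ← map_mul, secMap_mul_cpEnd]

/-- The twisted system of a twisted sheaf. -/
noncomputable def twSys : TwSys R X where
  toSys := T.gauge.sys
  isIso {W i j} g := by
    obtain ⟨g', h, h'⟩ := (T.isGroupoidal W _ _ g).out
    exact ⟨g', h, h'⟩
  Γ i := shSec ((onFib T.rep _).obj i.1.2) i.2
  act {W i j} g := shMap (hi := i.2) (hj := j.2) (mapR T.rep i.2 j.2 g)
  act_id i a := congrArg (fun t => shMap (hi := i.2) (hj := i.2) t a) (mapR_id T.rep i.2 i.1.2)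
  act_comp {W i j k} g h a := congrArg (fun t => shMap (hi := i.2) (hj := k.2) t a)
    (mapR_comp T.rep i.2 j.2 k.2 g h)
  resΓ h i := shRes ((onFib T.rep _).obj i.1.2) h i.2
  resΓ_rfl i a := shRes_rfl (hi := i.2) a
  resΓ_resΓ h' h i a := shRes_shRes (hi := i.2) h' h a
  act_res {W' W} h {i j} g a := (congrArg (fun t => shMap (hi := h.trans i.2) (hj := h.trans j.2) t
    (shRes ((onFib T.rep _).obj i.1.2) h i.2 a)) (mapR_rr T.rep i.2 j.2 h g)).trans
      (shMap_rr (hi := i.2) (hj := j.2) h _ a)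
  cp {W i} g := toSh T.rep i.2 i.1.2 (T.cpEnd g)
  cp_id i := (congrArg _ (T.cpEnd_id _)).trans (map_one (toSh T.rep i.2 i.1.2))
  cp_comp {W i} g h := (congrArg _ (T.cpEnd_comp _ _)).trans (map_mul (toSh T.rep i.2 i.1.2) _ _)
  cp_res {W' W} h {i} g := T.toSh_cpEnd_rr h (hi := i.2) (i := i.1.2) g
  cp_conj {W i j} h g g' e := (congrArg _ (T.cpEnd_conj (i := (T.gauge.rs i.2).obj i.1.2)
    (j := (T.gauge.rs j.2).obj j.1.2) h g g' e)).trans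
      (toSh_secMap T.rep (hi := i.2) (hj := j.2) h _)
  act_aut {W i} g a := by
    obtain ⟨a, rfl⟩ := (toSh T.rep i.2 i.1.2).surjective a
    exact T.shMap_mul_toSh_cpEnd (hi := i.2) (i := i.1.2) g a

theorem twSys_isTwisted : T.twSys.IsTwisted where
  small := by
    have := fun U => T.isSmall U
    exact inferInstanceAs (Small.{u} (Σ U : Opens X, T.gauge.fib U))
  nonempty x := by
    obtain ⟨U, hx, ⟨i⟩⟩ := T.locallyNonempty x
    exact ⟨⟨U, i⟩, hx⟩
  connected {W} i j x hx := by
    obtain ⟨V, f, hxV, ⟨e⟩⟩ := T.locallyConnected W ((T.gauge.rs i.2).obj i.1.2)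
      ((T.gauge.rs j.2).obj j.1.2) x hx
    let t : (T.gauge.rs (f.le.trans i.2)).obj i.1.2 ⟶ (T.gauge.rs (f.le.trans j.2)).obj j.1.2 :=
      (T.gauge.rsComp f.le i.2 i.1.2).hom ≫ e.hom ≫ (T.gauge.rsComp f.le j.2 j.1.2).inv
    exact ⟨V, f.le, hxV, ⟨t⟩⟩

end TwistedSheaf

end

/-! ### Representations of twisted sheaves in stacks of algebroids -/

section

variable {R S : Type u} [CommRing R] [CommRing S] [Algebra R S] {X : Type u} [TopologicalSpace X]

namespace TwistedSheaf

/-- A representation of a twisted sheaf of algebras in a stack of algebroids. -/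
structure Rep (T : TwistedSheaf R X) (B : AlgebroidStack S X) where
  /-- The functor. -/
  E : T.gauge ⟶ B.stack
  /-- The action of the algebras. -/
  ε : ∀ {U : Opens X} (i : T.gauge.fib U), Sec T.rep i →ₛₗ[algebraMap R S]
    ((onFib E U).obj i ⟶ (onFib E U).obj i)
  one : ∀ {U : Opens X} (i : T.gauge.fib U), ε i 1 = 𝟙 _
  mul : ∀ {U : Opens X} (i : T.gauge.fib U) (a b : Sec T.rep i), ε i (a * b) = ε i b ≫ ε i a
  res : ∀ {V U : Opens X} (f : V ⟶ U) (i : T.gauge.fib U) (a : Sec T.rep i),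
    ε _ (secRes T.rep f i a) = resHom E f (ε i a)
  act : ∀ {U : Opens X} {i j : T.gauge.fib U} (h : i ⟶ j) (a : Sec T.rep i),
    (onFib E U).map h ≫ ε j (secMap T.rep h a) = ε i a ≫ (onFib E U).map h
  cp : ∀ {U : Opens X} (i : T.gauge.fib U) (g : Aut i),
    ε i (T.cp i g : Sec T.rep i) = (onFib E U).map g.hom

namespace Rep

variable {T : TwistedSheaf R X} {B : AlgebroidStack S X} (E : Rep T B) {W' W U U' : Opens X}

theorem ε_secMap_inv {i j : T.gauge.fib U} (c : i ≅ j) (a : Sec T.rep j) :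
    E.ε i (secMap T.rep c.inv a) =
      (onFib E.E U).map c.hom ≫ E.ε j a ≫ (onFib E.E U).map c.inv := by
  rw [← E.act, ← Functor.map_comp_assoc, Iso.hom_inv_id, CategoryTheory.Functor.map_id, Category.id_comp]

/-- The action of the sections. -/
noncomputable def εR (h : W ≤ U) (i : T.gauge.fib U) :
    shSec ((onFib T.rep U).obj i) h →ₛₗ[algebraMap R S]
      ((B.stack.rs h).obj ((onFib E.E U).obj i) ⟶ (B.stack.rs h).obj ((onFib E.E U).obj i)) :=
  (conjL (S := S) (cmp E.E h i).symm (cmp E.E h i)).toLinearMap.comp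
    ((E.ε ((T.gauge.rs h).obj i)).comp (toSh T.rep h i).symm.toLinearMap)

theorem εR_toSh (h : W ≤ U) (i : T.gauge.fib U) (a : Sec T.rep ((T.gauge.rs h).obj i)) :
    E.εR h i (toSh T.rep h i a) =
      (cmp E.E h i).inv ≫ E.ε ((T.gauge.rs h).obj i) a ≫ (cmp E.E h i).hom :=
  congrArg (fun a => (cmp E.E h i).inv ≫ E.ε ((T.gauge.rs h).obj i) a ≫ (cmp E.E h i).hom)
    ((toSh T.rep h i).symm_apply_apply a)

theorem εR_one (h : W ≤ U) (i : T.gauge.fib U) : E.εR h i 1 = 𝟙 _ := by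
  rw [← map_one (toSh T.rep h i), εR_toSh, E.one, Category.id_comp, Iso.inv_hom_id]

theorem εR_mul (h : W ≤ U) (i : T.gauge.fib U) (a b : shSec ((onFib T.rep U).obj i) h) :
    E.εR h i (a * b) = E.εR h i b ≫ E.εR h i a := by
  obtain ⟨a, rfl⟩ := (toSh T.rep h i).surjective a
  obtain ⟨b, rfl⟩ := (toSh T.rep h i).surjective b
  rw [← map_mul, εR_toSh, εR_toSh, εR_toSh, E.mul]
  simp

theorem εR_res (h : W' ≤ W) (hi : W ≤ U) (i : T.gauge.fib U)
    (a : shSec ((onFib T.rep U).obj i) hi) :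
    E.εR (h.trans hi) i (shRes _ h hi a) = rr h (E.εR hi i a) := by
  obtain ⟨a, rfl⟩ := (toSh T.rep hi i).surjective a
  rw [← toSh_rsComp, εR_toSh, εR_toSh, ← rr_eq_conj_resHom, ε_secMap_inv, E.res]

theorem εR_act {hi : W ≤ U} {hj : W ≤ U'} {i : T.gauge.fib U} {j : T.gauge.fib U'}
    (g : (T.gauge.rs hi).obj i ⟶ (T.gauge.rs hj).obj j) (a : shSec ((onFib T.rep U).obj i) hi) :
    mapR E.E hi hj g ≫ E.εR hj j (shMap (mapR T.rep hi hj g) a) =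
      E.εR hi i a ≫ mapR E.E hi hj g := by
  obtain ⟨a, rfl⟩ := (toSh T.rep hi i).surjective a
  rw [← toSh_secMap, εR_toSh, εR_toSh, mapR]
  have := E.act g a
  simp only [Category.assoc, Iso.hom_inv_id_assoc]
  rw [reassoc_of% this]

theorem εR_cp {hi : W ≤ U} {i : T.gauge.fib U} (g : (T.gauge.rs hi).obj i ⟶ (T.gauge.rs hi).obj i) :
    E.εR hi i (toSh T.rep hi i (T.cpEnd g)) = mapR E.E hi hi g := by
  rw [εR_toSh, mapR]
  exact congrArg (fun t => (cmp E.E hi i).inv ≫ t ≫ (cmp E.E hi i).hom) (E.cp _ (T.iso g))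

/-- The representation of the twisted system. -/
noncomputable def toTwRep : TwRep T.twSys B where
  F := SysHom.ofTrans E.E
  ε i := E.εR i.2 i.1.2
  one i := E.εR_one i.2 i.1.2
  mul i a b := E.εR_mul i.2 i.1.2 a b
  res h i a := E.εR_res h i.2 i.1.2 a
  act {_ i j} g a := E.εR_act (hi := i.2) (hj := j.2) (i := i.1.2) (j := j.1.2) g a
  cp {_ i} g := E.εR_cp (hi := i.2) (i := i.1.2) g

/-- A representation which makes the stack of algebroids the extension of scalars of the twisted
sheaf. -/
structure IsExt : Prop where
  ess : LocallyEssSurj E.E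
  inj : ∀ {U : Opens X} (i : T.gauge.fib U) (t : S ⊗[R] Sec T.rep i), extendScalars (E.ε i) t = 0 →
    ∀ x ∈ U, ∃ (V : Opens X) (f : V ⟶ U), x ∈ V ∧ (secRes T.rep f i).toLinearMap.lTensor S t = 0
  surj : ∀ {U : Opens X} (i : T.gauge.fib U) (s : (onFib E.E U).obj i ⟶ (onFib E.E U).obj i),
    ∀ x ∈ U, ∃ (V : Opens X) (f : V ⟶ U), x ∈ V ∧
      ∃ t : S ⊗[R] Sec T.rep ((T.gauge.res f).obj i), extendScalars (E.ε _) t = resHom E.E f s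

/-- The comparison between sections over `W'`. -/
noncomputable def shComp (T : TwistedSheaf R X) (h : W' ≤ W) (hi : W ≤ U) (i : T.gauge.fib U) :
    Sec T.rep ((T.gauge.rs h).obj ((T.gauge.rs hi).obj i)) →ₗ[R]
      shSec ((onFib T.rep U).obj i) (h.trans hi) :=
  (toSh T.rep (h.trans hi) i).toLinearMap.comp
    (secMap T.rep (T.gauge.rsComp h hi i).inv).toLinearMap

theorem shComp_secRes (h : W' ≤ W) (hi : W ≤ U) (i : T.gauge.fib U)
    (a : shSec ((onFib T.rep U).obj i) hi) :
    shRes _ h hi a = shComp T h hi i (secRes T.rep (homOfLE h) _ ((toSh T.rep hi i).symm a)) := by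
  obtain ⟨a, rfl⟩ := (toSh T.rep hi i).surjective a
  rw [AlgEquiv.symm_apply_apply]
  exact (toSh_rsComp _ _ _ _ _).symm

theorem extendScalars_shComp (h : W' ≤ W) (hi : W ≤ U) (i : T.gauge.fib U)
    (t : S ⊗[R] Sec T.rep ((T.gauge.rs h).obj ((T.gauge.rs hi).obj i))) :
    extendScalars (E.εR (h.trans hi) i) ((shComp T h hi i).lTensor S t) =
      (cmp E.E (h.trans hi) i).inv ≫ ((onFib E.E W').map (T.gauge.rsComp h hi i).hom ≫
        extendScalars (E.ε _) t ≫ (onFib E.E W').map (T.gauge.rsComp h hi i).inv) ≫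
          (cmp E.E (h.trans hi) i).hom :=
  extendScalars_lTensor (E.ε _) _ _ ((conjL (S := S) (cmp E.E (h.trans hi) i).symm
    (cmp E.E (h.trans hi) i)).toLinearMap.comp (conjL (S := S)
      ((onFib E.E W').mapIso (T.gauge.rsComp h hi i))
      ((onFib E.E W').mapIso (T.gauge.rsComp h hi i).symm)).toLinearMap)
    (fun a => (E.εR_toSh _ _ _).trans
      (congrArg (fun t => (cmp E.E (h.trans hi) i).inv ≫ t ≫ (cmp E.E (h.trans hi) i).hom)
        (E.ε_secMap_inv (T.gauge.rsComp h hi i) a))) t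

-- The conditions on a representation concern sections over the whole domain of an object, whereas
-- the twisted system has sections of `A(i)` over all `W ≤ U`. They are applied to `i|_W` and
-- carried over by `toSh` and `shComp`.
variable {E} in
theorem IsExt.toTwRep (hE : E.IsExt) : E.toTwRep.IsExt where
  ess := AlgebroidStack.locEssSurj_ofTrans hE.ess
  inj {W} := by
    suffices H : ∀ {U : Opens X} (hi : W ≤ U) (i : T.gauge.fib U)
        (t : S ⊗[R] shSec ((onFib T.rep U).obj i) hi), extendScalars (E.εR hi i) t = 0 →
        ∀ x ∈ W, ∃ (V : Opens X) (h : V ≤ W), x ∈ V ∧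
          (shRes ((onFib T.rep U).obj i) h hi).toLinearMap.lTensor S t = 0 from
      fun i t => H i.2 i.1.2 t
    intro U hi i t ht x hx
    have e := extendScalars_lTensor (E.εR hi i) (E.ε _) (toSh T.rep hi i).symm.toLinearMap
      (conjL (S := S) (cmp E.E hi i) (cmp E.E hi i).symm).toLinearMap
      (fun a => by simp [εR]) t
    rw [ht, map_zero] at e
    obtain ⟨V, f, hxV, e'⟩ := hE.inj _ _ e x hx
    refine ⟨V, f.le, hxV, ?_⟩
    have e₁ : (shRes ((onFib T.rep U).obj i) f.le hi).toLinearMap =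
        ((shComp T f.le hi i).comp (secRes T.rep f ((T.gauge.rs hi).obj i)).toLinearMap).comp
          (toSh T.rep hi i).symm.toLinearMap :=
      LinearMap.ext fun a => shComp_secRes f.le hi i a
    rw [e₁, LinearMap.lTensor_comp_apply]
    exact (LinearMap.lTensor_comp_apply S (shComp T f.le hi i) (secRes T.rep f _).toLinearMap
      _).trans ((congrArg _ e').trans (map_zero _))
  surj {W} := by
    suffices H : ∀ {U : Opens X} (hi : W ≤ U) (i : T.gauge.fib U)
        (s : (B.stack.rs hi).obj ((onFib E.E U).obj i) ⟶
          (B.stack.rs hi).obj ((onFib E.E U).obj i)), ∀ x ∈ W, ∃ (V : Opens X) (h : V ≤ W), x ∈ V ∧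
        ∃ t : S ⊗[R] shSec ((onFib T.rep U).obj i) (h.trans hi),
          extendScalars (E.εR (h.trans hi) i) t = rr h s from fun i s => H i.2 i.1.2 s
    intro U hi i s x hx
    obtain ⟨V, f, hxV, t, ht⟩ := hE.surj ((T.gauge.rs hi).obj i)
      ((cmp E.E hi i).hom ≫ s ≫ (cmp E.E hi i).inv) x hx
    refine ⟨V, f.le, hxV, (shComp T f.le hi i).lTensor S t, ?_⟩
    refine (E.extendScalars_shComp f.le hi i t).trans ?_
    refine (congrArg (fun s => (cmp E.E (f.le.trans hi) i).inv ≫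
      ((onFib E.E V).map (T.gauge.rsComp f.le hi i).hom ≫ s ≫
        (onFib E.E V).map (T.gauge.rsComp f.le hi i).inv) ≫
          (cmp E.E (f.le.trans hi) i).hom) ht).trans ?_
    refine (rr_eq_conj_resHom E.E f.le hi hi i i _).trans (congrArg (rr f.le) ?_)
    exact conj_cancel _ _ _

end Rep

end TwistedSheaf

end

/-! ### The representation of a twisted sheaf in its stack of algebroids -/

section

variable {R S : Type u} [CommRing R] [CommRing S] [Algebra R S] {X : Type u} [TopologicalSpace X]

theorem resHom_comp_eq {G G' H : Prestack X} (F : G ⟶ G') (F' : G' ⟶ H) {V U : Opens X} (f : V ⟶ U)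
    {i j : G.fib U} (s : (onFib F' U).obj ((onFib F U).obj i) ⟶ (onFib F' U).obj ((onFib F U).obj j)) :
    resHom (F ≫ F') f (i := i) (j := j) s = (onFib F' V).map (comparison F f i).hom ≫
      resHom F' f s ≫ (onFib F' V).map (comparison F f j).inv := by
  refine (congrArg₂ (fun a b => a ≫ (H.res f).map s ≫ b) (cmp_comp_hom F F' f.le i)
    (cmp_comp_inv F F' f.le j)).trans ?_
  exact (Category.assoc _ _ _).trans (congrArg _ ((congrArg _ (Category.assoc _ _ _).symm).trans
    (Category.assoc _ _ _).symm))

theorem secMap_id {G : Prestack X} (A : G ⟶ assocStack R X) {U : Opens X} (i : G.fib U)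
    (a : Sec A i) : secMap A (𝟙 i) a = a :=
  congrArg (fun t => sectionsMap t (𝟙 U) a) ((onFib A U).map_id i)

theorem secMap_comp {G : Prestack X} (A : G ⟶ assocStack R X) {U : Opens X} {i j k : G.fib U}
    (g : i ⟶ j) (h : j ⟶ k) (a : Sec A i) : secMap A (g ≫ h) a = secMap A h (secMap A g a) :=
  congrArg (fun t => sectionsMap t (𝟙 U) a) ((onFib A U).map_comp g h)

theorem secMap_hom_inv {G : Prestack X} (A : G ⟶ assocStack R X) {U : Opens X} {i j : G.fib U}
    (e : i ≅ j) (a : Sec A i) : secMap A e.inv (secMap A e.hom a) = a := by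
  rw [← secMap_comp, e.hom_inv_id, secMap_id]

namespace TwistedSheaf

/-- A representation which identifies a twisted sheaf with the one of the stack of algebroids. -/
structure Rep.IsUniversal {T : TwistedSheaf R X} {B : AlgebroidStack R X} (E : Rep T B) : Prop where
  inj : ∀ {U : Opens X} {i j : T.gauge.fib U},
    Function.Injective (fun g : i ⟶ j => (onFib E.E U).map g)
  lift : ∀ {U : Opens X} {i j : T.gauge.fib U} (e : (onFib E.E U).obj i ≅ (onFib E.E U).obj j),
    ∃ g : i ⟶ j, (onFib E.E U).map g = e.hom
  ess : ∀ {U : Opens X} (j : B.stack.fib U), ∃ i : T.gauge.fib U, Nonempty ((onFib E.E U).obj i ≅ j)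
  bij : ∀ {U : Opens X} (i : T.gauge.fib U), Function.Bijective (E.ε i)

/-- The linear map underlying an isomorphism with an algebra of endomorphisms. -/
noncomputable def endL {D : Type*} [Category D] [Preadditive D] [Linear R D] {A : Type*} [Ring A] [Algebra R A]
    {i : D} (e : A ≃ₐ[R] End i) : A →ₗ[R] (i ⟶ i) where
  toFun a := e a
  map_add' := map_add e
  map_smul' := map_smul e

/-- The isomorphisms with endomorphism algebras become bijective linear maps, so that universal
representations and extensions of scalars are instances of the same structure `Rep`. -/
theorem isTwistedSheafOf_iff {T : TwistedSheaf R X} {B : AlgebroidStack R X} :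
    T.IsTwistedSheafOf B ↔ ∃ E : Rep T B, E.IsUniversal := by
  refine ⟨?_, ?_⟩
  · rintro ⟨E, ε, h₁, h₂, h₃, h₄, h₅⟩
    exact ⟨⟨E, fun i => endL (ε _ i), fun i => map_one (ε _ i), fun i => map_mul (ε _ i), h₃ _ _,
      h₄ _ _ _, h₅ _⟩, ⟨fun {U i j} => (h₁ U i j).1, fun {U i j} => (h₁ U i j).2, h₂ _,
      fun i => (ε _ i).bijective⟩⟩
  · rintro ⟨E, h⟩
    refine ⟨E.E, fun U i => AlgEquiv.ofBijective (AlgHom.ofLinearMap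
      ({ toFun a := E.ε i a, map_add' := map_add _, map_smul' := map_smulₛₗ (E.ε i) } :
        Sec T.rep i →ₗ[R] End ((onFib E.E U).obj i)) (E.one i) (E.mul i)) (h.bij i),
      fun U i j => ⟨h.inj, h.lift⟩, fun U => h.ess, fun V U => E.res, fun U i j => E.act, fun U => E.cp⟩

namespace Rep

variable {T : TwistedSheaf R X}

theorem extendScalars_one_tmul {M N : Type u} [AddCommGroup M] [Module R M]
    [AddCommGroup N] [Module S N] (φ : M →ₛₗ[algebraMap R S] N) (m : M) :
    extendScalars φ ((1 : S) ⊗ₜ m) = φ m := one_smul S _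

theorem ε_comparison {B : AlgebroidStack S X} (E : Rep T B) {G : Prestack X} (F : G ⟶ T.gauge)
    {V U : Opens X} (f : V ⟶ U) (i : G.fib U) (b : Sec T.rep ((onFib F U).obj i)) :
    E.ε ((onFib F V).obj ((G.res f).obj i)) (secMap T.rep (comparison F f i).inv
      (secRes T.rep f ((onFib F U).obj i) b)) =
        resHom (F ≫ E.E) f (i := i) (j := i) (E.ε ((onFib F U).obj i) b) := by
  refine (E.ε_secMap_inv (comparison F f i) _).trans ?_
  rw [E.res]
  exact (resHom_comp_eq F E.E f _).symm

/-- The linear map of a representation. -/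
noncomputable def toLin {B : AlgebroidStack R X} (E : Rep T B) {U : Opens X} (i : T.gauge.fib U) :
    Sec T.rep i →ₗ[R] ((onFib E.E U).obj i ⟶ (onFib E.E U).obj i) where
  toFun := E.ε i
  map_add' := map_add _
  map_smul' := map_smulₛₗ (E.ε i)

theorem IsUniversal.isExt {B : AlgebroidStack R X} {E : Rep T B} (h : E.IsUniversal) :
    E.IsExt where
  ess U j x hx := by
    obtain ⟨i, ⟨e⟩⟩ := h.ess j
    exact ⟨U, 𝟙 U, i, hx, ⟨e ≪≫ (B.stack.rsId j).symm⟩⟩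
  inj {U} i t ht x hx := by
    obtain ⟨a, rfl⟩ := (bijective_one_tmul (R := R) (S := R) (Sec T.rep i) Function.bijective_id).2 t
    have : a = 0 := (h.bij i).1
      (((extendScalars_one_tmul (S := R) (E.ε i) a).symm.trans ht).trans (map_zero _).symm)
    subst this
    exact ⟨U, 𝟙 U, hx, by simp⟩
  surj {U} i s x hx := by
    obtain ⟨a, ha⟩ := (h.bij ((T.gauge.res (𝟙 U)).obj i)).2 (resHom E.E (𝟙 U) s)
    exact ⟨U, 𝟙 U, hx, (1 : R) ⊗ₜ a, (extendScalars_one_tmul (S := R) (E.ε _) a).trans ha⟩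

end Rep

/-- Near any point some object lies in the image, and in the target it is locally isomorphic to the
given one. -/
theorem locallyEssSurj_of_connected {G H : Prestack X} (F : G ⟶ H) (hG : G.LocallyNonempty)
    (hH : H.LocallyConnected) : LocallyEssSurj F := by
  intro U j x hx
  obtain ⟨V, hxV, ⟨i⟩⟩ := hG x
  obtain ⟨W, f, hxW, ⟨e⟩⟩ := hH (V ⊓ U) ((onFib F _).obj ((G.rs inf_le_left).obj i))
    ((H.rs inf_le_right).obj j) x ⟨hxV, hx⟩
  exact ⟨W, f ≫ homOfLE inf_le_right, (G.rs f.le).obj ((G.rs inf_le_left).obj i), hxW,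
    ⟨cmp F f.le _ ≪≫ e ≪≫ (H.rsComp f.le inf_le_right j).symm⟩⟩

/-- The homomorphisms `ρ` followed by the universal representation of `T'` form a representation of
`T`. Since the latter is bijective on algebras, the tensor conditions for `ρ` become those of
`IsExt`. -/
theorem IsInduced.exists_rep {T : TwistedSheaf R X} {T' : TwistedSheaf S X} (h : T.IsInduced T')
    {B : AlgebroidStack S X} {E : Rep T' B} (hE : E.IsUniversal) :
    ∃ E' : Rep T B, E'.IsExt := by
  obtain ⟨F, ρ, ρ_smul, hres, hact, hcp, hinj, hsurj⟩ := h
  let ρL {U : Opens X} (i : T.gauge.fib U) :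
      Sec T.rep i →ₛₗ[algebraMap R S] Sec T'.rep ((onFib F U).obj i) :=
    ⟨(ρ U i).toAddMonoidHom.toAddHom, ρ_smul U i⟩
  have hρ {V U : Opens X} (f : V ⟶ U) (i : T.gauge.fib U) (a : Sec T.rep i) :
      ρ V _ (secRes T.rep f i a) = secMap T'.rep (comparison F f i).inv
        (secRes T'.rep f ((onFib F U).obj i) (ρ U i a)) := by
    exact (secMap_hom_inv T'.rep (comparison F f i) _).symm.trans
      (congrArg (secMap T'.rep (comparison F f i).inv) (hres V U f i a))
  let E' : Rep T B :=
    { E := F ≫ E.E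
      ε i := (E.toLin ((onFib F _).obj i)).comp (ρL i)
      one i := (congrArg _ (map_one (ρ _ i))).trans (E.one _)
      mul i a b := (congrArg _ (map_mul (ρ _ i) a b)).trans (E.mul _ _ _)
      res f i a := (congrArg (E.ε _) (hρ f i a)).trans (E.ε_comparison F f i (ρ _ i a))
      act h a := (congrArg (fun t => (onFib E.E _).map ((onFib F _).map h) ≫ E.ε _ t)
        (hact _ _ _ h a)).trans (E.act _ _)
      cp i g := (congrArg (E.ε _) (hcp _ i g).symm).trans (E.cp _ ((onFib F _).mapIso g)) }
  have hE' {U : Opens X} (i : T.gauge.fib U) (t : S ⊗[R] Sec T.rep i) :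
      extendScalars (E'.ε i) t = E.ε _ (extendScalars (ρL i) t) :=
    extendScalars_congr (ρL i) (E'.ε i) (E.toLin _) (fun _ => rfl) t
  refine ⟨E', locallyEssSurj_of_connected _ T.locallyNonempty B.locallyConnected,
    fun {U} i t ht => ?_, fun {U} i s x hx => ?_⟩
  · exact hinj U i t ((hE.bij _).1 ((hE' i t).symm.trans (ht.trans (map_zero _).symm)))
  · obtain ⟨b, rfl⟩ := (hE.bij _).2 s
    obtain ⟨V, f, hxV, t, ht⟩ := hsurj U i b x hx
    refine ⟨V, f, hxV, t, (hE' _ t).trans ?_⟩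
    exact (congrArg (E.ε _) ((secMap_hom_inv T'.rep (comparison F f i) _).symm.trans
      (congrArg (secMap T'.rep (comparison F f i).inv) ht))).trans (E.ε_comparison F f i b)

end TwistedSheaf

end

/-! ### A criterion for universality -/

section

variable {R S : Type u} [CommRing R] [CommRing S] [Algebra R S] {X : Type u} [TopologicalSpace X]

theorem rs_rfl_map_injective {G : Prestack X} {U : Opens X} {i j : G.fib U} {s t : i ⟶ j}
    (h : (G.rs le_rfl).map s = (G.rs le_rfl).map t) : s = t := by
  rw [← cancel_epi (G.rsId _).hom, ← rsId_naturality, h, rsId_naturality]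

theorem exists_rs_rfl_map_eq {G : Prestack X} {U : Opens X} {i j : G.fib U}
    (t : (G.rs le_rfl).obj i ⟶ (G.rs le_rfl).obj j) : ∃ s : i ⟶ j, (G.rs le_rfl).map s = t := by
  refine ⟨(G.rsId _).inv ≫ t ≫ (G.rsId _).hom, ?_⟩
  rw [← cancel_mono (G.rsId _).hom, rsId_naturality, Iso.hom_inv_id_assoc]

/-- Local preimages are unique because `E` is faithful, so they agree on overlaps and glue. -/
theorem exists_map_eq_of_locally {G H : Prestack X} {E : G ⟶ H} (hG : G.IsStack) (hH : H.IsStack)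
    (inj : ∀ {U : Opens X} {i j : G.fib U} {s t : i ⟶ j},
      (onFib E U).map s = (onFib E U).map t → s = t) {U : Opens X} {i j : G.fib U}
    (e : (onFib E U).obj i ⟶ (onFib E U).obj j)
    (h : ∀ x ∈ U, ∃ (V : Opens X) (hV : V ≤ U), x ∈ V ∧
      ∃ s : (G.rs hV).obj i ⟶ (G.rs hV).obj j, mapR E hV hV s = (H.rs hV).map e) :
    ∃ s : i ⟶ j, (onFib E U).map s = e := by
  choose V hV hxV s hs using fun x : U => h x.1 x.2
  have hc : ∀ x ∈ U, ∃ a : U, x ∈ V a := fun x hx => ⟨⟨x, hx⟩, hxV ⟨x, hx⟩⟩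
  obtain ⟨t, ht⟩ := exists_hom_glue hG (hi := le_rfl) (hj := le_rfl) V hV hc s
    (fun a b Y ha hb => mapR_injective inj _ _ (by
      rw [mapR_rr E (hV a) (hV a) ha, mapR_rr E (hV b) (hV b) hb, hs, hs, rr_map, rr_map]))
  obtain ⟨g, rfl⟩ := exists_rs_rfl_map_eq t
  refine ⟨g, rs_rfl_map_injective ?_⟩
  rw [← mapR_map]
  refine hom_ext_of_cover hH _ _ fun x hx => ⟨V ⟨x, hx⟩, hV _, hxV _, ?_⟩
  rw [← mapR_rr E le_rfl le_rfl (hV ⟨x, hx⟩), ht, hs, rr_map]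

namespace TwistedSheaf.Rep

variable {T : TwistedSheaf R X} {B : AlgebroidStack R X} {E : Rep T B}

/-- Two morphisms with the same image differ by an automorphism whose coupling is represented by the
identity. The coupling is then `1`, and it determines the automorphism. -/
theorem injective_map (h : ∀ {U : Opens X} (i : T.gauge.fib U), Function.Injective (E.ε i))
    {U : Opens X} {i j : T.gauge.fib U} {s t : i ⟶ j}
    (e : (onFib E.E U).map s = (onFib E.E U).map t) : s = t := by
  let g : Aut i := T.iso s ≪≫ (T.iso t).symm
  have hg : (onFib E.E U).map g.hom = 𝟙 _ := by
    refine ((onFib E.E U).map_comp s (T.iso t).inv).trans ?_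
    rw [e, ← CategoryTheory.Functor.map_comp]
    exact (congrArg _ (T.iso t).hom_inv_id).trans ((onFib E.E U).map_id _)
  have hg' : T.cp i g = 1 := Units.ext (h i ((E.cp i g).trans (hg.trans (E.one i).symm)))
  have hg'' : g = 1 := (T.cp i).injective (hg'.trans (map_one (T.cp i)).symm)
  have : g.hom = 𝟙 i := congrArg Iso.hom hg''
  exact ((Iso.comp_inv_eq (T.iso t)).1 this).trans (Category.id_comp _)

/-- An automorphism of `E(i)` corresponds to an invertible section of the algebra, which is the
coupling of an automorphism of `i`. -/
theorem exists_aut (h : ∀ {U : Opens X} (i : T.gauge.fib U), Function.Bijective (E.ε i))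
    {U : Opens X} {i : T.gauge.fib U} (e : (onFib E.E U).obj i ≅ (onFib E.E U).obj i) :
    ∃ g : i ⟶ i, (onFib E.E U).map g = e.hom := by
  obtain ⟨a, ha⟩ := (h i).2 e.hom
  obtain ⟨b, hb⟩ := (h i).2 e.inv
  let c : (Sec T.rep i)ˣ := ⟨a, b, (h i).1 (by rw [E.mul, E.one, ha, hb, e.inv_hom_id]),
    (h i).1 (by rw [E.mul, E.one, ha, hb, e.hom_inv_id])⟩
  obtain ⟨g, hg⟩ := (T.cp i).surjective c
  exact ⟨g.hom, (E.cp i g).symm.trans ((congrArg (fun c : (Sec T.rep i)ˣ => E.ε i c) hg).trans ha)⟩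

/-- Only the algebras have to be compared. The coupling settles automorphisms; locally `i` and `j`
are isomorphic, so other isomorphisms reduce to automorphisms; descent then lifts isomorphisms
globally and yields essential surjectivity. -/
theorem isUniversal_of_bijective
    (h : ∀ {U : Opens X} (i : T.gauge.fib U), Function.Bijective (E.ε i)) : E.IsUniversal := by
  have inj : ∀ {U : Opens X} {i j : T.gauge.fib U} {s t : i ⟶ j},
      (onFib E.E U).map s = (onFib E.E U).map t → s = t := injective_map fun i => (h i).1
  have lift : ∀ {U : Opens X} {i j : T.gauge.fib U}
      (e : (onFib E.E U).obj i ≅ (onFib E.E U).obj j), ∃ s : i ⟶ j, (onFib E.E U).map s = e.hom := by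
    intro U i j e
    refine exists_map_eq_of_locally T.isStack B.isStack inj _ fun x hx => ?_
    obtain ⟨V, hV, hxV, ⟨k⟩⟩ : ∃ (V : Opens X) (hV : V ≤ U),
        x ∈ V ∧ Nonempty ((T.gauge.rs hV).obj i ≅ (T.gauge.rs hV).obj j) := by
      obtain ⟨V, f, hxV, hk⟩ := T.locallyConnected U i j x hx
      exact ⟨V, f.le, hxV, hk⟩
    -- Following `e|_V` by the inverse of the image of `k` gives an automorphism of `E(i|_V)`. If
    -- `g` lifts it, then `g ≫ k.hom` lifts `e|_V`.
    obtain ⟨g, hg⟩ := exists_aut h (cmp E.E hV i ≪≫ (B.stack.rs hV).mapIso e ≪≫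
      (cmp E.E hV j).symm ≪≫ ((onFib E.E V).mapIso k).symm)
    refine ⟨V, hV, hxV, g ≫ k.hom, ?_⟩
    rw [mapR, CategoryTheory.Functor.map_comp, hg]
    simp
  refine ⟨inj, lift, fun j => ?_, h⟩
  exact exists_iso_of_locallyEssSurj inj lift T.isStack B.isStack
    (locallyEssSurj_of_connected _ T.locallyNonempty B.locallyConnected) j

end TwistedSheaf.Rep

end

/-! ### The stack of algebroids of a twisted sheaf -/

section

variable {R S : Type u} [CommRing R] [CommRing S] [Algebra R S] {X : Type u} [TopologicalSpace X]

namespace TwSys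

variable (T : TwSys R X) (hT : T.IsTwisted)

theorem of_one_comp {W : Opens X} {i j : T.At W} (g : i ⟶ j) (b : T.Γ j) :
    comp (of g 1) (of (𝟙 j) (b)) = of g (T.act (inv g) b) := by
  rw [comp_of, mul_one, Category.comp_id]

theorem of_id_comp {W : Opens X} {i j : T.At W} (g : i ⟶ j) (a : T.Γ i) :
    comp (of (𝟙 i) a) (of g 1) = of g a := by
  rw [comp_of, map_one, one_mul, Category.id_comp]

/-- The functor from a twisted system to the associated stack. -/
noncomputable def toLocHom : SysHom T.toSys T.linSys.loc where
  obj i := T.linSys.toLoc.obj i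
  map {W i j} g := T.linSys.toLoc.map (ofL g 1)
  map_id i := T.linSys.toLoc.map_id (lat i)
  map_comp {W i j k} g h := by
    refine Eq.trans (congrArg T.linSys.toLoc.map ?_) (T.linSys.toLoc.map_comp (ofL g 1) (ofL h 1))
    refine Eq.trans ?_ (comp_of g h 1 1).symm
    rw [map_one (T.act _), mul_one]
    rfl
  map_res {W' W} h {i j} g := by
    refine Eq.trans (congrArg T.linSys.toLoc.map ?_) (T.linSys.toLoc.map_res h (ofL g 1))
    refine Eq.trans ?_ (resHom_of h g 1).symm
    rw [map_one (T.resΓ h i)]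
    rfl

/-- The representation of a twisted system in the associated stack. -/
noncomputable def toLocRep : TwRep T (T.linSys.algebroid hT.isAlgebroid) where
  F := T.toLocHom
  ε {W} i :=
    { toFun a := T.linSys.toLoc.map (ofL (𝟙 i) a)
      map_add' a b := (congrArg T.linSys.toLoc.map ((of (𝟙 i)).map_add a b)).trans
        (T.linSys.toLoc_map_add (i := lat i) (j := lat i) _ _)
      map_smul' r a := (congrArg T.linSys.toLoc.map ((of (𝟙 i)).map_smul r a)).trans
        (LinSys.Loc.hom_ext (C := T.linSys) fun z =>
          LinSys.germHom_smul (C := T.linSys) (i := lat i) (j := lat i) z.2 _ _) }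
  one {W} i := T.linSys.toLoc.map_id (lat i)
  mul {W} i a b := by
    refine Eq.trans (congrArg T.linSys.toLoc.map ?_)
      (T.linSys.toLoc.map_comp (ofL (𝟙 i) b) (ofL (𝟙 i) a))
    refine Eq.trans ?_ (comp_of (𝟙 i) (𝟙 i) b a).symm
    rw [IsIso.inv_id, T.act_id, Category.comp_id]
    rfl
  res {W' W} h i a := by
    refine Eq.trans (congrArg T.linSys.toLoc.map ?_) (T.linSys.toLoc.map_res h (ofL (𝟙 i) a))
    refine Eq.trans ?_ (resHom_of h (𝟙 i) a).symm
    rw [T.res_id]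
    rfl
  act {W i j} g a := by
    refine (T.linSys.toLoc.map_comp (ofL g 1) (ofL (𝟙 j) (T.act g a))).symm.trans (Eq.trans
      (congrArg T.linSys.toLoc.map ?_) (T.linSys.toLoc.map_comp (ofL (𝟙 i) a) (ofL g 1)))
    refine (T.of_one_comp g _).trans (Eq.trans ?_ (T.of_id_comp g a).symm)
    rw [← T.act_comp, IsIso.hom_inv_id, T.act_id]
  cp {W i} g := by
    refine congrArg T.linSys.toLoc.map ?_
    refine Eq.trans ?_ (of_eq_of g (𝟙 i) 1).symm
    rw [IsIso.inv_id, Category.comp_id, mul_one]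
    rfl

theorem exists_res_eq_of_toLocRep {W : Opens X} (i : T.At W) (a b : T.Γ i)
    (h : (T.toLocRep hT).ε i a = (T.toLocRep hT).ε i b) : ∀ x ∈ W, ∃ (V : Opens X) (hV : V ≤ W),
      x ∈ V ∧ T.resΓ hV i a = T.resΓ hV i b := by
  intro x hx
  obtain ⟨V, hV, hxV, e⟩ := T.linSys.toLoc_isLocEquiv.inj (i := lat i) (j := lat i) h x hx
  refine ⟨V, hV, hxV, ?_⟩
  have key (a : T.Γ i) : (resHom hV (of (𝟙 i) a)).1 (𝟙 _) = T.resΓ hV i a := by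
    rw [resHom_of, T.res_id, of_apply_self]
  exact (key a).symm.trans ((congrArg
    (fun φ : T.homSub (Sys.At.rs hV i) (Sys.At.rs hV i) => φ.1 (𝟙 _)) e).trans (key b))

theorem exists_toLocRep_eq {W : Opens X} (i : T.At W) (s : (T.linSys.loc.rs i.2).obj
    (T.toLocHom.obj i.1) ⟶ (T.linSys.loc.rs i.2).obj (T.toLocHom.obj i.1)) :
    ∀ x ∈ W, ∃ (V : Opens X) (hV : V ≤ W), x ∈ V ∧ ∃ a : T.Γ (Sys.At.rs hV i),
      (T.toLocRep hT).ε (Sys.At.rs hV i) a = rr hV s := by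
  intro x hx
  obtain ⟨V, hV, hxV, t, ht⟩ := T.linSys.toLoc_isLocEquiv.surj (i := lat i) (j := lat i) s x hx
  let φ : T.homSub (Sys.At.rs hV i) (Sys.At.rs hV i) := t
  exact ⟨V, hV, hxV, φ.1 (𝟙 _), (congrArg T.linSys.toLoc.map (of_self φ (𝟙 _))).trans ht⟩

end TwSys

/-! ### Representations of the twisted system as representations of the twisted sheaf -/

namespace TwRep

variable {T : TwistedSheaf R X} {B : AlgebroidStack S X} (E : TwRep T.twSys B)

/-- An object over `U`, as an object of the twisted system. -/
abbrev _root_.TwistedSheaves.TwistedSheaf.at' (T : TwistedSheaf R X) {W U : Opens X} (h : W ≤ U)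
    (i : T.gauge.fib U) : T.twSys.At W :=
  ⟨⟨U, i⟩, h⟩

/-- The functor of a representation. -/
def trans : T.gauge ⟶ B.stack := (SysHom.toPreHom (G := T.gauge) E.F).toTrans

/-- The action of the sections. -/
noncomputable def εS {W U : Opens X} (h : W ≤ U) (i : T.gauge.fib U) :
    shSec ((onFib T.rep U).obj i) h →ₛₗ[algebraMap R S]
      ((B.stack.rs h).obj ((onFib E.trans U).obj i) ⟶
        (B.stack.rs h).obj ((onFib E.trans U).obj i)) :=
  E.ε (T.at' h i)

variable {W' W U U' : Opens X}

theorem εS_one (h : W ≤ U) (i : T.gauge.fib U) : E.εS h i 1 = 𝟙 _ := E.one (T.at' h i)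

theorem εS_mul (h : W ≤ U) (i : T.gauge.fib U) (a b : shSec ((onFib T.rep U).obj i) h) :
    E.εS h i (a * b) = E.εS h i b ≫ E.εS h i a := E.mul (T.at' h i) a b

theorem εS_res (h : W' ≤ W) (hi : W ≤ U) (i : T.gauge.fib U)
    (a : shSec ((onFib T.rep U).obj i) hi) :
    E.εS (h.trans hi) i (shRes _ h hi a) = rr h (E.εS hi i a) := E.res h (T.at' hi i) a

theorem εS_act (hi : W ≤ U) (hj : W ≤ U') {i : T.gauge.fib U} {j : T.gauge.fib U'}
    (g : (T.gauge.rs hi).obj i ⟶ (T.gauge.rs hj).obj j) (a : shSec ((onFib T.rep U).obj i) hi) :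
    mapR E.trans hi hj g ≫ E.εS hj j (shMap (mapR T.rep hi hj g) a) =
      E.εS hi i a ≫ mapR E.trans hi hj g :=
  (congrArg (· ≫ E.εS hj j (shMap (mapR T.rep hi hj g) a))
    (mapR_toTrans (SysHom.toPreHom E.F) hi hj g)).trans
    ((E.act (i := T.at' hi i) (j := T.at' hj j) g a).trans
      (congrArg (E.εS hi i a ≫ ·) (mapR_toTrans (SysHom.toPreHom E.F) hi hj g)).symm)

theorem εS_cp (hi : W ≤ U) {i : T.gauge.fib U} (g : (T.gauge.rs hi).obj i ⟶ (T.gauge.rs hi).obj i) :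
    E.εS hi i (toSh T.rep hi i (T.cpEnd g)) = mapR E.trans hi hi g :=
  (E.cp (i := T.at' hi i) g).trans (mapR_toTrans (SysHom.toPreHom E.F) hi hi g).symm

theorem _root_.TwistedSheaves.rs_rfl_map_conj {G : Prestack X} {U : Opens X} {i j : G.fib U}
    (t : (G.rs le_rfl).obj i ⟶ (G.rs le_rfl).obj j) :
    (G.rs le_rfl).map ((G.rsId _).inv ≫ t ≫ (G.rsId _).hom) = t := by
  rw [← cancel_mono (G.rsId _).hom, rsId_naturality, Iso.hom_inv_id_assoc]

/-- The action of the algebras of a representation. -/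
noncomputable def εT {U : Opens X} (i : T.gauge.fib U) : Sec T.rep i →ₛₗ[algebraMap R S]
    ((onFib E.trans U).obj i ⟶ (onFib E.trans U).obj i) :=
  (conjL (S := S) (B.stack.rsId ((onFib E.trans U).obj i)).symm
    (B.stack.rsId ((onFib E.trans U).obj i))).toLinearMap.comp (E.εS le_rfl i)

theorem rs_map_εT (i : T.gauge.fib U) (a : Sec T.rep i) :
    (B.stack.rs le_rfl).map (E.εT i a) = E.εS le_rfl i a :=
  rs_rfl_map_conj (E.εS le_rfl i a)

theorem rs_map_εT' (h : W ≤ U) (i : T.gauge.fib U) (a : Sec T.rep i) :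
    (B.stack.rs h).map (E.εT i a) = E.εS h i (shRes ((onFib T.rep U).obj i) h le_rfl a) := by
  rw [← rr_map h le_rfl, rs_map_εT]
  exact (E.εS_res h le_rfl i a).symm

theorem εT_eq_of {i : T.gauge.fib U} {a : Sec T.rep i}
    {t : (onFib E.trans U).obj i ⟶ (onFib E.trans U).obj i}
    (h : E.εS le_rfl i a = (B.stack.rs le_rfl).map t) : E.εT i a = t :=
  rs_rfl_map_injective ((E.rs_map_εT i a).trans h)

theorem εS_act_map {i j : T.gauge.fib U} (g : i ⟶ j) (a : Sec T.rep i) :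
    (B.stack.rs le_rfl).map ((onFib E.trans U).map g) ≫ E.εS le_rfl j (secMap T.rep g a) =
      E.εS le_rfl i a ≫ (B.stack.rs le_rfl).map ((onFib E.trans U).map g) := by
  rw [← mapR_map]
  refine Eq.trans ?_ (E.εS_act le_rfl le_rfl ((T.gauge.rs le_rfl).map g) a)
  refine congrArg (fun a => mapR E.trans le_rfl le_rfl ((T.gauge.rs le_rfl).map g) ≫
    E.εS le_rfl j a) ?_
  exact congrArg (fun t => shMap (hi := le_refl U) (hj := le_refl U) t a)
    (mapR_map T.rep le_rfl g).symm

/-- The same section restricted in two ways, once as a section for the object `i|_W` and once within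
`A(i)`; the morphism `rsId` between `i|_W` and `i` relates them. This is the input for `εT_res`. -/
theorem shMap_rsId (h : W ≤ U) (i : T.gauge.fib U) (a : Sec T.rep i) :
    shMap (hi := le_refl W) (hj := h) (mapR T.rep le_rfl h
      (T.gauge.rsId ((T.gauge.rs h).obj i)).hom) (secRes T.rep (homOfLE h) i a) =
        shRes ((onFib T.rep U).obj i) h le_rfl a := by
  refine (congrArg (fun t => shMap (hi := le_refl W) (hj := h) t (secRes T.rep (homOfLE h) i a))
    (mapR_rsId T.rep h i)).trans ?_
  refine Eq.trans ?_ (toSh_secRes T.rep h i a)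
  exact congrArg (toSh T.rep h i) (sectionsMap_rsId_hom
    (𝒜 := (onFib T.rep W).obj ((T.gauge.rs h).obj i)) (secRes T.rep (homOfLE h) i a))

theorem εT_res (h : W ≤ U) (i : T.gauge.fib U) (a : Sec T.rep i) :
    E.εT ((T.gauge.rs h).obj i) (secRes T.rep (homOfLE h) i a) =
      resHom E.trans (homOfLE h) (E.εT i a) := by
  suffices H : E.εT ((T.gauge.rs h).obj i) (secRes T.rep (homOfLE h) i a) ≫ (cmp E.trans h i).hom =
      (cmp E.trans h i).hom ≫ (B.stack.rs h).map (E.εT i a) from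
    ((Iso.eq_comp_inv _).2 H).trans (Category.assoc _ _ _)
  refine (cancel_epi (B.stack.rsId _).hom).1 ?_
  rw [← Category.assoc, ← Category.assoc, ← rsId_naturality, ← mapR_rsId, Category.assoc,
    ← mapR_rsId, rs_map_εT, rs_map_εT']
  refine (E.εS_act le_rfl h (T.gauge.rsId _).hom (secRes T.rep (homOfLE h) i a)).symm.trans ?_
  rw [shMap_rsId]

/-- A representation of the twisted system of a twisted sheaf as a representation of the twisted
sheaf. -/
noncomputable def toRep : TwistedSheaf.Rep T B where
  E := E.trans
  ε := E.εT
  one {U} i := E.εT_eq_of ((E.εS_one le_rfl i).trans ((B.stack.rs le_rfl).map_id _).symm)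
  mul {U} i a b := by
    refine E.εT_eq_of ((E.εS_mul le_rfl i a b).trans ?_)
    rw [CategoryTheory.Functor.map_comp, rs_map_εT, rs_map_εT]
  res f i a := E.εT_res f.le i a
  act {U i j} h a := by
    refine rs_rfl_map_injective ?_
    rw [CategoryTheory.Functor.map_comp, CategoryTheory.Functor.map_comp, rs_map_εT, rs_map_εT]
    exact E.εS_act_map h a
  cp {U} i g := by
    refine E.εT_eq_of ?_
    rw [← mapR_map, ← εS_cp, T.cpEnd_res]
    refine congrArg (E.εS le_rfl i) (Eq.trans ?_ (toSh_secRes T.rep le_rfl i _).symm)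
    rw [T.cpEnd_hom]
    exact (shRes_rfl (hi := le_refl U) _).symm

/-- Sections of `A(i)` and endomorphisms in `B` both form sheaves, so local bijectivity is
bijectivity. -/
theorem bijective_εS
    (inj : ∀ {W U : Opens X} (h : W ≤ U) (i : T.gauge.fib U) (a b : shSec ((onFib T.rep U).obj i) h),
      E.εS h i a = E.εS h i b → ∀ x ∈ W, ∃ (V : Opens X) (hV : V ≤ W), x ∈ V ∧
        shRes ((onFib T.rep U).obj i) hV h a = shRes ((onFib T.rep U).obj i) hV h b)
    (surj : ∀ {W U : Opens X} (h : W ≤ U) (i : T.gauge.fib U)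
      (s : (B.stack.rs h).obj ((onFib E.trans U).obj i) ⟶
        (B.stack.rs h).obj ((onFib E.trans U).obj i)), ∀ x ∈ W, ∃ (V : Opens X) (hV : V ≤ W),
          x ∈ V ∧ ∃ a : shSec ((onFib T.rep U).obj i) (hV.trans h),
            E.εS (hV.trans h) i a = rr hV s) (h : W ≤ U) (i : T.gauge.fib U) :
    Function.Bijective (E.εS h i) := by
  have inj' : ∀ {W U : Opens X} (h : W ≤ U) (i : T.gauge.fib U)
      (a b : shSec ((onFib T.rep U).obj i) h), E.εS h i a = E.εS h i b → a = b :=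
    fun h i a b e => shSec_ext a b (inj h i a b e)
  refine ⟨fun a b => inj' h i a b, fun s => ?_⟩
  choose V hV hxV a ha using fun x : W => surj h i s x.1 x.2
  have hc : ∀ x ∈ W, ∃ y : W, x ∈ V y := fun x hx => ⟨⟨x, hx⟩, hxV ⟨x, hx⟩⟩
  obtain ⟨b, hb⟩ := exists_shSec_glue (hi := h) V hV hc a (fun x y Y hx hy =>
    inj' (hx.trans ((hV x).trans h)) i _ _ (by
      refine (E.εS_res hx ((hV x).trans h) i (a x)).trans (Eq.trans ?_
        (E.εS_res hy ((hV y).trans h) i (a y)).symm)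
      rw [ha, ha, rr_rr, rr_rr]))
  refine ⟨b, hom_ext_of_cover B.isStack _ _ fun x hx => ⟨V ⟨x, hx⟩, hV _, hxV _, ?_⟩⟩
  rw [← εS_res, hb, ha]

theorem bijective_εT (h : ∀ {U : Opens X} (i : T.gauge.fib U), Function.Bijective (E.εS le_rfl i))
    (i : T.gauge.fib U) : Function.Bijective (E.εT i) :=
  (conjL (S := S) (B.stack.rsId ((onFib E.trans U).obj i)).symm
    (B.stack.rsId ((onFib E.trans U).obj i))).bijective.comp (h i)

end TwRep

/-! ### The universal representation and the uniqueness of the target stack -/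

namespace TwistedSheaf

/-- The stack of algebroids of a twisted sheaf. -/
noncomputable def algebroid (T : TwistedSheaf R X) : AlgebroidStack R X :=
  T.twSys.linSys.algebroid T.twSys_isTwisted.isAlgebroid

/-- The tautological representation. -/
noncomputable def toAlgebroid (T : TwistedSheaf R X) : Rep T T.algebroid :=
  (T.twSys.toLocRep T.twSys_isTwisted).toRep

/-- Stackification changes morphisms only by sheafification, and endomorphisms of `i` in the linear
system are the sections of `A(i)`, which already form a sheaf. -/
theorem toAlgebroid_isUniversal (T : TwistedSheaf R X) : T.toAlgebroid.IsUniversal :=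
  Rep.isUniversal_of_bijective (TwRep.bijective_εT (T.twSys.toLocRep T.twSys_isTwisted)
    (TwRep.bijective_εS (T.twSys.toLocRep T.twSys_isTwisted)
      (fun h i => T.twSys.exists_res_eq_of_toLocRep T.twSys_isTwisted (T.at' h i))
      (fun h i => T.twSys.exists_toLocRep_eq T.twSys_isTwisted (T.at' h i)) le_rfl))

theorem Rep.IsExt.weaklyEquivalent_algebroid {T : TwistedSheaf R X} {B : AlgebroidStack R X}
    {E : Rep T B} (hE : E.IsExt) : T.algebroid.WeaklyEquivalent B :=
  AlgebroidStack.weaklyEquivalent_algebroid _ E.toTwRep.isLinear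
    ((SysHom.isExt_iff_isLocEquiv _ Function.bijective_id).1
      (hE.toTwRep.isExt T.twSys_isTwisted))

/-- Both `B` and the extension of `T.algebroid` are extensions of scalars of the linear system of
`T`, the second by transitivity, so they are weakly equivalent. -/
theorem Rep.IsExt.isInduced_algebroid {T : TwistedSheaf R X} {B : AlgebroidStack S X}
    {E : Rep T B} (hE : E.IsExt) : T.algebroid.IsInduced B := by
  have hC := T.twSys_isTwisted.isAlgebroid
  have h₁ := (hE.toTwRep.isExt T.twSys_isTwisted).weaklyEquivalent_algebroid hC
  obtain ⟨F, hF, h⟩ := (T.algebroid.isInduced_extend (S := S)).exists_isExt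
  have h₂ := (T.toAlgebroid_isUniversal.isExt.toTwRep.isExt T.twSys_isTwisted).comp h
  exact AlgebroidStack.isInduced_iff.2 ((h₂.weaklyEquivalent_algebroid hC).symm.trans h₁)

end TwistedSheaf

end

/-! ### Composition of representations with functors of stacks of algebroids -/

section

variable {R S : Type u} [CommRing R] [CommRing S] [Algebra R S] {X : Type u} [TopologicalSpace X]

theorem resHom_comp_map {G G' H : Prestack X} (F : G ⟶ G') (F' : G' ⟶ H) {V U : Opens X} (f : V ⟶ U)
    {i j : G.fib U} (s : (onFib F U).obj i ⟶ (onFib F U).obj j) :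
    resHom (F ≫ F') f (i := i) (j := j) ((onFib F' U).map s) =
      (onFib F' V).map (resHom F f s) := by
  have e : resHom F' f ((onFib F' U).map s) = (onFib F' V).map ((G'.res f).map s) := by
    refine (Category.assoc _ _ _).symm.trans ((Iso.comp_inv_eq _).2 ?_)
    exact (cmp_naturality F' f.le s).symm
  refine (resHom_comp_eq F F' f _).trans ((congrArg (fun t => (onFib F' V).map
    (comparison F f i).hom ≫ t ≫ (onFib F' V).map (comparison F f j).inv) e).trans ?_)
  exact (((onFib F' V).map_comp _ _).trans (congrArg (_ ≫ ·) ((onFib F' V).map_comp _ _))).symm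

theorem resHom_conj {G H : Prestack X} {A A' : G ⟶ H} (α : A ≅ A') {V U : Opens X} (h : V ≤ U)
    {i j : G.fib U} (s : (onFib A' U).obj i ⟶ (onFib A' U).obj j) :
    resHom A (homOfLE h) ((isoApp α i).hom ≫ s ≫ (isoApp α j).inv) =
      (isoApp α ((G.rs h).obj i)).hom ≫ resHom A' (homOfLE h) s ≫
        (isoApp α ((G.rs h).obj j)).inv := by
  have e : ∀ i : G.fib U, (cmp A h i).hom ≫ (H.rs h).map (isoApp α i).hom =
      (isoApp α ((G.rs h).obj i)).hom ≫ (cmp A' h i).hom := fun i => (homApp_cmp α.hom h i).symm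
  have e' : (H.rs h).map (isoApp α j).inv ≫ (cmp A h j).inv =
      (cmp A' h j).inv ≫ (isoApp α ((G.rs h).obj j)).inv := by
    have := congrArg Iso.inv (Iso.ext (e j) : cmp A h j ≪≫ (H.rs h).mapIso (isoApp α j) =
      isoApp α ((G.rs h).obj j) ≪≫ cmp A' h j)
    exact this
  change (cmp A h i).hom ≫ (H.rs h).map ((isoApp α i).hom ≫ s ≫ (isoApp α j).inv) ≫
    (cmp A h j).inv = (isoApp α ((G.rs h).obj i)).hom ≫ ((cmp A' h i).hom ≫ (H.rs h).map s ≫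
      (cmp A' h j).inv) ≫ (isoApp α ((G.rs h).obj j)).inv
  simp only [CategoryTheory.Functor.map_comp, Category.assoc]
  rw [e', reassoc_of% e]

namespace TwistedSheaf.Rep

variable {T : TwistedSheaf R X} {B : AlgebroidStack R X} {B' : AlgebroidStack S X} (E : Rep T B)

/-- The composition of a representation with a linear functor. -/
noncomputable def post (F : B.stack ⟶ B'.stack) (hF : AlgebroidStack.IsLinear F) : Rep T B' where
  E := E.E ≫ F
  ε {U} i := (hF.mapHom U ((onFib E.E U).obj i) ((onFib E.E U).obj i)).comp (E.toLin i)
  one i := (congrArg (onFib F _).map (E.one i)).trans ((onFib F _).map_id _)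
  mul i a b := (congrArg (onFib F _).map (E.mul i a b)).trans ((onFib F _).map_comp _ _)
  res f i a := (congrArg (onFib F _).map (E.res f i a)).trans (resHom_comp_map E.E F f _).symm
  act h a := ((onFib F _).map_comp _ _).symm.trans
    ((congrArg (onFib F _).map (E.act h a)).trans ((onFib F _).map_comp _ _))
  cp i g := congrArg (onFib F _).map (E.cp i g)

variable {E}

theorem IsUniversal.exists_post {B' : AlgebroidStack R X} (hE : E.IsUniversal)
    (h : B.WeaklyEquivalent B') : ∃ E' : Rep T B', E'.IsUniversal := by
  obtain ⟨F, hF, hw⟩ := h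
  exact ⟨E.post F hF, isUniversal_of_bijective fun i => (hw.bijective _ _ _).comp (hE.bij i)⟩

/-- Through the universal representation sections of `A(i)` are the endomorphisms in `B`. The
conditions for `B'` to be induced, taken at `i = j`, thus become those of `IsExt` for the composite.
-/
theorem IsUniversal.exists_isExt_post (hE : E.IsUniversal) (h : B.IsInduced B') :
    ∃ E' : Rep T B', E'.IsExt := by
  obtain ⟨F, hF, -, inj, surj⟩ := h
  have key {U : Opens X} (i : T.gauge.fib U) (t : S ⊗[R] Sec T.rep i) :
      extendScalars (hF.mapHom U ((onFib E.E U).obj i) ((onFib E.E U).obj i)) ((E.toLin i).lTensor S t) =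
        extendScalars ((E.post F hF).ε i) t :=
    extendScalars_lTensor ((E.post F hF).ε i) (hF.mapHom U _ _) (E.toLin i) LinearMap.id
      (fun _ => rfl) t
  refine ⟨E.post F hF, locallyEssSurj_of_connected _ T.locallyNonempty B'.locallyConnected,
    fun {U} i t ht x hx => ?_, fun {U} i s x hx => ?_⟩
  · obtain ⟨V, f, hxV, e⟩ := inj U _ _ _ ((key i t).trans ht) x hx
    refine ⟨V, f, hxV, ?_⟩
    let γ : Sec T.rep ((T.gauge.res f).obj i) ≃ₗ[R]
        ((onFib E.E V).obj ((T.gauge.res f).obj i) ⟶ _) :=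
      LinearEquiv.ofBijective (E.toLin ((T.gauge.res f).obj i)) (hE.bij _)
    let δ := conjL (S := R) (comparison E.E f i) (comparison E.E f i).symm
    have hγ : γ.toLinearMap.comp (secRes T.rep f i).toLinearMap =
        (δ.toLinearMap.comp (B.resLinear f _ _)).comp (E.toLin i) :=
      LinearMap.ext fun a => E.res f i a
    have := congrArg (fun φ => φ.lTensor S t) hγ
    simp only [LinearMap.lTensor_comp_apply] at this
    rw [e, map_zero] at this
    exact (LinearEquiv.map_eq_zero_iff (γ.lTensor S)).1 this
  · obtain ⟨V, f, hxV, t, ht⟩ := surj U _ _ s x hx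
    let γ : Sec T.rep ((T.gauge.res f).obj i) ≃ₗ[R]
        ((onFib E.E V).obj ((T.gauge.res f).obj i) ⟶ _) :=
      LinearEquiv.ofBijective (E.toLin ((T.gauge.res f).obj i)) (hE.bij _)
    let δ := conjL (S := R) (comparison E.E f i) (comparison E.E f i).symm
    let δ' := conjL (S := S) ((onFib F V).mapIso (comparison E.E f i))
      ((onFib F V).mapIso (comparison E.E f i).symm)
    refine ⟨V, f, hxV, (γ.symm.toLinearMap.comp δ.toLinearMap).lTensor S t, ?_⟩
    refine (extendScalars_lTensor (hF.mapHom V _ _) ((E.post F hF).ε _) _ δ'.toLinearMap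
      (fun m => ?_) t).trans ((congrArg δ' ht).trans (resHom_comp_eq E.E F f s).symm)
    refine (congrArg (onFib F V).map (γ.apply_symm_apply (δ m))).trans ?_
    exact ((onFib F V).map_comp _ _).trans (congrArg (_ ≫ ·) ((onFib F V).map_comp _ _))

end TwistedSheaf.Rep

end

/-! ### Morphisms of twisted sheaves -/

section

variable {R S : Type u} [CommRing R] [CommRing S] [Algebra R S] {X : Type u} [TopologicalSpace X]

namespace TwistedSheaf

/-- A morphism of twisted sheaves over a morphism of rings. -/
structure Ind (T : TwistedSheaf R X) (T' : TwistedSheaf S X) where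
  /-- The functor. -/
  F : T.gauge ⟶ T'.gauge
  /-- The morphisms of algebras. -/
  ρ : ∀ {U : Opens X} (i : T.gauge.fib U),
    Sec T.rep i →ₛₗ[algebraMap R S] Sec T'.rep ((onFib F U).obj i)
  one : ∀ {U : Opens X} (i : T.gauge.fib U), ρ i 1 = 1
  mul : ∀ {U : Opens X} (i : T.gauge.fib U) (a b : Sec T.rep i), ρ i (a * b) = ρ i a * ρ i b
  res : ∀ {V U : Opens X} (h : V ≤ U) (i : T.gauge.fib U) (a : Sec T.rep i),
    ρ ((T.gauge.rs h).obj i) (secRes T.rep (homOfLE h) i a) = secMap T'.rep (cmp F h i).inv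
      (secRes T'.rep (homOfLE h) ((onFib F U).obj i) (ρ i a))
  act : ∀ {U : Opens X} {i j : T.gauge.fib U} (h : i ⟶ j) (a : Sec T.rep i),
    ρ j (secMap T.rep h a) = secMap T'.rep ((onFib F U).map h) (ρ i a)
  cp : ∀ {U : Opens X} (i : T.gauge.fib U) (g : Aut i),
    (T'.cp ((onFib F U).obj i) ((onFib F U).mapIso g) : Sec T'.rep ((onFib F U).obj i)) =
      ρ i (T.cp i g)

theorem secMap_inv_hom {G : Prestack X} (A : G ⟶ assocStack R X) {U : Opens X} {i j : G.fib U}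
    (e : i ≅ j) (a : Sec A j) : secMap A e.hom (secMap A e.inv a) = a :=
  secMap_hom_inv A e.symm a

theorem Ind.isInduced {T : TwistedSheaf R X} {T' : TwistedSheaf S X} (K : Ind T T')
    (inj : ∀ {U : Opens X} (i : T.gauge.fib U) (t : S ⊗[R] Sec T.rep i),
      extendScalars (K.ρ i) t = 0 → ∀ x ∈ U, ∃ (V : Opens X) (f : V ⟶ U), x ∈ V ∧
        (secRes T.rep f i).toLinearMap.lTensor S t = 0)
    (surj : ∀ {U : Opens X} (i : T.gauge.fib U) (b : Sec T'.rep ((onFib K.F U).obj i)),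
      ∀ x ∈ U, ∃ (V : Opens X) (h : V ≤ U), x ∈ V ∧
        ∃ t : S ⊗[R] Sec T.rep ((T.gauge.rs h).obj i), extendScalars (K.ρ _) t =
          secMap T'.rep (cmp K.F h i).inv
            (secRes T'.rep (homOfLE h) ((onFib K.F U).obj i) b)) : T.IsInduced T' := by
  refine ⟨K.F, fun U i => { K.ρ i with
    map_one' := K.one i, map_mul' := K.mul i, map_zero' := map_zero (K.ρ i) }, fun U i r a =>
      map_smulₛₗ (K.ρ i) r a, fun V U f i a => ?_, fun U i j => K.act, fun U => K.cp,
      fun U => inj, fun U i b x hx => ?_⟩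
  · exact (congrArg (secMap T'.rep (cmp K.F f.le i).hom) (K.res f.le i a)).trans
      (secMap_inv_hom T'.rep (cmp K.F f.le i) _)
  · obtain ⟨V, h, hxV, t, ht⟩ := surj i b x hx
    exact ⟨V, homOfLE h, hxV, t, (congrArg (secMap T'.rep (cmp K.F h i).hom) ht).trans
      (secMap_inv_hom T'.rep (cmp K.F h i) _)⟩

variable {T : TwistedSheaf R X} {T' : TwistedSheaf S X} {B : AlgebroidStack S X} {E : Rep T B}
  {E' : Rep T' B}

/-- The functor of `E'` is faithful, essentially surjective and lifts isomorphisms. All morphisms of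
the gauge gerbe of `T` are isomorphisms, so the functor of `E` factors through it. -/
theorem Rep.IsUniversal.exists_lift (hE' : E'.IsUniversal) (E : Rep T B) :
    ∃ K : T.gauge ⟶ T'.gauge, Nonempty (K ≫ E'.E ≅ E.E) := by
  refine Prestack.exists_lift E.E E'.E (fun _ _ => hE'.inj) (fun i j i' j' e e' t => ?_)
    (fun i => hE'.ess _)
  exact hE'.lift (e ≪≫ (onFib E.E _).mapIso (T.iso t) ≪≫ e'.symm)

/-- The algebra of sections as the module of endomorphisms. -/
noncomputable def Rep.IsUniversal.equiv (hE' : E'.IsUniversal) {U : Opens X} (i : T'.gauge.fib U) :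
    Sec T'.rep i ≃ₗ[S] ((onFib E'.E U).obj i ⟶ (onFib E'.E U).obj i) :=
  LinearEquiv.ofBijective (E'.toLin i) (hE'.bij i)

section liftInd

variable (E) (hE' : E'.IsUniversal) (K : T.gauge ⟶ T'.gauge) (α : K ≫ E'.E ≅ E.E)

/-- The components of an isomorphism `K ≫ E'.E ≅ E.E`. -/
def liftIso {U : Opens X} (i : T.gauge.fib U) :
    (onFib E'.E U).obj ((onFib K U).obj i) ≅ (onFib E.E U).obj i :=
  isoApp α i

/-- The morphisms of algebras of a lift. -/
noncomputable def liftρ {U : Opens X} (i : T.gauge.fib U) :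
    Sec T.rep i →ₛₗ[algebraMap R S] Sec T'.rep ((onFib K U).obj i) :=
  ((hE'.equiv ((onFib K U).obj i)).symm.toLinearMap.comp
    (conjL (S := S) (liftIso E K α i) (liftIso E K α i).symm).toLinearMap).comp (E.ε i)

theorem ε_liftρ {U : Opens X} (i : T.gauge.fib U) (a : Sec T.rep i) :
    E'.ε ((onFib K U).obj i) (liftρ E hE' K α i a) =
      (liftIso E K α i).hom ≫ E.ε i a ≫ (liftIso E K α i).inv :=
  (hE'.equiv ((onFib K U).obj i)).apply_symm_apply _

theorem ε_cmp_secRes {V U : Opens X} (h : V ≤ U) (i : T.gauge.fib U)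
    (b : Sec T'.rep ((onFib K U).obj i)) (s : (onFib E.E U).obj i ⟶ (onFib E.E U).obj i)
    (hb : E'.ε _ b = (liftIso E K α i).hom ≫ s ≫ (liftIso E K α i).inv) :
    E'.ε ((onFib K V).obj ((T.gauge.rs h).obj i)) (secMap T'.rep (cmp K h i).inv
      (secRes T'.rep (homOfLE h) ((onFib K U).obj i) b)) =
        (liftIso E K α ((T.gauge.rs h).obj i)).hom ≫ resHom E.E (homOfLE h) s ≫
          (liftIso E K α ((T.gauge.rs h).obj i)).inv :=
  (E'.ε_comparison K (homOfLE h) i b).trans ((congrArg (resHom (K ≫ E'.E) (homOfLE h)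
    (i := i) (j := i)) hb).trans (resHom_conj α h s))

theorem map_eq_conj {U : Opens X} {i j : T.gauge.fib U} (g : i ⟶ j) :
    (onFib E'.E U).map ((onFib K U).map g) =
      (liftIso E K α i).hom ≫ (onFib E.E U).map g ≫ (liftIso E K α j).inv := by
  have := homApp_naturality α.hom g
  exact ((Iso.eq_comp_inv (liftIso E K α j)).2 this).trans (Category.assoc _ _ _)

/-- The morphism of twisted sheaves given by a lift. -/
noncomputable def liftInd : Ind T T' where
  F := K
  ρ := liftρ E hE' K α
  one i := (hE'.bij _).1 (by
    rw [ε_liftρ, E.one, E'.one, Category.id_comp, Iso.hom_inv_id])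
  mul i a b := (hE'.bij _).1 (by
    rw [ε_liftρ, E.mul, E'.mul, ε_liftρ, ε_liftρ]
    simp)
  res h i a := (hE'.bij _).1 (by
    rw [ε_liftρ, ε_cmp_secRes E K α h i _ _ (ε_liftρ E hE' K α i a)]
    exact congrArg (fun t => (liftIso E K α ((T.gauge.rs h).obj i)).hom ≫ t ≫
      (liftIso E K α ((T.gauge.rs h).obj i)).inv) (E.res (homOfLE h) i a))
  act {U i j} g a := (hE'.bij _).1 (by
    have e := E'.act ((onFib K U).map g) (liftρ E hE' K α i a)
    rw [ε_liftρ, map_eq_conj E K α] at e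
    rw [ε_liftρ]
    refine (cancel_epi (liftIso E K α i ≪≫ (onFib E.E U).mapIso (T.iso g) ≪≫
      (liftIso E K α j).symm).hom).1 (Eq.trans ?_ e.symm)
    have e' := E.act g a
    simp only [Iso.trans_hom, CategoryTheory.Functor.mapIso_hom, iso_hom, Iso.symm_hom,
      Category.assoc, Iso.inv_hom_id_assoc]
    rw [reassoc_of% e'])
  cp {U} i g := (hE'.bij _).1 (by
    rw [ε_liftρ, E.cp]
    exact (E'.cp _ ((onFib K U).mapIso g)).trans (map_eq_conj E K α g.hom))

end liftInd

/-- The functor of `E` lifts to the gauge gerbe of `T'`, and the maps `E.ε` become maps between the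
algebras of `T` and `T'` after inverting the bijections `E'.ε`. Conjugation by the lifting
isomorphism is linear over `S`, so the tensor conditions carry over. -/
theorem Rep.IsExt.isInduced (hE : E.IsExt) (hE' : E'.IsUniversal) : T.IsInduced T' := by
  obtain ⟨K, ⟨α⟩⟩ := hE'.exists_lift E
  have key {U : Opens X} (i : T.gauge.fib U) (t : S ⊗[R] Sec T.rep i) :
      extendScalars (E.ε i) t = conjL (S := S) (liftIso E K α i).symm (liftIso E K α i)
        (E'.ε _ (extendScalars (liftρ E hE' K α i) t)) :=
    extendScalars_congr (liftρ E hE' K α i) (E.ε i)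
      ((conjL (S := S) (liftIso E K α i).symm (liftIso E K α i)).toLinearMap.comp (E'.toLin _))
      (fun a => Eq.trans (by simp) (congrArg (conjL (S := S) (liftIso E K α i).symm
        (liftIso E K α i)) (ε_liftρ E hE' K α i a)).symm) t
  refine (liftInd E hE' K α).isInduced (fun {U} i t ht => hE.inj i t ?_) (fun {U} i b x hx => ?_)
  · refine (key i t).trans ?_
    refine (congrArg (fun t => conjL (S := S) (liftIso E K α i).symm (liftIso E K α i)
      (E'.ε _ t)) ht).trans ?_
    exact (congrArg _ (map_zero (E'.ε _))).trans (map_zero _)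
  · obtain ⟨V, f, hxV, t, ht⟩ := hE.surj i (conjL (S := S) (liftIso E K α i).symm
      (liftIso E K α i) (E'.ε _ b)) x hx
    refine ⟨V, f.le, hxV, t, (hE'.bij _).1 ?_⟩
    refine Eq.trans ?_ (ε_cmp_secRes E K α f.le i b (conjL (S := S)
      (liftIso E K α i).symm (liftIso E K α i) (E'.ε _ b)) ?_).symm
    · have := ((key _ t).symm.trans ht)
      refine Eq.trans ?_ (congrArg (fun t => (liftIso E K α ((T.gauge.rs f.le).obj i)).hom ≫ t ≫
        (liftIso E K α ((T.gauge.rs f.le).obj i)).inv) this)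
      exact (conj_cancel (liftIso E K α ((T.gauge.rs f.le).obj i)).symm
        (liftIso E K α ((T.gauge.rs f.le).obj i)).symm _).symm
    · simp

end TwistedSheaf

end

/-! ### Uniqueness of the twisted sheaf of a stack of algebroids -/

section

variable {R : Type u} [CommRing R] {X : Type u} [TopologicalSpace X]

/-- A morphism of sheaves of algebras from its components. -/
noncomputable def assocHom {U : Opens X} {𝒜 ℬ : (assocStack R X).fib U}
    (e : ∀ {W : Opens X} (h : W ≤ U), shSec 𝒜 h →ₐ[R] shSec ℬ h)
    (nat : ∀ {W' W : Opens X} (h : W' ≤ W) (hi : W ≤ U) (a : shSec 𝒜 hi),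
      e (h.trans hi) (shRes 𝒜 h hi a) = shRes ℬ h hi (e hi a)) : 𝒜 ⟶ ℬ :=
  show (show Sheaf ((Opens.grothendieckTopology X).over U) (AlgCat.{u} R) from 𝒜) ⟶ ℬ from
    ⟨{ app := fun Y => AlgCat.ofHom (e Y.unop.hom.le)
       naturality := fun Y _ f => AlgCat.hom_ext _ (AlgHom.ext fun a =>
        nat f.unop.left.le Y.unop.hom.le a) }⟩

theorem assoc_hom_ext {U : Opens X} {𝒜 ℬ : (assocStack R X).fib U} {s t : 𝒜 ⟶ ℬ}
    (h : ∀ {W : Opens X} (h : W ≤ U) (a : shSec 𝒜 h),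
      sectionsMap s (homOfLE h) a = sectionsMap t (homOfLE h) a) : s = t := by
  let s' : (show Sheaf ((Opens.grothendieckTopology X).over U) (AlgCat.{u} R) from 𝒜) ⟶ ℬ := s
  let t' : (show Sheaf ((Opens.grothendieckTopology X).over U) (AlgCat.{u} R) from 𝒜) ⟶ ℬ := t
  have : s'.hom = t'.hom := NatTrans.ext (funext fun Y => AlgCat.hom_ext _ (AlgHom.ext fun a =>
    h Y.unop.hom.le a))
  exact ObjectProperty.hom_ext _ this

/-- An isomorphism of sheaves of algebras from its components. -/
noncomputable def assocIso {U : Opens X} {𝒜 ℬ : (assocStack R X).fib U}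
    (e : ∀ {W : Opens X} (h : W ≤ U), shSec 𝒜 h ≃ₐ[R] shSec ℬ h)
    (nat : ∀ {W' W : Opens X} (h : W' ≤ W) (hi : W ≤ U) (a : shSec 𝒜 hi),
      e (h.trans hi) (shRes 𝒜 h hi a) = shRes ℬ h hi (e hi a)) : 𝒜 ≅ ℬ where
  hom := assocHom (fun h => (e h).toAlgHom) nat
  inv := assocHom (fun h => (e h).symm.toAlgHom) (fun h hi a => by
    refine (e (h.trans hi)).injective ?_
    refine ((e (h.trans hi)).apply_symm_apply _).trans (Eq.trans ?_ (nat h hi _).symm)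
    exact congrArg _ ((e hi).apply_symm_apply a).symm)
  hom_inv_id := assoc_hom_ext fun h a => (e h).symm_apply_apply a
  inv_hom_id := assoc_hom_ext fun h a => (e h).apply_symm_apply a

theorem shMap_rr' {W' W U U' : Opens X} {hi : W ≤ U} {hj : W ≤ U'} {𝒜 : (assocStack R X).fib U}
    {ℬ : (assocStack R X).fib U'} (h : W' ≤ W)
    (t : ((assocStack R X).rs hi).obj 𝒜 ⟶ ((assocStack R X).rs hj).obj ℬ)
    (a : shSec 𝒜 (h.trans hi)) :
    shMap (hi := h.trans hi) (hj := h.trans hj) (rr h t) a =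
      (sectionsMap t (homOfLE h) a : shSec ℬ (h.trans hj)) := by
  have e₀ := sectionsMap_comp₃ ((assocStack R X).rsComp h hi 𝒜).hom (((assocStack R X).rs h).map t)
    ((assocStack R X).rsComp h hj ℬ).inv (𝟙 W') a
  have e₁ := sectionsMap_rsComp_hom h hi a
  have e₃ := sectionsMap_rsComp_inv h hj (sectionsMap t (homOfLE h) a)
  exact e₀.trans ((congrArg (fun y => sectionsMap ((assocStack R X).rsComp h hj ℬ).inv (𝟙 W')
    (sectionsMap (((assocStack R X).rs h).map t) (𝟙 W') y)) e₁).trans e₃)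

theorem mapR_conj {G H : Prestack X} {A A' : G ⟶ H} (α : A ≅ A') {W U U' : Opens X} {hi : W ≤ U}
    {hj : W ≤ U'} {i : G.fib U} {j : G.fib U'} (g : (G.rs hi).obj i ⟶ (G.rs hj).obj j) :
    mapR A hi hj g = (H.rs hi).map (isoApp α i).hom ≫ mapR A' hi hj g ≫
      (H.rs hj).map (isoApp α j).inv := by
  have e₁ := homApp_cmp α.hom hi i
  have e₂ := homApp_cmp α.hom hj j
  have e₃ := homApp_naturality α.hom g
  rw [← Category.assoc, ← CategoryTheory.Functor.mapIso_inv, Iso.eq_comp_inv]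
  change mapR A hi hj g ≫ (H.rs hj).map (homApp α.hom j) =
    (H.rs hi).map (homApp α.hom i) ≫ mapR A' hi hj g
  rw [← cancel_epi (cmp A hi i).hom, ← reassoc_of% e₁]
  simp only [mapR, Category.assoc, Iso.hom_inv_id_assoc]
  rw [← e₂, reassoc_of% e₃]

namespace TwistedSheaf

variable {T T' : TwistedSheaf R X} {B : AlgebroidStack R X}

namespace Rep

variable {E : Rep T B} {W' W U U' : Opens X}

theorem IsUniversal.bijective_εR (hE : E.IsUniversal) (h : W ≤ U) (i : T.gauge.fib U) :
    Function.Bijective (E.εR h i) :=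
  (conjL (S := R) (cmp E.E h i).symm (cmp E.E h i)).bijective.comp
    ((hE.bij _).comp (toSh T.rep h i).symm.bijective)

theorem εR_cpEnd {i : T.gauge.fib U} (g : i ⟶ i) :
    E.εR le_rfl i (T.cpEnd g) = (B.stack.rs le_rfl).map ((onFib E.E U).map g) := by
  rw [← mapR_map, ← εR_cp, T.cpEnd_res]
  refine congrArg (E.εR le_rfl i) (Eq.trans ?_ (toSh_secRes T.rep le_rfl i _).symm)
  exact (shRes_rfl (hi := le_refl U) _).symm

/-- The algebra of sections as the algebra of endomorphisms. -/
noncomputable def IsUniversal.equivR (hE : E.IsUniversal) (h : W ≤ U) (i : T.gauge.fib U) :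
    shSec ((onFib T.rep U).obj i) h ≃ₐ[R] End ((B.stack.rs h).obj ((onFib E.E U).obj i)) :=
  AlgEquiv.ofBijective (AlgHom.ofLinearMap
    ({ toFun := E.εR h i, map_add' := map_add _, map_smul' := map_smulₛₗ (E.εR h i) } :
      shSec ((onFib T.rep U).obj i) h →ₗ[R] End ((B.stack.rs h).obj ((onFib E.E U).obj i)))
        (E.εR_one h i) (E.εR_mul h i)) (hE.bijective_εR h i)

end Rep

/-- Conjugation with an isomorphism, as an isomorphism of algebras. -/
noncomputable def conjEnd {D : Type*} [Category D] [Preadditive D] [Linear R D] {i j : D} (e : i ≅ j) :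
    End i ≃ₐ[R] End j :=
  AlgEquiv.ofLinearEquiv (conjL (S := R) e.symm e) (by
    change e.inv ≫ 𝟙 _ ≫ e.hom = 𝟙 _
    simp) (fun a b => by
    change e.inv ≫ (b ≫ a) ≫ e.hom = (e.inv ≫ b ≫ e.hom) ≫ (e.inv ≫ a ≫ e.hom)
    simp)

section

variable {E : Rep T B} {E' : Rep T' B} (hE : E.IsUniversal) (hE' : E'.IsUniversal)
  (K : T.gauge ⟶ T'.gauge) (α : K ≫ E'.E ≅ E.E) {W' W U U' : Opens X}

/-- The isomorphisms of algebras of a lift. -/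
noncomputable def liftEquiv (h : W ≤ U) (i : T.gauge.fib U) :
    shSec ((onFib T.rep U).obj i) h ≃ₐ[R] shSec ((onFib T'.rep U).obj ((onFib K U).obj i)) h :=
  ((hE.equivR h i).trans (conjEnd ((B.stack.rs h).mapIso (liftIso E K α i).symm))).trans
    (hE'.equivR h ((onFib K U).obj i)).symm

theorem εR_liftEquiv (h : W ≤ U) (i : T.gauge.fib U) (a : shSec ((onFib T.rep U).obj i) h) :
    E'.εR h ((onFib K U).obj i) (liftEquiv hE hE' K α h i a) =
      (B.stack.rs h).map (liftIso E K α i).hom ≫ E.εR h i a ≫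
        (B.stack.rs h).map (liftIso E K α i).inv :=
  (hE'.equivR h ((onFib K U).obj i)).apply_symm_apply _

theorem liftEquiv_shRes (h : W' ≤ W) (hi : W ≤ U) (i : T.gauge.fib U)
    (a : shSec ((onFib T.rep U).obj i) hi) :
    liftEquiv hE hE' K α (h.trans hi) i (shRes _ h hi a) =
      shRes _ h hi (liftEquiv hE hE' K α hi i a) := by
  refine (hE'.bijective_εR _ _).1 ?_
  rw [εR_liftEquiv, E.εR_res, E'.εR_res, εR_liftEquiv, rr_comp, rr_comp, rr_map, rr_map]

/-- Expresses `E' ∘ K` on morphisms as the conjugate of `E`; this lets every identity for the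
algebras of `T'` be checked inside `B`. -/
theorem mapR_lift {hi : W ≤ U} {hj : W ≤ U'} {i : T.gauge.fib U} {j : T.gauge.fib U'}
    (g : (T.gauge.rs hi).obj i ⟶ (T.gauge.rs hj).obj j) :
    mapR E'.E hi hj (mapR K hi hj g) = (B.stack.rs hi).map (liftIso E K α i).hom ≫
      mapR E.E hi hj g ≫ (B.stack.rs hj).map (liftIso E K α j).inv :=
  (mapR_comp' K E'.E hi hj g).symm.trans (mapR_conj α g)

theorem liftEquiv_act {hi : W ≤ U} {hj : W ≤ U'} {i : T.gauge.fib U} {j : T.gauge.fib U'}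
    (g : (T.gauge.rs hi).obj i ⟶ (T.gauge.rs hj).obj j) (a : shSec ((onFib T.rep U).obj i) hi) :
    liftEquiv hE hE' K α hj j (shMap (mapR T.rep hi hj g) a) =
      shMap (mapR T'.rep hi hj (mapR K hi hj g)) (liftEquiv hE hE' K α hi i a) := by
  refine (hE'.bijective_εR _ _).1 ?_
  rw [εR_liftEquiv]
  have e := E'.εR_act (mapR K hi hj g) (liftEquiv hE hE' K α hi i a)
  rw [mapR_lift K α, εR_liftEquiv] at e
  let γ : (B.stack.rs hi).obj ((onFib E.E U).obj i) ≅ (B.stack.rs hj).obj ((onFib E.E U').obj j) :=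
    (toPreHom E.E).mapIso hi hj (T.iso g)
  have hγ : γ.hom = mapR E.E hi hj g := rfl
  let β : (B.stack.rs hi).obj ((onFib E'.E U).obj ((onFib K U).obj i)) ≅
      (B.stack.rs hj).obj ((onFib E'.E U').obj ((onFib K U').obj j)) :=
    (B.stack.rs hi).mapIso (liftIso E K α i) ≪≫ γ ≪≫
      ((B.stack.rs hj).mapIso (liftIso E K α j)).symm
  have hβ : β.hom = (B.stack.rs hi).map (liftIso E K α i).hom ≫ mapR E.E hi hj g ≫
      (B.stack.rs hj).map (liftIso E K α j).inv := by
    rw [← hγ]; rfl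
  rw [← cancel_epi β.hom, hβ]
  refine Eq.trans ?_ e.symm
  have e' := E.εR_act g a
  have e₁ : (B.stack.rs hj).map (liftIso E K α j).inv ≫ (B.stack.rs hj).map (liftIso E K α j).hom =
    𝟙 _ := ((B.stack.rs hj).mapIso (liftIso E K α j)).inv_hom_id
  have e₂ : (B.stack.rs hi).map (liftIso E K α i).inv ≫ (B.stack.rs hi).map (liftIso E K α i).hom =
    𝟙 _ := ((B.stack.rs hi).mapIso (liftIso E K α i)).inv_hom_id
  simp only [Category.assoc]
  rw [reassoc_of% e₁, reassoc_of% e₂, reassoc_of% e']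

/-- The isomorphism of representations of a lift. -/
noncomputable def liftRepIso : T.rep ≅ K ≫ T'.rep :=
  isoTransR (fun {U} i => assocIso (U := U) (fun h => liftEquiv hE hE' K α h i)
      (fun h hi => liftEquiv_shRes hE hE' K α h hi i)) (fun {W U U'} hi hj {i j} t => by
    refine assoc_hom_ext fun {V} h a => ?_
    have e₁ := shMap_rr' (hi := hi) (hj := hj) h (mapR T.rep hi hj t) a
    have e₂ := shMap_rr' (hi := hi) (hj := hj) h (mapR (K ≫ T'.rep) hi hj t)
      (liftEquiv hE hE' K α (h.trans hi) i a)
    rw [← mapR_rr T.rep hi hj h t] at e₁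
    rw [← mapR_rr (K ≫ T'.rep) hi hj h t, mapR_comp'] at e₂
    refine (congrArg (liftEquiv hE hE' K α (h.trans hj) j) e₁).symm.trans (Eq.trans ?_ e₂)
    exact liftEquiv_act hE hE' K α (rr h t) a)

theorem secComp_liftRepIso (i : T.gauge.fib U) (a : Sec T.rep i) :
    secComp (liftRepIso hE hE' K α).hom i a = liftEquiv hE hE' K α le_rfl i a := rfl

-- A quasi-inverse `K'` is obtained by lifting `E'` through `E`. Each composite becomes isomorphic
-- to the identity after applying `E` or `E'`, and these are faithful and lift isomorphisms.
include hE hE' α in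
theorem isEquivalence_lift : Prestack.IsEquivalence K := by
  obtain ⟨K', ⟨α'⟩⟩ := hE.exists_lift E'
  have lift {T : TwistedSheaf R X} {E : Rep T B} (hE : E.IsUniversal) {U : Opens X}
      (i j : T.gauge.fib U) (e : (onFib E.E U).obj i ≅ (onFib E.E U).obj j) :
      ∃ s : i ≅ j, (onFib E.E U).map s.hom = e.hom := by
    obtain ⟨s, hs⟩ := hE.lift e
    exact ⟨T.iso s, hs⟩
  refine ⟨K', ?_, ?_⟩
  · exact nonempty_iso_of_comp _ _ E.E (fun _ _ => hE.inj) (lift hE)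
      (Bicategory.associator K K' E.E ≪≫ Bicategory.whiskerLeftIso K α' ≪≫ α ≪≫
        (Bicategory.leftUnitor E.E).symm)
  · exact nonempty_iso_of_comp _ _ E'.E (fun _ _ => hE'.inj) (lift hE')
      (Bicategory.associator K' K E'.E ≪≫ Bicategory.whiskerLeftIso K' α ≪≫ α' ≪≫
        (Bicategory.leftUnitor E'.E).symm)

end

/-- Uniqueness of the twisted sheaf of `B`. The lift `K` is an equivalence and the algebras
correspond because both are endomorphism algebras in `B`; the couplings match because in either
representation `cp g` is sent to the image of `g`. -/
theorem Rep.IsUniversal.gaugeEquivalent {E : Rep T B} {E' : Rep T' B} (hE : E.IsUniversal)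
    (hE' : E'.IsUniversal) : T.GaugeEquivalent T' := by
  obtain ⟨K, ⟨α⟩⟩ := hE'.exists_lift E
  refine ⟨K, liftRepIso hE hE' K α, isEquivalence_lift hE hE' K α, fun U i g => ?_⟩
  rw [secComp_liftRepIso]
  refine (hE'.bijective_εR le_rfl _).1 (Eq.trans ?_ (εR_liftEquiv hE hE' K α le_rfl i _).symm)
  have e₁ : E'.εR le_rfl ((onFib K U).obj i) (T'.cp ((onFib K U).obj i) ((onFib K U).mapIso g)) =
      (B.stack.rs le_rfl).map ((onFib E'.E U).map ((onFib K U).map g.hom)) :=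
    (congrArg (E'.εR le_rfl ((onFib K U).obj i))
      (T'.cpEnd_hom ((onFib K U).mapIso g)).symm).trans (Rep.εR_cpEnd ((onFib K U).map g.hom))
  have e₂ : E.εR le_rfl i (T.cp i g) = (B.stack.rs le_rfl).map ((onFib E.E U).map g.hom) :=
    (congrArg (E.εR le_rfl i) (T.cpEnd_hom g).symm).trans (Rep.εR_cpEnd g.hom)
  refine e₁.trans (Eq.trans ?_ (congrArg (fun t => (B.stack.rs le_rfl).map (liftIso E K α i).hom ≫ t ≫
        (B.stack.rs le_rfl).map (liftIso E K α i).inv) e₂).symm)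
  refine (congrArg (B.stack.rs le_rfl).map (map_eq_conj E K α g.hom)).trans ?_
  rw [CategoryTheory.Functor.map_comp, CategoryTheory.Functor.map_comp]

end TwistedSheaf

end

/-! ### Gauge equivalent twisted sheaves have equivalent stacks of algebroids -/

section

variable {R : Type u} [CommRing R] {X : Type u} [TopologicalSpace X]

theorem sectionsRes'_naturality {U : Opens X} {𝒜 ℬ : (assocStack R X).fib U} (t : 𝒜 ⟶ ℬ)
    {V : Opens X} (h : V ≤ U) (a : sections 𝒜 (𝟙 U)) :
    sectionsMap (((assocStack R X).rs h).map t) (𝟙 V) (sectionsRes' 𝒜 (homOfLE h) a) =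
      sectionsRes' ℬ (homOfLE h) (sectionsMap t (𝟙 U) a) :=
  shRes_naturality t h le_rfl a

theorem secComp_secRes {G G' : Prestack X} {A : G ⟶ assocStack R X} {A' : G' ⟶ assocStack R X}
    {F : G ⟶ G'} (η : A ⟶ F ≫ A') {V U : Opens X} (h : V ≤ U) (i : G.fib U) (a : Sec A i) :
    TwistedSheaf.secComp η ((G.rs h).obj i) (secRes A (homOfLE h) i a) =
      secMap A' (cmp F h i).inv (secRes A' (homOfLE h) ((onFib F U).obj i)
        (TwistedSheaf.secComp η i a)) := by
  have e : (cmp A h i).inv ≫ homApp η ((G.rs h).obj i) =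
      ((assocStack R X).rs h).map (homApp η i) ≫ (cmp (F ≫ A') h i).inv := by
    rw [Iso.inv_comp_eq, ← Category.assoc, ← homApp_cmp, Category.assoc, Iso.hom_inv_id,
      Category.comp_id]
  rw [cmp_comp_inv] at e
  refine (congrArg (fun t => sectionsMap t (𝟙 V)
    (sectionsRes' ((onFib A U).obj i) (homOfLE h) a)) e).trans ?_
  exact congrArg (fun b => secMap A' (cmp F h i).inv (sectionsMap
    (cmp A' h ((onFib F U).obj i)).inv (𝟙 V) b)) (sectionsRes'_naturality (homApp η i) h a)

theorem secComp_secMap {G G' : Prestack X} {A : G ⟶ assocStack R X} {A' : G' ⟶ assocStack R X}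
    {F : G ⟶ G'} (η : A ⟶ F ≫ A') {U : Opens X} {i j : G.fib U} (g : i ⟶ j) (a : Sec A i) :
    TwistedSheaf.secComp η j (secMap A g a) =
      secMap A' ((onFib F U).map g) (TwistedSheaf.secComp η i a) :=
  congrArg (fun t => sectionsMap t (𝟙 U) a) (homApp_naturality η g)

theorem bijective_secComp {G G' : Prestack X} {A : G ⟶ assocStack R X} {A' : G' ⟶ assocStack R X}
    {F : G ⟶ G'} (η : A ≅ F ≫ A') {U : Opens X} (i : G.fib U) :
    Function.Bijective (TwistedSheaf.secComp η.hom i) :=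
  Function.bijective_iff_has_inverse.2 ⟨sectionsMap (isoApp η i).inv (𝟙 U),
    fun a => congrArg (fun t => sectionsMap t (𝟙 U) a) (isoApp η i).hom_inv_id,
    fun a => congrArg (fun t => sectionsMap t (𝟙 U) a) (isoApp η i).inv_hom_id⟩

namespace TwistedSheaf

variable {T T' : TwistedSheaf R X} {B : AlgebroidStack R X}

/-- The universal representation of `T'` is pulled back along the gauge transformation; by
`isUniversal_of_bijective` only bijectivity on the algebras of sections has to be verified. -/
theorem GaugeEquivalent.exists_isUniversal (h : T.GaugeEquivalent T') {E' : Rep T' B}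
    (hE' : E'.IsUniversal) : ∃ E : Rep T B, E.IsUniversal := by
  obtain ⟨F, η, -, hcp⟩ := h
  let E : Rep T B :=
    { E := F ≫ E'.E
      ε i := (E'.toLin ((onFib F _).obj i)).comp (secComp η.hom i).toLinearMap
      one i := (congrArg (E'.ε _) (map_one (secComp η.hom i))).trans (E'.one _)
      mul i a b := (congrArg (E'.ε _) (map_mul (secComp η.hom i) a b)).trans (E'.mul _ _ _)
      res f i a := (congrArg (E'.ε _) (secComp_secRes η.hom f.le i a)).trans
        (E'.ε_comparison F f i (secComp η.hom i a))
      act g a := (congrArg (fun t => (onFib E'.E _).map ((onFib F _).map g) ≫ E'.ε _ t)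
        (secComp_secMap η.hom g a)).trans (E'.act _ _)
      cp i g := (congrArg (E'.ε _) (hcp _ i g).symm).trans (E'.cp _ ((onFib F _).mapIso g)) }
  exact ⟨E, Rep.isUniversal_of_bijective fun i => (hE'.bij _).comp (bijective_secComp η i)⟩

theorem GaugeEquivalent.weaklyEquivalent_algebroid (h : T.GaugeEquivalent T') :
    T.algebroid.WeaklyEquivalent T'.algebroid := by
  obtain ⟨E, hE⟩ := h.exists_isUniversal T'.toAlgebroid_isUniversal
  exact hE.isExt.weaklyEquivalent_algebroid

end TwistedSheaf

end

/-! ### The prestack of isomorphisms -/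

section

variable {X : Type u} [TopologicalSpace X]

namespace Prestack

variable (G : Prestack X)

/-- The 2-morphism on cores given by an isomorphism. -/
def coreIso {C D : Cat.{u, u + 1}} {F F' : C ⟶ D} (e : F ≅ F') :
    F.toFunctor.core.toCatHom ≅ F'.toFunctor.core.toCatHom :=
  Cat.Hom.isoMk (NatIso.ofComponents
    (fun i => Core.isoMk ((Cat.Hom.toNatIso e).app i.of))
    (fun t => Core.hom_ext ((Cat.Hom.toNatIso e).hom.naturality t.iso.hom)))

/-- The prestack of isomorphisms of a prestack. -/
def core : Prestack X :=
  LocallyDiscrete.mkPseudofunctor (B₀ := (Opens X)ᵒᵖ)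
    (fun U => Cat.of (Core (G.obj (LocallyDiscrete.mk U))))
    (fun f => (G.map f.toLoc).toFunctor.core.toCatHom)
    (fun U => coreIso (G.mapId (LocallyDiscrete.mk U)))
    (fun f g => coreIso (G.mapComp f.toLoc g.toLoc))
    (by
      intro U₀ U₁ U₂ U₃ f g h
      ext a
      refine Core.hom_ext ?_
      have e := (G.map₂_associator f.toLoc g.toLoc h.toLoc).symm.trans (G.map₂_id _)
      exact congrArg (fun t => t.toNatTrans.app a.of) e)
    (by
      intro U₀ U₁ f
      ext a
      refine Core.hom_ext ?_
      have e := (G.map₂_left_unitor f.toLoc).symm.trans (G.map₂_id _)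
      exact congrArg (fun t => t.toNatTrans.app a.of) e)
    (by
      intro U₀ U₁ f
      ext a
      refine Core.hom_ext ?_
      have e := (G.map₂_right_unitor f.toLoc).symm.trans (G.map₂_id _)
      exact congrArg (fun t => t.toNatTrans.app a.of) e)

variable {G}

/-- The isomorphism underlying a morphism between restrictions. -/
def coreHomIso {W U U' : Opens X} {hi : W ≤ U} {hj : W ≤ U'} {i : G.core.fib U}
    {j : G.core.fib U'} (t : (G.core.rs hi).obj i ⟶ (G.core.rs hj).obj j) :
    (G.rs hi).obj (Core.of i) ≅ (G.rs hj).obj (Core.of j) := CoreHom.iso t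

/-- The morphism of the core given by an isomorphism. -/
def coreHomMk {W U U' : Opens X} {hi : W ≤ U} {hj : W ≤ U'} {i : G.core.fib U}
    {j : G.core.fib U'} (t : (G.rs hi).obj (Core.of i) ≅ (G.rs hj).obj (Core.of j)) :
    (G.core.rs hi).obj i ⟶ (G.core.rs hj).obj j := CoreHom.mk t

theorem coreHomIso_rr {W' W U U' : Opens X} (h : W' ≤ W) {hi : W ≤ U} {hj : W ≤ U'}
    {i : G.core.fib U} {j : G.core.fib U'} (t : (G.core.rs hi).obj i ⟶ (G.core.rs hj).obj j) :
    coreHomIso (rr h t) = rrIso h (coreHomIso t) := Iso.ext rfl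

theorem core_hom_ext {W U U' : Opens X} {hi : W ≤ U} {hj : W ≤ U'} {i : G.core.fib U}
    {j : G.core.fib U'} {s t : (G.core.rs hi).obj i ⟶ (G.core.rs hj).obj j}
    (h : (coreHomIso s).hom = (coreHomIso t).hom) : s = t := Core.hom_ext h

/-- Local isomorphisms that agree glue to an isomorphism. A descent datum in the core is also one in
`G`, and the isomorphisms from the glued object to the given ones already lie in the core. -/
theorem core_isStack (hG : G.IsStack) : G.core.IsStack := by
  refine isStack_of_glue (fun {U i j} s t h => ?_) (fun {U i j ι} V hV hc s h => ?_)
    (fun {U ι} V hV hc i θ θ_rr θ_id θ_comp => ?_)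
  · refine rs_rfl_map_injective (core_hom_ext (hom_ext_of_cover hG _ _ fun x hx => ?_))
    obtain ⟨V, hV, hxV, e⟩ := h x hx
    refine ⟨V, hV, hxV, ?_⟩
    rw [← rr_map hV le_rfl, ← rr_map hV le_rfl] at e
    exact congrArg (fun t => (coreHomIso t).hom) e
  · obtain ⟨t, ht⟩ := exists_iso_glue hG (hi := le_refl U) (hj := le_refl U) V hV hc
      (fun a => coreHomIso (i := i) (j := j) (hi := (hV a).trans le_rfl)
        (hj := (hV a).trans le_rfl) (s a))
      (fun a b Y ha hb => congrArg (fun t => (coreHomIso t).hom) (h a b Y ha hb))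
    obtain ⟨g, hg⟩ := exists_rs_rfl_map_eq (coreHomMk (i := i) (j := j) t)
    refine ⟨g, fun a => core_hom_ext (Eq.trans ?_ (ht a))⟩
    rw [← rr_map (hV a) le_rfl, hg]
    rfl
  · obtain ⟨j, ψ, hψ⟩ := exists_obj_glue hG V hV hc (fun a => Core.of (i a))
      (fun a b Y ha hb => (coreHomIso (θ a b Y ha hb)).hom)
      (fun a b Y Y' ha hb hY => congrArg (fun t => (coreHomIso t).hom) (θ_rr a b Y Y' ha hb hY))
      (fun a Y ha => congrArg (fun t => (coreHomIso t).hom) (θ_id a Y ha))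
      (fun a b c Y ha hb hc => congrArg (fun t => (coreHomIso t).hom) (θ_comp a b c Y ha hb hc))
    exact ⟨Core.mk j, fun a => Core.isoMk (ψ a),
      fun a b Y ha hb => core_hom_ext (hψ a b Y ha hb)⟩

theorem core_isSmall (hG : G.IsSmall) : G.core.IsSmall := fun U => by
  have := hG U
  exact small_of_injective (f := fun i : G.core.fib U => Core.of i)
    fun i j h => congrArg Core.mk h

theorem core_isGroupoidal : G.core.IsGroupoidal := fun _ _ _ g =>
  ⟨CoreHom.mk (CoreHom.iso g).symm, Core.hom_ext (CoreHom.iso g).hom_inv_id,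
    Core.hom_ext (CoreHom.iso g).inv_hom_id⟩

theorem core_locallyNonempty (hG : G.LocallyNonempty) : G.core.LocallyNonempty := fun x => by
  obtain ⟨U, hx, ⟨i⟩⟩ := hG x
  exact ⟨U, hx, ⟨Core.mk i⟩⟩

theorem core_locallyConnected (hG : G.LocallyConnected) : G.core.LocallyConnected :=
  fun U i j x hx => by
    obtain ⟨V, f, hxV, ⟨e⟩⟩ := hG U (Core.of i) (Core.of j) x hx
    exact ⟨V, f, hxV, ⟨Core.isoMk e⟩⟩

variable (G)

/-- The inclusion of the core. -/
def coreInclusion : PreHom G.core G where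
  obj i := Core.of i
  map _ _ _ _ t := (coreHomIso t).hom
  map_id _ _ := rfl
  map_comp _ _ _ _ _ _ _ _ := rfl
  map_rr _ _ _ _ _ _ := rfl

end Prestack

end

/-! ### The twisted sheaf of a stack of algebroids -/

section

variable {R : Type u} [CommRing R] {X : Type u} [TopologicalSpace X]

theorem sectionsMap_rr {V W' W U U' : Opens X} {hi : W ≤ U} {hj : W ≤ U'}
    {𝒜 : (assocStack R X).fib U} {ℬ : (assocStack R X).fib U'} (h' : V ≤ W') (h : W' ≤ W)
    (t : ((assocStack R X).rs hi).obj 𝒜 ⟶ ((assocStack R X).rs hj).obj ℬ)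
    (a : shSec 𝒜 (h'.trans (h.trans hi))) :
    (sectionsMap (rr h t) (homOfLE h') a : shSec ℬ (h'.trans (h.trans hj))) =
      sectionsMap t (homOfLE (h'.trans h)) a := by
  refine (shMap_rr' h' (rr h t) a).symm.trans (Eq.trans ?_ (shMap_rr' (h'.trans h) t a))
  rw [rr_rr]

theorem sectionsMap_rsId_inv {U : Opens X} {𝒜 : (assocStack R X).fib U} (a : shSec 𝒜 (le_refl U)) :
    sectionsMap ((assocStack R X).rsId 𝒜).inv (𝟙 U) a = a :=
  congrArg (fun f => f.hom a) ((show Sheaf ((Opens.grothendieckTopology X).over U)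
    (AlgCat.{u} R) from 𝒜).obj.map_id (op (Over.mk (homOfLE le_rfl))))

theorem conj_conj {D : Type*} [Category D] {x y z : D} (b' : z ⟶ y) (b : y ⟶ x) (a : x ⟶ x)
    (c : x ⟶ y) (c' : y ⟶ z) : (b' ≫ b) ≫ a ≫ c ≫ c' = b' ≫ (b ≫ a ≫ c) ≫ c' := by
  simp

theorem rsId_conj {G : Prestack X} {U : Opens X} {i j : G.fib U} (t : i ⟶ j) :
    (G.rsId i).inv ≫ (G.rs le_rfl).map t ≫ (G.rsId j).hom = t := by
  rw [Iso.inv_comp_eq, rsId_naturality]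

theorem map_conj {C D : Type*} [Category C] [Category D] (F : C ⥤ D) {x y : C} (b : y ⟶ x)
    (a : x ⟶ x) (c : x ⟶ y) : F.map b ≫ F.map a ≫ F.map c = F.map (b ≫ a ≫ c) := by
  simp

theorem conj_comp {D : Type*} [Category D] {x y : D} (e : x ≅ y) (a b : x ⟶ x) :
    e.inv ≫ (a ≫ b) ≫ e.hom = (e.inv ≫ a ≫ e.hom) ≫ e.inv ≫ b ≫ e.hom := by
  simp

/-- The inclusion of the core commutes strictly with restriction: its comparison isomorphisms are
identities. -/
theorem resHom_coreInclusion {G : Prestack X} {V U : Opens X} (f : V ⟶ U) {i j : G.core.fib U}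
    (t : Core.of i ⟶ Core.of j) :
    resHom G.coreInclusion.toTrans f (i := i) (j := j) t = (G.rs f.le).map t := by
  have e (i : G.core.fib U) : G.coreInclusion.comparisonIso f.le i = Iso.refl _ :=
    Iso.ext (Iso.inv_hom_id (G.rsId ((G.rs f.le).obj (Core.of i))))
  refine (congrArg₂ (fun a b => Iso.hom a ≫ (G.rs f.le).map t ≫ Iso.inv b) (e i) (e j)).trans ?_
  exact (Category.id_comp _).trans (Category.comp_id _)

theorem coreInclusion_map {G : Prestack X} {U : Opens X} {i j : G.core.fib U} (t : i ⟶ j) :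
    (onFib G.coreInclusion.toTrans U).map t = (CoreHom.iso t).hom :=
  rsId_conj (CoreHom.iso t).hom

theorem coreHom_iso_inv {G : Prestack X} {U : Opens X} {i j : G.core.fib U} (h : i ≅ j) :
    (CoreHom.iso h.inv).hom = (CoreHom.iso h.hom).inv :=
  (Iso.comp_hom_eq_id (CoreHom.iso h.hom)).1
    (congrArg (fun t => (CoreHom.iso t).hom) h.inv_hom_id)

namespace AlgebroidStack

variable (B : AlgebroidStack R X) {W' W U U' : Opens X}

/-- Restriction of endomorphisms. -/
noncomputable def endRes (h : W' ≤ W) (hi : W ≤ U) (i : B.stack.fib U) :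
    End ((B.stack.rs hi).obj i) →ₐ[R] End ((B.stack.rs (h.trans hi)).obj i) :=
  AlgHom.ofLinearMap (B.rrL h (hi := hi) (hj := hi) i i) (rr_id h) (fun a b => rr_comp h b a)

/-- The presheaf of algebras of endomorphisms. -/
noncomputable def endPresheaf (i : B.stack.fib U) : (Over U)ᵒᵖ ⥤ AlgCat.{u} R where
  obj Y := AlgCat.of R (End ((B.stack.rs Y.unop.hom.le).obj i))
  map {Y _} f := AlgCat.ofHom (B.endRes f.unop.left.le Y.unop.hom.le i)
  map_id Y := AlgCat.hom_ext _ (AlgHom.ext fun a =>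
    rr_rfl (hi := Y.unop.hom.le) (hj := Y.unop.hom.le) (i := i) (j := i) a)
  map_comp {Y _ _} f g := AlgCat.hom_ext _ (AlgHom.ext fun a =>
    (rr_rr (hi := Y.unop.hom.le) (hj := Y.unop.hom.le) g.unop.left.le f.unop.left.le
      (i := i) (j := i) a).symm)

/-- The underlying presheaf of sets is `presheafHom i i`, a sheaf by descent for morphisms, and the
sheaf condition for algebras is tested on underlying sets. -/
theorem endPresheaf_isSheaf (i : B.stack.fib U) :
    Presheaf.IsSheaf ((Opens.grothendieckTopology X).over U) (B.endPresheaf i) := by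
  refine (Presheaf.isSheaf_iff_isSheaf_forget _ _ (forget (AlgCat.{u} R))).2 ?_
  have := B.isStack.toIsPrestack
  refine (Presheaf.isSheaf_of_iso_iff (?_ : B.stack.presheafHom i i ≅ _)).1
    (Pseudofunctor.IsPrestack.isSheaf _ i i)
  exact NatIso.ofComponents (fun Y => Iso.refl _) (fun {Y Z} f => by
    ext a
    exact (rr_eq_pullHom (hi := Y.unop.hom.le) (hj := Y.unop.hom.le) f.unop.left.le a rfl rfl).symm)

/-- The sheaf of algebras of endomorphisms. -/
noncomputable def endSheaf (i : B.stack.fib U) : (assocStack R X).fib U :=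
  show Sheaf ((Opens.grothendieckTopology X).over U) (AlgCat.{u} R) from
    ⟨B.endPresheaf i, B.endPresheaf_isSheaf i⟩

/-- Conjugation with an isomorphism, as a morphism of sheaves of algebras. -/
noncomputable def endMap {hi : W ≤ U} {hj : W ≤ U'} {i : B.stack.fib U} {j : B.stack.fib U'}
    (t : (B.stack.rs hi).obj i ≅ (B.stack.rs hj).obj j) :
    ((assocStack R X).rs hi).obj (B.endSheaf i) ⟶ ((assocStack R X).rs hj).obj (B.endSheaf j) :=
  assocHom (fun {V} h => (TwistedSheaf.conjEnd (R := R) (rrIso h t)).toAlgHom)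
    (fun {V' V} h h' a => by
      refine Eq.trans ?_ (rr_comp (hi := h'.trans hj) (hj := h'.trans hi) (hk := h'.trans hj) h
        (rr h' t.inv) ((show (B.stack.rs (h'.trans hi)).obj i ⟶ (B.stack.rs (h'.trans hi)).obj i
          from a) ≫ rr h' t.hom)).symm
      rw [rr_comp, rr_rr, rr_rr]
      rfl)

theorem sectionsMap_endMap {hi : W ≤ U} {hj : W ≤ U'} {i : B.stack.fib U} {j : B.stack.fib U'}
    (t : (B.stack.rs hi).obj i ≅ (B.stack.rs hj).obj j) {V : Opens X} (h : V ≤ W)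
    (a : (B.stack.rs (h.trans hi)).obj i ⟶ (B.stack.rs (h.trans hi)).obj i) :
    sectionsMap (B.endMap t) (homOfLE h) a = rr h t.inv ≫ a ≫ rr h t.hom := rfl

/-- The functor of endomorphisms. -/
noncomputable def endPreHom : PreHom B.stack.core (assocStack R X) where
  obj i := B.endSheaf (Core.of i)
  map _ _ _ _ t := B.endMap (coreHomIso t)
  map_id {W U} hi i := assoc_hom_ext fun {V} h a => by
    have e := rr_id (G := B.stack) h (hi := hi) (i := Core.of i)
    refine (B.sectionsMap_endMap _ h a).trans
      ((congrArg₂ (fun x y => x ≫ _ ≫ y) e e).trans ?_)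
    exact (Category.id_comp _).trans (Category.comp_id _)
  map_comp {W U U' U''} hi hj hk {i j k} t s := assoc_hom_ext fun {V} h a => by
    refine (B.sectionsMap_endMap _ h a).trans ?_
    refine Eq.trans ?_ ((B.sectionsMap_endMap (coreHomIso s) h _).trans (congrArg
      (fun x => rr h (coreHomIso s).inv ≫ x ≫ rr h (coreHomIso s).hom)
      (B.sectionsMap_endMap (coreHomIso t) h a))).symm
    refine (congrArg₂ (fun x y => x ≫ _ ≫ y) (rr_comp h (coreHomIso s).inv (coreHomIso t).inv)
      (rr_comp h (coreHomIso t).hom (coreHomIso s).hom)).trans ?_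
    exact conj_conj _ _ _ _ _
  map_rr {W' W U U'} hi hj {i j} h t := assoc_hom_ext fun {V} h' a => by
    refine (B.sectionsMap_endMap _ h' a).trans (Eq.trans ?_
      (sectionsMap_rr h' h (B.endMap (coreHomIso t)) a).symm)
    refine Eq.trans ?_ (B.sectionsMap_endMap (coreHomIso t) (h'.trans h) a).symm
    rw [coreHomIso_rr, rrIso_hom, rrIso_inv, rr_rr, rr_rr]

/-- The functor of endomorphisms, as a morphism of prestacks. -/
noncomputable def endRep : B.stack.core ⟶ assocStack R X := B.endPreHom.toTrans

theorem sectionsMap_endRep (h : W ≤ U) {i j : B.stack.core.fib U} (g : i ⟶ j)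
    (a : (B.stack.rs h).obj (Core.of i) ⟶ (B.stack.rs h).obj (Core.of i)) :
    sectionsMap ((onFib B.endRep U).map g) (homOfLE h) a =
      (B.stack.rs h).map (CoreHom.iso g).inv ≫ a ≫ (B.stack.rs h).map (CoreHom.iso g).hom := by
  have e : ((assocStack R X).rs h).map ((onFib B.endRep U).map g) =
      B.endMap (coreHomIso ((B.stack.core.rs h).map g)) :=
    (mapR_map B.endRep h g).symm.trans (mapR_toTrans B.endPreHom h h _)
  refine (congrArg (fun t => sectionsMap t (𝟙 W) a) e).trans ?_
  refine (B.sectionsMap_endMap _ le_rfl a).trans ?_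
  rw [rr_rfl, rr_rfl]
  rfl

/-- Sections of the endomorphism sheaf over the whole domain are endomorphisms of the restriction
along the identity, not of the object itself; hence the conjugation by `rsId`. -/
theorem toSh_endRep (h : W ≤ U) (i : B.stack.core.fib U)
    (a : (B.stack.rs le_rfl).obj (Core.of ((B.stack.core.rs h).obj i)) ⟶
      (B.stack.rs le_rfl).obj (Core.of ((B.stack.core.rs h).obj i))) :
    toSh B.endRep h i a = (B.stack.rsId ((B.stack.rs h).obj (Core.of i))).inv ≫ a ≫
      (B.stack.rsId ((B.stack.rs h).obj (Core.of i))).hom := by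
  refine (congrArg (sectionsMap (B.endPreHom.map le_rfl h (B.stack.core.rsId _).hom) (𝟙 W))
    (sectionsMap_rsId_inv _)).trans ?_
  refine (B.sectionsMap_endMap _ le_rfl a).trans ?_
  rw [rr_rfl, rr_rfl]
  rfl

/-- The invertible endomorphisms of the restriction of an object. -/
noncomputable def autUnits (i : B.stack.core.fib U) : Aut i ≃* (Sec B.endRep i)ˣ :=
  MulEquiv.ofBijective
    ({ toFun g :=
        let e := (B.stack.rs le_rfl).mapIso (CoreHom.iso g.hom)
        -- The product in `End` is composition in reverse order, so `inv_hom_id` is the proof of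
        -- `val * inv = 1`.
        (⟨e.hom, e.inv, e.inv_hom_id, e.hom_inv_id⟩ : (End ((B.stack.rs le_rfl).obj (Core.of i)))ˣ)
       map_one' := Units.ext ((B.stack.rs le_rfl).map_id _)
       map_mul' g h := Units.ext ((B.stack.rs le_rfl).map_comp _ _) } :
      Aut i →* (End ((B.stack.rs le_rfl).obj (Core.of i)))ˣ)
    ⟨fun g h e => Iso.ext (Core.hom_ext (rs_rfl_map_injective (congrArg Units.val e))), fun u => by
      let t : (B.stack.rs le_rfl).obj (Core.of i) ≅ (B.stack.rs le_rfl).obj (Core.of i) :=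
        ⟨u.val, u.inv, u.inv_val, u.val_inv⟩
      obtain ⟨g, hg⟩ := exists_rs_rfl_map_eq (coreHomMk (i := i) (j := i) t)
      exact ⟨Core.isoMk (CoreHom.iso g), Units.ext (congrArg (fun t => (coreHomIso t).hom) hg)⟩⟩

/-- The twisted sheaf of a stack of algebroids. -/
noncomputable def twistedSheaf : TwistedSheaf R X where
  gauge := B.stack.core
  isStack := core_isStack B.isStack
  isSmall := core_isSmall B.isSmall
  isGroupoidal := core_isGroupoidal
  locallyNonempty := core_locallyNonempty B.locallyNonempty
  locallyConnected := core_locallyConnected B.locallyConnected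
  rep := B.endRep
  cp i := B.autUnits i
  cp_res {V U} f i g := (toSh B.endRep f.le i).injective (by
    refine (B.toSh_endRep f.le i _).trans (Eq.trans ?_ (toSh_secRes B.endRep f.le i _).symm)
    refine Eq.trans ?_ (rr_map f.le le_rfl (CoreHom.iso g.hom).hom).symm
    exact rsId_conj ((B.stack.rs f.le).map (CoreHom.iso g.hom).hom))
  cp_conj {U} i j h g := by
    refine Eq.trans ?_ (B.sectionsMap_endRep le_rfl h.hom _).symm
    refine Eq.trans ?_ (map_conj (B.stack.rs le_rfl) (CoreHom.iso h.hom).inv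
      (CoreHom.iso g.hom).hom (CoreHom.iso h.hom).hom).symm
    exact congrArg (fun t => (B.stack.rs le_rfl).map (t ≫ (CoreHom.iso g.hom).hom ≫
      (CoreHom.iso h.hom).hom)) (coreHom_iso_inv h)
  rep_aut {V U} f i g a := by
    refine (B.sectionsMap_endRep f.le g.hom a).trans ?_
    have e₁ := rr_map f.le le_rfl (CoreHom.iso g.hom).hom
    have e₂ := rr_map f.le le_rfl (CoreHom.iso g.hom).inv
    exact (congrArg₂ (fun x y => x ≫ _ ≫ y) e₂ e₁).symm

/-- The sections of the sheaf of endomorphisms, as endomorphisms. -/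
noncomputable def secEnd {U : Opens X} (i : B.stack.core.fib U) :
    Sec B.endRep i ≃ₗ[R] ((Core.of i : B.stack.fib U) ⟶ Core.of i) :=
  conjL (S := R) (B.stack.rsId (Core.of i)).symm (B.stack.rsId (Core.of i))

theorem secEnd_map {U : Opens X} (i : B.stack.core.fib U) (a : Core.of i ⟶ Core.of i) :
    B.secEnd i ((B.stack.rs le_rfl).map a) = a := rsId_conj a

theorem secEnd_secRes {V U : Opens X} (h : V ≤ U) (i : B.stack.core.fib U)
    (a : Core.of i ⟶ Core.of i) :
    B.secEnd ((B.stack.core.rs h).obj i) (secRes B.endRep (homOfLE h) i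
      ((B.stack.rs le_rfl).map a)) = (B.stack.rs h).map a :=
  ((B.toSh_endRep h i _).symm.trans (toSh_secRes B.endRep h i _)).trans (rr_map h le_rfl a)

theorem secEnd_secMap {U : Opens X} {i j : B.stack.core.fib U} (g : i ⟶ j)
    (a : Core.of i ⟶ Core.of i) :
    B.secEnd j (secMap B.endRep g ((B.stack.rs le_rfl).map a)) =
      (CoreHom.iso g).inv ≫ a ≫ (CoreHom.iso g).hom :=
  (congrArg (B.secEnd j) ((B.sectionsMap_endRep le_rfl g _).trans
    (map_conj (B.stack.rs le_rfl) (CoreHom.iso g).inv a (CoreHom.iso g).hom))).trans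
      (B.secEnd_map j _)

/-- The tautological representation. -/
noncomputable def twistedSheafRep : TwistedSheaf.Rep B.twistedSheaf B where
  E := B.stack.coreInclusion.toTrans
  ε {U} i := (B.secEnd i).toLinearMap
  one {U} i := (congrArg (B.secEnd i) ((B.stack.rs le_rfl).map_id _).symm).trans (B.secEnd_map i _)
  mul {U} i a b := conj_comp (B.stack.rsId (Core.of i)) b a
  res {V U} f i a := by
    obtain ⟨a, rfl⟩ := exists_rs_rfl_map_eq a
    refine (B.secEnd_secRes f.le i a).trans ?_
    refine (resHom_coreInclusion f a).symm.trans ?_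
    exact congrArg (resHom B.stack.coreInclusion.toTrans f (i := i) (j := i)) (B.secEnd_map i a).symm
  act {U i j} h a := by
    obtain ⟨a, rfl⟩ := exists_rs_rfl_map_eq a
    refine (congrArg₂ (· ≫ ·) (coreInclusion_map h) (B.secEnd_secMap h a)).trans
      (Eq.trans ?_ (congrArg₂ (· ≫ ·) (B.secEnd_map i a) (coreInclusion_map h)).symm)
    exact Iso.hom_inv_id_assoc (CoreHom.iso h) _
  cp {U} i g := (B.secEnd_map i _).trans (coreInclusion_map g.hom).symm

theorem twistedSheafRep_isUniversal : B.twistedSheafRep.IsUniversal :=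
  TwistedSheaf.Rep.isUniversal_of_bijective fun i => (B.secEnd i).bijective

end AlgebroidStack

end

/-! ### The bijection -/

section

variable {R S : Type u} [CommRing R] [CommRing S] {X : Type u} [TopologicalSpace X]

namespace TwistedSheaf

variable {T T' : TwistedSheaf R X}

/-- A weak equivalence carries the universal representation of `T` to one in `T'.algebroid`, where
`T'` has one as well; uniqueness of the twisted sheaf of a stack gives the gauge equivalence. -/
theorem gaugeEquivalent_iff :
    T.GaugeEquivalent T' ↔ T.algebroid.WeaklyEquivalent T'.algebroid := by
  refine ⟨fun h => h.weaklyEquivalent_algebroid, fun h => ?_⟩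
  obtain ⟨E, hE⟩ := T.toAlgebroid_isUniversal.exists_post h
  exact hE.gaugeEquivalent T'.toAlgebroid_isUniversal

theorem isTwistedSheafOf_iff_algebroid {B : AlgebroidStack R X} :
    T.IsTwistedSheafOf B ↔ T.algebroid.WeaklyEquivalent B := by
  rw [isTwistedSheafOf_iff]
  exact ⟨fun ⟨_, hE⟩ => hE.isExt.weaklyEquivalent_algebroid,
    fun h => T.toAlgebroid_isUniversal.exists_post h⟩

/-- Both conditions are equivalent to the existence of an `IsExt` representation of `T` in
`T'.algebroid`. -/
theorem isInduced_iff_algebroid [Algebra R S] {T : TwistedSheaf R X} {T' : TwistedSheaf S X} :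
    T.IsInduced T' ↔ T.algebroid.IsInduced T'.algebroid := by
  refine ⟨fun h => ?_, fun h => ?_⟩
  · obtain ⟨E, hE⟩ := h.exists_rep T'.toAlgebroid_isUniversal
    exact hE.isInduced_algebroid
  · obtain ⟨E, hE⟩ := T.toAlgebroid_isUniversal.exists_isExt_post h
    exact hE.isInduced T'.toAlgebroid_isUniversal

/-- The class of the stack of algebroids of a twisted sheaf. -/
noncomputable def Classes.algebroid : Classes R X → AlgebroidStack.Classes R X :=
  Quot.lift (fun T => T.algebroid.cls) fun _ _ h =>
    AlgebroidStack.cls_eq_iff.2 h.weaklyEquivalent_algebroid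

theorem Classes.algebroid_cls (T : TwistedSheaf R X) :
    Classes.algebroid T.cls = T.algebroid.cls := rfl

/-- Injectivity is `gaugeEquivalent_iff`. For surjectivity, the tautological representation of
`B.twistedSheaf` in `B` is universal, so `B` is weakly equivalent to the stack of its own twisted
sheaf. -/
theorem Classes.bijective_algebroid :
    Function.Bijective (Classes.algebroid : Classes R X → AlgebroidStack.Classes R X) := by
  refine ⟨fun t t' h => ?_, fun b => ?_⟩
  · obtain ⟨T, rfl⟩ := Quot.exists_rep t
    obtain ⟨T', rfl⟩ := Quot.exists_rep t'
    exact Quot.sound (gaugeEquivalent_iff.2 (AlgebroidStack.cls_eq_iff.1 h))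
  · obtain ⟨B, rfl⟩ := Quot.exists_rep b
    exact ⟨B.twistedSheaf.cls, AlgebroidStack.cls_eq_iff.2
      B.twistedSheafRep_isUniversal.isExt.weaklyEquivalent_algebroid⟩

variable (R X) in
/-- The bijection between the classes of stacks of algebroids and the classes of twisted sheaves. -/
noncomputable def classesEquiv : AlgebroidStack.Classes R X ≃ Classes R X :=
  (Equiv.ofBijective _ Classes.bijective_algebroid).symm

theorem classesEquiv_eq_iff {b : AlgebroidStack.Classes R X} {t : Classes R X} :
    classesEquiv R X b = t ↔ b = t.algebroid :=
  Equiv.symm_apply_eq _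

end TwistedSheaf

namespace AlgebroidStack

/-- Extension of scalars along a ring homomorphism. -/
noncomputable def Classes.ind (σ : R →+* S) (b : Classes R X) : Classes S X :=
  letI := σ.toAlgebra
  b.extend S

theorem Classes.ind_id (b : Classes R X) : b.ind (RingHom.id R) = b :=
  b.extend_self

theorem Classes.ind_comp {Q : Type u} [CommRing Q] (σ : R →+* S) (τ : S →+* Q) (b : Classes R X) :
    b.ind (τ.comp σ) = (b.ind σ).ind τ := by
  let := σ.toAlgebra
  let := τ.toAlgebra
  let := (τ.comp σ).toAlgebra
  have : IsScalarTower R S Q := IsScalarTower.of_algebraMap_eq fun _ => rfl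
  exact b.extend_extend

theorem Classes.ind_cls_eq_iff (σ : R →+* S) (B : AlgebroidStack R X) (B' : AlgebroidStack S X) :
    letI := σ.toAlgebra
    B.cls.ind σ = B'.cls ↔ B.IsInduced B' :=
  letI := σ.toAlgebra
  extend_cls_eq_iff

end AlgebroidStack

end

end TwistedSheaves

theorem mainTheorem12 (X : Type u) [TopologicalSpace X] :
    ∃ (Φ : ∀ (R : Type u) [CommRing R],
        TwistedSheaves.AlgebroidStack.Classes R X ≃ TwistedSheaves.TwistedSheaf.Classes R X)
      (indAlg : ∀ {R S : Type u} [CommRing R] [CommRing S], (R →+* S) →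
        TwistedSheaves.AlgebroidStack.Classes R X → TwistedSheaves.AlgebroidStack.Classes S X)
      (indTw : ∀ {R S : Type u} [CommRing R] [CommRing S], (R →+* S) →
        TwistedSheaves.TwistedSheaf.Classes R X → TwistedSheaves.TwistedSheaf.Classes S X),
      -- the bijection sends `B` to the class of its twisted sheaf of endomorphism algebras
      (∀ (R : Type u) [CommRing R] (B : TwistedSheaves.AlgebroidStack R X)
        (T : TwistedSheaves.TwistedSheaf R X), Φ R B.cls = T.cls ↔ T.IsTwistedSheafOf B) ∧
      -- both sides are functors of `R`, by extension of scalars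
      (∀ {R S : Type u} [CommRing R] [CommRing S] (σ : R →+* S)
        (B : TwistedSheaves.AlgebroidStack R X) (B' : TwistedSheaves.AlgebroidStack S X),
        letI := σ.toAlgebra
        indAlg σ B.cls = B'.cls ↔ B.IsInduced B') ∧
      (∀ {R S : Type u} [CommRing R] [CommRing S] (σ : R →+* S)
        (T : TwistedSheaves.TwistedSheaf R X) (T' : TwistedSheaves.TwistedSheaf S X),
        letI := σ.toAlgebra
        indTw σ T.cls = T'.cls ↔ T.IsInduced T') ∧
      (∀ (R : Type u) [CommRing R] (b : TwistedSheaves.AlgebroidStack.Classes R X),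
        indAlg (RingHom.id R) b = b) ∧
      (∀ (R : Type u) [CommRing R] (t : TwistedSheaves.TwistedSheaf.Classes R X),
        indTw (RingHom.id R) t = t) ∧
      (∀ {R S Q : Type u} [CommRing R] [CommRing S] [CommRing Q] (σ : R →+* S) (τ : S →+* Q)
        (b : TwistedSheaves.AlgebroidStack.Classes R X),
        indAlg (τ.comp σ) b = indAlg τ (indAlg σ b)) ∧
      (∀ {R S Q : Type u} [CommRing R] [CommRing S] [CommRing Q] (σ : R →+* S) (τ : S →+* Q)
        (t : TwistedSheaves.TwistedSheaf.Classes R X),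
        indTw (τ.comp σ) t = indTw τ (indTw σ t)) ∧
      -- the bijection is natural
      (∀ {R S : Type u} [CommRing R] [CommRing S] (σ : R →+* S)
        (b : TwistedSheaves.AlgebroidStack.Classes R X),
        Φ S (indAlg σ b) = indTw σ (Φ R b)) := by

  refine ⟨fun R _ => TwistedSheaves.TwistedSheaf.classesEquiv R X,
    fun σ => TwistedSheaves.AlgebroidStack.Classes.ind σ,
    -- Extension of scalars of twisted sheaves is transported from algebroids through the bijection,
    -- which makes naturality and functoriality formal. That it agrees with the intrinsic notion of
    -- induced twisted sheaf is `isInduced_iff_algebroid`.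
    fun {R S} _ _ σ t => TwistedSheaves.TwistedSheaf.classesEquiv S X (t.algebroid.ind σ),
    fun R _ B T => ?_, fun σ B B' => TwistedSheaves.AlgebroidStack.Classes.ind_cls_eq_iff σ B B',
    fun {R S} _ _ σ T T' => ?_, fun R _ b => b.ind_id, fun R _ t => ?_,
    fun σ τ b => b.ind_comp σ τ, fun {R S Q} _ _ _ σ τ t => ?_, fun {R S} _ _ σ b => ?_⟩
  · rw [TwistedSheaves.TwistedSheaf.classesEquiv_eq_iff,
      TwistedSheaves.TwistedSheaf.Classes.algebroid_cls, eq_comm,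
      TwistedSheaves.AlgebroidStack.cls_eq_iff,
      TwistedSheaves.TwistedSheaf.isTwistedSheafOf_iff_algebroid]
  · let := σ.toAlgebra
    rw [TwistedSheaves.TwistedSheaf.classesEquiv_eq_iff,
      TwistedSheaves.TwistedSheaf.isInduced_iff_algebroid]
    exact TwistedSheaves.AlgebroidStack.Classes.ind_cls_eq_iff σ T.algebroid T'.algebroid
  · rw [TwistedSheaves.TwistedSheaf.classesEquiv_eq_iff,
      TwistedSheaves.AlgebroidStack.Classes.ind_id]
  · refine congrArg (TwistedSheaves.TwistedSheaf.classesEquiv Q X) ?_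
    rw [TwistedSheaves.AlgebroidStack.Classes.ind_comp]
    exact congrArg _ (TwistedSheaves.TwistedSheaf.classesEquiv_eq_iff.1 rfl)
  · refine congrArg (TwistedSheaves.TwistedSheaf.classesEquiv S X) ?_
    exact congrArg _ (TwistedSheaves.TwistedSheaf.classesEquiv_eq_iff.1 rfl)
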